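/- Let $X=(K;F_1,\dots,F_N)$, $N\ge 2$, be a connected post-critically finite self-similar fractal in $\mathbb R^n$, where the $F_i$ are contracting similitudes satisfying the open set condition, with post-critical set $P$ and boundary $V_0=\pi(P)$ ($\pi$ is the projection from the address space). Let $\mu$ be the normalised Hausdorff measure on $K$ in its Hausdorff dimension. Fix a regular harmonic structure on $X$: a Dirichlet form $\mathcal E_0$ on $V_0$, weights $r_i>0$ and a factor $c$ with $r_i<c$, such that the forms $\mathcal E_{k+1}(f,f)=c\sum_i r_i^{-1}\mathcal E_k(f\circ F_i,f\circ F_i)$ are compatible. Let $\mathcal E=\lim_k\mathcal E_k$ on the continuous functions on $K$ of finite energy which vanish on a given set $B\subseteq V_0$ ($B=\emptyset$: Neumann conditions; $B=V_0$: Dirichlet conditions), and let $\Delta$ be the Laplace operator on $L^2(K,\mu)$ given by $\mathcal E(u,v)=-\langle\Delta u,v\rangle$ for all such $v$. Let $p_t(x,y)$ be the heat kernel of $\Delta$, i.e. the kernel, continuous on $(0,\infty)\times K\times K$, of the strongly continuous semigroup on $L^2(K,\mu)$ with generator $\Delta$. Put $K(t)=\int_K p_t(x,x)\,d\mu(x)$,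 let $n_0=\dim\ker\Delta$, and let $\zeta_\Delta(s)=\sum\lambda_k^{-s}$, the sum being over the nonzero eigenvalues $\lambda_k$ of $-\Delta$ with multiplicity. Assume that $\Delta$ admits spectral decimation with a real polynomial $p$ of degree $d\ge2$, $p(0)=0$, $p'(0)=\lambda>1$. That is: let $\Phi$ be the entire function with $\Phi(\lambda z)=p(\Phi(z))$, $\Phi(0)=0$, $\Phi'(0)=1$; there are a finite nonempty set $A\subset\mathbb C$ and integers $\beta_m(w)\ge0$ ($w\in A$, $m\ge0$), where for each $w\in A$ some $\beta_m(w)$ is nonzero and $\Phi(z)=w$ has a solution $z\neq 0$, such that every $\lambda^m z$ with $\beta_m(w)\ne0$, $\Phi(z)=w$, $z\ne0$ is a (real) eigenvalue of $\Delta$; the multiplicity of each $x\ne0$ as an eigenvalue of $\Delta$ is $\sum_{w\in A}\sum_{m\ge0}\beta_m(w)\,\mathrm{ord}_{z=x/\lambda^m}(\Phi(z)-w)$; and the generating functions $R_w(z)=\sum_{m\ge0}\beta_m(w)z^m$ are rational. Then $\zeta_\Delta$ has a meromorphic continuation to $\mathbb C$, and the following hold. (1) Let $d_S/2$ be the maximum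 of $\log_\lambda d$ and of the real parts of the poles of the functions $R_w(\lambda^{-s})$, $w\in A$. Then $d_S>0$, the series for $\zeta_\Delta(s)$ converges absolutely for $\operatorname{Re}s>d_S/2$, and $d_S/2$ is a pole of $\zeta_\Delta$. (2) There are finitely many complex numbers $\alpha_j$, poles of $\zeta_\Delta(s)\Gamma(s)$ with $\operatorname{Re}\alpha_j\le d_S/2$, such that the sets $\alpha_j+\frac{2\pi i}{\log\lambda}\mathbb Z$ and $\frac{d_S}2+\frac{2\pi i}{\log\lambda}\mathbb Z$ are pairwise disjoint and together contain all poles of $\zeta_\Delta(s)\Gamma(s)$. Each $\alpha_j$ is a pole of some $R_w(\lambda^{-s})$, or satisfies $\lambda^{\alpha_j}=d$, or is $0$ (this last case only if $0\in A$). (3) If all poles of $\zeta_\Delta(s)\Gamma(s)$ are simple, then there are real-analytic $1$-periodic functions $H,H_j:\mathbb R\to\mathbb C$ such that for every integer $M\ge 0$ $$K(t)=n_0+t^{-d_S/2}H(\log_\lambda t)+\sum_j t^{-\alpha_j}H_j(\log_\lambda t)+O(t^{M+1/2})\qquad(t\to0^+),$$ and for every $k\in\mathbb Z$ $$\int_0^1H(u)e^{2\pi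 i k u}\,du=\operatorname*{Res}_{s=\frac{d_S}2+\frac{2k\pi i}{\log\lambda}}\zeta_\Delta(s)\Gamma(s),\qquad \int_0^1H_j(u)e^{2\pi i k u}\,du=\operatorname*{Res}_{s=\alpha_j+\frac{2k\pi i}{\log\lambda}}\zeta_\Delta(s)\Gamma(s)$$ (residues at points that are not poles are $0$). -/

import Mathlib

open MeasureTheory Filter Topology Set Asymptotics

noncomputable section

namespace FractalHeat

/-- Euclidean space `ℝ^d`. -/
abbrev Euc (d : ℕ) : Type := EuclideanSpace ℝ (Fin d)

/-- A finite family of contracting similitudes `F_i (x) = b_i + A_i (x - b_i)` of `ℝ^d`,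
`‖A_i x‖ = α_i ‖x‖` with `0 < α_i < 1`. -/
structure Similitudes (d m : ℕ) where
  fixedPt : Fin m → Euc d
  lin : Fin m → (Euc d →ₗ[ℝ] Euc d)
  ratio : Fin m → ℝ
  ratio_pos : ∀ i, 0 < ratio i
  ratio_lt_one : ∀ i, ratio i < 1
  norm_lin : ∀ i x, ‖lin i x‖ = ratio i * ‖x‖

namespace Similitudes

variable {d m : ℕ} (F : Similitudes d m)

/-- The map `F_i`. -/
def map (i : Fin m) (x : Euc d) : Euc d := F.fixedPt i + F.lin i (x - F.fixedPt i)

/-- The open set condition. -/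
def OpenSetCondition : Prop :=
  ∃ O : Set (Euc d), O.Nonempty ∧ IsOpen O ∧ Bornology.IsBounded O ∧
    (∀ i, F.map i '' O ⊆ O) ∧ ∀ i j, i ≠ j → Disjoint (F.map i '' O) (F.map j '' O)

/-- `F_{ε_0} ∘ F_{ε_1} ∘ ⋯ ∘ F_{ε_{n-1}}`. -/
def wordMap (ε : ℕ → Fin m) : ℕ → Euc d → Euc d
  | 0 => id
  | n + 1 => wordMap ε n ∘ F.map (ε n)

/-- The projection `π` from the address space; the limit always exists and does not depend on
the starting point, which is taken to be the origin. -/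
def proj (ε : ℕ → Fin m) : Euc d := limUnder atTop fun n => F.wordMap ε n 0

/-- The critical set `C` of the attractor `K`. -/
def criticalSet (K : Set (Euc d)) : Set (ℕ → Fin m) :=
  {ε | ∃ i j, i ≠ j ∧ F.proj ε ∈ F.map i '' K ∩ F.map j '' K}

/-- The post-critical set `P = ⋃_{n ≥ 1} σ^n (C)`, with `σ` the shift. -/
def postCriticalSet (K : Set (Euc d)) : Set (ℕ → Fin m) :=
  {η | ∃ ε ∈ F.criticalSet K, ∃ n : ℕ, 1 ≤ n ∧ η = fun k => ε (k + n)}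

end Similitudes

/-- A connected post-critically finite self-similar fractal in `ℝ^d`, generated by `m ≥ 2`
similitudes that satisfy the open set condition. -/
structure PCFFractal (d m : ℕ) extends Similitudes d m where
  two_le : 2 ≤ m
  openSetCondition : toSimilitudes.OpenSetCondition
  /-- The attractor `K`: the unique nonempty compact set with `K = ⋃ F_i (K)`. -/
  carrier : Set (Euc d)
  nonempty : carrier.Nonempty
  isCompact : IsCompact carrier
  selfSimilar : carrier = ⋃ i, toSimilitudes.map i '' carrier
  isConnected : IsConnected carrier
  pcf : (toSimilitudes.postCriticalSet carrier).Finite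
  /-- The Hausdorff dimension: the unique positive solution of `∑ α_i ^ s = 1`. -/
  dim : ℝ
  dim_pos : 0 < dim
  sum_ratio : ∑ i, ratio i ^ dim = 1

namespace PCFFractal

variable {d m : ℕ} (X : PCFFractal d m)

/-- The normalised Hausdorff measure `E ↦ H^ρ (E ∩ K) / H^ρ (K)`. -/
def measure : Measure (Euc d) :=
  (μH[X.dim] X.carrier)⁻¹ • (μH[X.dim]).restrict X.carrier

/-- The real Hilbert space `L² (K)`. -/
abbrev L2 : Type := Lp ℝ 2 X.measure

theorem isFiniteMeasure : IsFiniteMeasure X.measure := by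
  refine ⟨?_⟩
  simp only [measure, Measure.smul_apply, Measure.restrict_apply_univ, smul_eq_mul]
  exact (ENNReal.inv_mul_le_one _).trans_lt ENNReal.one_lt_top

theorem integrable_mul (g : X.L2) {v : Euc d → ℝ} (hv : ContinuousOn v X.carrier) :
    Integrable (fun x => g x * v x) X.measure := by
  have := X.isFiniteMeasure
  have hK : MeasurableSet X.carrier := X.isCompact.isClosed.measurableSet
  obtain ⟨C, hC⟩ := X.isCompact.exists_bound_of_continuousOn hv
  refine Integrable.mul_bdd (c := C) ((Lp.memLp g).integrable (by norm_num))
    ((hv.aestronglyMeasurable hK).smul_measure _) ?_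
  refine Measure.ae_smul_measure ?_ _
  filter_upwards [ae_restrict_mem hK] with x hx using hC x hx

/-- The set `V_0 = π (P)`. -/
def V0 : Set (Euc d) := X.proj '' X.postCriticalSet X.carrier

/-- Restriction of a function to `V_0`. -/
def res (f : Euc d → ℝ) : X.V0 → ℝ := fun x => f x

/-- A symmetric bilinear form on the real functions on a (finite) set `V` is a Dirichlet form. -/
structure IsDirichletForm {V : Type} (e : LinearMap.BilinForm ℝ (V → ℝ)) : Prop where
  symm : ∀ u v, e u v = e v u
  nonneg : ∀ u, 0 ≤ e u u
  const_of_zero : ∀ u, e u u = 0 → ∀ x y, u x = u y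
  markov : ∀ u : V → ℝ, e (fun x => max 0 (min (u x) 1)) (fun x => max 0 (min (u x) 1)) ≤ e u u

/-- A regular harmonic structure on `X`: a Dirichlet form `E_0` on `V_0`, positive weights `r_i`
and a renormalisation factor `c` such that
`R_{V_1,V_0} (c ∑ r_i⁻¹ E_0 (· ∘ F_i, · ∘ F_i)) = E_0`, where the restriction `R_{V_1,V_0}` of a
form on `V_1 = ⋃ F_i (V_0)` to `V_0` assigns to `u` its minimum over all extensions of `u` to `V_1`.
(Extensions to `V_1` are written as functions on the whole space; only the values on `V_1`
enter.)  Regularity `r_i < c` is the condition that the limit form lives on all of `K`. -/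
structure HarmonicStructure where
  form : LinearMap.BilinForm ℝ (X.V0 → ℝ)
  isDirichlet : IsDirichletForm form
  weight : Fin m → ℝ
  weight_pos : ∀ i, 0 < weight i
  factor : ℝ
  regular : ∀ i, weight i < factor
  compatible : ∀ u : X.V0 → ℝ,
    IsLeast {y : ℝ | ∃ v : Euc d → ℝ, X.res v = u ∧
      y = factor * ∑ i, (weight i)⁻¹ * form (X.res (v ∘ X.map i)) (X.res (v ∘ X.map i))}
      (form u u)

variable {X}

namespace HarmonicStructure

variable (S : X.HarmonicStructure)

/-- The forms `E_n`, with `E_{n+1} (f, g) = c ∑ r_i⁻¹ E_n (f ∘ F_i, g ∘ F_i)`. -/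
def energy : ℕ → (Euc d → ℝ) → (Euc d → ℝ) → ℝ
  | 0, f, g => S.form (X.res f) (X.res g)
  | n + 1, f, g =>
      S.factor * ∑ i, (S.weight i)⁻¹ * energy n (f ∘ X.map i) (g ∘ X.map i)

/-- The domain of the limit form `E (f, g) = lim E_n (f, g)`: continuous functions on `K` of finite
energy, which vanish on the subset `B` of `V_0` (`B = ∅`: Neumann boundary conditions, `B = V_0`:
Dirichlet boundary conditions).  The sequence `E_n (f, f)` is nondecreasing. -/
def formDomain (B : Set (Euc d)) : Set (Euc d → ℝ) :=
  {f | ContinuousOn f X.carrier ∧ BddAbove (range fun n => S.energy n f f) ∧ ∀ x ∈ B, f x = 0}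

/-- `S.IsLaplacian B u g` says that `u` is in the domain of the Laplace operator `Δ` and
`Δ u = g`, that is, `u` is in the domain of the form and `E (u, v) = - ⟨g, v⟩` for all `v` in it. -/
def IsLaplacian (B : Set (Euc d)) (u g : X.L2) : Prop :=
  ∃ f ∈ S.formDomain B, u =ᵐ[X.measure] f ∧
    ∀ v ∈ S.formDomain B,
      Tendsto (fun n => S.energy n f v) atTop (𝓝 (-∫ x, g x * v x ∂X.measure))

theorem energy_add_left (n : ℕ) (f f' g : Euc d → ℝ) :
    S.energy n (f + f') g = S.energy n f g + S.energy n f' g := by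
  induction n generalizing f f' g with
  | zero =>
    have h : X.res (f + f') = X.res f + X.res f' := rfl
    simp [energy, h]
  | succ n ih =>
    have h : ∀ i, (f + f') ∘ X.map i = f ∘ X.map i + f' ∘ X.map i := fun _ => rfl
    simp only [energy, h, ih, mul_add, Finset.sum_add_distrib]

theorem energy_smul_left (n : ℕ) (a : ℝ) (f g : Euc d → ℝ) :
    S.energy n (a • f) g = a * S.energy n f g := by
  induction n generalizing f g with
  | zero =>
    have h : X.res (a • f) = a • X.res f := rfl
    simp [energy, h]
  | succ n ih =>
    have h : ∀ i, (a • f) ∘ X.map i = a • (f ∘ X.map i) := fun _ => rfl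
    simp only [energy, h, ih, Finset.mul_sum]
    exact Finset.sum_congr rfl fun i _ => by ring

theorem energy_symm (n : ℕ) (f g : Euc d → ℝ) : S.energy n f g = S.energy n g f := by
  induction n generalizing f g with
  | zero => exact S.isDirichlet.symm _ _
  | succ n ih => simp only [energy, ih]

theorem factor_pos : 0 < S.factor :=
  (S.weight_pos ⟨0, by have := X.two_le; omega⟩).trans (S.regular _)

theorem energy_nonneg (n : ℕ) (f : Euc d → ℝ) : 0 ≤ S.energy n f f := by
  induction n generalizing f with
  | zero => exact S.isDirichlet.nonneg _
  | succ n ih =>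
    exact mul_nonneg S.factor_pos.le
      (Finset.sum_nonneg fun i _ => mul_nonneg (inv_nonneg.2 (S.weight_pos i).le) (ih _))

theorem energy_add_le (n : ℕ) (f g : Euc d → ℝ) :
    S.energy n (f + g) (f + g) ≤ 2 * S.energy n f f + 2 * S.energy n g g := by
  have h := S.energy_nonneg n (f + (-1 : ℝ) • g)
  simp only [energy_add_left, energy_smul_left, S.energy_symm n _ (f + _)] at h ⊢
  have h2 := S.energy_symm n f g
  have h3 : ∀ k : Euc d → ℝ, S.energy n k ((-1 : ℝ) • g) = -S.energy n g k := fun k => by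
    rw [S.energy_symm, energy_smul_left]
    ring
  rw [h3, h3] at h
  linarith

theorem formDomain_add {B : Set (Euc d)} {f g : Euc d → ℝ} (hf : f ∈ S.formDomain B)
    (hg : g ∈ S.formDomain B) : f + g ∈ S.formDomain B := by
  obtain ⟨hf1, ⟨a, ha⟩, hf3⟩ := hf
  obtain ⟨hg1, ⟨b, hb⟩, hg3⟩ := hg
  refine ⟨hf1.add hg1, ⟨2 * a + 2 * b, ?_⟩, fun x hx => by simp [hf3 x hx, hg3 x hx]⟩
  rintro _ ⟨n, rfl⟩
  have h1 := ha ⟨n, rfl⟩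
  have h2 := hb ⟨n, rfl⟩
  have h3 := S.energy_add_le n f g
  simp only at h1 h2 ⊢
  linarith

theorem formDomain_smul {B : Set (Euc d)} {f : Euc d → ℝ} (hf : f ∈ S.formDomain B) (a : ℝ) :
    a • f ∈ S.formDomain B := by
  obtain ⟨hf1, ⟨b, hb⟩, hf3⟩ := hf
  refine ⟨hf1.const_smul a, ⟨a ^ 2 * b, ?_⟩, fun x hx => by simp [hf3 x hx]⟩
  rintro _ ⟨n, rfl⟩
  have h1 : S.energy n f f ≤ b := hb ⟨n, rfl⟩
  simp only [energy_smul_left, S.energy_symm n f (a • f)]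
  nlinarith [sq_nonneg a, mul_le_mul_of_nonneg_left h1 (sq_nonneg a)]

/-- The eigenspace `{u | Δ u = x u}`. -/
def eigenspace (B : Set (Euc d)) (x : ℝ) : Submodule ℝ X.L2 where
  carrier := {u | S.IsLaplacian B u (x • u)}
  zero_mem' := by
    refine ⟨0, ⟨continuousOn_const, ⟨0, ?_⟩, fun _ _ => rfl⟩, Lp.coeFn_zero _ _ _, fun v _ => ?_⟩
    · rintro _ ⟨n, rfl⟩
      have h := S.energy_smul_left n 0 0 0
      simp only [zero_smul, zero_mul] at h
      exact h.le
    · have h : ∀ n, S.energy n 0 v = 0 := fun n => by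
        have h := S.energy_smul_left n 0 0 v
        simpa only [zero_smul, zero_mul] using h
      have h2 : ∫ y, (x • (0 : X.L2)) y * v y ∂X.measure = 0 := by
        rw [smul_zero]
        refine integral_eq_zero_of_ae ?_
        filter_upwards [Lp.coeFn_zero ℝ 2 X.measure] with y hy
        rw [hy]
        simp
      rw [h2]
      simp only [h, neg_zero]
      exact tendsto_const_nhds
  smul_mem' := by
    rintro a u ⟨f, hf, huf, H⟩
    refine ⟨a • f, S.formDomain_smul hf a, ?_, fun v hv => ?_⟩
    · filter_upwards [Lp.coeFn_smul a u, huf] with y h1 h2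
      rw [h1, Pi.smul_apply, Pi.smul_apply, h2]
    · have h := (H v hv).const_mul a
      simp only [energy_smul_left]
      convert h using 2
      rw [mul_neg, ← integral_const_mul, smul_comm]
      congr 1
      refine integral_congr_ae ?_
      filter_upwards [Lp.coeFn_smul a (x • u)] with y hy
      simp only [hy, Pi.smul_apply, smul_eq_mul, mul_assoc]
  add_mem' := by
    rintro u u' ⟨f, hf, huf, H⟩ ⟨f', hf', huf', H'⟩
    refine ⟨f + f', S.formDomain_add hf hf', ?_, fun v hv => ?_⟩
    · filter_upwards [Lp.coeFn_add u u', huf, huf'] with y h1 h2 h3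
      rw [h1, Pi.add_apply, Pi.add_apply, h2, h3]
    · have h := (H v hv).add (H' v hv)
      simp only [energy_add_left]
      convert h using 2
      rw [← neg_add, ← integral_add (X.integrable_mul _ hv.1) (X.integrable_mul _ hv.1), smul_add]
      congr 1
      refine integral_congr_ae ?_
      filter_upwards [Lp.coeFn_add (x • u) (x • u')] with y hy
      rw [hy, Pi.add_apply, add_mul]

/-- The multiplicity of `x` as an eigenvalue of `-Δ`. -/
def mult (B : Set (Euc d)) (x : ℝ) : ℕ := Module.finrank ℝ (S.eigenspace B (-x))

/-- `p_t (x, y)` is the heat kernel of `Δ`: it is continuous on `(0, ∞) × K × K`, and the integral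
operators `A_t` with kernel `p_t` form a strongly continuous semigroup on `L² (K)` whose
infinitesimal generator is `Δ`. -/
structure IsHeatKernel (B : Set (Euc d)) (p : ℝ → Euc d → Euc d → ℝ) : Prop where
  continuousOn : ContinuousOn (fun q : ℝ × Euc d × Euc d => p q.1 q.2.1 q.2.2)
    (Ioi 0 ×ˢ X.carrier ×ˢ X.carrier)
  semigroup : ∃ T : ℝ → X.L2 →L[ℝ] X.L2,
    (∀ t, 0 < t → ∀ u : X.L2,
      T t u =ᵐ[X.measure] fun x => ∫ y, p t x y * u y ∂X.measure) ∧
    (∀ s t, 0 < s → 0 < t → T (s + t) = (T s).comp (T t)) ∧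
    (∀ u, Tendsto (fun t => T t u) (𝓝[>] 0) (𝓝 u)) ∧
    ∀ u g : X.L2, S.IsLaplacian B u g ↔
      Tendsto (fun t : ℝ => t⁻¹ • (T t u - u)) (𝓝[>] 0) (𝓝 g)

/-- Spectral decimation of `Δ` by a real polynomial `p` of degree at least two, normalised by
`p (0) = 0` and `p' (0) = λ > 1`.  The points `z = lim λ^n z_n` with `p^(n) (z_n) = w` are the
solutions of `Φ (z) = w`, where `Φ` is the Poincaré function of `p`.  The spectrum of `Δ` (apart
from the eigenvalue zero) consists of the points `λ^m z`, where `w ∈ A`, `m ≥ 0` and `Φ (z) = w`,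
`z ≠ 0`; such a point contributes `β_m (w)` to the multiplicity for each zero of `Φ - w` at `z`
counted with its order.  The generating function `∑ β_m (w) z^m` is the rational function
`num w / den w` in lowest terms. -/
structure SpectralDecimation (B : Set (Euc d)) where
  poly : Polynomial ℝ
  lam : ℝ
  one_lt_lam : 1 < lam
  two_le_degree : 2 ≤ poly.natDegree
  coeff_zero : poly.coeff 0 = 0
  coeff_one : poly.coeff 1 = lam
  /-- The Poincaré function `Φ`. -/
  poincare : ℂ → ℂ
  poincare_entire : Differentiable ℂ poincare
  poincare_zero : poincare 0 = 0
  deriv_poincare_zero : deriv poincare 0 = 1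
  poincare_eq : ∀ z, poincare (lam * z) = Polynomial.aeval (poincare z) poly
  /-- The finite set `A`. -/
  A : Finset ℂ
  A_nonempty : A.Nonempty
  /-- The multiplicities `β_m (w)`. -/
  β : ℂ → ℕ → ℕ
  /-- No element of `A` is superfluous. -/
  occurs : ∀ w ∈ A, (∃ m, β w m ≠ 0) ∧ ∃ z, z ≠ 0 ∧ poincare z = w
  isEigenvalue : ∀ w ∈ A, ∀ m, β w m ≠ 0 → ∀ z, z ≠ 0 → poincare z = w →
    ∃ x : ℝ, (x : ℂ) = lam ^ m * z ∧ S.eigenspace B x ≠ ⊥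
  rank_eigenspace : ∀ x : ℝ, x ≠ 0 → Module.rank ℝ (S.eigenspace B x) =
    ((∑ w ∈ A, ∑ᶠ m : ℕ,
      β w m * analyticOrderNatAt (fun z => poincare z - w) ((x : ℂ) / lam ^ m) : ℕ) : Cardinal)
  num : ℂ → Polynomial ℂ
  den : ℂ → Polynomial ℂ
  coprime : ∀ w ∈ A, IsCoprime (num w) (den w)
  generating : ∀ w ∈ A,
    (den w : PowerSeries ℂ) * PowerSeries.mk (fun m => (β w m : ℂ)) = (num w : PowerSeries ℂ)

end HarmonicStructure

end PCFFractal

/-- The meromorphic function `f` has a pole at `s`. -/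
def IsPole (f : ℂ → ℂ) (s : ℂ) : Prop := meromorphicOrderAt f s < 0

/-- The points `α + 2 k π i / log λ`. -/
def latticePt (lam : ℝ) (α : ℂ) (k : ℤ) : ℂ :=
  α + 2 * k * Real.pi * Complex.I / Real.log lam

/-- `h` is real-analytic and `1`-periodic, and its Fourier coefficients
`∫_0^1 h (u) e^{2 k π i u} du` are the residues of `G` at the points `α + 2 k π i / log λ`, at which
`G` has at most a simple pole (the residue at `s_k` is then the limit of `(s - s_k) G (s)`). -/
structure IsResidueFunction (lam : ℝ) (G : ℂ → ℂ) (α : ℂ) (h : ℝ → ℂ) : Prop where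
  periodic : Function.Periodic h 1
  analytic : AnalyticOnNhd ℝ h univ
  fourier : ∀ k : ℤ, Tendsto (fun s => (s - latticePt lam α k) * G s) (𝓝[≠] latticePt lam α k)
    (𝓝 (∫ u in (0 : ℝ)..1, h u * Complex.exp (2 * k * Real.pi * Complex.I * u)))

end FractalHeat

end

/-! The heat trace is an exponential sum over the eigenvalues, with Mellin transform `ζ(s) Γ(s)`.
The theorem follows from a continuation of `ζ` that is well controlled in vertical strips, together
with an exact way back from the Mellin transform to `t → 0`. Write `λ` for `lam` and `d` for the
degree of the polynomial `p`.

Spectral side. As `r_i < c`, the energy of a function on a cell of level `n` decays geometrically in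
`n`, so energy bounds oscillation on `K` (`exists_sub_sq_le`). Applied to combinations of
eigenfunctions, this gives `∑ 1 / (1 + x) < ∞` over the eigenvalues `x` of `-Δ`
(`exists_sum_inv_le`). The semigroup is symmetric and consists of compact operators, so there is an
orthonormal basis of eigenfunctions, and Parseval on the diagonal of the kernel gives the trace as
`n₀ + ∑ exp (-x t)` (`integral_heatKernel`).

Poincaré function. Since `-Δ ≥ 0`, the nonzero solutions of `Φ = w`, `w ∈ A`, are numbers `-a < 0`,
and `∑ 1 / a < ∞` by the spectral bound. As `Φ` has finite order, a Hadamard argument gives `Φ' / (Φ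
- w) = κ / x + P(x) + S(x)` for `x > 0`, where `S(x) = ∑ 1 / (x + a)`, `P` is a polynomial and `κ`
is `1` if `w = 0` and `0` otherwise (`exists_polynomial`). On the positive axis `|Φ|` exceeds every
power of `x` (`tendsto_norm`, `eventually_pow_le_norm`), so that `Φ(λ x) = p(Φ(x))` becomes, for
every `N`, the relation `λ S(λ x) = d S(x) + κ (d - 1) / x + O(x^(-N))` (`stieltjes_functional`),
and `d < λ`.

This relation is all that is used about `Φ` afterwards. Iterated, it shows `S(λ^k) ≍ (d / λ)^k`, so
`∑ a^(-s)` has abscissa of convergence `log_λ d` and diverges there. Under the Mellin transform,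
with `S` going to `Γ(s) Γ(1 - s) ∑ a^(-s)` at `1 - s`, it says that `(λ^s - d) ∑ a^(-s)` extends to
an entire function `Y_w`, that `Y_w Γ` has no pole except perhaps at `0` when `w = 0`, and, by
Phragmén–Lindelöf, that `Y_w` is `O(exp (δ |Im s|))` in strips for every `δ > 0`
(`exists_continuation`).

Zeta function. Summing over dilated spectra, `ζ = ∑_w R_w(λ^(-s)) Y_w(s) / (λ^s - d)`. This displays
all possible poles. At the rightmost exponent the nonnegativity of all coefficients excludes
cancellation, so there is a pole (`IsDecimation.isPole`).

Heat trace. The poles of `G = ζ Γ` lie on finitely many lattices `α + (2πi / log λ) ℤ`. If they are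
simple, multiplication by `q(s) = ∏ (1 - λ^α λ^(-s))` makes `G` entire, with the decay of `Γ` in
vertical strips. Multiplication by `λ^(-s)` is dilation by `λ` before the Mellin transform, so `q G`
is the transform of a combination `h` of dilates of `u(z) = ∑ exp (-x z)`; contour shifts along
rotated rays show that `h` is smaller than every power of `z` at `0` and `∞` in sectors. Partial
fractions of `1 / q` split `u` into functions `f` with `f(z) - λ^α f(λ z) = c h(z)`, that is, into
one-sided sums over the powers of `λ`. Completing them to two-sided sums costs `O(t^M)` for every
`M` and produces exact solutions of the homogeneous equation, `t^(-α) H(log_λ t)`. The function `H`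
is analytic since `h` is holomorphic in a half plane, and unfolding the sum identifies its Fourier
coefficients with residues of `G` (`IsMellinPair.exists_expansion`). -/

namespace FractalHeat

/-! ### Entire functions of finite order with negative zeros -/

theorem differentiable_dslope {f : ℂ → ℂ} (hf : Differentiable ℂ f) (c : ℂ) :
    Differentiable ℂ (dslope f c) :=
  differentiableOn_univ.1 ((Complex.differentiableOn_dslope univ_mem).2 hf.differentiableOn)

theorem eq_sub_mul_dslope {f : ℂ → ℂ} {c : ℂ} (h : f c = 0) (z : ℂ) :
    f z = (z - c) * dslope f c z := by
  have := sub_smul_dslope f c z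
  rw [h, sub_zero, smul_eq_mul] at this
  exact this.symm

/-- An entire function that is not identically zero near `c` is divisible by the power of `z - c`
given by its order. -/
theorem exists_eq_pow_mul_entire {c : ℂ} (k : ℕ) :
    ∀ {f : ℂ → ℂ}, Differentiable ℂ f → analyticOrderAt f c = k →
      ∃ g : ℂ → ℂ, Differentiable ℂ g ∧ (∀ z, f z = (z - c) ^ k * g z) ∧ g c ≠ 0 := by
  induction k with
  | zero =>
    intro f hf h
    refine ⟨f, hf, fun z => by simp, ?_⟩
    exact (hf.analyticAt c).analyticOrderAt_eq_zero.1 (by simpa using h)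
  | succ k ih =>
    intro f hf h
    have h0 : f c = 0 := (hf.analyticAt c).analyticOrderAt_ne_zero.1 (by rw [h]; simp)
    have hd := differentiable_dslope hf c
    have hfac : f = (fun z => z - c) * dslope f c := by
      ext z; exact eq_sub_mul_dslope h0 z
    have h1 : analyticOrderAt f c = 1 + analyticOrderAt (dslope f c) c := by
      conv_lhs => rw [hfac]
      rw [analyticOrderAt_mul (by fun_prop) (hd.analyticAt c)]
      congr 1
      exact analyticOrderAt_id_sub_const_self
    have h2 : analyticOrderAt (dslope f c) c = k := by
      rw [h] at h1
      have : (1 : ℕ∞) + k = 1 + analyticOrderAt (dslope f c) c := by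
        rw [← h1]; push_cast; ring
      exact (ENat.add_right_injective_of_ne_top (by simp) this).symm
    obtain ⟨g, hg, hfg, hgc⟩ := ih hd h2
    refine ⟨g, hg, fun z => ?_, hgc⟩
    rw [eq_sub_mul_dslope h0 z, hfg z]
    ring

/-- Division of an entire function by the product over finitely many of its negative zeros. -/
theorem exists_eq_prod_mul_entire {g : ℂ → ℂ} (hg : Differentiable ℂ g) {n : ℝ → ℕ}
    (S : Finset ℝ) (hS : ∀ x ∈ S, 0 < x) (hn : ∀ x ∈ S, analyticOrderAt g (-(x : ℂ)) = n x) :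
    ∃ E : ℂ → ℂ, Differentiable ℂ E ∧ (∀ z, g z = (∏ a ∈ S, (1 + z / a) ^ n a) * E z) ∧
      ∀ a ∈ S, E (-(a : ℂ)) ≠ 0 := by
  classical
  induction S using Finset.induction_on with
  | empty => exact ⟨g, hg, fun z => by simp, by simp⟩
  | insert b S hb ih =>
    obtain ⟨E, hE, hgE, hE0⟩ := ih (fun x hx => hS x (Finset.mem_insert_of_mem hx))
      (fun x hx => hn x (Finset.mem_insert_of_mem hx))
    have hbpos := hS b (Finset.mem_insert_self _ _)
    have hprod : (∏ a ∈ S, (1 + (-(b : ℂ)) / a) ^ n a) ≠ 0 := by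
      refine Finset.prod_ne_zero_iff.2 fun a ha => pow_ne_zero _ ?_
      have hapos := hS a (Finset.mem_insert_of_mem ha)
      have ha' : (a : ℂ) ≠ 0 := by exact_mod_cast hapos.ne'
      intro h
      field_simp at h
      have h2 : (a : ℂ) = b := by linear_combination h
      have h3 : a = b := by exact_mod_cast h2
      exact hb (h3 ▸ ha)
    have hfac : g = (fun z : ℂ => ∏ a ∈ S, (1 + z / (a : ℂ)) ^ n a) * E := by ext z; exact hgE z
    have hpd : Differentiable ℂ (fun z : ℂ => ∏ a ∈ S, (1 + z / a) ^ n a) := by fun_prop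
    have hord : analyticOrderAt E (-(b : ℂ)) = n b := by
      have h1 := hn b (Finset.mem_insert_self _ _)
      conv_lhs at h1 => rw [hfac]
      rw [analyticOrderAt_mul (hpd.analyticAt _) (hE.analyticAt _),
        (hpd.analyticAt _).analyticOrderAt_eq_zero.2 hprod, zero_add] at h1
      exact h1
    obtain ⟨G, hG, hEG, hGb⟩ := exists_eq_pow_mul_entire (n b) hE hord
    have hb' : (b : ℂ) ≠ 0 := by exact_mod_cast hbpos.ne'
    refine ⟨fun z => (b : ℂ) ^ n b * G z, by fun_prop, fun z => ?_, fun a ha => ?_⟩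
    · rw [Finset.prod_insert hb, hgE z, hEG z]
      have : (1 + z / b) ^ n b * (b : ℂ) ^ n b = (z - -(b : ℂ)) ^ n b := by
        rw [← mul_pow]; congr 1; field_simp; ring
      rw [← this]; ring
    · refine mul_ne_zero (pow_ne_zero _ hb') ?_
      rcases Finset.mem_insert.1 ha with rfl | ha
      · exact hGb
      · have := hE0 a ha
        rw [hEG] at this
        exact right_ne_zero_of_mul this

/-- The logarithmic derivative of a zero-free function bounded by `|E 0| e ^ m` on a disc. -/
theorem norm_logDeriv_le {E : ℂ → ℂ} {R m : ℝ} (hR : 0 < R) (hm : 0 < m)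
    (hE : Differentiable ℂ E) (h0 : ∀ z ∈ Metric.ball (0 : ℂ) R, E z ≠ 0)
    (hb : ∀ z ∈ Metric.ball (0 : ℂ) R, ‖E z‖ ≤ ‖E 0‖ * Real.exp m) {z : ℂ} (hz : ‖z‖ ≤ R / 4) :
    ‖deriv E z / E z‖ ≤ 8 * m / R := by
  have hd : DifferentiableOn ℂ (fun z => deriv E z / E z) (Metric.ball 0 R) :=
    (hE.deriv).differentiableOn.div hE.differentiableOn h0
  -- `L` is a logarithm of `E / E 0`, so its real part is at most `m`. Borel–Carathéodory bounds it
  -- by `2 m` on the half disc, and Cauchy's estimate on circles of radius `R / 4` gives `8 m / R`.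
  obtain ⟨L, hL0, hL⟩ := hd.isExactOn_ball.with_val_at 0 0
  have hmem0 : (0 : ℂ) ∈ Metric.ball (0 : ℂ) R := Metric.mem_ball_self hR
  have hexp : ∀ z ∈ Metric.ball (0 : ℂ) R, E z * Complex.exp (-L z) = E 0 := by
    have key : ∀ z ∈ Metric.ball (0 : ℂ) R,
        HasDerivAt (fun z => E z * Complex.exp (-L z)) 0 z := by
      intro z hz
      have h1 := (hE z).hasDerivAt.mul (hL z hz).neg.cexp
      refine h1.congr_deriv ?_
      simp only [Pi.neg_apply]
      rw [show E z * (Complex.exp (-L z) * -(deriv E z / E z))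
        = -(deriv E z * Complex.exp (-L z)) * (E z / E z) by ring, div_self (h0 z hz)]
      ring
    intro z hz
    have := (convex_ball (0 : ℂ) R).is_const_of_fderivWithin_eq_zero (𝕜 := ℂ)
      (f := fun z => E z * Complex.exp (-L z))
      (fun z hz => (key z hz).differentiableAt.differentiableWithinAt)
      (fun z hz => by
        rw [fderivWithin_of_isOpen Metric.isOpen_ball hz]
        ext
        simp [(key z hz).deriv]) hz hmem0
    simpa [hL0] using this
  have hre : MapsTo L (Metric.ball 0 R) {z | z.re ≤ m} := by
    intro z hz
    have h1 := hexp z hz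
    have h2 : E z = E 0 * Complex.exp (L z) := by
      rw [← h1, mul_assoc, ← Complex.exp_add]; simp
    have h3 := hb z hz
    rw [h2, norm_mul, Complex.norm_exp] at h3
    have h4 := le_of_mul_le_mul_left h3 (norm_pos_iff.2 (h0 0 hmem0))
    exact Real.exp_le_exp.1 h4
  have hLd : DifferentiableOn ℂ L (Metric.ball 0 R) := fun z hz =>
    (hL z hz).differentiableAt.differentiableWithinAt
  have hbc : ∀ w : ℂ, ‖w‖ ≤ R / 2 → ‖L w‖ ≤ 2 * m := by
    intro w hw
    have hwR : w ∈ Metric.ball (0 : ℂ) R := by rw [mem_ball_zero_iff]; linarith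
    refine (Complex.borelCaratheodory_zero hm hLd hre hR hwR hL0).trans ?_
    rw [div_le_iff₀ (by linarith)]
    nlinarith [norm_nonneg w]
  have hzb : z ∈ Metric.ball (0 : ℂ) R := by rw [mem_ball_zero_iff]; linarith
  have hsub : Metric.closedBall z (R / 4) ⊆ Metric.ball 0 R := by
    intro w hw
    rw [mem_ball_zero_iff]
    have := norm_sub_norm_le w z
    rw [mem_closedBall_iff_norm] at hw
    linarith
  have := Complex.norm_deriv_le_of_forall_mem_sphere_norm_le (f := L) (c := z) (R := R / 4)
    (C := 2 * m) (by linarith)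
    ((hLd.mono hsub).diffContOnCl_ball (U := Metric.closedBall z (R/4)) (by exact subset_rfl))
        (fun w hw => hbc w (by
      have h1 := norm_sub_norm_le w z
      rw [mem_sphere_iff_norm] at hw
      linarith))
  rw [(hL z hzb).deriv] at this
  refine this.trans (le_of_eq ?_)
  field_simp
  ring

theorem finite_le_of_summable {n : ℝ → ℕ} (hsum : Summable fun x => (n x : ℝ) / x)
    (hn0 : ∀ x ≤ 0, n x = 0) (R : ℝ) : {x | n x ≠ 0 ∧ x ≤ R}.Finite := by
  by_cases hR : 0 < R
  · have h := hsum.tendsto_cofinite_zero.eventually (gt_mem_nhds (show (0 :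
        ℝ) < 1 / R by positivity))
    refine Set.Finite.subset (Filter.eventually_cofinite.1 h) fun x hx => ?_
    simp only [mem_ofPred_eq, not_lt]
    have hx0 : 0 < x := by
      by_contra h; exact hx.1 (hn0 x (not_lt.1 h))
    have h1 : (1 : ℝ) ≤ n x := by exact_mod_cast Nat.one_le_iff_ne_zero.2 hx.1
    exact div_le_div₀ (by linarith) h1 hx0 hx.2
  · convert Set.finite_empty (α := ℝ)
    ext x
    simp only [mem_ofPred_eq, mem_empty_iff_false, iff_false, not_and, not_le]
    intro h
    by_contra h'
    exact h (hn0 x (by linarith))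

theorem sub_norm_le_norm_add_ofReal {z : ℂ} {x : ℝ} : x - ‖z‖ ≤ ‖z + x‖ := by
  have := norm_sub_norm_le (x : ℂ) (-z)
  rw [norm_neg, sub_neg_eq_add, add_comm, Complex.norm_real] at this
  exact (sub_le_sub_right (le_abs_self x) _).trans (by simpa [add_comm] using this)

/-- The logarithmic derivative of an entire function of finite order whose zeros `-x`, `x > 0`,
satisfy `∑ 1 / x < ∞`, is the sum of a polynomial and of the simple fractions. -/
theorem exists_polynomial_logDeriv {g : ℂ → ℂ} (hg : Differentiable ℂ g) (hg0 : g 0 ≠ 0)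
    {C : ℝ} {N : ℕ} (hC : 0 ≤ C) (hM : ∀ z, ‖g z‖ ≤ Real.exp (C * (1 + ‖z‖) ^ N))
    {n : ℝ → ℕ} (hn0 : ∀ x ≤ 0, n x = 0) (hsum : Summable fun x => (n x : ℝ) / x)
    (hz : ∀ z, g z = 0 → ∃ x : ℝ, 0 < x ∧ z = -x)
    (hn : ∀ x : ℝ, 0 < x → analyticOrderAt g (-(x : ℂ)) = n x) :
    ∃ P : Polynomial ℂ, ∀ z, g z ≠ 0 →
      deriv g z / g z = P.eval z + ∑' x : ℝ, (n x : ℂ) / (z + x) := by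
  classical
  have hnz : ∀ x, n x ≠ 0 → 0 < x := fun x hx => by
    by_contra h; exact hx (hn0 x (not_lt.1 h))
  set F : ℂ → ℂ := fun z => deriv g z / g z - ∑' x : ℝ, (n x : ℂ) / (z + x) with hF
  set σ : ℝ := ∑' x : ℝ, (n x : ℝ) / x with hσ
  have hσ0 : 0 ≤ σ := tsum_nonneg fun x => by
    by_cases h : n x = 0
    · simp [h]
    · exact div_nonneg (by positivity) (hnz x h).le
  set m : ℝ → ℝ := fun R => C * (1 + 3 * R) ^ N + |Real.log ‖g 0‖| + 1 with hm
  -- Locally `F` extends over the zeros. Dividing by the zeros `-x` with `x ≤ R` leaves a function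
  -- `E` without zeros in the disc of radius `R`, whose logarithmic derivative is controlled; the
  -- remaining fractions satisfy `|z + x| ≥ x / 2` on the half disc and add at most `2 σ`.
  have key : ∀ R : ℝ, 0 < R → ∃ h : ℂ → ℂ, DifferentiableOn ℂ h (Metric.ball 0 (R / 2)) ∧
      (∀ z ∈ Metric.ball (0 : ℂ) (R / 2), g z ≠ 0 → h z = F z) ∧
      ∀ z : ℂ, ‖z‖ ≤ R / 4 → ‖h z‖ ≤ 8 * m R / R + 2 * σ := by
    intro R hR
    have hfin := finite_le_of_summable hsum hn0 R
    set S := hfin.toFinset with hS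
    have hSmem : ∀ x, x ∈ S ↔ n x ≠ 0 ∧ x ≤ R := fun x => by simp [hS]
    obtain ⟨E, hE, hgE, hES⟩ := exists_eq_prod_mul_entire hg (n := n) S
      (fun x hx => hnz x ((hSmem x).1 hx).1) (fun x hx => hn x (hnz x ((hSmem x).1 hx).1))
    have hE0 : E 0 = g 0 := by rw [hgE 0]; simp
    have hEne : ∀ z ∈ Metric.ball (0 : ℂ) R, E z ≠ 0 := by
      intro z hzR h
      obtain ⟨x, hx, rfl⟩ := hz z (by rw [hgE, h, mul_zero])
      rw [mem_ball_zero_iff, norm_neg, Complex.norm_real, Real.norm_of_nonneg hx.le] at hzR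
      refine hES x ((hSmem x).2 ⟨fun h0 => ?_, hzR.le⟩) h
      have h1 := hn x hx
      rw [h0] at h1
      exact (hg.analyticAt _).analyticOrderAt_eq_zero.1 (by simpa using h1)
        (by rw [hgE, h, mul_zero])
    have hEle : ∀ z ∈ Metric.ball (0 : ℂ) R, ‖E z‖ ≤ ‖E 0‖ * Real.exp (m R) := by
      -- On the radius `3 R` every removed factor `1 + z / a`, `a ≤ R`, has modulus at least `2`, so
      -- division does not increase the function there; the maximum principle carries the bound
      -- inside.
      have hsph : ∀ z ∈ frontier (Metric.ball (0 : ℂ) (3 * R)),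
          ‖E z‖ ≤ Real.exp (C * (1 + 3 * R) ^ N) := by
        intro z hz
        rw [frontier_ball _ (by positivity), mem_sphere_zero_iff_norm] at hz
        have h1 := hM z
        rw [hgE, norm_mul, hz] at h1
        refine le_trans (le_mul_of_one_le_left (norm_nonneg _) ?_) h1
        rw [norm_prod]
        refine Finset.one_le_prod fun a ha => ?_
        rw [norm_pow]
        refine one_le_pow₀ ?_
        have hapos := hnz a ((hSmem a).1 ha).1
        have haR := ((hSmem a).1 ha).2
        have h2 := norm_sub_norm_le (z / a) (-1)
        rw [sub_neg_eq_add, norm_neg, norm_one, norm_div, hz, Complex.norm_real,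
          Real.norm_of_nonneg hapos.le, add_comm (z / _)] at h2
        have h3 : 3 ≤ 3 * R / a := by rw [le_div_iff₀ hapos]; linarith
        linarith
      intro z hz
      have h1 := Complex.norm_le_of_forall_mem_frontier_norm_le Metric.isBounded_ball
        hE.diffContOnCl hsph (z := z) (subset_closure (by
          rw [mem_ball_zero_iff] at hz ⊢; linarith))
      refine h1.trans ?_
      have hpos : 0 < ‖g 0‖ := norm_pos_iff.2 hg0
      rw [hE0]
      conv_rhs => rw [← Real.exp_log hpos]
      rw [← Real.exp_add]
      refine Real.exp_le_exp.2 ?_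
      simp only [hm]
      have := neg_abs_le (Real.log ‖g 0‖)
      linarith
    set T : ℝ → ℂ → ℂ := fun x z => if x ∈ S then 0 else (n x : ℂ) / (z + x) with hT
    have hxS : ∀ x, x ∉ S → n x ≠ 0 → R < x := fun x hx h => by
      by_contra h'; exact hx ((hSmem x).2 ⟨h, not_lt.1 h'⟩)
    have hTb : ∀ x z, ‖z‖ ≤ R / 2 → ‖T x z‖ ≤ 2 * ((n x : ℝ) / x) := by
      intro x z hz
      simp only [hT]
      split_ifs with hx
      · have := hnz x ((hSmem x).1 hx).1
        rw [norm_zero]; positivity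
      · by_cases h : n x = 0
        · simp [h]
        have hxR := hxS x hx h
        have h1 : x / 2 ≤ ‖z + x‖ := le_trans (by linarith) sub_norm_le_norm_add_ofReal
        have hx0 := hnz x h
        rw [norm_div, Complex.norm_natCast]
        calc (n x : ℝ) / ‖z + x‖ ≤ n x / (x / 2) := by gcongr
          _ = _ := by field_simp
    have hTd : DifferentiableOn ℂ (fun z => ∑' x, T x z) (Metric.ball 0 (R / 2)) := by
      refine Complex.differentiableOn_tsum_of_summable_norm (hsum.mul_left 2) (fun x => ?_)
        Metric.isOpen_ball (fun x z hz => hTb x z (mem_ball_zero_iff.1 hz).le)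
      simp only [hT]
      split_ifs with hx
      · fun_prop
      · by_cases h : n x = 0
        · simp only [h, Nat.cast_zero, zero_div]; fun_prop
        intro z hz
        have h1 : x / 2 ≤ ‖z + x‖ := le_trans (by
          have := hxS x hx h; have := mem_ball_zero_iff.1 hz; linarith) sub_norm_le_norm_add_ofReal
        have h2 : z + x ≠ 0 := norm_pos_iff.1 (lt_of_lt_of_le (by linarith [hnz x h]) h1)
        have h3 : DifferentiableAt ℂ (fun z : ℂ => (n x : ℂ) / (z + x)) z :=
          (differentiableAt_const _).div (by fun_prop) h2
        exact h3.differentiableWithinAt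
    refine ⟨fun z => deriv E z / E z - ∑' x, T x z, ?_, ?_, ?_⟩
    · refine (DifferentiableOn.div hE.deriv.differentiableOn hE.differentiableOn fun z hz =>
        hEne z ?_).sub hTd
      rw [mem_ball_zero_iff] at hz ⊢
      linarith
    · intro z hz hgz
      have hzR := (mem_ball_zero_iff.1 hz).le
      have hsT : Summable fun x => T x z :=
        Summable.of_norm_bounded (hsum.mul_left 2) (fun x => hTb x z hzR)
      have hfac : ∀ a ∈ S, (1 + z / (a : ℂ)) ≠ 0 := by
        intro a ha h0
        apply hgz
        rw [hgE]
        rw [Finset.prod_eq_zero ha, zero_mul]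
        rw [h0, zero_pow ((hSmem a).1 ha).1]
      have hlog : deriv g z / g z = (∑ a ∈ S, (n a : ℂ) / (z + a)) + deriv E z / E z := by
        have hEz : E z ≠ 0 := fun h => hgz (by rw [hgE, h, mul_zero])
        have h1 : g = fun z : ℂ => (∏ a ∈ S, (1 + z / (a : ℂ)) ^ n a) * E z := funext hgE
        have h2 : logDeriv g z = logDeriv (fun z : ℂ => ∏ a ∈ S, (1 + z / (a : ℂ)) ^ n a) z
            + logDeriv E z := by
          rw [h1]
          exact logDeriv_mul z (Finset.prod_ne_zero_iff.2 fun a ha => pow_ne_zero _ (hfac a ha)) hEz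
            (by fun_prop) (hE z)
        rw [logDeriv_prod (𝕜 := ℂ) (f := fun (a : ℝ) (z : ℂ) => (1 + z / (a : ℂ)) ^ n a) (x :=
            z) (fun a ha => pow_ne_zero _ (hfac a ha)) (fun a ha => by fun_prop)] at h2
        rw [logDeriv_apply, logDeriv_apply] at h2
        rw [h2]
        congr 1
        refine Finset.sum_congr rfl fun a ha => ?_
        have ha0 : (a : ℂ) ≠ 0 := by exact_mod_cast (hnz a ((hSmem a).1 ha).1).ne'
        have hd : HasDerivAt (fun z : ℂ => 1 + z / (a : ℂ)) (1 / a) z := by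
          simpa using ((hasDerivAt_id z).div_const (a : ℂ)).const_add 1
        rw [logDeriv_fun_pow hd.differentiableAt, logDeriv_apply, hd.deriv]
        have h3 := hfac a ha
        have h4 : z + a ≠ 0 := fun h => h3 (by field_simp; linear_combination h)
        rw [show 1 + z / (a : ℂ) = (z + a) / a by field_simp; ring, div_div_div_cancel_right₀ ha0,
            mul_one_div]
      have hsplit : ∑' x : ℝ, (n x : ℂ) / (z + x) = (∑ a ∈ S, (n a : ℂ) / (z + a)) + ∑' x,
          T x z := by
        have hs2 : HasSum (fun x : ℝ => if x ∈ S then (n x : ℂ) / (z + x) else 0)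
            (∑ a ∈ S, (n a : ℂ) / (z + a)) := by
          have : HasSum (fun x : ℝ => if x ∈ S then (n x : ℂ) / (z + x) else 0)
              (∑ x ∈ S, if x ∈ S then (n x : ℂ) / (z + x) else 0) :=
            hasSum_sum_of_ne_finset_zero fun x hx => if_neg hx
          rwa [Finset.sum_congr rfl fun x hx => if_pos hx] at this
        have hs3 := hs2.add hsT.hasSum
        rw [← hs3.tsum_eq]
        refine tsum_congr fun x => ?_
        simp only [hT]
        split_ifs <;> simp
      simp only [hF]
      rw [hlog, hsplit]
      ring
    · intro z hz
      refine (norm_sub_le _ _).trans (add_le_add ?_ ?_)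
      · have hmpos : 0 < m R := by simp only [hm]; positivity
        exact norm_logDeriv_le hR hmpos hE hEne hEle hz
      · refine (tsum_of_norm_bounded ((hsum.mul_left 2).hasSum) (fun x =>
            hTb x z (by linarith))).trans ?_
        rw [tsum_mul_left]
  set c : ℕ → ℂ := fun k => ((k.factorial : ℂ))⁻¹ * iteratedDeriv k F 0 with hc
  have hgnear : ∀ᶠ z in 𝓝 (0 : ℂ), g z ≠ 0 := hg.continuous.continuousAt.eventually_ne hg0
  have hcoef : ∀ R > 0, ∀ h : ℂ → ℂ,
      (∀ z ∈ Metric.ball (0 : ℂ) (R / 2), g z ≠ 0 → h z = F z) →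
      ∀ k, iteratedDeriv k h 0 = iteratedDeriv k F 0 := by
    intro R hR h hh k
    refine Filter.EventuallyEq.iteratedDeriv_eq k ?_
    filter_upwards [hgnear, Metric.ball_mem_nhds (0 : ℂ) (half_pos hR)] with z h1 h2
    exact hh z h2 h1
  -- Liouville's argument: `m R = O(R ^ N)`, so the Cauchy estimates on radius `R / 4` annihilate
  -- all Taylor coefficients of order above `N` as `R → ∞`.
  have hc0 : ∀ k, N < k → c k = 0 := by
    intro k hk
    have hlim : Tendsto (fun R : ℝ => (8 * m R / R + 2 * σ) / (R / 4) ^ k) atTop (𝓝 0) := by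
      have hle : ∀ R : ℝ, 1 ≤ R → ‖(8 * m R / R + 2 * σ) / (R / 4) ^ k‖ ≤
          (8 * (C * 4 ^ N + |Real.log ‖g 0‖| + 1) + 2 * σ) * 4 ^ k * R⁻¹ := by
        intro R hR
        have hR0 : 0 < R := by linarith
        have hmR : m R ≤ (C * 4 ^ N + |Real.log ‖g 0‖| + 1) * R ^ N := by
          simp only [hm]
          have h1 : (1 + 3 * R) ^ N ≤ 4 ^ N * R ^ N := by
            rw [← mul_pow]; gcongr; linarith
          have h2 : (1 : ℝ) ≤ R ^ N := one_le_pow₀ hR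
          nlinarith [mul_le_mul_of_nonneg_left h1 hC, abs_nonneg (Real.log ‖g 0‖)]
        have hmpos : 0 < m R := by simp only [hm]; positivity
        rw [Real.norm_of_nonneg (by positivity), div_pow, div_div_eq_mul_div]
        rw [div_le_iff₀ (by positivity)]
        have h3 : R ^ N ≤ R⁻¹ * R ^ k := by
          rw [inv_mul_eq_div, le_div_iff₀ hR0, ← pow_succ]
          exact pow_le_pow_right₀ hR hk
        have h4 : 8 * m R / R ≤ 8 * m R := div_le_self (by positivity) hR
        have h2 : (1 : ℝ) ≤ R ^ N := one_le_pow₀ hR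
        calc (8 * m R / R + 2 * σ) * 4 ^ k
            ≤ ((8 * (C * 4 ^ N + |Real.log ‖g 0‖| + 1) + 2 * σ) * R ^ N) * 4 ^ k := by
              gcongr
              nlinarith
          _ ≤ ((8 * (C * 4 ^ N + |Real.log ‖g 0‖| + 1) + 2 * σ) * (R⁻¹ * R ^ k)) * 4 ^ k := by
              gcongr
          _ = _ := by ring
      refine squeeze_zero_norm' (eventually_atTop.2 ⟨1, hle⟩) ?_
      simpa using (tendsto_inv_atTop_zero (𝕜 := ℝ)).const_mul
        ((8 * (C * 4 ^ N + |Real.log ‖g 0‖| + 1) + 2 * σ) * 4 ^ k)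
    have hbound : ∀ R : ℝ, 1 ≤ R → ‖c k‖ ≤ (8 * m R / R + 2 * σ) / (R / 4) ^ k := by
      intro R hR
      have hR0 : 0 < R := by linarith
      obtain ⟨h, hd, hh, hb⟩ := key R hR0
      have h1 := Complex.norm_iteratedDeriv_le_of_forall_mem_sphere_norm_le (f := h) (c := 0)
        (R := R / 4) (C := 8 * m R / R + 2 * σ) k (by positivity)
        (DifferentiableOn.diffContOnCl (hd.mono (by
          rw [closure_ball _ (by positivity)]
          intro z hz
          rw [mem_closedBall_zero_iff] at hz
          rw [mem_ball_zero_iff]; linarith)))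
        (fun z hz => hb z (by rw [mem_sphere_zero_iff_norm] at hz; exact hz.le))
      rw [hcoef R hR0 h hh k] at h1
      simp only [hc, norm_mul, norm_inv, Complex.norm_natCast]
      rw [inv_mul_le_iff₀ (by positivity)]
      exact h1.trans (le_of_eq (by ring))
    have := ge_of_tendsto hlim (eventually_atTop.2 ⟨1, hbound⟩)
    exact norm_le_zero_iff.1 this
  refine ⟨∑ k ∈ Finset.range (N + 1), Polynomial.monomial k (c k), fun z hgz => ?_⟩
  obtain ⟨h, hd, hh, -⟩ := key (2 * ‖z‖ + 2) (by positivity)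
  have hzb : z ∈ Metric.ball (0 : ℂ) ((2 * ‖z‖ + 2) / 2) := by
    rw [mem_ball_zero_iff]; linarith
  have h1 := Complex.hasSum_taylorSeries_on_ball hd hzb
  have h2 : HasSum (fun k : ℕ => ((k.factorial : ℂ))⁻¹ • (z - 0) ^ k • iteratedDeriv k h 0)
      (∑ k ∈ Finset.range (N + 1), c k * z ^ k) := by
    have : HasSum (fun k : ℕ => c k * z ^ k) (∑ k ∈ Finset.range (N + 1), c k * z ^ k) :=
      hasSum_sum_of_ne_finset_zero fun k hk => by
        rw [hc0 k (by simpa [Nat.lt_succ_iff] using hk), zero_mul]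
    convert! this using 1
    ext k
    rw [hcoef _ (by positivity) h hh k]
    simp only [hc, smul_eq_mul, sub_zero]
    ring
  have h3 := h1.unique h2
  rw [hh z hzb hgz] at h3
  simp only [hF] at h3
  rw [Polynomial.eval_finsetSum]
  simp only [Polynomial.eval_monomial]
  rw [← h3]
  ring

/-! ### Growth of polynomials -/

theorem exists_norm_aeval_le (q : Polynomial ℂ) (d : ℕ) (hd : q.natDegree ≤ d) :
    ∃ K : ℝ, 1 ≤ K ∧ ∀ y : ℂ, ‖q.eval y‖ ≤ K * (1 + ‖y‖) ^ d := by
  refine ⟨1 + ∑ i ∈ Finset.range (q.natDegree + 1), ‖q.coeff i‖, ?_, fun y => ?_⟩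
  · have : 0 ≤ ∑ i ∈ Finset.range (q.natDegree + 1), ‖q.coeff i‖ :=
      Finset.sum_nonneg fun _ _ => norm_nonneg _
    linarith
  · rw [Polynomial.eval_eq_sum_range, add_mul, Finset.sum_mul]
    have h1 : ‖∑ i ∈ Finset.range (q.natDegree + 1), q.coeff i * y ^ i‖ ≤
        ∑ i ∈ Finset.range (q.natDegree + 1), ‖q.coeff i‖ * (1 + ‖y‖) ^ d := by
      refine (norm_sum_le _ _).trans (Finset.sum_le_sum fun i hi => ?_)
      rw [norm_mul, norm_pow]
      have hi' : i ≤ d := by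
        have := Finset.mem_range.1 hi; omega
      have h2 : ‖y‖ ^ i ≤ (1 + ‖y‖) ^ i := by gcongr; linarith
      have h3 : (1 + ‖y‖) ^ i ≤ (1 + ‖y‖) ^ d :=
        pow_le_pow_right₀ (by linarith [norm_nonneg y]) hi'
      exact mul_le_mul_of_nonneg_left (h2.trans h3) (norm_nonneg _)
    have h2 : 0 ≤ 1 * (1 + ‖y‖) ^ d := by positivity
    linarith

theorem exists_le_norm_eval (q : Polynomial ℂ) (hq : 0 < q.natDegree) :
    ∃ c : ℝ, 0 < c ∧ ∃ Y : ℝ, 1 ≤ Y ∧ ∀ y : ℂ, Y ≤ ‖y‖ → c * ‖y‖ ^ q.natDegree ≤ ‖q.eval y‖ := by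
  have hq0 : q ≠ 0 := fun h => by simp [h] at hq
  have hlc : 0 < ‖q.leadingCoeff‖ := norm_pos_iff.2 (Polynomial.leadingCoeff_ne_zero.2 hq0)
  obtain ⟨K, hK1, hK⟩ := exists_norm_aeval_le q.eraseLead (q.natDegree - 1)
    q.eraseLead_natDegree_le
  set c := ‖q.leadingCoeff‖
  refine ⟨c / 2, by positivity, max 1 (K * 2 ^ (q.natDegree - 1) / (c / 2)), le_max_left _ _,
    fun y hy => ?_⟩
  have hy1 : 1 ≤ ‖y‖ := (le_max_left _ _).trans hy
  have hy2 : K * 2 ^ (q.natDegree - 1) ≤ c / 2 * ‖y‖ := by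
    have := (le_max_right _ _).trans hy
    rw [div_le_iff₀ (by positivity)] at this
    linarith
  have h1 : q.eval y = q.eraseLead.eval y + q.leadingCoeff * y ^ q.natDegree := by
    have := congrArg (Polynomial.eval y) q.eraseLead_add_C_mul_X_pow
    rw [Polynomial.eval_add, Polynomial.eval_mul, Polynomial.eval_C, Polynomial.eval_pow,
      Polynomial.eval_X] at this
    exact this.symm
  have h2 : ‖q.leadingCoeff * y ^ q.natDegree‖ = c * ‖y‖ ^ q.natDegree := by
    rw [norm_mul, norm_pow]
  have h3 : ‖q.eraseLead.eval y‖ ≤ c / 2 * ‖y‖ ^ q.natDegree := by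
    refine (hK y).trans ?_
    have h4 : (1 + ‖y‖) ^ (q.natDegree - 1) ≤ (2 * ‖y‖) ^ (q.natDegree - 1) := by
      gcongr; linarith
    calc K * (1 + ‖y‖) ^ (q.natDegree - 1) ≤ K * (2 * ‖y‖) ^ (q.natDegree - 1) := by gcongr
      _ = (K * 2 ^ (q.natDegree - 1)) * ‖y‖ ^ (q.natDegree - 1) := by rw [mul_pow]; ring
      _ ≤ (c / 2 * ‖y‖) * ‖y‖ ^ (q.natDegree - 1) := by gcongr
      _ = c / 2 * ‖y‖ ^ (q.natDegree - 1 + 1) := by ring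
      _ = _ := by rw [Nat.sub_add_cancel hq]
  rw [h1]
  have h5 := norm_sub_norm_le (q.leadingCoeff * y ^ q.natDegree) (-q.eraseLead.eval y)
  rw [norm_neg, sub_neg_eq_add, add_comm (q.leadingCoeff * _), h2] at h5
  linarith

/-- A polynomial that tends to zero along the positive reals is zero. -/
theorem eq_zero_of_tendsto_eval (q : Polynomial ℂ)
    (h : Tendsto (fun x : ℝ => q.eval (x : ℂ)) atTop (𝓝 0)) : q = 0 := by
  have hdeg : q.natDegree = 0 := by
    by_contra hd
    obtain ⟨c, hc, Y, hY1, hY⟩ := exists_le_norm_eval q (Nat.pos_of_ne_zero hd)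
    have h1 := h.norm.eventually (gt_mem_nhds (show ‖(0 : ℂ)‖ < c by simpa using hc))
    obtain ⟨x, hx1, hx2⟩ := (h1.and (eventually_ge_atTop Y)).exists
    have hxn : ‖(x : ℂ)‖ = x := by
      rw [Complex.norm_real, Real.norm_of_nonneg (by linarith)]
    have h2 := hY x (by rw [hxn]; exact hx2)
    rw [hxn] at h2
    have h3 : (1 : ℝ) ≤ x ^ q.natDegree := one_le_pow₀ (by linarith)
    nlinarith
  rw [Polynomial.eq_C_of_natDegree_eq_zero hdeg] at h ⊢
  simp only [Polynomial.eval_C] at h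
  rw [tendsto_nhds_unique h tendsto_const_nhds |>.symm ▸ rfl |> fun h : q.coeff 0 = 0 => h,
      map_zero]

/-! ### The Poincaré function: finite order and reality on the real axis -/

/-- The Poincaré function `Φ` of a polynomial `p` with `p 0 = 0`, `p' 0 = λ > 1`. -/
structure IsPoincare (Φ : ℂ → ℂ) (p : Polynomial ℝ) (lam : ℝ) : Prop where
  one_lt : 1 < lam
  two_le : 2 ≤ p.natDegree
  coeff_zero : p.coeff 0 = 0
  coeff_one : p.coeff 1 = lam
  entire : Differentiable ℂ Φ
  map_zero : Φ 0 = 0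
  deriv_zero : deriv Φ 0 = 1
  eq : ∀ z, Φ (lam * z) = (p.map (algebraMap ℝ ℂ)).eval (Φ z)

namespace IsPoincare

variable {Φ : ℂ → ℂ} {p : Polynomial ℝ} {lam : ℝ}

theorem natDegree_map (p : Polynomial ℝ) : (p.map (algebraMap ℝ ℂ)).natDegree = p.natDegree :=
  Polynomial.natDegree_map _

/-- A dilation by `lam` multiplies `log |Φ|` by at most about `d`, so `log |Φ|` grows no faster than
a power of `|z|` whose exponent `N` satisfies `d < lam ^ N`. -/
theorem exists_growth (h : IsPoincare Φ p lam) :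
    ∃ C : ℝ, 0 ≤ C ∧ ∃ N : ℕ, ∀ z, 1 + ‖Φ z‖ ≤ Real.exp (C * (1 + ‖z‖) ^ N) := by
  obtain ⟨K, hK1, hK⟩ := exists_norm_aeval_le (p.map (algebraMap ℝ ℂ)) p.natDegree
    (natDegree_map p).le
  set d := p.natDegree
  have hlam := h.one_lt
  obtain ⟨N, hN⟩ := pow_unbounded_of_one_lt (d : ℝ) hlam
  obtain ⟨B, hB⟩ := (isCompact_closedBall (0 : ℂ) 1).exists_bound_of_continuousOn
    h.entire.continuous.continuousOn
  have hB0 : 0 ≤ B := (norm_nonneg _).trans (hB 0 (by simp))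
  have hd2 : (2 : ℝ) ≤ d := by exact_mod_cast h.two_le
  -- The summand `log (2 K)` absorbs the additive error: one step adds `log (2 K)`, while
  -- multiplication by `d ≥ 2` provides an extra copy of it.
  set a : ℂ → ℝ := fun z => Real.log (1 + ‖Φ z‖) + Real.log (2 * K) with ha
  have hlogK : 0 ≤ Real.log (2 * K) := Real.log_nonneg (by linarith)
  have ha0 : ∀ z, 0 ≤ a z := fun z =>
    add_nonneg (Real.log_nonneg (by linarith [norm_nonneg (Φ z)])) hlogK
  have hstep : ∀ z, a (lam * z) ≤ d * a z := by
    intro z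
    have hpos : 0 < 1 + ‖Φ z‖ := by positivity
    have h1 : 1 + ‖Φ (lam * z)‖ ≤ 2 * K * (1 + ‖Φ z‖) ^ d := by
      have h2 := hK (Φ z)
      rw [← h.eq] at h2
      have h3 : 1 ≤ K * (1 + ‖Φ z‖) ^ d :=
        one_le_mul_of_one_le_of_one_le hK1 (one_le_pow₀ (by linarith [norm_nonneg (Φ z)]))
      linarith
    have h2 := Real.log_le_log (by positivity) h1
    rw [Real.log_mul (by positivity) (by positivity), Real.log_pow] at h2
    simp only [ha]
    nlinarith
  set A := Real.log (1 + B) + Real.log (2 * K)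
  have hball : ∀ n : ℕ, ∀ z : ℂ, ‖z‖ ≤ lam ^ n → a z ≤ (d : ℝ) ^ n * A := by
    intro n
    induction n with
    | zero =>
      intro z hz
      have h1 := hB z (by simpa using hz)
      simp only [pow_zero, one_mul, ha, A]
      gcongr
    | succ n ih =>
      intro z hz
      have hl : (lam : ℂ) ≠ 0 := by exact_mod_cast (zero_lt_one.trans hlam).ne'
      have h1 := hstep (z / lam)
      rw [mul_div_cancel₀ _ hl] at h1
      refine h1.trans ?_
      rw [pow_succ', mul_assoc]
      refine mul_le_mul_of_nonneg_left (ih _ ?_) (by positivity)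
      rw [norm_div, Complex.norm_real, Real.norm_of_nonneg (by linarith), div_le_iff₀ (by linarith)]
      rwa [pow_succ] at hz
  have hA : 0 ≤ A := add_nonneg (Real.log_nonneg (by linarith)) hlogK
  refine ⟨A * lam ^ N, by positivity, N, fun z => ?_⟩
  obtain ⟨n, hn1, hn2⟩ := exists_nat_pow_near (show (1 :
      ℝ) ≤ 1 + ‖z‖ by linarith [norm_nonneg z]) hlam
  have h1 := hball (n + 1) z (by linarith)
  have h2 : (d : ℝ) ^ (n + 1) ≤ (lam * (1 + ‖z‖)) ^ N := by
    calc (d : ℝ) ^ (n + 1) ≤ (lam ^ N) ^ (n + 1) := by gcongr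
      _ = (lam ^ (n + 1)) ^ N := by rw [← pow_mul, ← pow_mul, mul_comm]
      _ ≤ _ := by
        gcongr
        rw [pow_succ']
        gcongr
  have h3 : Real.log (1 + ‖Φ z‖) ≤ A * lam ^ N * (1 + ‖z‖) ^ N := by
    have : a z ≤ (lam * (1 + ‖z‖)) ^ N * A := h1.trans (mul_le_mul_of_nonneg_right h2 hA)
    rw [mul_pow] at this
    simp only [ha] at this
    nlinarith
  calc 1 + ‖Φ z‖ = Real.exp (Real.log (1 + ‖Φ z‖)) := (Real.exp_log (by positivity)).symm
    _ ≤ _ := Real.exp_le_exp.2 h3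

/-- Uniqueness of the Poincaré function, applied to `Φ` and its conjugate `Ψ`; both satisfy the
functional equation since `p` is real. If `Φ - Ψ = z ^ k G` with `G 0 ≠ 0`, then `p(Φ) - p(Ψ) ~ lam
(Φ - Ψ)` near `0` forces `lam ^ k = lam`, so `k = 1`. But both derivatives at `0` are `1`, so `G 0 =
0`. -/
theorem conj_eq (h : IsPoincare Φ p lam) (z : ℂ) :
    Φ ((starRingEnd ℂ) z) = (starRingEnd ℂ) (Φ z) := by
  set Ψ : ℂ → ℂ := (starRingEnd ℂ) ∘ Φ ∘ (starRingEnd ℂ) with hΨ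
  have hΨd : Differentiable ℂ Ψ := fun z => by
    have := (h.entire ((starRingEnd ℂ) z)).conj_conj
    simpa [hΨ] using this
  set q := p.map (algebraMap ℝ ℂ) with hq
  have hΨeq : ∀ z, Ψ (lam * z) = q.eval (Ψ z) := by
    intro z
    simp only [hΨ, Function.comp_apply, map_mul, Complex.conj_ofReal]
    rw [h.eq, ← hq, ← Polynomial.eval_map_apply, Polynomial.map_map]
    congr 1
    rw [hq]
    congr 1
    ext x
    simp
  have hΨ0 : Ψ 0 = 0 := by simp [hΨ, h.map_zero]
  have hΨ1 : deriv Ψ 0 = 1 := by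
    have h1 : HasDerivAt Φ 1 0 := by
      rw [← h.deriv_zero]; exact (h.entire 0).hasDerivAt
    have h2 := h1.conj_conj
    rw [_root_.map_zero, map_one] at h2
    exact h2.deriv
  set D : ℂ → ℂ := fun z => Φ z - Ψ z with hD
  have hDd : Differentiable ℂ D := h.entire.sub hΨd
  suffices hD0 : ∀ z, D z = 0 by
    have := hD0 ((starRingEnd ℂ) z)
    simp only [hD, hΨ, Function.comp_apply, Complex.conj_conj] at this
    exact sub_eq_zero.1 this
  by_cases htop : analyticOrderAt D 0 = ⊤
  · intro z
    have hev := analyticOrderAt_eq_top.1 htop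
    have := (Complex.analyticOnNhd_univ_iff_differentiable.2 hDd).eq_of_eventuallyEq (g := 0)
      (Complex.analyticOnNhd_univ_iff_differentiable.2 (differentiable_const 0)) hev
    rw [this]; rfl
  exfalso
  obtain ⟨k, hk⟩ := ENat.ne_top_iff_exists.1 htop
  obtain ⟨G, hG, hDG, hG0⟩ := exists_eq_pow_mul_entire k hDd hk.symm
  simp only [sub_zero] at hDG
  have hlam := h.one_lt
  have hstrict : HasStrictDerivAt (fun y => q.eval y) (lam : ℂ) 0 := by
    have h0 : q.derivative.eval 0 = lam := by
      rw [← Polynomial.coeff_zero_eq_eval_zero, Polynomial.coeff_derivative, hq,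
        Polynomial.coeff_map, zero_add, h.coeff_one]
      simp
    rw [← h0]
    exact q.hasStrictDerivAt (0 : ℂ)
  have ho := hstrict.isLittleO
  have htend : Tendsto (fun z => (Φ z, Ψ z)) (𝓝 0) (𝓝 (0, 0)) := by
    have h1 := h.entire.continuous.tendsto 0
    have h2 := hΨd.continuous.tendsto 0
    rw [h.map_zero] at h1
    rw [hΨ0] at h2
    exact h1.prodMk_nhds h2
  have ho2 := (ho.comp_tendsto htend).mono (nhdsWithin_le_nhds (s := {0}ᶜ))
  have ho3 : (fun z => (lam : ℂ) ^ k * G (lam * z) - lam * G z) =o[𝓝[≠] 0] fun z => G z := by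
    refine ((isLittleO_iff.2 fun c hc => ?_))
    filter_upwards [isLittleO_iff.1 ho2 hc, self_mem_nhdsWithin] with z hz hz0
    simp only [Function.comp_apply, ContinuousLinearMap.toSpanSingleton_apply, smul_eq_mul] at hz
    rw [← h.eq, ← hΨeq] at hz
    have e1 : Φ (lam * z) - Ψ (lam * z) = (lam * z) ^ k * G (lam * z) := hDG _
    have e2 : Φ z - Ψ z = z ^ k * G z := hDG _
    have hzk : 0 < ‖z ^ k‖ := norm_pos_iff.2 (pow_ne_zero _ hz0)
    rw [e1, e2, show ((lam : ℂ) * z) ^ k * G (lam * z) - z ^ k * G z * lam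
      = z ^ k * ((lam : ℂ) ^ k * G (lam * z) - lam * G z) by ring, norm_mul, norm_mul] at hz
    have : ‖z ^ k‖ * ‖(lam : ℂ) ^ k * G (lam * z) - lam * G z‖ ≤ ‖z ^ k‖ * (c * ‖G z‖) := by
      linarith
    exact le_of_mul_le_mul_left this hzk
  have hlim : Tendsto (fun z => (lam : ℂ) ^ k * G (lam * z) - lam * G z) (𝓝[≠] 0)
      (𝓝 ((lam : ℂ) ^ k * G 0 - lam * G 0)) := by
    have : Continuous fun z => (lam : ℂ) ^ k * G (lam * z) - lam * G z := by
      have := hG.continuous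
      fun_prop
    have h1 := this.tendsto 0
    rw [mul_zero] at h1
    exact h1.mono_left nhdsWithin_le_nhds
  have hlim0 : Tendsto (fun z => (lam : ℂ) ^ k * G (lam * z) - lam * G z) (𝓝[≠] 0) (𝓝 0) :=
    (isLittleO_one_iff ℂ).1 (ho3.trans_isBigO
      (((hG.continuous.tendsto 0).mono_left nhdsWithin_le_nhds).isBigO_one ℂ))
  have heq := tendsto_nhds_unique hlim hlim0
  rw [← sub_mul, mul_eq_zero, or_iff_left hG0, sub_eq_zero] at heq
  have hk1 : k = 1 := by
    have h1 : lam ^ k = lam ^ 1 := by rw [pow_one]; exact_mod_cast heq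
    exact pow_right_injective₀ (by linarith) hlam.ne' h1
  have hder : deriv D 0 = 0 := by
    simp only [hD]
    rw [deriv_fun_sub (h.entire 0) (hΨd 0), h.deriv_zero, hΨ1, sub_self]
  have hder2 : HasDerivAt D (G 0) 0 := by
    have h1 := (hasDerivAt_id (0 : ℂ)).mul (hG 0).hasDerivAt
    have : D = id * G := by ext z; rw [hDG, hk1]; simp
    rw [this]
    simpa using h1
  exact hG0 (hder2.deriv.symm.trans hder)

theorem ofReal_re (h : IsPoincare Φ p lam) (x : ℝ) : ((Φ x).re : ℂ) = Φ x := by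
  have := h.conj_eq x
  rw [Complex.conj_ofReal] at this
  exact (Complex.conj_eq_iff_re.1 this.symm)

end IsPoincare

/-! ### Multiplicities of solutions of `Φ = w` and their Stieltjes transforms -/

/-- The order of the zero of `Φ - w` at `-x`, for `x > 0`. -/
noncomputable def zeroMult (Φ : ℂ → ℂ) (w : ℂ) (x : ℝ) : ℕ :=
  if 0 < x then analyticOrderNatAt (fun z => Φ z - w) (-(x : ℂ)) else 0

/-- The Stieltjes transform `∑ n(a) / (x + a)`. -/
noncomputable def stieltjes (n : ℝ → ℕ) (x : ℝ) : ℝ := ∑' a : ℝ, (n a : ℝ) / (x + a)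

/-- A multiplicity function on the positive reals with `∑ n(a) / a < ∞`. -/
structure IsMult (n : ℝ → ℕ) : Prop where
  nonpos : ∀ x ≤ 0, n x = 0
  summable : Summable fun x => (n x : ℝ) / x

namespace IsMult

variable {n : ℝ → ℕ}

theorem pos (h : IsMult n) {x : ℝ} (hx : n x ≠ 0) : 0 < x := by
  by_contra h'; exact hx (h.nonpos x (not_lt.1 h'))

theorem term_nonneg (h : IsMult n) {x : ℝ} (hx : 0 ≤ x) (a : ℝ) : 0 ≤ (n a : ℝ) / (x + a) := by
  by_cases hn : n a = 0
  · simp [hn]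
  · have := h.pos hn
    positivity

theorem term_le (h : IsMult n) {x : ℝ} (hx : 0 ≤ x) (a : ℝ) : (n a : ℝ) / (x + a) ≤ n a / a := by
  by_cases hn : n a = 0
  · simp [hn]
  · have := h.pos hn
    gcongr
    linarith

theorem summable_term (h : IsMult n) {x : ℝ} (hx : 0 ≤ x) :
    Summable fun a : ℝ => (n a : ℝ) / (x + a) :=
  Summable.of_nonneg_of_le (h.term_nonneg hx) (h.term_le hx) h.summable

theorem stieltjes_nonneg (h : IsMult n) {x : ℝ} (hx : 0 ≤ x) : 0 ≤ stieltjes n x :=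
  tsum_nonneg (h.term_nonneg hx)

theorem stieltjes_le (h : IsMult n) {x : ℝ} (hx : 0 ≤ x) :
    stieltjes n x ≤ ∑' a : ℝ, (n a : ℝ) / a :=
  (h.summable_term hx).tsum_le_tsum (h.term_le hx) h.summable

theorem le_stieltjes (h : IsMult n) {x : ℝ} (hx : 0 ≤ x) {a : ℝ} (ha : n a ≠ 0) :
    1 / (x + a) ≤ stieltjes n x := by
  have h1 := (h.summable_term hx).le_tsum a fun b _ => h.term_nonneg hx b
  refine le_trans ?_ h1
  have := h.pos ha
  have h2 : (1 : ℝ) ≤ n a := by exact_mod_cast Nat.one_le_iff_ne_zero.2 ha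
  gcongr

theorem tendsto_stieltjes (h : IsMult n) : Tendsto (stieltjes n) atTop (𝓝 0) := by
  have h0 : (0 : ℝ) = ∑' _ : ℝ, (0 : ℝ) := by simp
  rw [h0]
  refine tendsto_tsum_of_dominated_convergence h.summable (fun a => ?_) ?_
  · exact tendsto_const_nhds.div_atTop (tendsto_atTop_add_const_right _ _ tendsto_id)
  · filter_upwards [eventually_ge_atTop 0] with x hx a
    rw [Real.norm_of_nonneg (h.term_nonneg hx a)]
    exact h.term_le hx a

end IsMult

theorem zeroMult_of_nonpos {Φ : ℂ → ℂ} {w : ℂ} {x : ℝ} (hx : x ≤ 0) : zeroMult Φ w x = 0 :=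
  if_neg (not_lt.2 hx)

namespace IsPoincare

variable {Φ : ℂ → ℂ} {p : Polynomial ℝ} {lam : ℝ}

theorem order_ne_top (h : IsPoincare Φ p lam) (w z : ℂ) :
    analyticOrderAt (fun z => Φ z - w) z ≠ ⊤ := by
  intro htop
  have hd : Differentiable ℂ (fun z => Φ z - w) := h.entire.sub_const w
  have h1 := (Complex.analyticOnNhd_univ_iff_differentiable.2 hd).eq_of_eventuallyEq (g := 0)
      (Complex.analyticOnNhd_univ_iff_differentiable.2 (differentiable_const 0))
      (analyticOrderAt_eq_top.1 htop)
  have h2 : Φ = fun _ => w := by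
    ext z
    exact sub_eq_zero.1 (congrFun h1 z)
  have h3 := h.deriv_zero
  rw [h2] at h3
  simp at h3

theorem order_eq (h : IsPoincare Φ p lam) (w : ℂ) {x : ℝ} (hx : 0 < x) :
    analyticOrderAt (fun z => Φ z - w) (-(x : ℂ)) = zeroMult Φ w x := by
  rw [zeroMult, if_pos hx, Nat.cast_analyticOrderNatAt (h.order_ne_top w _)]

/-- The Hadamard argument applied to `Φ - w`, or to `Φ z / z` if `w = 0`: the zero at the origin is
not counted by `zeroMult` and is responsible for the summand `1 / x`. -/
theorem exists_polynomial (h : IsPoincare Φ p lam) {w : ℂ}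
    (hw : ∀ z, z ≠ 0 → Φ z = w → ∃ x : ℝ, 0 < x ∧ z = -x) (hn : IsMult (zeroMult Φ w)) :
    ∃ P : Polynomial ℂ, ∀ x : ℝ, 0 < x → Φ x - w ≠ 0 ∧
      deriv Φ x / (Φ x - w) = (if w = 0 then 1 else 0) / x + P.eval (x : ℂ)
        + stieltjes (zeroMult Φ w) x := by
  obtain ⟨C, hC, N, hM⟩ := h.exists_growth
  have hne : ∀ x : ℝ, 0 < x → Φ x - w ≠ 0 := by
    intro x hx h0
    obtain ⟨y, hy, hxy⟩ := hw x (by exact_mod_cast hx.ne') (sub_eq_zero.1 h0)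
    have : x = -y := by exact_mod_cast hxy
    linarith
  have hcast : ∀ x : ℝ, ((stieltjes (zeroMult Φ w) x : ℝ) : ℂ)
      = ∑' a : ℝ, (zeroMult Φ w a : ℂ) / ((x : ℂ) + a) := by
    intro x
    rw [stieltjes, Complex.ofReal_tsum]
    push_cast
    rfl
  by_cases hw0 : w = 0
  · subst hw0
    simp only [sub_zero] at hne ⊢
    set g := dslope Φ 0 with hg
    have hgd : Differentiable ℂ g := differentiable_dslope h.entire 0
    have hfac : ∀ z, Φ z = z * g z := fun z => by
      have := eq_sub_mul_dslope h.map_zero z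
      rwa [sub_zero] at this
    have hg0 : g 0 = 1 := by rw [hg, dslope_same, h.deriv_zero]
    -- Division by `z` is harmless for `|z| ≥ 1`; inside the unit disc the bound comes from the unit
    -- circle by the maximum principle, where `1 + |z| = 2`, hence the factor `2 ^ N`.
    have hgM : ∀ z, ‖g z‖ ≤ Real.exp ((C * 2 ^ N) * (1 + ‖z‖) ^ N) := by
      have hbig : ∀ z : ℂ, 1 ≤ ‖z‖ → ‖g z‖ ≤ ‖Φ z‖ := by
        intro z hz
        rw [hfac z, norm_mul]
        exact le_mul_of_one_le_left (norm_nonneg _) hz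
      intro z
      have hz1 : (1 : ℝ) ≤ (1 + ‖z‖) ^ N := one_le_pow₀ (by linarith [norm_nonneg z])
      rcases le_total 1 ‖z‖ with hz | hz
      · refine (hbig z hz).trans ((by linarith [hM z] : ‖Φ z‖ ≤ _).trans (Real.exp_le_exp.2 ?_))
        have : (1 : ℝ) ≤ 2 ^ N := one_le_pow₀ (by norm_num)
        have h0 : 0 ≤ C * (1 + ‖z‖) ^ N := by positivity
        nlinarith
      · have hsph : ∀ z ∈ frontier (Metric.ball (0 : ℂ) 1), ‖g z‖ ≤ Real.exp (C * 2 ^ N) := by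
          intro z hz
          rw [frontier_ball _ (by positivity), mem_sphere_zero_iff_norm] at hz
          have h1 := hM z
          rw [hz] at h1
          have h2 := hbig z hz.ge
          norm_num at h1
          linarith
        refine (Complex.norm_le_of_forall_mem_frontier_norm_le Metric.isBounded_ball
          hgd.diffContOnCl hsph (z := z) ?_).trans (Real.exp_le_exp.2 ?_)
        · rw [closure_ball _ one_ne_zero, mem_closedBall_zero_iff]; exact hz
        · have : 0 ≤ C * 2 ^ N := by positivity
          nlinarith
    have hord : ∀ x : ℝ, 0 < x → analyticOrderAt g (-(x : ℂ)) = zeroMult Φ 0 x := by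
      intro x hx
      rw [← h.order_eq 0 hx]
      have h1 : (fun z => Φ z - 0) = (fun z : ℂ => z) * g := by
        ext z; rw [sub_zero, hfac z]; rfl
      rw [h1, analyticOrderAt_mul (by fun_prop) (hgd.analyticAt _)]
      have h2 : analyticOrderAt (fun z : ℂ => z) (-(x : ℂ)) = 0 := by
        refine analyticOrderAt_eq_zero.2 (Or.inr ?_)
        simpa using hx.ne'
      rw [h2, zero_add]
    obtain ⟨P, hP⟩ := exists_polynomial_logDeriv hgd (by rw [hg0]; exact one_ne_zero)
      (by positivity) hgM hn.nonpos hn.summable (fun z hz => by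
        refine hw z (fun h0 => ?_) (by rw [hfac, hz, mul_zero])
        rw [h0, hg0] at hz
        exact one_ne_zero hz) hord
    refine ⟨P, fun x hx => ⟨hne x hx, ?_⟩⟩
    have hxc : (x : ℂ) ≠ 0 := by exact_mod_cast hx.ne'
    have hgx : g x ≠ 0 := fun h0 => hne x hx (by rw [hfac, h0, mul_zero])
    have h1 := hP x hgx
    rw [hcast, if_pos trivial, add_assoc, ← h1]
    have h2 : deriv Φ x = g x + x * deriv g x := by
      have : Φ = fun z => z * g z := funext hfac
      rw [this]
      rw [deriv_fun_mul (by fun_prop) (hgd _)]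
      simp
    rw [h2, hfac x]
    field_simp
  · have hd : Differentiable ℂ (fun z => Φ z - w) := h.entire.sub_const w
    have hM' : ∀ z, ‖Φ z - w‖ ≤ Real.exp ((C + ‖w‖) * (1 + ‖z‖) ^ N) := by
      intro z
      have hz1 : (1 : ℝ) ≤ (1 + ‖z‖) ^ N := one_le_pow₀ (by linarith [norm_nonneg z])
      have h1 : ‖Φ z - w‖ ≤ (1 + ‖Φ z‖) * (1 + ‖w‖) := by
        refine (norm_sub_le _ _).trans ?_
        nlinarith [norm_nonneg (Φ z), norm_nonneg w]
      refine h1.trans ?_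
      rw [add_mul C, Real.exp_add]
      refine mul_le_mul (hM z) ?_ (by positivity) (by positivity)
      have h2 := Real.add_one_le_exp (‖w‖ * (1 + ‖z‖) ^ N)
      nlinarith [norm_nonneg w]
    obtain ⟨P, hP⟩ := exists_polynomial_logDeriv hd (by
        rw [h.map_zero, zero_sub]; exact neg_ne_zero.2 hw0) (by positivity) hM' hn.nonpos
        hn.summable (fun z hz => by
        refine hw z (fun h0 => ?_) (sub_eq_zero.1 hz)
        rw [h0, h.map_zero, zero_sub] at hz
        exact hw0 (neg_eq_zero.1 hz)) (fun x hx => h.order_eq w hx)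
    refine ⟨P, fun x hx => ⟨hne x hx, ?_⟩⟩
    have h1 := hP x (hne x hx)
    rw [hcast, if_neg hw0, zero_div, zero_add, ← h1, deriv_sub_const]

/-- Multiplicities of preimages. -/
theorem isMult_preimage (h : IsPoincare Φ p lam) {w v : ℂ}
    (hv : (p.map (algebraMap ℝ ℂ)).eval v = w) (hn : IsMult (zeroMult Φ w)) :
    IsMult (zeroMult Φ v) := by
  have hlam0 : 0 < lam := zero_lt_one.trans h.one_lt
  have hlc : (lam : ℂ) ≠ 0 := by exact_mod_cast hlam0.ne'
  refine ⟨fun x hx => zeroMult_of_nonpos hx, ?_⟩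
  -- As `p(v) = w`, the polynomial `p - w` is divisible by `y - v`, so `Φ (lam z) - w` is a multiple
  -- of `Φ z - v` by an entire function.
  have hle : ∀ x, zeroMult Φ v x ≤ zeroMult Φ w (lam * x) := by
    intro x
    by_cases hx : 0 < x
    · obtain ⟨q, hq⟩ := Polynomial.dvd_iff_isRoot.2 (show
        ((p.map (algebraMap ℝ ℂ)) - Polynomial.C w).IsRoot v by simp [hv])
      have h1 : (fun z => Φ z - w) ∘ (fun z => lam * z)
          = (fun z => Φ z - v) * fun z => q.eval (Φ z) := by
        ext z
        have := congrArg (Polynomial.eval (Φ z)) hq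
        simp only [Polynomial.eval_sub, Polynomial.eval_C, Polynomial.eval_mul,
          Polynomial.eval_X] at this
        simp only [Function.comp_apply, Pi.mul_apply]
        rw [h.eq, this]
      have hqd : Differentiable ℂ fun z => q.eval (Φ z) := q.differentiable.comp h.entire
      have h2 : analyticOrderAt ((fun z => Φ z - w) ∘ (fun z => lam * z)) (-(x : ℂ))
          = zeroMult Φ w (lam * x) := by
        rw [analyticOrderAt_comp_of_deriv_ne_zero (by fun_prop) (by
          rw [deriv_const_mul_field, deriv_id'', mul_one]; exact hlc)]
        rw [← h.order_eq w (mul_pos hlam0 hx)]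
        congr 1
        push_cast
        ring
      rw [h1, analyticOrderAt_mul ((h.entire.sub_const v).analyticAt _) (hqd.analyticAt _),
        h.order_eq v hx] at h2
      have : ((zeroMult Φ v x : ℕ) : ℕ∞) ≤ zeroMult Φ w (lam * x) := by
        rw [← h2]; exact le_self_add
      exact_mod_cast this
    · rw [zeroMult_of_nonpos (not_lt.1 hx)]
      exact Nat.zero_le _
  have hs : Summable fun x : ℝ => (zeroMult Φ w (lam * x) : ℝ) / (lam * x) :=
    hn.summable.comp_injective (mul_right_injective₀ hlam0.ne')
  refine Summable.of_nonneg_of_le (fun x => ?_) (fun x => ?_) (hs.mul_left lam)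
  · by_cases hx : 0 < x
    · positivity
    · rw [zeroMult_of_nonpos (not_lt.1 hx)]; simp
  · by_cases hx : 0 < x
    · have : (zeroMult Φ v x : ℝ) ≤ zeroMult Φ w (lam * x) := by exact_mod_cast hle x
      calc (zeroMult Φ v x : ℝ) / x ≤ zeroMult Φ w (lam * x) / x := by gcongr
        _ = _ := by field_simp
    · rw [zeroMult_of_nonpos (not_lt.1 hx), zeroMult_of_nonpos (by nlinarith)]; simp

end IsPoincare

/-! ### Escape of `Φ` to infinity along the positive axis -/

theorem le_of_hasDerivAt_nonneg {u u' : ℝ → ℝ} {X : ℝ}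
    (h : ∀ x, X ≤ x → HasDerivAt u (u' x) x ∧ 0 ≤ u' x) {x : ℝ} (hx : X ≤ x) : u X ≤ u x := by
  have hm : MonotoneOn u (Ici X) := by
    refine monotoneOn_of_deriv_nonneg (convex_Ici X)
      (fun x hx => (h x hx).1.continuousAt.continuousWithinAt) (fun x hx => ?_) (fun x hx => ?_)
    · rw [interior_Ici] at hx
      exact (h x (le_of_lt hx)).1.differentiableAt.differentiableWithinAt
    · rw [interior_Ici] at hx
      rw [(h x (le_of_lt hx)).1.deriv]
      exact (h x (le_of_lt hx)).2
  exact hm self_mem_Ici hx hx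

theorem exists_real_polynomial (P : Polynomial ℂ) :
    ∃ Q : Polynomial ℝ, ∀ x : ℝ, (P.eval (x : ℂ)).re = Q.eval x := by
  induction P using Polynomial.induction_on' with
  | add p q hp hq =>
    obtain ⟨a, ha⟩ := hp
    obtain ⟨b, hb⟩ := hq
    exact ⟨a + b, fun x => by rw [Polynomial.eval_add, Complex.add_re, ha, hb, Polynomial.eval_add]⟩
  | monomial k c =>
    refine ⟨Polynomial.monomial k c.re, fun x => ?_⟩
    rw [Polynomial.eval_monomial, Polynomial.eval_monomial, ← Complex.ofReal_pow,
      Complex.re_mul_ofReal]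

/-- The definite gap `c` in the second alternative is what later turns a negative polynomial part
into exponential decay. -/
theorem eventually_nonneg_or_le_neg (Q : Polynomial ℝ) :
    (∀ᶠ x in atTop, 0 ≤ Q.eval x) ∨ ∃ c : ℝ, 0 < c ∧ ∀ᶠ x in atTop, Q.eval x ≤ -c := by
  by_cases hd : 0 < Q.degree
  · rcases le_total 0 Q.leadingCoeff with h | h
    · exact Or.inl ((Q.tendsto_atTop_of_leadingCoeff_nonneg hd h).eventually_ge_atTop 0)
    · exact Or.inr ⟨1, one_pos, (Q.tendsto_atBot_of_leadingCoeff_nonpos hd h).eventually_le_atBot _⟩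
  · have h1 := Polynomial.eq_C_of_degree_le_zero (not_lt.1 hd)
    rw [h1]
    simp only [Polynomial.eval_C]
    rcases le_or_gt 0 (Q.coeff 0) with h | h
    · exact Or.inl (Eventually.of_forall fun _ => h)
    · exact Or.inr ⟨-Q.coeff 0, by linarith, Eventually.of_forall fun _ => by linarith⟩

theorem tendsto_pow_mul_exp_neg_mul {b : ℝ} (hb : 0 < b) (k : ℕ) :
    Tendsto (fun x : ℝ => x ^ k * Real.exp (-(b * x))) atTop (𝓝 0) := by
  have h := ((Real.tendsto_pow_mul_exp_neg_atTop_nhds_zero k).comp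
    (tendsto_id.const_mul_atTop hb)).const_mul ((b ^ k)⁻¹)
  rw [mul_zero] at h
  refine h.congr fun x => ?_
  have : b ^ k ≠ 0 := by positivity
  simp only [Function.comp_apply, id, mul_pow]
  field_simp

namespace IsPoincare

variable {Φ : ℂ → ℂ} {p : Polynomial ℝ} {lam : ℝ}

/-- The hypotheses on a value `w`: all nonzero solutions of `Φ z = w` are negative, there is one,
and the sum of their inverses converges. -/
structure IsSpectralValue (Φ : ℂ → ℂ) (w : ℂ) : Prop where
  neg : ∀ z, z ≠ 0 → Φ z = w → ∃ x : ℝ, 0 < x ∧ z = -x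
  isMult : IsMult (zeroMult Φ w)
  exists_ne : ∃ a, zeroMult Φ w a ≠ 0

theorem apply_neg_eq (_h : IsPoincare Φ p lam) {w : ℂ} {a : ℝ} (ha : zeroMult Φ w a ≠ 0) :
    0 < a ∧ Φ (-(a : ℂ)) = w := by
  have ha0 : 0 < a := by
    by_contra h'; exact ha (zeroMult_of_nonpos (not_lt.1 h'))
  refine ⟨ha0, ?_⟩
  rw [zeroMult, if_pos ha0] at ha
  have h1 := apply_eq_zero_of_analyticOrderNatAt_ne_zero (f := fun z => Φ z - w) ha
  exact sub_eq_zero.1 h1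

theorem exists_norm_logDeriv_le (h : IsPoincare Φ p lam) {w : ℂ}
    (hw : ∀ z, z ≠ 0 → Φ z = w → ∃ x : ℝ, 0 < x ∧ z = -x) (hn : IsMult (zeroMult Φ w)) :
    ∃ C : ℝ, 0 ≤ C ∧ ∃ m : ℕ, ∀ x : ℝ, 1 ≤ x → ‖deriv Φ x / (Φ x - w)‖ ≤ C * x ^ m := by
  obtain ⟨P, hP⟩ := h.exists_polynomial hw hn
  obtain ⟨K', hK'1, hK'⟩ := exists_norm_aeval_le P P.natDegree le_rfl
  set m := P.natDegree
  set σ := ∑' a : ℝ, (zeroMult Φ w a : ℝ) / a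
  have hσ : 0 ≤ σ := (hn.stieltjes_nonneg le_rfl).trans (hn.stieltjes_le le_rfl)
  refine ⟨1 + σ + K' * 2 ^ m, by positivity, m, fun x hx1 => ?_⟩
  have hx0 : 0 < x := by linarith
  rw [(hP x hx0).2]
  have hxn : ‖(x : ℂ)‖ = x := by rw [Complex.norm_real, Real.norm_of_nonneg hx0.le]
  have h1 : ‖(if w = 0 then (1 : ℂ) else 0) / x‖ ≤ 1 := by
    split_ifs
    · rw [norm_div, hxn, norm_one, div_le_one hx0]; exact hx1
    · simp
  have h2 : ‖P.eval (x : ℂ)‖ ≤ K' * 2 ^ m * x ^ m := by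
    refine (hK' x).trans ?_
    rw [hxn, mul_assoc, ← mul_pow]
    gcongr
    linarith
  have h3 : ‖((stieltjes (zeroMult Φ w) x : ℝ) : ℂ)‖ ≤ σ := by
    rw [Complex.norm_real, Real.norm_of_nonneg (hn.stieltjes_nonneg hx0.le)]
    exact hn.stieltjes_le hx0.le
  have hxm : (1 : ℝ) ≤ x ^ m := one_le_pow₀ hx1
  refine (norm_add₃_le).trans ?_
  nlinarith

/-- Exponential convergence `Φ → w` would make `w` a fixed point of `p`. If `w` has another preimage
`v`, then `Φ - v` has a nonzero limit and `x Φ'(x) → 0`, so `x Φ' / (Φ - v) → 0`. In the partial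
fraction expansion at `v` this kills the polynomial and then, by positivity, every other term, so
`Φ' = 0` on the positive axis although `Φ'(0) = 1`. If `w` is its own only preimage, a solution `-a`
yields the solutions `-a / lam ^ n`, which accumulate at `0`, again against `Φ'(0) = 1`. -/
theorem not_tendsto (h : IsPoincare Φ p lam) {w : ℂ} (hw : IsSpectralValue Φ w) {c K : ℝ}
    (hc : 0 < c) (hK : ∀ᶠ x : ℝ in atTop, ‖Φ x - w‖ ≤ K * Real.exp (-(c * x))) : False := by
  set q := p.map (algebraMap ℝ ℂ) with hq
  have hlam0 : 0 < lam := zero_lt_one.trans h.one_lt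
  have hlc : (lam : ℂ) ≠ 0 := by exact_mod_cast hlam0.ne'
  obtain ⟨a, ha⟩ := hw.exists_ne
  obtain ⟨ha0, hΦa⟩ := h.apply_neg_eq ha
  have hlim : Tendsto (fun x : ℝ => Φ x) atTop (𝓝 w) := by
    rw [tendsto_iff_norm_sub_tendsto_zero]
    refine squeeze_zero' (Eventually.of_forall fun _ => norm_nonneg _) hK ?_
    simpa using (tendsto_pow_mul_exp_neg_mul hc 0).const_mul K
  have hfix : q.eval w = w := by
    have h1 : Tendsto (fun x : ℝ => Φ ((lam * x : ℝ) : ℂ)) atTop (𝓝 w) :=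
      hlim.comp (tendsto_id.const_mul_atTop hlam0)
    have h2 : Tendsto (fun x : ℝ => q.eval (Φ x)) atTop (𝓝 (q.eval w)) :=
      (q.continuous.tendsto w).comp hlim
    refine tendsto_nhds_unique h2 (h1.congr fun x => ?_)
    rw [Complex.ofReal_mul, h.eq]
  by_cases hv : ∃ v, v ≠ w ∧ q.eval v = w
  · obtain ⟨v, hvw, hv⟩ := hv
    have hvneg : ∀ z, z ≠ 0 → Φ z = v → ∃ x : ℝ, 0 < x ∧ z = -x := by
      intro z hz hzv
      obtain ⟨x, hx, hxz⟩ := hw.neg (lam * z) (mul_ne_zero hlc hz) (by rw [h.eq, hzv, hv])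
      refine ⟨x / lam, by positivity, ?_⟩
      push_cast
      field_simp
      rw [mul_comm]; exact hxz
    have hvm := h.isMult_preimage hv hw.isMult
    obtain ⟨Q, hQ⟩ := h.exists_polynomial hvneg hvm
    obtain ⟨C, hC, m, hCm⟩ := h.exists_norm_logDeriv_le hw.neg hw.isMult
    have hder : Tendsto (fun x : ℝ => (x : ℂ) * deriv Φ x) atTop (𝓝 0) := by
      have hb : Tendsto (fun x : ℝ => (C * K) * (x ^ (m + 1) * Real.exp (-(c * x)))) atTop (𝓝 0)
          := by
        simpa using (tendsto_pow_mul_exp_neg_mul hc (m + 1)).const_mul (C * K)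
      refine squeeze_zero_norm' ?_ hb
      filter_upwards [hK, eventually_ge_atTop 1] with x hx hx1
      have hx0 : 0 < x := by linarith
      obtain ⟨P, hP⟩ := h.exists_polynomial hw.neg hw.isMult
      have hd : deriv Φ x = deriv Φ x / (Φ x - w) * (Φ x - w) := by
        rw [div_mul_cancel₀ _ (hP x hx0).1]
      rw [hd, norm_mul, norm_mul, Complex.norm_real, Real.norm_of_nonneg hx0.le]
      calc x * (_ * ‖Φ x - w‖) ≤ x * ((C * x ^ m) * (K * Real.exp (-(c * x)))) := by
            gcongr
            exact hCm x hx1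
        _ = _ := by ring
    have hxGv : Tendsto (fun x : ℝ => (x : ℂ) * (deriv Φ x / (Φ x - v))) atTop (𝓝 0) := by
      have h1 : Tendsto (fun x : ℝ => Φ x - v) atTop (𝓝 (w - v)) := hlim.sub_const v
      have h2 := hder.div h1 (sub_ne_zero.2 hvw.symm)
      rw [zero_div] at h2
      exact h2.congr fun x => by simp only [Pi.div_apply, mul_div_assoc]
    have hinv : Tendsto (fun x : ℝ => ((x : ℂ))⁻¹) atTop (𝓝 0) := by
      have := (Complex.continuous_ofReal.tendsto 0).comp (tendsto_inv_atTop_zero (𝕜 := ℝ))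
      simpa [Function.comp_def] using this
    have hSv : Tendsto (fun x : ℝ => ((stieltjes (zeroMult Φ v) x : ℝ) : ℂ)) atTop (𝓝 0) := by
      have := (Complex.continuous_ofReal.tendsto 0).comp hvm.tendsto_stieltjes
      simpa [Function.comp_def] using this
    have hQ0 : Q = 0 := by
      refine eq_zero_of_tendsto_eval Q ?_
      have h1 := ((hinv.mul hxGv).sub (hinv.const_mul (if v = 0 then (1 : ℂ) else 0))).sub hSv
      simp only [mul_zero, sub_zero] at h1
      refine h1.congr' ?_
      filter_upwards [eventually_gt_atTop 0] with x hx
      have hxc : (x : ℂ) ≠ 0 := by exact_mod_cast hx.ne'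
      rw [(hQ x hx).2, inv_mul_cancel_left₀ hxc]
      ring
    set κ : ℝ := if v = 0 then 1 else 0 with hκ
    have hκ0 : 0 ≤ κ := by rw [hκ]; split_ifs <;> norm_num
    have hκc : (if v = 0 then (1 : ℂ) else 0) = (κ : ℂ) := by rw [hκ]; split_ifs <;> simp
    -- Both summands are nonnegative, so both tend to zero; but a single zero `-b` already
    -- contributes at least `x / (x + b)`, which tends to `1`.
    have hreal : Tendsto (fun x : ℝ => κ + x * stieltjes (zeroMult Φ v) x) atTop (𝓝 0) := by
      have h1 := (Complex.continuous_re.tendsto 0).comp hxGv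
      rw [Complex.zero_re] at h1
      refine h1.congr' ?_
      filter_upwards [eventually_gt_atTop 0] with x hx
      have hxc : (x : ℂ) ≠ 0 := by exact_mod_cast hx.ne'
      simp only [Function.comp_apply]
      rw [(hQ x hx).2, hQ0, Polynomial.eval_zero, add_zero, hκc, mul_add, mul_div_cancel₀ _ hxc,
        ← Complex.ofReal_mul, ← Complex.ofReal_add, Complex.ofReal_re]
    have hκz : κ = 0 := by
      refine le_antisymm ?_ hκ0
      refine ge_of_tendsto hreal ?_
      filter_upwards [eventually_ge_atTop 0] with x hx
      have := mul_nonneg hx (hvm.stieltjes_nonneg hx)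
      linarith
    have hnv : ∀ b, zeroMult Φ v b = 0 := by
      intro b
      by_contra hb
      have hb0 := hvm.pos hb
      rw [hκz] at hreal
      have h1 := hreal.eventually (gt_mem_nhds (show (0 : ℝ) < 1 / 2 by norm_num))
      obtain ⟨x, hx, hxb⟩ := (h1.and (eventually_ge_atTop b)).exists
      have h2 := hvm.le_stieltjes (x := x) (by linarith) hb
      have h3 : x * (1 / (x + b)) ≤ x * stieltjes (zeroMult Φ v) x :=
        mul_le_mul_of_nonneg_left h2 (by linarith)
      have h4 : 1 / 2 ≤ x * (1 / (x + b)) := by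
        rw [mul_one_div, div_le_div_iff₀ (by norm_num) (by linarith)]
        linarith
      linarith
    have hd0 : ∀ x : ℝ, 0 < x → deriv Φ x = 0 := by
      intro x hx
      obtain ⟨hne, hG⟩ := hQ x hx
      have hS0 : stieltjes (zeroMult Φ v) x = 0 := by simp [stieltjes, hnv]
      rw [hQ0, hκc, hκz, hS0] at hG
      simp only [Complex.ofReal_zero, zero_div, Polynomial.eval_zero, add_zero] at hG
      exact (div_eq_zero_iff.1 hG).resolve_right hne
    have hcont : Tendsto (fun x : ℝ => deriv Φ x) (𝓝[>] 0) (𝓝 1) := by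
      have h1 : Continuous fun x : ℝ => deriv Φ x :=
        h.entire.deriv.continuous.comp Complex.continuous_ofReal
      have h2 := h1.tendsto 0
      rw [Complex.ofReal_zero, h.deriv_zero] at h2
      exact h2.mono_left nhdsWithin_le_nhds
    have hcont0 : Tendsto (fun x : ℝ => deriv Φ x) (𝓝[>] 0) (𝓝 0) :=
      tendsto_const_nhds.congr' (by
        filter_upwards [self_mem_nhdsWithin] with x hx using (hd0 x hx).symm)
    exact one_ne_zero (tendsto_nhds_unique hcont hcont0)
  · push Not at hv
    have hall : ∀ n : ℕ, Φ (-(a : ℂ) / lam ^ n) = w := by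
      intro n
      induction n with
      | zero => simpa using hΦa
      | succ n ih =>
        by_contra hne
        refine hv _ hne ?_
        rw [← h.eq, ← ih]
        congr 1
        rw [pow_succ]
        field_simp
    have ht : Tendsto (fun n : ℕ => -(a : ℂ) / lam ^ n) atTop (𝓝[≠] 0) := by
      refine tendsto_nhdsWithin_iff.2 ⟨?_, Eventually.of_forall fun n => ?_⟩
      · have h1 : Tendsto (fun n : ℕ => ((lam : ℂ)⁻¹) ^ n) atTop (𝓝 0) := by
          refine tendsto_pow_atTop_nhds_zero_of_norm_lt_one ?_
          rw [norm_inv, Complex.norm_real, Real.norm_of_nonneg hlam0.le]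
          exact inv_lt_one_of_one_lt₀ h.one_lt
        have h2 := h1.const_mul (-(a : ℂ))
        rw [mul_zero] at h2
        exact h2.congr fun n => by rw [inv_pow, div_eq_mul_inv]
      · have : (a : ℂ) ≠ 0 := by exact_mod_cast ha0.ne'
        simp [this, hlc]
    have hd : HasDerivAt Φ 1 0 := by rw [← h.deriv_zero]; exact (h.entire 0).hasDerivAt
    have h1 := ht.eventually (hd.eventually_ne (c := w) one_ne_zero)
    obtain ⟨n, hn⟩ := h1.exists
    exact hn (hall n)

/-- The value `w` is real, being attained at a real point, and the sign of the real polynomial part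
of the logarithmic derivative decides. If it is eventually nonnegative, the derivative of `log |Φ -
w|` is at least `1 / (x + a)` for one zero `-a`, so `|Φ - w|` grows at least linearly. Otherwise it
is at most `-c / 2` for large `x`, and `Φ` converges to `w` exponentially, which is impossible. -/
theorem tendsto_norm (h : IsPoincare Φ p lam) {w : ℂ} (hw : IsSpectralValue Φ w) :
    Tendsto (fun x : ℝ => ‖Φ x‖) atTop atTop := by
  obtain ⟨a, ha⟩ := hw.exists_ne
  obtain ⟨ha0, hΦa⟩ := h.apply_neg_eq ha
  obtain ⟨r, rfl⟩ : ∃ r : ℝ, (r : ℂ) = w :=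
    ⟨(Φ ((-a : ℝ) : ℂ)).re, by rw [h.ofReal_re]; push_cast; exact hΦa⟩
  obtain ⟨P, hP⟩ := h.exists_polynomial hw.neg hw.isMult
  obtain ⟨Q, hQ⟩ := exists_real_polynomial P
  set S := stieltjes (zeroMult Φ r)
  set φ : ℝ → ℝ := fun x => (Φ x).re with hφ
  set κ : ℝ := if (r : ℂ) = 0 then 1 else 0 with hκ
  have hκ0 : 0 ≤ κ := by rw [hκ]; split_ifs <;> norm_num
  have hκc : (if (r : ℂ) = 0 then (1 : ℂ) else 0) = (κ : ℂ) := by rw [hκ]; split_ifs <;> simp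
  have hΦφ : ∀ x : ℝ, Φ x = φ x := fun x => (h.ofReal_re x).symm
  have hnorm : ∀ x : ℝ, ‖Φ x - r‖ = |φ x - r| := fun x => by
    rw [hΦφ, ← Complex.ofReal_sub, Complex.norm_real, Real.norm_eq_abs]
  have hφd : ∀ x : ℝ, HasDerivAt (fun x => φ x - r) (deriv Φ x).re x := fun x =>
    (h.entire x).hasDerivAt.real_of_complex.sub_const r
  have hG : ∀ x : ℝ, 0 < x → φ x - r ≠ 0 ∧
      (deriv Φ x).re / (φ x - r) = κ / x + Q.eval x + S x := by
    intro x hx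
    obtain ⟨hne, hx2⟩ := hP x hx
    rw [hΦφ, ← Complex.ofReal_sub] at hne hx2
    refine ⟨by exact_mod_cast hne, ?_⟩
    have := congrArg Complex.re hx2
    rw [Complex.div_ofReal_re, hκc, Complex.add_re, Complex.add_re, hQ, ← Complex.ofReal_div,
      Complex.ofReal_re, Complex.ofReal_re] at this
    exact this
  rcases eventually_nonneg_or_le_neg Q with hpos | ⟨c, hc, hneg⟩
  · obtain ⟨X, hX⟩ := eventually_atTop.1 (hpos.and (eventually_ge_atTop 1))
    have key : ∀ x, X ≤ x → Real.log (φ X - r) - Real.log (X + a) ≤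
        Real.log (φ x - r) - Real.log (x + a) := by
      intro x hx
      refine le_of_hasDerivAt_nonneg (u := fun x => Real.log (φ x - r) - Real.log (x + a))
        (u' := fun x => (deriv Φ x).re / (φ x - r) - 1 / (x + a)) (fun x hx => ?_) hx
      obtain ⟨h1, h2⟩ := hX x hx
      have hx0 : 0 < x := by linarith
      refine ⟨((hφd x).log (hG x hx0).1).sub (((hasDerivAt_id x).add_const a).log (by
        simp only [id]; positivity)), ?_⟩
      rw [(hG x hx0).2]
      have h3 := hw.isMult.le_stieltjes hx0.le ha
      have h4 : 0 ≤ κ / x := by positivity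
      linarith
    have hlb : ∀ᶠ x : ℝ in atTop, Real.exp (Real.log (φ X - r) - Real.log (X + a)) * (x + a)
        ≤ ‖Φ x - r‖ := by
      filter_upwards [eventually_ge_atTop X] with x hx
      have hx0 : 0 < x := by linarith [(hX x hx).2]
      have h1 := key x hx
      rw [hnorm, ← Real.exp_log_eq_abs (hG x hx0).1]
      conv_lhs => rw [← Real.exp_log (show 0 < x + a by positivity)]
      rw [← Real.exp_add]
      exact Real.exp_le_exp.2 (by linarith)
    have h1 : Tendsto (fun x : ℝ => ‖Φ x - r‖) atTop atTop :=
      tendsto_atTop_mono' _ hlb ((tendsto_atTop_add_const_right _ a tendsto_id).const_mul_atTop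
        (Real.exp_pos _))
    have h2 := tendsto_atTop_add_const_right _ (-‖(r : ℂ)‖) h1
    refine tendsto_atTop_mono (fun x => ?_) h2
    have := norm_sub_le (Φ x) (r : ℂ)
    linarith
  · exfalso
    have hsmall : ∀ᶠ x : ℝ in atTop, κ / x + S x < c / 2 := by
      have h1 : Tendsto (fun x : ℝ => κ / x + S x) atTop (𝓝 (0 + 0)) :=
        (tendsto_const_nhds.div_atTop tendsto_id).add hw.isMult.tendsto_stieltjes
      rw [add_zero] at h1
      exact h1.eventually (gt_mem_nhds (by positivity))
    obtain ⟨X, hX⟩ := eventually_atTop.1 ((hneg.and hsmall).and (eventually_ge_atTop 1))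
    have key : ∀ x, X ≤ x → -Real.log (φ X - r) - c / 2 * X ≤ -Real.log (φ x - r) - c / 2 * x := by
      intro x hx
      refine le_of_hasDerivAt_nonneg (u := fun x => -Real.log (φ x - r) - c / 2 * x)
        (u' := fun x => -((deriv Φ x).re / (φ x - r)) - c / 2 * 1) (fun x hx => ?_) hx
      obtain ⟨⟨h1, h2⟩, h3⟩ := hX x hx
      have hx0 : 0 < x := by linarith
      refine ⟨((hφd x).log (hG x hx0).1).neg.sub ((hasDerivAt_id x).const_mul _), ?_⟩
      rw [(hG x hx0).2]
      linarith
    refine h.not_tendsto hw (c := c / 2) (K := Real.exp (Real.log (φ X - r) + c / 2 * X))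
      (by positivity) ?_
    filter_upwards [eventually_ge_atTop X] with x hx
    have hx0 : 0 < x := by linarith [(hX x hx).2]
    rw [hnorm, ← Real.exp_log_eq_abs (hG x hx0).1, ← Real.exp_add]
    refine Real.exp_le_exp.2 ?_
    have := key x hx
    linarith

end IsPoincare

/-! ### The functional equation passes to the Stieltjes transform -/

namespace IsPoincare

variable {Φ : ℂ → ℂ} {p : Polynomial ℝ} {lam : ℝ}

/-- As `p` has degree at least two, `|p(y)| ≥ lam ^ (N + 1) |y|` for large `y`, so each dilation by
`lam` gains that factor. The exponent is one larger than needed in order to absorb the constant from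
the starting point. -/
theorem eventually_pow_le_norm (h : IsPoincare Φ p lam) {w : ℂ} (hw : IsSpectralValue Φ w) (N : ℕ) :
    ∀ᶠ x : ℝ in atTop, x ^ N ≤ ‖Φ x‖ := by
  have hlam := h.one_lt
  have hlam0 : 0 < lam := zero_lt_one.trans h.one_lt
  set q := p.map (algebraMap ℝ ℂ) with hq
  have hqd : q.natDegree = p.natDegree := natDegree_map p
  obtain ⟨c, hc, Y, hY1, hY⟩ := exists_le_norm_eval q (by rw [hqd]; linarith [h.two_le])
  have hgrow : ∃ Y' : ℝ, 1 ≤ Y' ∧ ∀ y : ℂ, Y' ≤ ‖y‖ → lam ^ (N + 1) * ‖y‖ ≤ ‖q.eval y‖ := by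
    refine ⟨max Y (lam ^ (N + 1) / c), hY1.trans (le_max_left _ _), fun y hy => ?_⟩
    have hy1 := (le_max_left _ _).trans hy
    have hy2 := (le_max_right _ _).trans hy
    rw [div_le_iff₀ hc] at hy2
    refine le_trans ?_ (hY y hy1)
    have h1 : ‖y‖ ^ 2 ≤ ‖y‖ ^ q.natDegree :=
      pow_le_pow_right₀ (hY1.trans hy1) (by rw [hqd]; exact h.two_le)
    calc lam ^ (N + 1) * ‖y‖ ≤ (‖y‖ * c) * ‖y‖ := by gcongr
      _ = c * ‖y‖ ^ 2 := by ring
      _ ≤ _ := by gcongr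
  obtain ⟨Y', hY'1, hY'⟩ := hgrow
  obtain ⟨X, hX⟩ := eventually_atTop.1
    (((h.tendsto_norm hw).eventually_ge_atTop Y').and (eventually_ge_atTop 1))
  have hX1 : 1 ≤ X := (hX X le_rfl).2
  have hiter : ∀ n : ℕ, ∀ x : ℝ, X ≤ x → (lam ^ (N + 1)) ^ n ≤ ‖Φ ((lam ^ n * x : ℝ) : ℂ)‖ := by
    intro n
    induction n with
    | zero =>
      intro x hx
      simpa using hY'1.trans (hX x hx).1
    | succ n ih =>
      intro x hx
      have h1 : X ≤ lam ^ n * x := hx.trans (le_mul_of_one_le_left (by linarith)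
          (one_le_pow₀ hlam.le))
      have h2 := hY' _ (hX _ h1).1
      have h3 : ((lam ^ (n + 1) * x : ℝ) : ℂ) = lam * ((lam ^ n * x : ℝ) : ℂ) := by
        push_cast; ring
      rw [h3, h.eq, pow_succ']
      exact (mul_le_mul_of_nonneg_left (ih x hx) (by positivity)).trans h2
  filter_upwards [eventually_ge_atTop ((lam * X) ^ (N + 1)), eventually_ge_atTop X] with t ht htX
  obtain ⟨n, hn1, hn2⟩ := exists_nat_pow_near (show (1 : ℝ) ≤ t / X by
    rw [one_le_div (by linarith)]; exact htX) hlam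
  have hln : 0 < lam ^ n := by positivity
  have h1 := hiter n (t / lam ^ n) (by
    rw [le_div_iff₀ hln]
    rw [le_div_iff₀ (by linarith)] at hn1
    linarith)
  rw [mul_div_cancel₀ _ hln.ne'] at h1
  refine le_trans ?_ h1
  have h2 : t / (lam * X) ≤ lam ^ n := by
    rw [div_le_iff₀ (by positivity)]
    rw [div_lt_iff₀ (by linarith), pow_succ] at hn2
    linarith
  have ht0 : 0 < t := by linarith
  calc t ^ N ≤ t ^ N * (t / (lam * X) ^ (N + 1)) :=
        le_mul_of_one_le_right (by positivity) (by rw [one_le_div (by positivity)]; exact ht)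
    _ = (t / (lam * X)) ^ (N + 1) := by rw [div_pow, pow_succ t N]; ring
    _ ≤ (lam ^ n) ^ (N + 1) := by gcongr
    _ = _ := by rw [← pow_mul, ← pow_mul, mul_comm]

/-- The logarithmic derivative of `Φ - w` satisfies a functional equation up to a term that decays
faster than any power. -/
theorem logDeriv_functional (h : IsPoincare Φ p lam) {w : ℂ} (hw : IsSpectralValue Φ w) (N : ℕ) :
    (fun x : ℝ => lam * (deriv Φ (lam * x : ℝ) / (Φ (lam * x : ℝ) - w))
      - p.natDegree * (deriv Φ x / (Φ x - w))) =O[atTop] fun x : ℝ => (x ^ N)⁻¹ := by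
  have hlam0 : 0 < lam := zero_lt_one.trans h.one_lt
  have hlc : (lam : ℂ) ≠ 0 := by exact_mod_cast hlam0.ne'
  set q := p.map (algebraMap ℝ ℂ) with hq
  set d := p.natDegree with hd
  have hqd : q.natDegree = d := natDegree_map p
  have hd2 : 2 ≤ d := h.two_le
  obtain ⟨P, hP⟩ := h.exists_polynomial hw.neg hw.isMult
  obtain ⟨C, hC, m, hCm⟩ := h.exists_norm_logDeriv_le hw.neg hw.isMult
  -- The numerator of `p' / (p - w) - d / (y - w)`. Its coefficient of degree `d` cancels, so
  -- divided by `p - w` and evaluated at `Φ x` it is `O(1 / |Φ x|)`.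
  set q1 := Polynomial.derivative q * (Polynomial.X - Polynomial.C w)
    - Polynomial.C (d : ℂ) * (q - Polynomial.C w) with hq1
  have hq1d : q1.natDegree ≤ d - 1 := by
    refine Polynomial.natDegree_le_pred ?_ ?_
    · refine (Polynomial.natDegree_sub_le _ _).trans (max_le ?_ ?_)
      · refine Polynomial.natDegree_mul_le.trans ?_
        have h1 := Polynomial.natDegree_derivative_le q
        have h2 := Polynomial.natDegree_X_sub_C_le w
        omega
      · refine (Polynomial.natDegree_C_mul_le _ _).trans ?_
        rw [Polynomial.natDegree_sub_C, hqd]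
    · obtain ⟨e, he⟩ : ∃ e, d = e + 1 := ⟨d - 1, by omega⟩
      rw [hq1, he, Polynomial.coeff_sub, Polynomial.coeff_mul_X_sub_C, Polynomial.coeff_C_mul,
        Polynomial.coeff_sub, Polynomial.coeff_derivative, Polynomial.coeff_derivative,
        Polynomial.coeff_C, if_neg (by omega),
        Polynomial.coeff_eq_zero_of_natDegree_lt (n := e + 1 + 1) (by rw [hqd]; omega)]
      push_cast
      ring
  obtain ⟨K, hK1, hK⟩ := exists_norm_aeval_le q1 (d - 1) hq1d
  obtain ⟨c, hc, Y, hY1, hY⟩ := exists_le_norm_eval (q - Polynomial.C w) (by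
    rw [Polynomial.natDegree_sub_C, hqd]; omega)
  rw [Polynomial.natDegree_sub_C, hqd] at hY
  refine IsBigO.of_bound (C * (K * 2 ^ (d - 1) / c)) ?_
  filter_upwards [(h.tendsto_norm hw).eventually_ge_atTop Y, eventually_ge_atTop 1,
    h.eventually_pow_le_norm hw (N + m)] with x hxY hx1 hxN
  have hx0 : 0 < x := by linarith
  have hne := (hP x hx0).1
  have hne2 := (hP (lam * x) (by positivity)).1
  have hfun : Φ (lam * x : ℝ) = q.eval (Φ x) := by rw [Complex.ofReal_mul, h.eq]
  have hder : lam * deriv Φ (lam * x : ℝ) = (Polynomial.derivative q).eval (Φ x) * deriv Φ x := by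
    have h1 : HasDerivAt (fun z : ℂ => Φ (lam * z)) (deriv Φ (lam * x) * lam) x := by
      have := (h.entire (lam * x)).hasDerivAt.comp (x : ℂ) ((hasDerivAt_id (x :
          ℂ)).const_mul (lam : ℂ))
      simpa [Function.comp_def] using this
    have h2 : HasDerivAt (fun z : ℂ => Φ (lam * z))
        ((Polynomial.derivative q).eval (Φ x) * deriv Φ x) x := by
      have := (q.hasDerivAt (Φ x)).comp (x : ℂ) (h.entire x).hasDerivAt
      refine this.congr_of_eventuallyEq (Eventually.of_forall fun z => ?_)
      exact h.eq z
    rw [Complex.ofReal_mul, mul_comm]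
    exact h1.unique h2
  rw [hfun] at hne2
  have hkey : lam * (deriv Φ (lam * x : ℝ) / (Φ (lam * x : ℝ) - w)) - d * (deriv Φ x / (Φ x - w))
      = deriv Φ x / (Φ x - w) * (q1.eval (Φ x) / (q - Polynomial.C w).eval (Φ x)) := by
    rw [← mul_div_assoc, hder, hfun, hq1]
    simp only [Polynomial.eval_sub, Polynomial.eval_mul, Polynomial.eval_C, Polynomial.eval_X]
    field_simp
  rw [hkey, norm_mul, norm_div (q1.eval _)]
  have hΦ1 : 1 ≤ ‖Φ x‖ := hY1.trans hxY
  have h3 : ‖q1.eval (Φ x)‖ / ‖(q - Polynomial.C w).eval (Φ x)‖ ≤ K * 2 ^ (d - 1) / c / ‖Φ x‖ := by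
    have h4 : ‖q1.eval (Φ x)‖ ≤ K * 2 ^ (d - 1) * ‖Φ x‖ ^ (d - 1) := by
      refine (hK _).trans ?_
      rw [mul_assoc, ← mul_pow]
      gcongr
      linarith
    calc _ ≤ K * 2 ^ (d - 1) * ‖Φ x‖ ^ (d - 1) / (c * ‖Φ x‖ ^ d) := by
          gcongr
          exact hY _ hxY
      _ = _ := by
          obtain ⟨e, he⟩ : ∃ e, d = e + 1 := ⟨d - 1, by omega⟩
          rw [he, Nat.add_sub_cancel, pow_succ ‖Φ x‖]
          field_simp
  have hxm : 0 < x ^ m := by positivity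
  calc _ ≤ C * x ^ m * (K * 2 ^ (d - 1) / c / ‖Φ x‖) := by gcongr; exact hCm x hx1
    _ ≤ C * x ^ m * (K * 2 ^ (d - 1) / c / x ^ (N + m)) := by gcongr
    _ = C * (K * 2 ^ (d - 1) / c) * ‖(x ^ N)⁻¹‖ := by
      rw [Real.norm_of_nonneg (by positivity), pow_add]
      field_simp

/-- Insert the partial fraction expansion into the functional equation of the logarithmic
derivative. The polynomial part `lam P(lam x) - d P(x)` is a difference of functions that tend to
zero, hence is the zero polynomial; what remains is the relation for the Stieltjes transform. It
excludes `lam ≤ d`, as it would then force a decay faster than `1 / x`. -/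
theorem stieltjes_functional (h : IsPoincare Φ p lam) {w : ℂ} (hw : IsSpectralValue Φ w) :
    (p.natDegree : ℝ) < lam ∧ ∀ N : ℕ, (fun x : ℝ => lam * stieltjes (zeroMult Φ w) (lam * x)
      - p.natDegree * stieltjes (zeroMult Φ w) x
      - (if w = 0 then 1 else 0) * (p.natDegree - 1) / x) =O[atTop] fun x : ℝ => (x ^ N)⁻¹ := by
  have hlam := h.one_lt
  have hlam0 : 0 < lam := zero_lt_one.trans h.one_lt
  have hlc : (lam : ℂ) ≠ 0 := by exact_mod_cast hlam0.ne'
  set d := p.natDegree with hd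
  have hd2 : (2 : ℝ) ≤ d := by exact_mod_cast h.two_le
  set S := stieltjes (zeroMult Φ w) with hS
  have hn := hw.isMult
  set κ : ℝ := if w = 0 then 1 else 0 with hκ
  have hκ0 : 0 ≤ κ := by rw [hκ]; split_ifs <;> norm_num
  have hκc : (if w = 0 then (1 : ℂ) else 0) = (κ : ℂ) := by rw [hκ]; split_ifs <;> simp
  obtain ⟨P, hP⟩ := h.exists_polynomial hw.neg hw.isMult
  rw [hκc] at hP
  have hfun := fun N => h.logDeriv_functional hw N
  set R : Polynomial ℂ := Polynomial.C (lam : ℂ) * P.comp (Polynomial.C (lam : ℂ) * Polynomial.X)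
    - Polynomial.C (d : ℂ) * P with hR
  set e : ℝ → ℝ := fun x => lam * S (lam * x) - d * S x - κ * (d - 1) / x with he
  have hsplit : ∀ x : ℝ, 0 < x → lam * (deriv Φ (lam * x : ℝ) / (Φ (lam * x : ℝ) - w))
      - d * (deriv Φ x / (Φ x - w)) = R.eval (x : ℂ) + (e x : ℂ) := by
    intro x hx
    have hxc : (x : ℂ) ≠ 0 := by exact_mod_cast hx.ne'
    rw [(hP x hx).2, (hP (lam * x) (by positivity)).2, hR, he]
    simp only [Polynomial.eval_sub, Polynomial.eval_mul, Polynomial.eval_C, Polynomial.eval_comp,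
      Polynomial.eval_X]
    push_cast
    field_simp
    ring
  have hto : ∀ N : ℕ, (fun x : ℝ => R.eval (x : ℂ) + (e x : ℂ)) =O[atTop] fun x : ℝ => (x ^ N)⁻¹ :=
    fun N => (hfun N).congr' (by
      filter_upwards [eventually_gt_atTop 0] with x hx using hsplit x hx) EventuallyEq.rfl
  have het : Tendsto e atTop (𝓝 0) := by
    have h1 := ((hn.tendsto_stieltjes.comp (tendsto_id.const_mul_atTop hlam0)).const_mul lam).sub
      (hn.tendsto_stieltjes.const_mul (d : ℝ))
    have h2 := h1.sub (tendsto_const_nhds (x := κ * (d - 1)) |>.div_atTop tendsto_id)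
    simpa [he, Function.comp_def] using h2
  have hinv : Tendsto (fun x : ℝ => (x ^ 1)⁻¹) atTop (𝓝 0) := by
    simpa using tendsto_inv_atTop_zero (𝕜 := ℝ)
  have hR0 : R = 0 := by
    refine eq_zero_of_tendsto_eval R ?_
    have h1 := (hto 1).trans_tendsto hinv
    have h2 := (Complex.continuous_ofReal.tendsto 0).comp het
    rw [Complex.ofReal_zero] at h2
    have h3 := h1.sub h2
    rw [sub_zero] at h3
    exact h3.congr fun x => by simp
  have heO : ∀ N : ℕ, e =O[atTop] fun x : ℝ => (x ^ N)⁻¹ := by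
    intro N
    have := hto N
    rw [hR0] at this
    simp only [Polynomial.eval_zero, zero_add] at this
    exact (Complex.isBigO_ofReal_left).1 this
  refine ⟨?_, heO⟩
  by_contra hge
  rw [not_lt] at hge
  obtain ⟨a, ha⟩ := hw.exists_ne
  have ha0 := hn.pos ha
  obtain ⟨C, hC⟩ := (heO 2).bound
  obtain ⟨X, hX⟩ := eventually_atTop.1 (hC.and (eventually_ge_atTop 1))
  -- With `κ / x` included the relation reads `lam T(lam x) - d T(x) = e(x)`. If `lam ≤ d`, then
  -- `T(x) ≤ T(lam x) + C x⁻²`, and iteration to infinity, where `T` vanishes, gives `T(x) =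
  -- O(x⁻²)`.
  set T : ℝ → ℝ := fun x => S x + κ / x with hT
  have hTnonneg : ∀ x, 0 < x → 0 ≤ T x := fun x hx =>
    add_nonneg (hn.stieltjes_nonneg hx.le) (by positivity)
  have hC0 : 0 ≤ C := by
    have := (norm_nonneg _).trans (hX X le_rfl).1
    have h2 : 0 < ‖(X ^ 2)⁻¹‖ := by
      have := (hX X le_rfl).2
      rw [Real.norm_of_nonneg (by positivity)]; positivity
    by_contra hneg
    nlinarith
  have hstep : ∀ x, X ≤ x → T x ≤ T (lam * x) + C * (x ^ 2)⁻¹ := by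
    intro x hx
    obtain ⟨h1, h2⟩ := hX x hx
    have hx0 : 0 < x := by linarith
    rw [Real.norm_of_nonneg (by positivity : 0 ≤ (x ^ 2)⁻¹)] at h1
    have h3 := neg_le_of_abs_le h1
    have h4 : e x = lam * T (lam * x) - d * T x := by
      simp only [he, hT]
      field_simp
      ring
    rw [h4] at h3
    have h5 := hTnonneg (lam * x) (by positivity)
    have h6 := hTnonneg x hx0
    have h7 : 0 ≤ C * (x ^ 2)⁻¹ := by positivity
    have h8 : d * T x ≤ d * T (lam * x) + d * (C * (x ^ 2)⁻¹) := by nlinarith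
    nlinarith
  have hiter : ∀ n : ℕ, ∀ x, X ≤ x →
      T x ≤ T (lam ^ n * x) + (C * (x ^ 2)⁻¹) * ∑ k ∈ Finset.range n, (lam⁻¹) ^ k := by
    intro n
    induction n with
    | zero => intro x _; simp
    | succ n ih =>
      intro x hx
      have hx1 := (hX x hx).2
      have hxn : X ≤ lam ^ n * x := hx.trans (le_mul_of_one_le_left (by linarith)
          (one_le_pow₀ hlam.le))
      have h1 := hstep _ hxn
      have h2 : lam * (lam ^ n * x) = lam ^ (n + 1) * x := by ring
      rw [h2] at h1
      have h3 : C * ((lam ^ n * x) ^ 2)⁻¹ ≤ C * (x ^ 2)⁻¹ * (lam⁻¹) ^ n := by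
        rw [mul_assoc]
        refine mul_le_mul_of_nonneg_left ?_ hC0
        rw [inv_pow, ← mul_inv]
        refine inv_anti₀ (by positivity) ?_
        have : 1 ≤ lam ^ n := one_le_pow₀ hlam.le
        calc x ^ 2 * lam ^ n ≤ x ^ 2 * lam ^ n * lam ^ n :=
            le_mul_of_one_le_right (by positivity) this
          _ = _ := by ring
      rw [Finset.sum_range_succ, mul_add]
      linarith [ih x hx]
  have hTlim : Tendsto T atTop (𝓝 0) := by
    have := hn.tendsto_stieltjes.add (tendsto_const_nhds (x := κ) |>.div_atTop tendsto_id)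
    rw [add_zero] at this
    exact this
  set G := ∑' k : ℕ, (lam⁻¹) ^ k
  have hgs : Summable fun k : ℕ => (lam⁻¹) ^ k :=
    summable_geometric_of_lt_one (by positivity) (inv_lt_one_of_one_lt₀ hlam)
  have hbound : ∀ x, X ≤ x → T x ≤ C * (x ^ 2)⁻¹ * G := by
    intro x hx
    have hx1 := (hX x hx).2
    have h1 : Tendsto (fun n : ℕ => T (lam ^ n * x) + (C * (x ^ 2)⁻¹) * G) atTop
        (𝓝 (0 + (C * (x ^ 2)⁻¹) * G)) := by
      refine Tendsto.add_const _ (hTlim.comp ?_)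
      exact (tendsto_pow_atTop_atTop_of_one_lt hlam).atTop_mul_const (by linarith)
    rw [zero_add] at h1
    refine ge_of_tendsto' h1 fun n => (hiter n x hx).trans ?_
    gcongr
    exact hgs.sum_le_tsum _ fun k _ => by positivity
  have hG0 : 0 ≤ G := tsum_nonneg fun k => by positivity
  -- For `x ≥ a` a zero `-a` gives `T(x) ≥ 1 / (2 x)`, which exceeds `C G / x²` once `x > 2 C G`.
  obtain ⟨x, hx⟩ : ∃ x, x = max X (max a (2 * (C * G) + 1)) := ⟨_, rfl⟩
  have hx1 : X ≤ x := by rw [hx]; exact le_max_left _ _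
  have hx2 : a ≤ x := by rw [hx]; exact (le_max_left _ _).trans (le_max_right _ _)
  have hx3 : 2 * (C * G) + 1 ≤ x := by rw [hx]; exact (le_max_right _ _).trans (le_max_right _ _)
  have hx0 : 0 < x := by linarith [(hX x hx1).2]
  have h1 := hbound x hx1
  have h2 := hn.le_stieltjes hx0.le ha
  have h3 : 1 / (x + a) ≤ C * (x ^ 2)⁻¹ * G := by
    have : 0 ≤ κ / x := by positivity
    simp only [hT] at h1
    linarith
  rw [div_le_iff₀ (by positivity)] at h3
  have h4 : C * (x ^ 2)⁻¹ * G * (x + a) ≤ C * (x ^ 2)⁻¹ * G * (2 * x) := by gcongr; linarith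
  have h5 : C * (x ^ 2)⁻¹ * G * (2 * x) = 2 * (C * G) / x := by field_simp
  have h6 : 2 * (C * G) / x < 1 := by rw [div_lt_one hx0]; linarith
  linarith

end IsPoincare

/-! ### Consequences of the scaling relation: the abscissa of convergence -/

theorem le_add_of_geometric {a : ℕ → ℝ} {C θ : ℝ} {K : ℕ} (hC : 0 ≤ C) (hθ0 : 0 < θ) (hθ1 : θ < 1)
    (h : ∀ k, K ≤ k → a (k + 1) ≤ a k + C * θ ^ k) {j k : ℕ} (hj : K ≤ j) (hk : j ≤ k) :
    a k ≤ a j + C * θ ^ j / (1 - θ) := by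
  have h1 : 0 < 1 - θ := by linarith
  have key : a k ≤ a j + C * (θ ^ j - θ ^ k) / (1 - θ) := by
    induction k, hk using Nat.le_induction with
    | base => simp
    | succ k hk ih =>
      refine (h k (hj.trans hk)).trans ?_
      have : C * (θ ^ j - θ ^ (k + 1)) / (1 - θ)
          = C * (θ ^ j - θ ^ k) / (1 - θ) + C * θ ^ k := by
        field_simp
        ring
      linarith
  refine key.trans ?_
  gcongr
  have : 0 < θ ^ k := by positivity
  linarith

/-- The Stieltjes transform of `n` satisfies an asymptotic scaling relation with factor `lam`. -/
structure IsScaling (n : ℝ → ℕ) (lam d κ : ℝ) : Prop where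
  isMult : IsMult n
  exists_ne : ∃ a, n a ≠ 0
  one_lt : 1 < d
  lt : d < lam
  kappa_nonneg : 0 ≤ κ
  asymp : ∀ N : ℕ, (fun x : ℝ => lam * stieltjes n (lam * x) - d * stieltjes n x
    - κ * (d - 1) / x) =O[atTop] fun x : ℝ => (x ^ N)⁻¹

theorem IsMult.stieltjes_anti {n : ℝ → ℕ} (h : IsMult n) {x y : ℝ} (hx : 0 ≤ x) (hxy : x ≤ y) :
    stieltjes n y ≤ stieltjes n x := by
  refine (h.summable_term (hx.trans hxy)).tsum_le_tsum (fun a => ?_) (h.summable_term hx)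
  by_cases hn : n a = 0
  · simp [hn]
  · have := h.pos hn
    gcongr

namespace IsScaling

variable {n : ℝ → ℕ} {lam d κ : ℝ}

theorem one_lt_lam (h : IsScaling n lam d κ) : 1 < lam := h.one_lt.trans h.lt

theorem rho_pos (h : IsScaling n lam d κ) : 0 < Real.logb lam d :=
  Real.logb_pos h.one_lt_lam h.one_lt

theorem rho_lt_one (h : IsScaling n lam d κ) : Real.logb lam d < 1 := by
  rw [Real.logb_lt_iff_lt_rpow h.one_lt_lam (by linarith [h.one_lt]), Real.rpow_one]
  exact h.lt

/-- At `x = lam ^ k` the scaling relation says that the normalised values `(lam / d) ^ k S(lam ^ k)`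
change by `O(d ^ (-k))`, a summable amount; `N = 1` suffices, because the term in `κ` is of the same
size. -/
theorem exists_seq_le (h : IsScaling n lam d κ) :
    ∃ C : ℝ, ∀ k : ℕ, (lam / d) ^ k * stieltjes n (lam ^ k) ≤ C := by
  have hd := h.one_lt
  have hl := h.one_lt_lam
  have hl0 : 0 < lam := by linarith
  have hd0 : 0 < d := by linarith
  obtain ⟨C, hC0, hC⟩ := (h.asymp 1).exists_pos
  have hC1 := (tendsto_pow_atTop_atTop_of_one_lt hl).eventually hC.bound
  obtain ⟨K, hK⟩ := eventually_atTop.1 hC1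
  have hk := h.kappa_nonneg
  set C' := (C + κ * (d - 1)) / d
  have hC' : 0 ≤ C' := div_nonneg (add_nonneg hC0.le (mul_nonneg hk (by linarith))) hd0.le
  have step : ∀ k, K ≤ k → (lam / d) ^ (k + 1) * stieltjes n (lam ^ (k + 1))
      ≤ (lam / d) ^ k * stieltjes n (lam ^ k) + C' * (d⁻¹) ^ k := by
    intro k hk
    have h1 := hK k hk
    rw [Real.norm_eq_abs, Real.norm_of_nonneg (by positivity), pow_one, ← pow_succ'] at h1
    have h2 := (abs_le.1 h1).2
    have h3 : lam * stieltjes n (lam ^ (k + 1))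
        ≤ d * stieltjes n (lam ^ k) + (C + κ * (d - 1)) / lam ^ k := by
      rw [add_div, div_eq_mul_inv C]
      linarith
    have h4 : (lam / d) ^ (k + 1) * stieltjes n (lam ^ (k + 1))
        = (lam / d) ^ k / d * (lam * stieltjes n (lam ^ (k + 1))) := by
      rw [pow_succ]; field_simp
    have h5 : (lam / d) ^ k * stieltjes n (lam ^ k) + C' * (d⁻¹) ^ k
        = (lam / d) ^ k / d * (d * stieltjes n (lam ^ k) + (C + κ * (d - 1)) / lam ^ k) := by
      simp only [C', div_pow, inv_pow]
      field_simp
    rw [h4, h5]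
    gcongr
  have hfin : ∃ C, ∀ k, k < K → (lam / d) ^ k * stieltjes n (lam ^ k) ≤ C := by
    obtain ⟨C, hC⟩ := ((Finset.range K).image
      (fun k : ℕ => (lam / d) ^ k * stieltjes n (lam ^ k))).bddAbove
    exact ⟨C, fun k hk => hC (by
      rw [Finset.coe_image]
      exact ⟨k, by simpa using hk, rfl⟩)⟩
  obtain ⟨C1, hC1⟩ := hfin
  refine ⟨max C1 ((lam / d) ^ K * stieltjes n (lam ^ K) + C' * (d⁻¹) ^ K / (1 - d⁻¹)),
    fun k => ?_⟩
  rcases lt_or_ge k K with hk | hk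
  · exact (hC1 k hk).trans (le_max_left _ _)
  · exact (le_add_of_geometric (a := fun k => (lam / d) ^ k * stieltjes n (lam ^ k)) hC'
      (inv_pos.2 hd0) (inv_lt_one_of_one_lt₀ hd) step le_rfl hk).trans (le_max_right _ _)

/-- For a lower bound the term in `κ` has the favourable sign and is dropped. With `N = 2` the total
loss from index `j` on is `O((d lam) ^ (-j))`, while one atom `a` gives `(lam / d) ^ j S(lam ^ j) ≥
d ^ (-j) / 2`, so a late enough start leaves a positive remainder. -/
theorem exists_le_seq (h : IsScaling n lam d κ) :
    ∃ c : ℝ, 0 < c ∧ ∀ᶠ k : ℕ in atTop, c ≤ (lam / d) ^ k * stieltjes n (lam ^ k) := by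
  have hd := h.one_lt
  have hl := h.one_lt_lam
  have hl0 : 0 < lam := by linarith
  have hd0 : 0 < d := by linarith
  obtain ⟨C, hC0, hC⟩ := (h.asymp 2).exists_pos
  have hC1 := (tendsto_pow_atTop_atTop_of_one_lt hl).eventually hC.bound
  obtain ⟨K, hK⟩ := eventually_atTop.1 hC1
  have hk := h.kappa_nonneg
  set C' := C / d
  have hC' : 0 ≤ C' := by positivity
  set θ := (d * lam)⁻¹ with hθ
  have hdl : 1 < d * lam := by nlinarith
  have step : ∀ k, K ≤ k → -((lam / d) ^ (k + 1) * stieltjes n (lam ^ (k + 1)))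
      ≤ -((lam / d) ^ k * stieltjes n (lam ^ k)) + C' * θ ^ k := by
    intro k hk'
    have h1 := hK k hk'
    rw [Real.norm_eq_abs, Real.norm_of_nonneg (by positivity), ← pow_succ'] at h1
    have h2 := (abs_le.1 h1).1
    have h0 : 0 ≤ κ * (d - 1) / lam ^ k :=
      div_nonneg (mul_nonneg hk (by linarith)) (by positivity)
    have h3 : d * stieltjes n (lam ^ k) - C * ((lam ^ k) ^ 2)⁻¹
        ≤ lam * stieltjes n (lam ^ (k + 1)) := by
      linarith
    have h4 : (lam / d) ^ (k + 1) * stieltjes n (lam ^ (k + 1))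
        = (lam / d) ^ k / d * (lam * stieltjes n (lam ^ (k + 1))) := by
      rw [pow_succ]; field_simp
    have h5 : (lam / d) ^ k * stieltjes n (lam ^ k) - C' * θ ^ k
        = (lam / d) ^ k / d * (d * stieltjes n (lam ^ k) - C * ((lam ^ k) ^ 2)⁻¹) := by
      simp only [C', hθ, div_pow, inv_pow, mul_pow]
      field_simp
    have h6 : (lam / d) ^ k / d * (d * stieltjes n (lam ^ k) - C * ((lam ^ k) ^ 2)⁻¹)
        ≤ (lam / d) ^ k / d * (lam * stieltjes n (lam ^ (k + 1))) := by gcongr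
    linarith
  obtain ⟨a, ha⟩ := h.exists_ne
  have ha0 := h.isMult.pos ha
  -- the first term dominates the error for a suitable starting point
  have hbig : Tendsto (fun j : ℕ => lam ^ j) atTop atTop := tendsto_pow_atTop_atTop_of_one_lt hl
  set A := C' / (1 - θ) with hA
  have hθ1 : θ < 1 := inv_lt_one_of_one_lt₀ hdl
  have hθ0 : 0 < θ := by rw [hθ]; positivity
  have hA0 : 0 ≤ A := div_nonneg hC' (by linarith)
  obtain ⟨j, hjK, hja, hjA⟩ := ((eventually_ge_atTop K).and
    ((hbig.eventually_ge_atTop a).and (hbig.eventually_gt_atTop (2 * A)))).exists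
  have hj1 : A * θ ^ j < (lam / d) ^ j * stieltjes n (lam ^ j) := by
    have h1 := h.isMult.le_stieltjes (x := lam ^ j) (by positivity) ha
    have h2 : 1 / (2 * lam ^ j) ≤ stieltjes n (lam ^ j) := by
      refine le_trans ?_ h1
      gcongr
      linarith
    have h3 : (lam / d) ^ j * (1 / (2 * lam ^ j)) ≤ (lam / d) ^ j * stieltjes n (lam ^ j) := by
      gcongr
    refine lt_of_lt_of_le ?_ h3
    rw [hθ, inv_pow, mul_pow, div_pow]
    have h4 : A * (d ^ j * lam ^ j)⁻¹ = A / (d ^ j * lam ^ j) := rfl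
    have h5 : lam ^ j / d ^ j * (1 / (2 * lam ^ j)) = (lam ^ j / 2) / (d ^ j * lam ^ j) := by
      field_simp
    rw [h4, h5]
    gcongr
    linarith
  refine ⟨(lam / d) ^ j * stieltjes n (lam ^ j) - A * θ ^ j, by linarith, ?_⟩
  filter_upwards [eventually_ge_atTop j] with k hjk
  have h1 := le_add_of_geometric (a := fun k => -((lam / d) ^ k * stieltjes n (lam ^ k)))
    hC' hθ0 hθ1 step hjK hjk
  have h2 : C' * θ ^ j / (1 - θ) = A * θ ^ j := by rw [hA]; ring
  rw [h2] at h1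
  linarith

theorem exists_pow_le {x lam : ℝ} (hl : 1 < lam) (hx : 1 ≤ x) :
    ∃ k : ℕ, lam ^ k ≤ x ∧ x < lam ^ (k + 1) := exists_nat_pow_near hx hl

theorem exists_stieltjes_le (h : IsScaling n lam d κ) :
    ∃ C : ℝ, ∀ x : ℝ, 1 ≤ x → stieltjes n x ≤ C * x ^ (Real.logb lam d - 1) := by
  have hd := h.one_lt
  have hl := h.one_lt_lam
  have hl0 : 0 < lam := by linarith
  have hd0 : 0 < d := by linarith
  obtain ⟨C, hC⟩ := h.exists_seq_le
  have hC0 : 0 ≤ C := le_trans (by simpa using h.isMult.stieltjes_nonneg zero_le_one) (hC 0)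
  have hρ1 := h.rho_lt_one
  have hdρ : lam ^ (Real.logb lam d) = d := Real.rpow_logb hl0 hl.ne' hd0
  refine ⟨C * (lam / d), fun x hx => ?_⟩
  obtain ⟨k, hk1, hk2⟩ := exists_pow_le hl hx
  have h1 := h.isMult.stieltjes_anti (by positivity) hk1
  have h2 : stieltjes n (lam ^ k) ≤ C * (d / lam) ^ k := by
    have := hC k
    have h3 : (d / lam) ^ k = ((lam / d) ^ k)⁻¹ := by rw [← inv_pow, inv_div]
    rw [h3, ← div_eq_mul_inv, le_div_iff₀ (by positivity)]
    linarith
  have h3 : (d / lam) ^ (k + 1) ≤ x ^ (Real.logb lam d - 1) := by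
    have h4 : d / lam = lam ^ (Real.logb lam d - 1) := by
      rw [Real.rpow_sub hl0, hdρ, Real.rpow_one]
    rw [h4, ← Real.rpow_natCast, ← Real.rpow_mul hl0.le, mul_comm, Real.rpow_mul hl0.le,
      Real.rpow_natCast]
    exact Real.rpow_le_rpow_of_nonpos (by linarith) hk2.le (by linarith)
  calc stieltjes n x ≤ C * (d / lam) ^ k := h1.trans h2
    _ = C * (lam / d) * (d / lam) ^ (k + 1) := by rw [pow_succ]; field_simp
    _ ≤ _ := by gcongr

/-- For `σ ≤ 1` the series of `lam ^ ((1 - σ) k) S(lam ^ k)` is dominated by a geometric series of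
ratio `d lam ^ (-σ) < 1`. An atom `a` in `[lam ^ k, lam ^ (k + 1))` contributes to the term of index
`k` at least a constant times `a ^ (-σ)`. Atoms below `1`, and the case `σ > 1`, are compared with
`∑ n(a) / a`. -/
theorem summable_rpow (h : IsScaling n lam d κ) {σ : ℝ} (hσ : Real.logb lam d < σ) :
    Summable fun a : ℝ => (n a : ℝ) * a ^ (-σ) := by
  have hd := h.one_lt
  have hl := h.one_lt_lam
  have hl0 : 0 < lam := by linarith
  have hd0 : 0 < d := by linarith
  have hdρ : lam ^ (Real.logb lam d) = d := Real.rpow_logb hl0 hl.ne' hd0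
  rcases lt_or_ge 1 σ with hσ1 | hσ1
  · have hfin := finite_le_of_summable h.isMult.summable h.isMult.nonpos 1
    refine Summable.of_norm_bounded_eventually h.isMult.summable ?_
    refine (Filter.eventually_cofinite.2 (hfin.subset fun a ha => ?_))
    by_contra hcon
    refine ha ?_
    by_cases hn : n a = 0
    · simp [hn]
    have ha1 : 1 < a := by
      by_contra h'; exact hcon ⟨hn, not_lt.1 h'⟩
    rw [Real.norm_of_nonneg (by positivity), div_eq_mul_inv]
    gcongr
    rw [← Real.rpow_neg_one]
    exact Real.rpow_le_rpow_of_exponent_le ha1.le (by linarith)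
  obtain ⟨C, hC⟩ := h.exists_seq_le
  set g : ℕ × ℝ → ℝ := fun q => (lam ^ (1 - σ)) ^ q.1 * ((n q.2 : ℝ) / (lam ^ q.1 + q.2)) with hg
  have hg0 : 0 ≤ g := fun q => mul_nonneg (by positivity)
    (h.isMult.term_nonneg (x := lam ^ q.1) (by positivity) q.2)
  have hgs : Summable g := by
    rw [summable_prod_of_nonneg hg0]
    refine ⟨fun k => by
      simp only [hg]
      exact (h.isMult.summable_term (x := lam ^ k) (by positivity)).mul_left _, ?_⟩
    have hr : d * lam ^ (-σ) < 1 := by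
      rw [Real.rpow_neg hl0.le, ← div_eq_mul_inv, div_lt_one (by positivity)]
      calc d = lam ^ (Real.logb lam d) := hdρ.symm
        _ < lam ^ σ := Real.rpow_lt_rpow_of_exponent_lt hl hσ
    have hgeo := (summable_geometric_of_lt_one (by positivity) hr).mul_left C
    refine Summable.of_nonneg_of_le (fun k => tsum_nonneg fun a => hg0 (k, a)) (fun k => ?_) hgeo
    have hT : ∑' a, g (k, a) = (lam ^ (1 - σ)) ^ k * stieltjes n (lam ^ k) := by
      simp only [hg, tsum_mul_left, stieltjes]
    have h1 := hC k
    have h2 : (lam ^ (1 - σ)) ^ k = (d * lam ^ (-σ)) ^ k * (lam / d) ^ k := by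
      rw [← mul_pow]
      congr 1
      rw [sub_eq_add_neg, Real.rpow_add hl0, Real.rpow_one]
      field_simp
    rw [hT, h2, mul_assoc, mul_comm C]
    gcongr
  have hk : ∀ a : ℝ, ∃ k : ℕ, 1 ≤ a → lam ^ k ≤ a ∧ a < lam ^ (k + 1) := fun a => by
    by_cases ha : 1 ≤ a
    · obtain ⟨k, hk⟩ := exists_pow_le hl ha
      exact ⟨k, fun _ => hk⟩
    · exact ⟨0, fun h => absurd h ha⟩
  choose k hk using hk
  have hinj : Function.Injective fun a : ℝ => (k a, a) := fun a b hab => (Prod.ext_iff.1 hab).2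
  have h1 := (hgs.comp_injective hinj).mul_left (2 * lam ^ (1 - σ))
  refine Summable.of_nonneg_of_le (fun a => ?_) (fun a => ?_) (h.isMult.summable.add h1)
  · by_cases hn : n a = 0
    · simp [hn]
    · have := h.isMult.pos hn
      positivity
  by_cases hn : n a = 0
  · have := hg0 (k a, a)
    simp only [hn, Nat.cast_zero, zero_mul, zero_div, zero_add, Function.comp]
    exact mul_nonneg (by positivity) this
  have ha0 := h.isMult.pos hn
  rcases lt_or_ge a 1 with ha | ha
  · have h2 : (n a : ℝ) * a ^ (-σ) ≤ n a / a := by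
      rw [div_eq_mul_inv]
      gcongr
      rw [← Real.rpow_neg_one]
      exact Real.rpow_le_rpow_of_exponent_ge ha0 ha.le (by linarith)
    have := hg0 (k a, a)
    have h3 : 0 ≤ 2 * lam ^ (1 - σ) * (g ∘ fun a => (k a, a)) a :=
      mul_nonneg (by positivity) this
    linarith
  · obtain ⟨h2, h3⟩ := hk a ha
    have h4 : (n a : ℝ) * a ^ (-σ) ≤ 2 * lam ^ (1 - σ) * (g ∘ fun a => (k a, a)) a := by
      simp only [Function.comp, hg]
      have h5 : (n a : ℝ) / (2 * a) ≤ n a / (lam ^ k a + a) := by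
        gcongr
        linarith
      have h6 : a ^ (1 - σ) ≤ lam ^ (1 - σ) * (lam ^ (1 - σ)) ^ k a := by
        rw [← pow_succ', ← Real.rpow_natCast, ← Real.rpow_mul hl0.le, mul_comm,
          Real.rpow_mul hl0.le, Real.rpow_natCast]
        exact Real.rpow_le_rpow ha0.le h3.le (by linarith)
      calc (n a : ℝ) * a ^ (-σ) = 2 * (a ^ (1 - σ) * (n a / (2 * a))) := by
            rw [sub_eq_add_neg, Real.rpow_add ha0, Real.rpow_one]; field_simp
        _ ≤ 2 * ((lam ^ (1 - σ) * (lam ^ (1 - σ)) ^ k a) * (n a / (lam ^ k a + a))) := by gcongr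
        _ = _ := by ring
    have : 0 ≤ (n a : ℝ) / a := by positivity
    linarith

/-- With `y = lam ^ k` the weight `(lam / d) ^ k` is `y ^ (1 - ρ)`, and the weighted mean inequality
bounds `y ^ (1 - ρ) / (y + a)` by `a ^ (-ρ)`. If the series converged, dominated convergence would
send `(lam / d) ^ k S(lam ^ k)` to zero, against its positive lower bound. -/
theorem not_summable_rpow (h : IsScaling n lam d κ) :
    ¬ Summable fun a : ℝ => (n a : ℝ) * a ^ (-Real.logb lam d) := by
  intro hs
  have hd := h.one_lt
  have hl := h.one_lt_lam
  have hl0 : 0 < lam := by linarith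
  have hd0 : 0 < d := by linarith
  set ρ := Real.logb lam d with hρ
  have hρ0 : 0 < ρ := h.rho_pos
  have hρ1 : ρ < 1 := h.rho_lt_one
  have hdρ : lam ^ ρ = d := Real.rpow_logb hl0 hl.ne' hd0
  obtain ⟨c, hc, hck⟩ := h.exists_le_seq
  have key : Tendsto (fun k : ℕ => ∑' a : ℝ, (lam / d) ^ k * ((n a : ℝ) / (lam ^ k + a)))
      atTop (𝓝 (∑' _ : ℝ, (0 : ℝ))) := by
    refine tendsto_tsum_of_dominated_convergence hs (fun a => ?_) ?_
    · have h0 : Tendsto (fun k : ℕ => (d⁻¹) ^ k * (n a : ℝ)) atTop (𝓝 (0 * (n a : ℝ))) :=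
        (tendsto_pow_atTop_nhds_zero_of_lt_one (inv_pos.2 hd0).le
          (inv_lt_one_of_one_lt₀ hd)).mul_const _
      rw [zero_mul] at h0
      refine squeeze_zero (fun k => mul_nonneg (by positivity)
        (h.isMult.term_nonneg (by positivity) _)) (fun k => ?_) h0
      by_cases hn : n a = 0
      · simp [hn]
      have ha := h.isMult.pos hn
      calc (lam / d) ^ k * ((n a : ℝ) / (lam ^ k + a)) ≤ (lam / d) ^ k * ((n a : ℝ) / lam ^ k) := by
            gcongr
            linarith
        _ = _ := by rw [div_pow, inv_pow]; field_simp
    · refine Eventually.of_forall fun k a => ?_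
      rw [Real.norm_of_nonneg (mul_nonneg (by positivity)
        (h.isMult.term_nonneg (by positivity) _))]
      by_cases hn : n a = 0
      · simp [hn]
      have ha := h.isMult.pos hn
      set y := lam ^ k with hy
      have hy0 : 0 < y := by positivity
      have h1 : (lam / d) ^ k = y ^ (1 - ρ) := by
        rw [hy, ← Real.rpow_natCast, ← Real.rpow_natCast, ← Real.rpow_mul hl0.le, mul_comm,
          Real.rpow_mul hl0.le, Real.rpow_sub hl0, Real.rpow_one, hdρ]
      have h2 : a ^ ρ * y ^ (1 - ρ) ≤ y + a := by
        have := Real.geom_mean_le_arith_mean2_weighted hρ0.le (by linarith : 0 ≤ 1 - ρ) ha.le hy0.le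
          (by ring)
        nlinarith
      rw [h1, Real.rpow_neg ha.le, ← div_eq_mul_inv, mul_div_assoc', div_le_div_iff₀ (by positivity)
        (by positivity)]
      nlinarith [(Nat.cast_nonneg (n a) : (0 : ℝ) ≤ n a)]
  simp only [tsum_zero, tsum_mul_left] at key
  have h3 : c ≤ 0 := ge_of_tendsto key hck
  linarith

end IsScaling

/-! ### Mellin transforms of Stieltjes transforms -/

theorem integrableOn_cpow_mul_exp_neg {s : ℂ} (hs : 0 < s.re) {t : ℝ} (ht : 0 < t) :
    IntegrableOn (fun x : ℝ => (x : ℂ) ^ (s - 1) * Complex.exp (-(t * x : ℂ))) (Ioi 0) := by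
  have h := Complex.GammaIntegral_convergent hs
  rw [← mul_zero t, ← integrableOn_Ioi_comp_mul_left_iff _ _ ht] at h
  refine IntegrableOn.congr_fun (Integrable.const_mul h ((t : ℂ) ^ (s - 1))⁻¹)
    (fun x (hx : 0 < x) => ?_) measurableSet_Ioi
  have ht0 : (t : ℂ) ^ (s - 1) ≠ 0 := by
    rw [Ne, Complex.cpow_eq_zero_iff, not_and_or]
    exact Or.inl (Complex.ofReal_ne_zero.2 ht.ne')
  simp only [Complex.ofReal_exp, Complex.ofReal_neg, Complex.ofReal_mul]
  rw [Complex.mul_cpow_ofReal_nonneg ht.le hx.le]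
  field_simp

/-- The Mellin transform of `1 / (x + a)`. -/
theorem hasMellin_inv_add {s : ℂ} (h0 : 0 < s.re) (h1 : s.re < 1) {a : ℝ} (ha : 0 < a) :
    HasMellin (fun x : ℝ => 1 / ((x : ℂ) + a)) (1 - s)
      (Complex.Gamma s * Complex.Gamma (1 - s) * (a : ℂ) ^ (-s)) := by
  have h1' : 0 < (1 - s).re := by simp; linarith
  set μ := (volume : Measure ℝ).restrict (Ioi 0) with hμ
  -- From `1 / (x + a) = ∫ exp (-(x + a) t) dt`; exchanging the integrals leaves two Gamma
  -- integrals.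
  set F : ℝ → ℝ → ℂ := fun x t => (x : ℂ) ^ (1 - s - 1) * Complex.exp (-(t * x : ℂ)) *
    Complex.exp (-(a * t : ℂ)) with hF
  have hnorm : ∀ x t : ℝ, 0 < x → ‖F x t‖ =
      x ^ ((1 - s).re - 1) * Real.exp (-(t * x)) * Real.exp (-(a * t)) := by
    intro x t hx
    simp only [hF, norm_mul, Complex.norm_exp, Complex.norm_cpow_eq_rpow_re_of_pos hx]
    simp [Complex.sub_re]
  have hpos : ∀ᵐ x ∂μ, 0 < x := ae_restrict_mem measurableSet_Ioi
  have hFt : ∀ t : ℝ, 0 < t → Integrable (fun x => F x t) μ := fun t ht =>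
    (integrableOn_cpow_mul_exp_neg h1' ht).mul_const _
  have hint : ∀ t : ℝ, 0 < t → ∫ x, ‖F x t‖ ∂μ =
      Real.Gamma ((1 - s).re) * (t ^ (s.re - 1) * Real.exp (-(a * t))) := by
    intro t ht
    have e1 : ∫ x, ‖F x t‖ ∂μ =
        ∫ x, x ^ ((1 - s).re - 1) * Real.exp (-(t * x)) * Real.exp (-(a * t)) ∂μ :=
      integral_congr_ae (hpos.mono fun x hx => hnorm x t hx)
    rw [e1, integral_mul_const, Real.integral_rpow_mul_exp_neg_mul_Ioi h1' ht]
    have : (1 / t) ^ (1 - s).re = t ^ (s.re - 1) := by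
      rw [one_div, Real.inv_rpow ht.le, ← Real.rpow_neg ht.le]
      congr 1
      simp
    rw [this]
    ring
  have hmeas : AEStronglyMeasurable (Function.uncurry F) (μ.prod μ) := by
    apply Measurable.aestronglyMeasurable
    simp only [hF, Function.uncurry_def]
    fun_prop
  have hgam : IntegrableOn (fun t : ℝ => t ^ (s.re - 1) * Real.exp (-(a * t))) (Ioi 0) := by
    have h := (integrableOn_cpow_mul_exp_neg h0 ha).norm
    refine h.congr (hpos.mono fun t ht => ?_)
    simp only [norm_mul, Complex.norm_exp, Complex.norm_cpow_eq_rpow_re_of_pos ht]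
    simp [Complex.sub_re]
  have hprod : Integrable (Function.uncurry F) (μ.prod μ) := by
    rw [integrable_prod_iff' hmeas]
    refine ⟨hpos.mono fun t ht => hFt t ht, ?_⟩
    refine (hgam.const_mul (Real.Gamma ((1 - s).re))).congr (hpos.mono fun t ht => ?_)
    exact (hint t ht).symm
  have hx : ∀ x : ℝ, 0 < x → ∫ t, F x t ∂μ = (x : ℂ) ^ (1 - s - 1) * (1 / ((x : ℂ) + a)) := by
    intro x hx
    have e2 : ∀ t : ℝ, F x t = (x : ℂ) ^ (1 - s - 1) * Complex.exp (-((x + a : ℝ) : ℂ) * t) := by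
      intro t
      simp only [hF, mul_assoc]
      rw [← Complex.exp_add]
      push_cast
      ring_nf
    simp_rw [e2]
    rw [integral_const_mul, integral_exp_mul_complex_Ioi (by simp; linarith)]
    congr 1
    rw [Complex.ofReal_zero, mul_zero, Complex.exp_zero, neg_div_neg_eq, Complex.ofReal_add]
  have ht : ∀ t : ℝ, 0 < t → ∫ x, F x t ∂μ
      = Complex.Gamma (1 - s) * ((t : ℂ) ^ (s - 1) * Complex.exp (-(a * t : ℂ))) := by
    intro t ht
    simp only [hF]
    rw [integral_mul_const, Complex.integral_cpow_mul_exp_neg_mul_Ioi h1' ht]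
    have : (1 / (t : ℂ)) ^ (1 - s) = (t : ℂ) ^ (s - 1) := by
      rw [one_div, Complex.inv_cpow _ _ (by
        rw [Complex.arg_ofReal_of_nonneg ht.le]; exact Real.pi_pos.ne), ← Complex.cpow_neg]
      congr 1
      ring
    rw [this]
    ring
  refine ⟨?_, ?_⟩
  · have := hprod.integral_prod_left
    refine this.congr (hpos.mono fun x h => ?_)
    simp only [Function.uncurry_apply_pair, smul_eq_mul]
    exact hx x h
  · have hsw := integral_integral_swap hprod
    have e3 : ∫ x, ∫ t, F x t ∂μ ∂μ = mellin (fun x : ℝ => 1 / ((x : ℂ) + a)) (1 - s) := by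
      simp only [mellin, smul_eq_mul]
      exact integral_congr_ae (hpos.mono fun x h => hx x h)
    have e4 : ∫ t, ∫ x, F x t ∂μ ∂μ = ∫ t : ℝ, Complex.Gamma (1 - s) *
        ((t : ℂ) ^ (s - 1) * Complex.exp (-(a * t : ℂ))) ∂μ :=
      integral_congr_ae (hpos.mono fun t h => ht t h)
    rw [← e3, hsw, e4, integral_const_mul, Complex.integral_cpow_mul_exp_neg_mul_Ioi h0 ha, one_div,
      Complex.inv_cpow _ _ (by
        rw [Complex.arg_ofReal_of_nonneg ha.le]; exact Real.pi_pos.ne), ← Complex.cpow_neg]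
    ring

/-- The Dirichlet series `∑ n(a) a ^ (-s)`. -/
noncomputable def dirichlet (n : ℝ → ℕ) (s : ℂ) : ℂ := ∑' a : ℝ, (n a : ℂ) * (a : ℂ) ^ (-s)

namespace IsMult

variable {n : ℝ → ℕ}

theorem norm_term (h : IsMult n) (s : ℂ) (a : ℝ) :
    ‖(n a : ℂ) * (a : ℂ) ^ (-s)‖ = (n a : ℝ) * a ^ (-s.re) := by
  by_cases hn : n a = 0
  · simp [hn]
  · have := h.pos hn
    rw [norm_mul, Complex.norm_natCast, Complex.norm_cpow_eq_rpow_re_of_pos this, Complex.neg_re]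

theorem summable_cpow (h : IsMult n) {s : ℂ} (hs : Summable fun a : ℝ => (n a : ℝ) * a ^ (-s.re)) :
    Summable fun a : ℝ => (n a : ℂ) * (a : ℂ) ^ (-s) :=
  Summable.of_norm (by simpa only [h.norm_term] using hs)

theorem countable (h : IsMult n) : {a | n a ≠ 0}.Countable :=
  h.summable.countable_support.mono fun a ha => by
    have := h.pos ha
    simp only [Function.mem_support]
    have : (n a : ℝ) ≠ 0 := by exact_mod_cast ha
    positivity

/-- Termwise integration of `∑ n(a) / (x + a)`. The integrals of the absolute values are given by
the same formula at the real point `s.re`, so the hypothesis on the series is exactly what Fubini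
needs. -/
theorem mellin_stieltjes (h : IsMult n) {s : ℂ} (h0 : 0 < s.re) (h1 : s.re < 1)
    (hs : Summable fun a : ℝ => (n a : ℝ) * a ^ (-s.re)) :
    mellin (fun x => (stieltjes n x : ℂ)) (1 - s)
      = Complex.Gamma s * Complex.Gamma (1 - s) * dirichlet n s := by
  set T := {a | n a ≠ 0}
  have hc : Countable T := h.countable
  have hpos : ∀ᵐ x ∂(volume : Measure ℝ).restrict (Ioi 0), 0 < x :=
    ae_restrict_mem measurableSet_Ioi
  set G : T → ℝ → ℂ := fun a x => (x : ℂ) ^ (1 - s - 1) * ((n a : ℂ) * (1 / ((x : ℂ) + (a : ℝ))))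
    with hG
  have hM := fun a : T => hasMellin_inv_add h0 h1 (h.pos a.2)
  have hM' : ∀ a : T, HasMellin (fun x : ℝ => (n a : ℂ) * (1 / ((x : ℂ) + (a : ℝ)))) (1 - s)
      ((n a : ℂ) * (Complex.Gamma s * Complex.Gamma (1 - s) * ((a : ℝ) : ℂ) ^ (-s))) := fun a => by
    have := hasMellin_const_smul (hM a).1 (n a : ℂ)
    rw [(hM a).2] at this
    exact this
  have hnorm : ∀ a : T, ∫ x in Ioi (0 : ℝ), ‖G a x‖ =
      (Complex.Gamma s.re * Complex.Gamma (1 - s.re)).re * ((n a : ℝ) * (a : ℝ) ^ (-s.re)) := by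
    intro a
    have hM2 := hasMellin_inv_add (s := (s.re : ℂ)) (by simpa using h0) (by simpa using h1)
      (h.pos a.2)
    have e1 : ∀ x : ℝ, 0 < x → ((‖G a x‖ : ℝ) : ℂ) = (n a : ℂ) *
        ((x : ℂ) ^ (1 - (s.re : ℂ) - 1) * (1 / ((x : ℂ) + (a : ℝ)))) := by
      intro x hx
      have ha := h.pos a.2
      have h2 : ‖(x : ℂ) + (a : ℝ)‖ = x + a := by
        rw [← Complex.ofReal_add, Complex.norm_real, Real.norm_of_nonneg (by positivity)]
      simp only [hG, norm_mul, norm_div, norm_one, h2, Complex.norm_natCast,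
        Complex.norm_cpow_eq_rpow_re_of_pos hx]
      have h3 : ((x : ℂ) ^ (1 - (s.re : ℂ) - 1)) = ((x ^ (1 - s.re - 1) : ℝ) : ℂ) := by
        rw [Complex.ofReal_cpow hx.le]; push_cast; rfl
      rw [h3]
      simp only [Complex.sub_re, Complex.one_re]
      push_cast
      ring
    have e2 : ((∫ x in Ioi (0 : ℝ), ‖G a x‖ : ℝ) : ℂ) = (n a : ℂ) *
        (Complex.Gamma s.re * Complex.Gamma (1 - s.re) * ((a : ℝ) : ℂ) ^ (-(s.re : ℂ))) := by
      rw [← integral_complex_ofReal, integral_congr_ae (hpos.mono fun x hx => e1 x hx),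
        integral_const_mul]
      congr 1
      exact hM2.2
    have e3 := congrArg Complex.re e2
    rw [Complex.ofReal_re] at e3
    rw [e3]
    have e4 : ((a : ℝ) : ℂ) ^ (-(s.re : ℂ)) = (((a : ℝ) ^ (-s.re) : ℝ) : ℂ) := by
      rw [Complex.ofReal_cpow (h.pos a.2).le]; push_cast; rfl
    rw [e4, ← Complex.ofReal_natCast, Complex.re_ofReal_mul, Complex.re_mul_ofReal]
    ring
  have hsum := hasSum_integral_of_summable_integral_norm (F := G)
    (μ := (volume : Measure ℝ).restrict (Ioi 0)) (fun a => (hM' a).1) (by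
      simp_rw [hnorm]
      exact (hs.subtype T).mul_left _)
  have e5 : mellin (fun x => (stieltjes n x : ℂ)) (1 - s) =
      ∫ x in Ioi (0 : ℝ), ∑' a : T, G a x := by
    simp only [mellin, smul_eq_mul]
    refine integral_congr_ae (hpos.mono fun x hx => ?_)
    simp only [hG]
    rw [tsum_mul_left]
    congr 1
    rw [stieltjes, Complex.ofReal_tsum, ← tsum_subtype_eq_of_support_subset (s := T)]
    · refine tsum_congr fun a => ?_
      push_cast
      ring
    · intro a ha
      simp only [Function.mem_support] at ha
      intro h0
      simp [h0] at ha
  rw [e5, ← hsum.tsum_eq, dirichlet, ← tsum_mul_left, ← tsum_subtype_eq_of_support_subset (s := T)]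
  · refine tsum_congr fun a => ?_
    have := (hM' a).2
    simp only [mellin, smul_eq_mul] at this
    simp only [hG]
    rw [this]
    ring
  · intro a ha
    simp only [Function.mem_support] at ha
    intro h0
    simp [h0] at ha

end IsMult

/-! ### Phragmén–Lindelöf estimates in strips, and bounds for `1 / Γ` -/

theorem exists_norm_mellin_le {f : ℝ → ℂ} {a b : ℝ} (ha : MellinConvergent f a)
    (hb : MellinConvergent f b) :
    ∃ C : ℝ, ∀ z : ℂ, a ≤ z.re → z.re ≤ b → ‖mellin f z‖ ≤ C := by
  refine ⟨∫ x in Ioi (0 : ℝ), (‖(x : ℂ) ^ ((a : ℂ) - 1) • f x‖ + ‖(x : ℂ) ^ ((b : ℂ) - 1) • f x‖),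
    fun z hza hzb => ?_⟩
  refine norm_integral_le_of_norm_le (ha.norm.add hb.norm) ?_
  filter_upwards [ae_restrict_mem measurableSet_Ioi] with x hx
  have hx0 : 0 < x := hx
  simp only [norm_smul, Complex.norm_cpow_eq_rpow_re_of_pos hx0, ← add_mul, Complex.sub_re,
    Complex.ofReal_re, Complex.one_re]
  gcongr
  rcases le_total 1 x with h | h
  · have := Real.rpow_le_rpow_of_exponent_le h (by linarith : z.re - 1 ≤ b - 1)
    have h0 : 0 ≤ x ^ (a - 1) := by positivity
    linarith
  · have := Real.rpow_le_rpow_of_exponent_ge hx0 h (by linarith : a - 1 ≤ z.re - 1)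
    have h0 : 0 ≤ x ^ (b - 1) := by positivity
    linarith

theorem norm_le_on_rectangle {f : ℂ → ℂ} (hf : Differentiable ℂ f) {a b c e C : ℝ}
    (hC : ∀ s : ℂ, a ≤ s.re → s.re ≤ b → c ≤ s.im → s.im ≤ e →
      s.re = a ∨ s.re = b ∨ s.im = c ∨ s.im = e → ‖f s‖ ≤ C) {s : ℂ}
    (h1 : a ≤ s.re) (h2 : s.re ≤ b) (h3 : c ≤ s.im) (h4 : s.im ≤ e) : ‖f s‖ ≤ C := by
  refine Complex.norm_le_of_forall_mem_frontier_norm_le (U := Icc a b ×ℂ Icc c e)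
    ((Metric.isBounded_Icc a b).reProdIm (Metric.isBounded_Icc c e)) hf.diffContOnCl
    (fun z hz => ?_) (subset_closure ⟨⟨h1, h2⟩, ⟨h3, h4⟩⟩)
  rw [frontier, ((isClosed_Icc).reProdIm isClosed_Icc).closure_eq, Complex.interior_reProdIm,
    interior_Icc, interior_Icc] at hz
  obtain ⟨⟨⟨h1, h2⟩, ⟨h3, h4⟩⟩, h5⟩ := hz
  refine hC z h1 h2 h3 h4 ?_
  by_contra! h
  exact h5 ⟨⟨lt_of_le_of_ne h1 (Ne.symm h.1), lt_of_le_of_ne h2 h.2.1⟩,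
    ⟨lt_of_le_of_ne h3 (Ne.symm h.2.2.1), lt_of_le_of_ne h4 h.2.2.2⟩⟩

/-- A form of the three lines theorem for a half strip. -/
theorem exists_norm_le_half_strip {Y : ℂ → ℂ} (hY : Differentiable ℂ Y) {a b c K : ℝ} (hab : a < b)
    (hb : ∃ C, ∀ s : ℂ, s.re = b → ‖Y s‖ ≤ C)
    (hg : ∃ C, ∀ s : ℂ, a ≤ s.re → s.re ≤ b → ‖Y s‖ ≤ C * Real.exp (K * |s.im|))
    (hc : 2 * c * (b - a) = K) (hc0 : 0 ≤ c) :
    ∃ C, ∀ s : ℂ, a ≤ s.re → s.re ≤ b → 0 ≤ s.im →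
      ‖Y s‖ ≤ C * Real.exp (2 * c * (b - s.re) * s.im) := by
  obtain ⟨C1, hC1⟩ := hb
  obtain ⟨C2, hC2⟩ := hg
  have hC20 : 0 ≤ C2 := by
    have h := (norm_nonneg _).trans (hC2 b (by simpa using hab.le) (by simp))
    simpa using h
  have hC10 : 0 ≤ C1 := (norm_nonneg _).trans (hC1 b (by simp))
  have hK : 0 ≤ K := by rw [← hc]; exact mul_nonneg (by positivity) (by linarith)
  set C := C1 + C2
  have hre : ∀ s : ℂ, (-Complex.I * c * (s - b) ^ 2).re = -(2 * c * (b - s.re) * s.im) := by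
    intro s
    simp [pow_two, Complex.mul_re, Complex.mul_im]
    ring
  have hre2 : ∀ s : ℂ, ((s - b) ^ 2).re = (s.re - b) ^ 2 - s.im ^ 2 := by
    intro s
    simp [pow_two]
  -- The multiplier has modulus `exp (-2 c (b - Re s) Im s)`: it equals `1` on `Re s = b`, and on
  -- `Re s = a` it cancels the growth `exp (K Im s)`, because `2 c (b - a) = K`.
  set f : ℂ → ℂ := fun s => Y s * Complex.exp (-Complex.I * c * (s - b) ^ 2) with hf
  have hfn : ∀ s, ‖f s‖ = ‖Y s‖ * Real.exp (-(2 * c * (b - s.re) * s.im)) := by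
    intro s
    rw [hf]
    simp only [norm_mul, Complex.norm_exp, hre]
  have key : ∀ ε : ℝ, 0 < ε → ∀ s : ℂ, a ≤ s.re → s.re ≤ b → 0 ≤ s.im →
      ‖f s * Complex.exp (ε * (s - b) ^ 2)‖ ≤ C * Real.exp (ε * (b - a) ^ 2) := by
    intro ε hε s h1 h2 h3
    -- The further factor `exp (ε (s - b) ^ 2)` decays like `exp (-ε T²)` at height `T`, which beats
    -- `exp (K T)` as soon as `T ≥ K / ε`; this closes the rectangle at the top. Afterwards `ε → 0`.
    set T := max s.im (K / ε) with hT
    have hT1 : K / ε ≤ T := le_max_right _ _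
    have hT0 : 0 ≤ T := h3.trans (le_max_left _ _)
    have hgn : ∀ z : ℂ, ‖f z * Complex.exp (ε * (z - b) ^ 2)‖
        = ‖Y z‖ * Real.exp (-(2 * c * (b - z.re) * z.im)) *
          Real.exp (ε * ((z.re - b) ^ 2 - z.im ^ 2)) := by
      intro z
      rw [norm_mul, hfn, Complex.norm_exp, Complex.re_ofReal_mul, hre2]
    refine norm_le_on_rectangle (f := fun s => f s * Complex.exp (ε * (s - b) ^ 2))
      (by rw [hf]; fun_prop) (a := a) (b := b) (c := 0) (e := T) ?_ h1 h2 h3 (le_max_left _ _)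
    intro z hz1 hz2 hz3 hz4 hz
    rw [hgn]
    have hY2 := hC2 z hz1 hz2
    rw [abs_of_nonneg hz3] at hY2
    have hsq : (z.re - b) ^ 2 ≤ (b - a) ^ 2 := by nlinarith
    have he : Real.exp (ε * ((z.re - b) ^ 2 - z.im ^ 2)) ≤ Real.exp (ε * (b - a) ^ 2) :=
      Real.exp_le_exp.2 (by nlinarith [sq_nonneg z.im])
    have hp : 0 ≤ 2 * c * (b - z.re) * z.im :=
      mul_nonneg (mul_nonneg (by positivity) (by linarith)) hz3
    have hp1 : Real.exp (-(2 * c * (b - z.re) * z.im)) ≤ 1 := Real.exp_le_one_iff.2 (by linarith)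
    rcases hz with hz | hz | hz | hz
    · have h5 : ‖Y z‖ * Real.exp (-(2 * c * (b - z.re) * z.im)) ≤ C := by
        rw [hz, hc]
        have : C2 * Real.exp (K * z.im) * Real.exp (-(K * z.im)) = C2 := by
          rw [mul_assoc, ← Real.exp_add]; simp
        calc _ ≤ C2 * Real.exp (K * z.im) * Real.exp (-(K * z.im)) := by gcongr
          _ ≤ C := by rw [this]; simp only [C]; linarith
      gcongr
    · have h5 : ‖Y z‖ * Real.exp (-(2 * c * (b - z.re) * z.im)) ≤ C * 1 := by
        gcongr
        exact (hC1 z hz).trans (by simp only [C]; linarith)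
      rw [mul_one] at h5
      gcongr
    · have h5 : ‖Y z‖ * Real.exp (-(2 * c * (b - z.re) * z.im)) ≤ C * 1 := by
        gcongr
        rw [hz] at hY2
        simp only [mul_zero, Real.exp_zero, mul_one] at hY2
        exact hY2.trans (by simp only [C]; linarith)
      rw [mul_one] at h5
      gcongr
    · have h5 : ‖Y z‖ * Real.exp (-(2 * c * (b - z.re) * z.im)) ≤ C2 * Real.exp (K * T) * 1 := by
        rw [hz] at hY2 hp1 ⊢
        gcongr
      have h6 : Real.exp (ε * ((z.re - b) ^ 2 - z.im ^ 2))
          ≤ Real.exp (-(K * T)) * Real.exp (ε * (b - a) ^ 2) := by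
        rw [← Real.exp_add, hz]
        refine Real.exp_le_exp.2 ?_
        have : K * T ≤ ε * T ^ 2 := by
          rw [div_le_iff₀ hε] at hT1
          nlinarith
        nlinarith
      calc _ ≤ C2 * Real.exp (K * T) * 1 * (Real.exp (-(K * T)) * Real.exp (ε * (b - a) ^ 2)) := by
            gcongr
        _ = C2 * (Real.exp (K * T) * Real.exp (-(K * T))) * Real.exp (ε * (b - a) ^ 2) := by ring
        _ = C2 * Real.exp (ε * (b - a) ^ 2) := by rw [← Real.exp_add]; simp
        _ ≤ _ := by
          gcongr
          simp only [C]; linarith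
  refine ⟨C, fun s h1 h2 h3 => ?_⟩
  have hlim : ‖f s‖ ≤ C := by
    have t1 : Tendsto (fun ε : ℝ => ‖f s * Complex.exp (ε * (s - b) ^ 2)‖) (𝓝[>] 0)
        (𝓝 ‖f s * Complex.exp ((0 : ℝ) * (s - b) ^ 2)‖) := by
      refine Tendsto.mono_left (Continuous.tendsto ?_ 0) nhdsWithin_le_nhds
      fun_prop
    have t2 : Tendsto (fun ε : ℝ => C * Real.exp (ε * (b - a) ^ 2)) (𝓝[>] 0)
        (𝓝 (C * Real.exp (0 * (b - a) ^ 2))) := by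
      refine Tendsto.mono_left (Continuous.tendsto ?_ 0) nhdsWithin_le_nhds
      fun_prop
    have := le_of_tendsto_of_tendsto t1 t2 (by
      filter_upwards [self_mem_nhdsWithin] with ε hε using key ε hε s h1 h2 h3)
    simpa using this
  rw [hfn, Real.exp_neg, ← div_eq_mul_inv, div_le_iff₀ (Real.exp_pos _)] at hlim
  exact hlim

/-- An entire function of exponential growth `e ^ (K |Im s|)` in every strip, bounded on a
vertical line, is of subexponential growth in the strips to the left of that line. -/
theorem exists_norm_le_strip {Y : ℂ → ℂ} (hY : Differentiable ℂ Y) {b K : ℝ} (hK : 0 < K)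
    (hb : ∃ C, ∀ s : ℂ, s.re = b → ‖Y s‖ ≤ C)
    (hg : ∀ a, ∃ C, ∀ s : ℂ, a ≤ s.re → s.re ≤ b → ‖Y s‖ ≤ C * Real.exp (K * |s.im|))
    (a δ : ℝ) (hδ : 0 < δ) :
    ∃ C, ∀ s : ℂ, a ≤ s.re → s.re ≤ b → ‖Y s‖ ≤ C * Real.exp (δ * |s.im|) := by
  rcases lt_or_ge b a with hab | hab
  · exact ⟨0, fun s h1 h2 => by linarith⟩
  -- Interpolating over a strip of width `L` gives the exponent `K (b - Re s) / L`; taking `L` large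
  -- makes it at most `δ` on the part `Re s ≥ a`.
  set L := max (b - a + 1) (K * (b - a) / δ) with hL
  have hL1 : b - a + 1 ≤ L := le_max_left _ _
  have hL2 : K * (b - a) / δ ≤ L := le_max_right _ _
  have hL0 : 0 < L := by linarith
  set c := K / (2 * L) with hc
  have hc0 : 0 < c := by positivity
  have hcK : 2 * c * (b - (b - L)) = K := by rw [hc]; field_simp; ring
  have hcδ : ∀ s : ℂ, a ≤ s.re → 2 * c * (b - s.re) ≤ δ := by
    intro s h1
    rw [div_le_iff₀ hδ] at hL2
    have : 2 * c * (b - s.re) = K * (b - s.re) / L := by rw [hc]; field_simp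
    rw [this, div_le_iff₀ hL0]
    nlinarith
  obtain ⟨C1, hC1⟩ := exists_norm_le_half_strip hY (by linarith : b - L < b) hb (hg _) hcK hc0.le
  -- The lower half strip is the upper half strip of the conjugate function.
  set Y' : ℂ → ℂ := fun s => starRingEnd ℂ (Y (starRingEnd ℂ s)) with hY'
  have hY'd : Differentiable ℂ Y' := fun s => by
    have := (hY (starRingEnd ℂ s)).conj_conj
    rwa [Complex.conj_conj] at this
  have hY'n : ∀ s, ‖Y' s‖ = ‖Y (starRingEnd ℂ s)‖ := fun s => by rw [hY']; exact Complex.norm_conj _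
  obtain ⟨C2, hC2⟩ := exists_norm_le_half_strip hY'd (by linarith : b - L < b)
    (by
      obtain ⟨C, hC⟩ := hb
      exact ⟨C, fun s hs => by rw [hY'n]; exact hC _ (by simpa using hs)⟩)
    (by
      obtain ⟨C, hC⟩ := hg (b - L)
      refine ⟨C, fun s h1 h2 => ?_⟩
      rw [hY'n]
      have := hC (starRingEnd ℂ s) (by simpa using h1) (by simpa using h2)
      simpa using this) hcK hc0.le
  have hC10 : 0 ≤ C1 := by
    have h := (norm_nonneg _).trans (hC1 b (by simpa using hL0.le) (by simp) (by simp))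
    simpa using h
  have hC20 : 0 ≤ C2 := by
    have h := (norm_nonneg _).trans (hC2 b (by simpa using hL0.le) (by simp) (by simp))
    simpa using h
  refine ⟨C1 + C2, fun s h1 h2 => ?_⟩
  have h3 := hcδ s h1
  have he : Real.exp (2 * c * (b - s.re) * |s.im|) ≤ Real.exp (δ * |s.im|) := by gcongr
  have hE := Real.exp_pos (δ * |s.im|)
  rcases le_total 0 s.im with h | h
  · have := hC1 s (by linarith) h2 h
    rw [abs_of_nonneg h] at he hE ⊢
    nlinarith
  · have := hC2 (starRingEnd ℂ s) (by simp; linarith) (by simpa using h2) (by simpa using h)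
    rw [hY'n, Complex.conj_conj] at this
    simp only [Complex.conj_re, Complex.conj_im] at this
    rw [abs_of_nonpos h] at he hE ⊢
    nlinarith

theorem norm_sin_le (z : ℂ) : ‖Complex.sin z‖ ≤ Real.exp |z.im| := by
  have h : Complex.sin z = (Complex.exp (-z * Complex.I) - Complex.exp (z * Complex.I)) *
    Complex.I / 2 := rfl
  rw [h, norm_div, norm_mul, Complex.norm_I, mul_one, Complex.norm_two, div_le_iff₀ two_pos]
  refine (norm_sub_le _ _).trans ?_
  rw [Complex.norm_exp, Complex.norm_exp]
  have h1 : (-z * Complex.I).re ≤ |z.im| := by simp [le_abs_self]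
  have h2 : (z * Complex.I).re ≤ |z.im| := by simp [neg_le_abs]
  linarith [Real.exp_le_exp.2 h1, Real.exp_le_exp.2 h2]

theorem norm_inv_Gamma_mul_Gamma_le (s : ℂ) :
    ‖(Complex.Gamma s)⁻¹ * (Complex.Gamma (1 - s))⁻¹‖ ≤ Real.exp (Real.pi * |s.im|) := by
  rw [← mul_inv, Complex.Gamma_mul_Gamma_one_sub, inv_div, norm_div]
  have h1 := norm_sin_le (Real.pi * s)
  rw [Complex.im_ofReal_mul, abs_mul, abs_of_pos Real.pi_pos] at h1
  have h2 : (1 : ℝ) ≤ ‖(Real.pi : ℂ)‖ := by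
    rw [Complex.norm_real, Real.norm_of_nonneg Real.pi_pos.le]
    linarith [Real.pi_gt_three]
  exact (div_le_self (norm_nonneg _) h2).trans h1

theorem eventually_Gamma_ne_zero (s : ℂ) : ∀ᶠ z in 𝓝[≠] s, Complex.Gamma z ≠ 0 ∧ z ≠ 0 := by
  have hd : AnalyticOnNhd ℂ (fun z => (Complex.Gamma z)⁻¹) univ :=
    Complex.analyticOnNhd_univ_iff_differentiable.2 Complex.differentiable_one_div_Gamma
  have h1 : ∀ᶠ z in 𝓝[≠] s, Complex.Gamma z ≠ 0 := by
    rcases (hd s trivial).eventually_eq_zero_or_eventually_ne_zero with h | h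
    · exfalso
      have := hd.eqOn_zero_of_preconnected_of_eventuallyEq_zero isPreconnected_univ trivial h
        (mem_univ 1)
      simp [Complex.Gamma_one] at this
    · exact h.mono fun z hz h0 => hz (by simp [h0])
  have h2 : ∀ᶠ z in 𝓝[≠] s, z ≠ (0 : ℂ) := by
    rcases eq_or_ne s 0 with rfl | h
    · exact self_mem_nhdsWithin
    · exact nhdsWithin_le_nhds (isOpen_ne.mem_nhds h)
  exact h1.and h2

theorem analyticAt_Gamma {s : ℂ} (hs : 0 < s.re) : AnalyticAt ℂ Complex.Gamma s := by
  refine DifferentiableOn.analyticAt (s := {z : ℂ | 0 < z.re}) (fun z hz => ?_)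
    ((isOpen_lt continuous_const Complex.continuous_re).mem_nhds hs)
  exact (Complex.differentiableAt_Gamma z fun m h => by
    have hz' : 0 < z.re := hz
    rw [h] at hz'
    simp at hz'
    linarith [(Nat.cast_nonneg m : (0 : ℝ) ≤ m)]).differentiableWithinAt

theorem IsMult.continuousOn_stieltjes {n : ℝ → ℕ} (h : IsMult n) :
    ContinuousOn (stieltjes n) (Ici 0) := by
  refine continuousOn_tsum (u := fun a => (n a : ℝ) / a) (fun a => ?_) h.summable
    (fun a x hx => ?_)
  · by_cases hn : n a = 0
    · simp only [hn, Nat.cast_zero, zero_div]; exact continuousOn_const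
    · have ha := h.pos hn
      refine ContinuousOn.div (by fun_prop) (by fun_prop) fun x hx => ?_
      have : (0 : ℝ) ≤ x := hx
      positivity
  · rw [Real.norm_of_nonneg (h.term_nonneg hx a)]
    exact h.term_le hx a

theorem norm_ofReal_cpow_le {lam : ℝ} (hl : 1 < lam) {s : ℂ} {b : ℝ} (hs : s.re ≤ b) :
    ‖(lam : ℂ) ^ s‖ ≤ lam ^ b := by
  rw [Complex.norm_cpow_eq_rpow_re_of_pos (by linarith)]
  exact Real.rpow_le_rpow_of_exponent_le hl.le hs

/-! ### Continuation of the Dirichlet series -/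

namespace IsScaling

variable {n : ℝ → ℕ} {lam d κ : ℝ}

theorem differentiableAt_dirichlet (h : IsScaling n lam d κ) {s : ℂ}
    (hs : Real.logb lam d < s.re) : DifferentiableAt ℂ (dirichlet n) s := by
  obtain ⟨σ, hσ1, hσ2⟩ := exists_between hs
  set U := {z : ℂ | σ < z.re ∧ z.re < s.re + 1}
  have hU : IsOpen U := (isOpen_lt continuous_const Complex.continuous_re).inter
    (isOpen_lt Complex.continuous_re continuous_const)
  refine DifferentiableOn.differentiableAt (s := U) ?_ (hU.mem_nhds ⟨hσ2, by linarith⟩)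
  refine Complex.differentiableOn_tsum_of_summable_norm
    (u := fun a => (n a : ℝ) * a ^ (-σ) + (n a : ℝ) * a ^ (-(s.re + 1)))
    ((h.summable_rpow hσ1).add (h.summable_rpow (by linarith))) (fun a => ?_) hU
    (fun a z hz => ?_)
  · by_cases hn : n a = 0
    · simp only [hn, Nat.cast_zero, zero_mul]; exact differentiableOn_const _
    · have ha := h.isMult.pos hn
      refine DifferentiableOn.const_mul (fun z _ => ?_) _
      have : (a : ℂ) ≠ 0 := by exact_mod_cast ha.ne'
      exact ((differentiableAt_id.neg).const_cpow (Or.inl this)).differentiableWithinAt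
  · rw [h.isMult.norm_term, ← mul_add]
    by_cases hn : n a = 0
    · simp [hn]
    have ha := h.isMult.pos hn
    gcongr
    obtain ⟨hz1, hz2⟩ := hz
    rcases le_total 1 a with h | h
    · have := Real.rpow_le_rpow_of_exponent_le h (by linarith : -z.re ≤ -σ)
      have h0 : 0 ≤ a ^ (-(s.re + 1)) := by positivity
      linarith
    · have := Real.rpow_le_rpow_of_exponent_ge ha h (by linarith : -(s.re + 1) ≤ -z.re)
      have h0 : 0 ≤ a ^ (-σ) := by positivity
      linarith

theorem exists_norm_dirichlet_le (h : IsScaling n lam d κ) {a b : ℝ} (ha : Real.logb lam d < a)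
    (hab : a ≤ b) : ∃ C, ∀ s : ℂ, a ≤ s.re → s.re ≤ b → ‖dirichlet n s‖ ≤ C := by
  refine ⟨∑' x, ((n x : ℝ) * x ^ (-a) + (n x : ℝ) * x ^ (-b)), fun s h1 h2 => ?_⟩
  refine tsum_of_norm_bounded ((h.summable_rpow ha).add
    (h.summable_rpow (by linarith))).hasSum fun x => ?_
  rw [h.isMult.norm_term, ← mul_add]
  by_cases hn : n x = 0
  · simp [hn]
  have hx := h.isMult.pos hn
  gcongr
  rcases le_total 1 x with h | h
  · have := Real.rpow_le_rpow_of_exponent_le h (by linarith : -s.re ≤ -a)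
    have h0 : 0 ≤ x ^ (-b) := by positivity
    linarith
  · have := Real.rpow_le_rpow_of_exponent_ge hx h (by linarith : -b ≤ -s.re)
    have h0 : 0 ≤ x ^ (-a) := by positivity
    linarith

/-- The Mellin transform of the error term in the scaling relation. -/
theorem exists_mellin_error (h : IsScaling n lam d κ) : ∃ M : ℂ → ℂ,
    (∀ s : ℂ, s.re < 1 → DifferentiableAt ℂ M s) ∧
    (∀ a b : ℝ, b < 1 → ∃ C, ∀ s : ℂ, a ≤ s.re → s.re ≤ b → ‖M s‖ ≤ C) ∧
    ∀ s : ℂ, Real.logb lam d < s.re → s.re < 1 →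
      ((lam : ℂ) ^ s - d) * (Complex.Gamma s * Complex.Gamma (1 - s) * dirichlet n s)
        = M s + κ * (d - 1) / s := by
  have hd := h.one_lt
  have hl := h.one_lt_lam
  have hl0 : 0 < lam := by linarith
  set S := stieltjes n with hS
  set c : ℝ := κ * (d - 1) with hc
  -- Only the part of `c / x` on `x > 1` is subtracted: the error term then stays bounded at `0` and
  -- is smaller than all powers at infinity, so its Mellin transform at `1 - s` is holomorphic on
  -- all of `Re s < 1`. The transform of the subtracted part is the explicit `c / s`.
  set T : ℝ → ℂ := (Ioi (1 : ℝ)).indicator fun x => (x : ℂ)⁻¹ with hT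
  set ε : ℝ → ℂ := fun x => (lam : ℂ) * (S (lam * x) : ℂ) - d * (S x : ℂ) - c * T x with hε
  have hSc : ContinuousOn (fun x => (S x : ℂ)) (Ioi 0) :=
    Complex.continuous_ofReal.comp_continuousOn (h.isMult.continuousOn_stieltjes.mono
        Ioi_subset_Ici_self)
  have hSl : ContinuousOn (fun x => (S (lam * x) : ℂ)) (Ioi 0) :=
    hSc.comp (by fun_prop) fun x (hx : 0 < x) => mul_pos hl0 hx
  have hTl : LocallyIntegrableOn T (Ioi 0) := by
    rw [locallyIntegrableOn_iff isOpen_Ioi.isLocallyClosed]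
    intro K hK hKc
    refine IntegrableOn.indicator ?_ measurableSet_Ioi
    refine ContinuousOn.integrableOn_compact hKc (fun x hx => ?_)
    have hx0 : 0 < x := hK hx
    have : (x : ℂ) ≠ 0 := by exact_mod_cast hx0.ne'
    exact ((Complex.continuous_ofReal.continuousAt).inv₀ this).continuousWithinAt
  have hεl : LocallyIntegrableOn ε (Ioi 0) := by
    refine LocallyIntegrableOn.sub (LocallyIntegrableOn.sub ?_ ?_) ?_
    · exact (continuousOn_const.mul hSl).locallyIntegrableOn measurableSet_Ioi
    · exact (continuousOn_const.mul hSc).locallyIntegrableOn measurableSet_Ioi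
    · exact hTl.smul (c : ℂ)
  have hbdd : ∃ B, ∀ x, 0 ≤ x → ‖(S x : ℂ)‖ ≤ B := ⟨∑' a : ℝ, (n a : ℝ) / a, fun x hx => by
    rw [Complex.norm_real, Real.norm_of_nonneg (h.isMult.stieltjes_nonneg hx)]
    exact h.isMult.stieltjes_le hx⟩
  have hε0 : ε =O[𝓝[>] 0] fun x : ℝ => x ^ (-(0 : ℝ)) := by
    obtain ⟨B, hB⟩ := hbdd
    refine IsBigO.of_bound (lam * B + |d| * B) ?_
    filter_upwards [Ioo_mem_nhdsGT zero_lt_one] with x hx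
    have hx1 : x ∉ Ioi (1 : ℝ) := by simpa using hx.2.le
    simp only [hε, hT, indicator_of_notMem hx1, mul_zero, sub_zero, neg_zero, Real.rpow_zero,
      norm_one, mul_one]
    refine (norm_sub_le _ _).trans ?_
    rw [norm_mul, norm_mul]
    have h1 := hB _ (mul_nonneg hl0.le hx.1.le)
    have h2 := hB _ hx.1.le
    have h3 : ‖(lam : ℂ)‖ = lam := by rw [Complex.norm_real, Real.norm_of_nonneg hl0.le]
    have h4 : ‖(d : ℂ)‖ = |d| := by rw [Complex.norm_real, Real.norm_eq_abs]
    rw [h3, h4]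
    gcongr
  have hεt : ∀ a : ℝ, ε =O[atTop] fun x : ℝ => x ^ (-a) := by
    intro a
    obtain ⟨N, hN⟩ := exists_nat_ge a
    have h1 := h.asymp N
    have h2 : ε =ᶠ[atTop] fun x : ℝ => ((lam * S (lam * x) - d * S x - κ * (d - 1) / x : ℝ) :
        ℂ) := by
      filter_upwards [eventually_gt_atTop 1] with x hx
      have hx1 : x ∈ Ioi (1 : ℝ) := hx
      simp only [hε, hT, indicator_of_mem hx1, hc]
      push_cast
      ring
    refine (IsBigO.trans ?_ (h1.trans ?_))
    · refine h2.trans_isBigO ?_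
      exact IsBigO.of_bound 1 (Eventually.of_forall fun x => by rw [Complex.norm_real, one_mul])
    · refine IsBigO.of_bound 1 ?_
      filter_upwards [eventually_ge_atTop 1] with x hx
      have hx0 : 0 < x := by linarith
      rw [one_mul, Real.norm_of_nonneg (by positivity), Real.norm_of_nonneg (by positivity),
        ← Real.rpow_natCast, ← Real.rpow_neg hx0.le]
      exact Real.rpow_le_rpow_of_exponent_le hx (by linarith)
  have hMc : ∀ z : ℂ, 0 < z.re → MellinConvergent ε z := fun z hz =>
    mellinConvergent_of_isBigO_rpow hεl (hεt (z.re + 1)) (by linarith) hε0 hz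
  refine ⟨fun s => mellin ε (1 - s), fun s hs => ?_, fun a b hb => ?_, fun s hs1 hs2 => ?_⟩
  · have hz : 0 < (1 - s).re := by simp; linarith
    have h1 := mellin_differentiableAt_of_isBigO_rpow hεl (hεt ((1 - s).re + 1)) (by linarith)
      hε0 hz
    exact h1.comp s ((differentiableAt_const 1).sub differentiableAt_id)
  · rcases le_or_gt a b with hab | hab
    · obtain ⟨C, hC⟩ := exists_norm_mellin_le (hMc ((1 - b : ℝ) : ℂ) (by simpa using hb))
        (hMc ((1 - a : ℝ) : ℂ) (by simp; linarith))
      exact ⟨C, fun s h1 h2 => hC _ (by simp; linarith) (by simp; linarith)⟩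
    · exact ⟨0, fun s h1 h2 => by linarith⟩
  · have hs0 : 0 < s.re := h.rho_pos.trans hs1
    have hsne : s ≠ 0 := by rintro rfl; simp at hs0
    have hlc : (lam : ℂ) ≠ 0 := by exact_mod_cast hl0.ne'
    have hzre : (1 - s).re = 1 - s.re := by simp
    have hSm : MellinConvergent (fun x => (S x : ℂ)) (1 - s) := by
      obtain ⟨C, hC⟩ := h.exists_stieltjes_le
      obtain ⟨B, hB⟩ := hbdd
      refine mellinConvergent_of_isBigO_rpow (a := 1 - Real.logb lam d) (b := 0)
        (hSc.locallyIntegrableOn measurableSet_Ioi) ?_ (by rw [hzre]; linarith) ?_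
        (by rw [hzre]; linarith)
      · refine IsBigO.of_bound C ?_
        filter_upwards [eventually_ge_atTop 1] with x hx
        have hx0 : 0 < x := by linarith
        rw [Complex.norm_real, Real.norm_of_nonneg (h.isMult.stieltjes_nonneg hx0.le),
          Real.norm_of_nonneg (by positivity), neg_sub]
        exact hC x hx
      · refine IsBigO.of_bound B ?_
        filter_upwards [self_mem_nhdsWithin] with x hx
        simp only [neg_zero, Real.rpow_zero, norm_one, mul_one]
        exact hB x (le_of_lt hx)
    have hS1 := h.isMult.mellin_stieltjes hs0 hs2 (h.summable_rpow hs1)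
    have hSm2 : HasMellin (fun x => (S (lam * x) : ℂ)) (1 - s)
        ((lam : ℂ) ^ (-(1 - s)) * mellin (fun x => (S x : ℂ)) (1 - s)) :=
      ⟨(MellinConvergent.comp_mul_left (f := fun x => (S x : ℂ)) hl0).2 hSm, by
        rw [mellin_comp_mul_left (fun x => (S x : ℂ)) _ hl0, smul_eq_mul]⟩
    have hTm : HasMellin T (1 - s) (1 / s) := by
      have e1 : ∀ x : ℝ, (x : ℂ) ^ (1 - s - 1) • T x
          = (Ioi (1 : ℝ)).indicator (fun x : ℝ => (x : ℂ) ^ (-s - 1)) x := by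
        intro x
        by_cases hx : x ∈ Ioi (1 : ℝ)
        · have hx0 : (x : ℂ) ≠ 0 := by
            have : (0 : ℝ) < x := zero_lt_one.trans hx
            exact_mod_cast this.ne'
          simp only [hT, indicator_of_mem hx, smul_eq_mul]
          rw [show 1 - s - 1 = -s by ring, Complex.cpow_sub _ _ hx0, Complex.cpow_one,
            div_eq_mul_inv]
        · simp [hT, indicator_of_notMem hx]
      have hre : (-s - 1).re < -1 := by simp; linarith
      constructor
      · rw [MellinConvergent]
        simp_rw [e1]
        exact (integrableOn_Ioi_cpow_of_lt hre zero_lt_one).integrable_indicator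
          measurableSet_Ioi |>.integrableOn
      · rw [mellin]
        simp_rw [e1]
        rw [setIntegral_indicator measurableSet_Ioi, inter_eq_right.2 (Ioi_subset_Ioi zero_le_one),
          integral_Ioi_cpow_of_lt hre zero_lt_one]
        simp
    have hA := hasMellin_const_smul hSm2.1 (lam : ℂ)
    have hB := hasMellin_const_smul hSm (d : ℂ)
    have hC := hasMellin_const_smul hTm.1 (c : ℂ)
    have hAB := hasMellin_sub hA.1 hB.1
    have hABC := hasMellin_sub hAB.1 hC.1
    have hfin : mellin ε (1 - s) = lam * ((lam : ℂ) ^ (-(1 - s)) *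
        mellin (fun x => (S x : ℂ)) (1 - s)) - d * mellin (fun x => (S x : ℂ)) (1 - s)
        - c * (1 / s) := by
      have e2 := hABC.2
      rw [hAB.2, hA.2, hB.2, hC.2, hSm2.2, hTm.2] at e2
      simpa only [smul_eq_mul] using e2
    simp only
    rw [hfin, hS1]
    have e3 : (lam : ℂ) * (lam : ℂ) ^ (-(1 - s)) = (lam : ℂ) ^ s := by
      rw [neg_sub, Complex.cpow_sub _ _ hlc, Complex.cpow_one]
      field_simp
    rw [← mul_assoc (lam : ℂ), e3, hc]
    push_cast
    ring

end IsScaling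

/-- Serves the value `w = 0`, where `1 / s` is absorbed as `1 / (s Γ(s)) = 1 / Γ(1 + s)`. For `|s| >
1` this is the reflection formula, near `0` it is compactness. -/
theorem exists_norm_inv_Gamma_one_add_le :
    ∃ C, ∀ s : ℂ, ‖(Complex.Gamma (1 + s))⁻¹ * (Complex.Gamma (1 - s))⁻¹‖
      ≤ C * Real.exp (Real.pi * |s.im|) := by
  have hcont : Continuous fun s : ℂ => (Complex.Gamma (1 + s))⁻¹ * (Complex.Gamma (1 - s))⁻¹ := by
    have h := Complex.differentiable_one_div_Gamma.continuous
    exact (h.comp (continuous_const.add continuous_id)).mul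
      (h.comp (continuous_const.sub continuous_id))
  obtain ⟨C, hC⟩ := (isCompact_closedBall (0 : ℂ) 1).exists_bound_of_continuousOn hcont.continuousOn
  have hC0 : 0 ≤ C := (norm_nonneg _).trans (hC 0 (by simp))
  refine ⟨C + 1, fun s => ?_⟩
  have hE : 1 ≤ Real.exp (Real.pi * |s.im|) := Real.one_le_exp (by positivity)
  rcases le_or_gt ‖s‖ 1 with h | h
  · have := hC s (by simpa using h)
    nlinarith
  · have hs0 : s ≠ 0 := by rintro rfl; simp at h; linarith
    have h1 := norm_inv_Gamma_mul_Gamma_le s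
    rw [add_comm 1 s, Complex.Gamma_add_one s hs0, mul_inv, mul_assoc, norm_mul, norm_inv]
    have h2 : ‖s‖⁻¹ ≤ 1 := inv_le_one_of_one_le₀ h.le
    calc _ ≤ 1 * Real.exp (Real.pi * |s.im|) := by gcongr
      _ ≤ _ := by gcongr; linarith

namespace IsScaling

variable {n : ℝ → ℕ} {lam d κ : ℝ}

/-- Continuation of the Dirichlet series of a scaling multiplicity function. -/
theorem exists_continuation (h : IsScaling n lam d κ) : ∃ Y : ℂ → ℂ, Differentiable ℂ Y ∧
    (∀ s : ℂ, Real.logb lam d < s.re → Y s = ((lam : ℂ) ^ s - d) * dirichlet n s) ∧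
    (∀ s : ℂ, κ = 0 ∨ s ≠ 0 → 0 ≤ meromorphicOrderAt (fun z => Y z * Complex.Gamma z) s) ∧
    ∀ a b δ : ℝ, 0 < δ → ∃ C, ∀ s : ℂ, a ≤ s.re → s.re ≤ b →
      ‖Y s‖ ≤ C * Real.exp (δ * |s.im|) := by
  have hd := h.one_lt
  have hl := h.one_lt_lam
  have hl0 : 0 < lam := by linarith
  have hlc : (lam : ℂ) ≠ 0 := by exact_mod_cast hl0.ne'
  have hρ0 := h.rho_pos
  have hρ1 := h.rho_lt_one
  set ρ := Real.logb lam d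
  obtain ⟨M, hMd, hMb, hM⟩ := h.exists_mellin_error
  set G : ℂ → ℂ := fun s => (Complex.Gamma s)⁻¹ with hG
  have hGd : Differentiable ℂ G := Complex.differentiable_one_div_Gamma
  -- Dividing the Mellin identity by `Γ(s) Γ(1 - s)` gives `Y1`, holomorphic for `Re s < 1`; the
  -- factor `1 / Γ(1 + s)` hides the division by `s`. The Dirichlet series gives `Y2` for `Re s >
  -- ρ`, and the two domains overlap because `ρ < 1`.
  set Y1 : ℂ → ℂ := fun s => M s * (G s * G (1 - s)) + κ * (d - 1) * (G (1 + s) * G (1 - s))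
    with hY1
  set Y2 : ℂ → ℂ := fun s => ((lam : ℂ) ^ s - d) * dirichlet n s with hY2
  set Y : ℂ → ℂ := fun s => if s.re < 1 then Y1 s else Y2 s with hY
  have hY1e : ∀ s : ℂ, s.re < 1 → Y s = Y1 s := fun s hs => if_pos hs
  have hY2e : ∀ s : ℂ, ρ < s.re → Y s = Y2 s := by
    intro s hs
    by_cases hs1 : s.re < 1
    · rw [hY1e s hs1]
      have hs0 : 0 < s.re := hρ0.trans hs
      have hsne : s ≠ 0 := by rintro rfl; simp at hs0
      have g1 : Complex.Gamma s ≠ 0 := Complex.Gamma_ne_zero_of_re_pos hs0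
      have g2 : Complex.Gamma (1 - s) ≠ 0 := Complex.Gamma_ne_zero_of_re_pos (by simp; linarith)
      have e := hM s hs hs1
      have e2 : Y2 s = (M s + κ * (d - 1) / s) * (G s * G (1 - s)) := by
        rw [← e, hY2, hG]
        field_simp
      rw [e2, hY1]
      simp only [hG]
      rw [add_comm 1 s, Complex.Gamma_add_one s hsne]
      field_simp
    · exact if_neg hs1
  have hY1d : ∀ s : ℂ, s.re < 1 → DifferentiableAt ℂ Y1 s := by
    intro s hs
    have := hMd s hs
    have g1 : DifferentiableAt ℂ (fun s => G (1 - s)) s :=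
      (hGd (1 - s)).comp s ((differentiableAt_const 1).sub differentiableAt_id)
    have g2 : DifferentiableAt ℂ (fun s => G (1 + s)) s :=
      (hGd (1 + s)).comp s ((differentiableAt_const 1).add differentiableAt_id)
    exact (this.mul ((hGd s).mul g1)).add ((g2.mul g1).const_mul _)
  have hYd : Differentiable ℂ Y := by
    intro s
    by_cases hs : s.re < 1
    · refine (hY1d s hs).congr_of_eventuallyEq ?_
      filter_upwards [(isOpen_lt Complex.continuous_re continuous_const).mem_nhds hs] with z hz
        using hY1e z hz
    · have hs' : ρ < s.re := by linarith
      have hd2 : DifferentiableAt ℂ Y2 s :=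
        ((differentiableAt_id.const_cpow (Or.inl hlc)).sub (differentiableAt_const _)).mul
          (h.differentiableAt_dirichlet hs')
      refine hd2.congr_of_eventuallyEq ?_
      filter_upwards [(isOpen_lt continuous_const Complex.continuous_re).mem_nhds hs'] with z hz
        using hY2e z hz
  refine ⟨Y, hYd, hY2e, fun s hs => ?_, fun a b δ hδ => ?_⟩
  · by_cases hs1 : 0 < s.re
    · exact ((hYd.analyticAt s).mul (analyticAt_Gamma hs1)).meromorphicOrderAt_nonneg
    have hs1' : s.re < 1 := by linarith
    have hopen : IsOpen {z : ℂ | z.re < 1} := isOpen_lt Complex.continuous_re continuous_const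
    -- After multiplication by `Γ` the factor `1 / Γ(s)` of `Y1` disappears, so the poles of `Γ` are
    -- cancelled; only `κ (d - 1) / s` can still produce one, at `0`.
    set A : ℂ → ℂ := fun z => M z * G (1 - z) + κ * (d - 1) * z⁻¹ * G (1 - z) with hA
    have hGan : AnalyticAt ℂ (fun z => G (1 - z)) s := by
      have : Differentiable ℂ fun z => G (1 - z) :=
        hGd.comp ((differentiable_const 1).sub differentiable_id)
      exact this.analyticAt s
    have hMan : AnalyticAt ℂ M s := DifferentiableOn.analyticAt
      (s := {z : ℂ | z.re < 1}) (fun z hz => (hMd z hz).differentiableWithinAt)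
          (hopen.mem_nhds hs1')
    have hAan : AnalyticAt ℂ A s := by
      rcases hs with hs | hs
      · have : A = fun z => M z * G (1 - z) := by
          ext z; simp [hA, hs]
        rw [this]
        exact hMan.mul hGan
      · exact (hMan.mul hGan).add ((analyticAt_const.mul (analyticAt_id.inv hs)).mul hGan)
    have hEq : (fun z => Y z * Complex.Gamma z) =ᶠ[𝓝[≠] s] A := by
      filter_upwards [eventually_Gamma_ne_zero s, nhdsWithin_le_nhds (hopen.mem_nhds hs1')]
        with z hz hz1
      obtain ⟨g1, hz0⟩ := hz
      rw [hY1e z hz1]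
      simp only [hY1, hA, hG]
      rw [add_comm 1 z, Complex.Gamma_add_one z hz0]
      field_simp
    rw [meromorphicOrderAt_congr hEq]
    exact hAan.meromorphicOrderAt_nonneg
  · obtain ⟨b', hb1, hb2⟩ := exists_between hρ1
    set B := max b 1 with hB
    have hB1 : 1 ≤ B := le_max_right _ _
    have hbound2 : ∃ C, ∀ s : ℂ, b' ≤ s.re → s.re ≤ B → ‖Y s‖ ≤ C := by
      obtain ⟨C, hC⟩ := h.exists_norm_dirichlet_le hb1 (by linarith : b' ≤ B)
      refine ⟨(lam ^ B + |d|) * C, fun s h1 h2 => ?_⟩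
      rw [hY2e s (by linarith), hY2]
      simp only [norm_mul]
      have hd2 : ‖(d : ℂ)‖ = |d| := by rw [Complex.norm_real, Real.norm_eq_abs]
      gcongr
      · refine (norm_sub_le _ _).trans ?_
        rw [hd2]
        gcongr
        exact norm_ofReal_cpow_le hl h2
      · exact hC s h1 h2
    obtain ⟨C2, hC2⟩ := hbound2
    have hC20 : 0 ≤ C2 := (norm_nonneg _).trans (hC2 ((1 : ℝ) : ℂ) (by simpa using hb2.le)
      (by simpa using hB1))
    obtain ⟨C3, hC3⟩ := exists_norm_inv_Gamma_one_add_le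
    have hC30 : 0 ≤ C3 := by
      have := (norm_nonneg _).trans (hC3 0)
      simpa using this
    -- By reflection `1 / (Γ(s) Γ(1 - s))` grows at most like `exp (π |Im s|)`, and `Y` is bounded
    -- on vertical lines of convergence; Phragmén–Lindelöf lowers `π` to any `δ > 0`.
    obtain ⟨C, hC⟩ := exists_norm_le_strip hYd (b := B) Real.pi_pos
      ⟨C2, fun s hs => hC2 s (by linarith) hs.le⟩ (fun a => by
        obtain ⟨C1, hC1⟩ := hMb a b' hb2
        set D := ‖(κ * (d - 1) : ℂ)‖
        refine ⟨|C1| + D * C3 + C2, fun s h1 h2 => ?_⟩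
        have hE : 1 ≤ Real.exp (Real.pi * |s.im|) :=
          Real.one_le_exp (mul_nonneg Real.pi_pos.le (abs_nonneg _))
        have hD0 : 0 ≤ D * C3 := mul_nonneg (norm_nonneg _) hC30
        rcases le_total s.re b' with hsb | hsb
        · rw [hY1e s (by linarith), hY1]
          have i1 := norm_inv_Gamma_mul_Gamma_le s
          have i2 := hC3 s
          have i3 := (hC1 s h1 hsb).trans (le_abs_self C1)
          calc _ ≤ ‖M s * (G s * G (1 - s))‖ + ‖κ * (d - 1) * (G (1 + s) * G (1 - s))‖ :=
                norm_add_le _ _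
            _ ≤ |C1| * Real.exp (Real.pi * |s.im|) + D * (C3 * Real.exp (Real.pi * |s.im|)) := by
                rw [norm_mul (M s), norm_mul (κ * (d - 1) : ℂ)]
                gcongr
            _ ≤ _ := by nlinarith
        · have := hC2 s hsb h2
          have h0 : 0 ≤ |C1| := abs_nonneg _
          nlinarith) a δ hδ
    exact ⟨C, fun s h1 h2 => hC s h1 (h2.trans (le_max_left _ _))⟩

/-- The Dirichlet series diverges at the abscissa of convergence. -/
theorem eventually_le_sum (h : IsScaling n lam d κ) (K : ℝ) :
    ∀ᶠ σ in 𝓝[>] (Real.logb lam d), K ≤ ∑' a : ℝ, (n a : ℝ) * a ^ (-σ) := by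
  have hnn : ∀ σ : ℝ, ∀ a : ℝ, 0 ≤ (n a : ℝ) * a ^ (-σ) := fun σ a => by
    by_cases hn : n a = 0
    · simp [hn]
    · have := h.isMult.pos hn
      positivity
  set ρ := Real.logb lam d with hρ
  -- A finite partial sum at the abscissa already exceeds `K`, and a finite sum is continuous in
  -- `σ`.
  have h1 : ∃ F : Finset ℝ, K < ∑ a ∈ F, (n a : ℝ) * a ^ (-ρ) := by
    by_contra! hcon
    exact h.not_summable_rpow (summable_of_sum_le (hnn _) hcon)
  obtain ⟨F, hF⟩ := h1
  have hcont : ContinuousAt (fun σ : ℝ => ∑ a ∈ F, (n a : ℝ) * a ^ (-σ)) ρ := by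
    refine tendsto_finsetSum _ fun a _ => ?_
    by_cases hn : n a = 0
    · simp [hn]
    · have ha := h.isMult.pos hn
      refine Tendsto.const_mul _ ?_
      exact ((Real.continuous_const_rpow ha.ne').comp continuous_neg).continuousAt
  filter_upwards [nhdsWithin_le_nhds (hcont.eventually (lt_mem_nhds hF)), self_mem_nhdsWithin]
    with σ hσ hσ2
  exact hσ.le.trans ((h.summable_rpow hσ2).sum_le_tsum _ fun a _ => hnn σ a)

end IsScaling

theorem IsPoincare.isScaling {Φ : ℂ → ℂ} {p : Polynomial ℝ} {lam : ℝ} (h : IsPoincare Φ p lam)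
    {w : ℂ} (hw : IsPoincare.IsSpectralValue Φ w) :
    IsScaling (zeroMult Φ w) lam p.natDegree (if w = 0 then 1 else 0) where
  isMult := hw.isMult
  exists_ne := hw.exists_ne
  one_lt := by exact_mod_cast h.two_le
  lt := (h.stieltjes_functional hw).1
  kappa_nonneg := by split_ifs <;> norm_num
  asymp := (h.stieltjes_functional hw).2

/-! ### Sequences with rational generating function -/

/-- A quotient of polynomials has a power series that converges absolutely inside the smallest root
of the denominator. One linear factor is removed at a time: if `(X - r) B = C`, then `r b_{m+1} =
b_m - c_{m+1}`, a recursion which contracts by `x / |r| < 1` in the norm weighted by `x ^ m`. -/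
theorem summable_coeff_of_mul_eq_polynomial {x : ℝ} (hx : 0 ≤ x) (N : ℕ) :
    ∀ (P Q : Polynomial ℂ) (B : PowerSeries ℂ), P.natDegree = N → P ≠ 0 →
      (∀ r, P.eval r = 0 → x < ‖r‖) → (P : PowerSeries ℂ) * B = (Q : PowerSeries ℂ) →
      Summable fun m => ‖PowerSeries.coeff m B‖ * x ^ m := by
  induction N with
  | zero =>
    intro P Q B hP hP0 _ h
    obtain ⟨c, rfl⟩ := Polynomial.natDegree_eq_zero.1 hP
    have hc : c ≠ 0 := by rintro rfl; simp at hP0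
    refine summable_of_ne_finset_zero (s := Q.support) fun m hm => ?_
    have h1 := congrArg (PowerSeries.coeff m) h
    rw [Polynomial.coe_C, PowerSeries.coeff_C_mul, Polynomial.coeff_coe,
      Polynomial.notMem_support_iff.1 hm] at h1
    rcases mul_eq_zero.1 h1 with h2 | h2
    · exact absurd h2 hc
    · simp [h2]
  | succ N ih =>
    intro P Q B hP hP0 hr h
    obtain ⟨r, hroot⟩ := IsAlgClosed.exists_root P (by
      intro hd
      have := Polynomial.natDegree_eq_of_degree_eq_some (n := 0) hd
      omega)
    obtain ⟨P', rfl⟩ := Polynomial.dvd_iff_isRoot.2 hroot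
    have hP'0 : P' ≠ 0 := right_ne_zero_of_mul hP0
    have hxr : x < ‖r‖ := hr r hroot
    have hr0 : 0 < ‖r‖ := hx.trans_lt hxr
    set C : PowerSeries ℂ := ((Polynomial.X - Polynomial.C r : Polynomial ℂ) : PowerSeries ℂ) * B
      with hC
    have hsum := ih P' Q C (by
        rw [Polynomial.natDegree_mul (Polynomial.X_sub_C_ne_zero r) hP'0,
          Polynomial.natDegree_X_sub_C] at hP
        omega) hP'0 (fun z hz => hr z (by simp [hz])) (by
        rw [hC, ← h, Polynomial.coe_mul]; ring)
    set u : ℕ → ℝ := fun m => ‖PowerSeries.coeff m B‖ * x ^ m with hu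
    have hu0 : ∀ m, 0 ≤ u m := fun m => by positivity
    have hC' : C = PowerSeries.X * B - PowerSeries.C r * B := by
      rw [hC, Polynomial.coe_sub, Polynomial.coe_X, Polynomial.coe_C, sub_mul]
    have hCs : ∀ m, PowerSeries.coeff (m + 1) C
        = PowerSeries.coeff m B - r * PowerSeries.coeff (m + 1) B := fun m => by
      rw [hC', map_sub, PowerSeries.coeff_succ_X_mul, PowerSeries.coeff_C_mul]
    set θ := x / ‖r‖ with hθ
    have hθ1 : θ < 1 := (div_lt_one hr0).2 hxr
    have hθ0 : 0 ≤ θ := by positivity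
    set v : ℕ → ℝ := fun m => ‖PowerSeries.coeff m C‖ * x ^ m with hv
    have hstep : ∀ m, u (m + 1) ≤ v (m + 1) / ‖r‖ + θ * u m := by
      intro m
      have h1 : ‖r‖ * ‖PowerSeries.coeff (m + 1) B‖
          ≤ ‖PowerSeries.coeff (m + 1) C‖ + ‖PowerSeries.coeff m B‖ := by
        rw [← norm_mul]
        have : r * PowerSeries.coeff (m + 1) B
            = PowerSeries.coeff m B - PowerSeries.coeff (m + 1) C := by rw [hCs]; ring
        rw [this]
        exact (norm_sub_le _ _).trans (by linarith)
      simp only [hu, hv, hθ]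
      calc ‖PowerSeries.coeff (m + 1) B‖ * x ^ (m + 1)
          = (‖r‖ * ‖PowerSeries.coeff (m + 1) B‖) * x ^ (m + 1) / ‖r‖ := by field_simp
        _ ≤ (‖PowerSeries.coeff (m + 1) C‖ + ‖PowerSeries.coeff m B‖) * x ^ (m + 1) / ‖r‖ := by
            gcongr
        _ = _ := by rw [pow_succ]; field_simp
    set T := u 0 + (∑' m, v m) / ‖r‖ with hT
    have hv0 : ∀ m, 0 ≤ v m := fun m => by positivity
    have hpart : ∀ M, ∑ m ∈ Finset.range (M + 1), u m
        ≤ u 0 + (∑ m ∈ Finset.range (M + 1), v m) / ‖r‖ + θ * ∑ m ∈ Finset.range M, u m := by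
      intro M
      induction M with
      | zero => simp; exact div_nonneg (hv0 0) hr0.le
      | succ M ihM =>
        rw [Finset.sum_range_succ u (M + 1), Finset.sum_range_succ v (M + 1),
          Finset.sum_range_succ u M]
        have := hstep M
        rw [Finset.sum_range_succ u M] at ihM
        rw [add_div, mul_add]
        linarith
    have hv2 : Summable v := hsum
    refine summable_of_sum_range_le (c := T / (1 - θ)) hu0 fun M => ?_
    rw [le_div_iff₀ (by linarith)]
    have h1 := hpart M
    have h2 : ∑ m ∈ Finset.range M, u m ≤ ∑ m ∈ Finset.range (M + 1), u m := by
      rw [Finset.sum_range_succ]; linarith [hu0 M]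
    have h3 : (∑ m ∈ Finset.range (M + 1), v m) / ‖r‖ ≤ (∑' m, v m) / ‖r‖ := by
      gcongr
      exact hv2.sum_le_tsum _ fun m _ => hv0 m
    nlinarith

/-- A sequence of natural numbers whose generating function is the rational function `P / Q`. -/
structure IsRationalSeq (b : ℕ → ℕ) (Q P : Polynomial ℂ) : Prop where
  coprime : IsCoprime P Q
  eq : (Q : PowerSeries ℂ) * PowerSeries.mk (fun m => (b m : ℂ)) = (P : PowerSeries ℂ)

namespace IsRationalSeq

variable {b : ℕ → ℕ} {P Q : Polynomial ℂ}

theorem num_ne_zero (h : IsRationalSeq b Q P) {z : ℂ} (hz : Q.eval z = 0) : P.eval z ≠ 0 := by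
  obtain ⟨u, v, huv⟩ := h.coprime
  intro h0
  have := congrArg (Polynomial.eval z) huv
  simp [hz, h0] at this

theorem eval_zero_ne (h : IsRationalSeq b Q P) : Q.eval 0 ≠ 0 := by
  intro h0
  refine h.num_ne_zero h0 ?_
  have h1 := congrArg PowerSeries.constantCoeff h.eq
  rw [map_mul, Polynomial.constantCoeff_coe, Polynomial.constantCoeff_coe,
    Polynomial.coeff_zero_eq_eval_zero, Polynomial.coeff_zero_eq_eval_zero, h0, zero_mul] at h1
  exact h1.symm

theorem ne_zero (h : IsRationalSeq b Q P) : Q ≠ 0 := by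
  rintro rfl
  exact h.eval_zero_ne (by simp)

theorem summable (h : IsRationalSeq b Q P) {x : ℝ} (hx : 0 ≤ x)
    (hr : ∀ r, Q.eval r = 0 → x < ‖r‖) : Summable fun m => (b m : ℝ) * x ^ m := by
  have := summable_coeff_of_mul_eq_polynomial hx _ Q P _ rfl h.ne_zero hr h.eq
  simpa using this

theorem eval_mul_tsum (h : IsRationalSeq b Q P) {z : ℂ}
    (hr : ∀ r, Q.eval r = 0 → ‖z‖ < ‖r‖) :
    Q.eval z * ∑' m, (b m : ℂ) * z ^ m = P.eval z := by
  have hev : ∀ R : Polynomial ℂ, HasSum (fun m => R.coeff m * z ^ m) (R.eval z) := by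
    intro R
    rw [Polynomial.eval_eq_sum]
    exact hasSum_sum_of_ne_finset_zero (f := fun m => R.coeff m * z ^ m) fun m hm => by
      rw [Polynomial.notMem_support_iff.1 hm, zero_mul]
  have hQs : Summable fun m => ‖Q.coeff m * z ^ m‖ := by
    refine summable_of_ne_finset_zero (s := Q.support) fun m hm => ?_
    rw [Polynomial.notMem_support_iff.1 hm, zero_mul, norm_zero]
  have hbs : Summable fun m => ‖(b m : ℂ) * z ^ m‖ := by
    simpa using h.summable (norm_nonneg z) hr
  rw [← (hev Q).tsum_eq, ← (hev P).tsum_eq,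
    tsum_mul_tsum_eq_tsum_sum_antidiagonal_of_summable_norm hQs hbs]
  refine tsum_congr fun m => ?_
  have h1 := congrArg (PowerSeries.coeff m) h.eq
  rw [PowerSeries.coeff_mul, Polynomial.coeff_coe] at h1
  rw [← h1, Finset.sum_mul]
  refine Finset.sum_congr rfl fun (kl : ℕ × ℕ) hkl => ?_
  rw [← Finset.HasAntidiagonal.mem_antidiagonal.1 hkl, pow_add, Polynomial.coeff_coe,
      PowerSeries.coeff_mk]
  ring

/-- Pringsheim's argument. Along the segment towards a denominator root `z` of least modulus the
quotient is unbounded, since coprimality keeps the numerator away from zero; as the coefficients are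
nonnegative, the sum at the point `x` of the same modulus dominates it. -/
theorem eventually_le_tsum (h : IsRationalSeq b Q P) {z : ℂ} (hz : Q.eval z = 0)
    (hmin : ∀ r, Q.eval r = 0 → ‖z‖ ≤ ‖r‖) (K : ℝ) :
    ∀ᶠ x in 𝓝[<] ‖z‖, K ≤ ∑' m, (b m : ℝ) * x ^ m := by
  have hz0 : z ≠ 0 := by rintro rfl; exact h.eval_zero_ne hz
  have hzn : 0 < ‖z‖ := norm_pos_iff.2 hz0
  set y : ℝ → ℂ := fun x => (x / ‖z‖ : ℝ) * z with hy
  have hyz : y ‖z‖ = z := by simp [hy, hzn.ne']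
  have hyc : Continuous y := by rw [hy]; fun_prop
  have h1 : ContinuousAt (fun x => ‖Q.eval (y x)‖ * K) ‖z‖ :=
    ((Q.continuous.comp hyc).norm.mul continuous_const).continuousAt
  have h2 : ContinuousAt (fun x => ‖P.eval (y x)‖) ‖z‖ :=
    (P.continuous.comp hyc).norm.continuousAt
  have h3 : ∀ᶠ x in 𝓝 ‖z‖, ‖Q.eval (y x)‖ * K < ‖P.eval (y x)‖ := by
    refine h1.eventually_lt h2 ?_
    rw [hyz, hz, norm_zero, zero_mul]
    exact norm_pos_iff.2 (h.num_ne_zero hz)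
  filter_upwards [nhdsWithin_le_nhds h3, Ioo_mem_nhdsLT hzn] with x hx hx2
  by_contra! hcon
  have hyx : ‖y x‖ = x := by
    simp only [hy, norm_mul, Complex.norm_real]
    rw [Real.norm_of_nonneg (div_nonneg hx2.1.le hzn.le)]
    field_simp
  have hr : ∀ r, Q.eval r = 0 → ‖y x‖ < ‖r‖ := fun r hr => by
    rw [hyx]; exact hx2.2.trans_le (hmin r hr)
  have e := h.eval_mul_tsum hr
  have hle : ‖∑' m, (b m : ℂ) * y x ^ m‖ ≤ ∑' m, (b m : ℝ) * x ^ m := by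
    refine tsum_of_norm_bounded (h.summable hx2.1.le fun r h' => by
      rw [← hyx]; exact hr r h').hasSum fun m => ?_
    rw [norm_mul, norm_pow, hyx, Complex.norm_natCast]
  have : ‖P.eval (y x)‖ ≤ ‖Q.eval (y x)‖ * K := by
    rw [← e, norm_mul]
    gcongr
    exact hle.trans hcon.le
  linarith

end IsRationalSeq

/-! ### Superpositions of dilated spectra -/

/-- The multiplicity function `x ↦ ∑ b(m) n(x / lam ^ m)`. -/
noncomputable def dilate (lam : ℝ) (b : ℕ → ℕ) (n : ℝ → ℕ) (x : ℝ) : ℕ :=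
  ∑ᶠ m, b m * n (x / lam ^ m)

/-- The points `x / lam ^ m` that count are distinct atoms of `n` in `(0, x]`, of which there are
finitely many. -/
theorem IsMult.finite_support_dilate {n : ℝ → ℕ} (h : IsMult n) {lam : ℝ} (hl : 1 < lam)
    (b : ℕ → ℕ) (x : ℝ) : (Function.support fun m => b m * n (x / lam ^ m)).Finite := by
  have hl0 : 0 < lam := by linarith
  have hinj : Set.InjOn (fun m : ℕ => x / lam ^ m)
      (Function.support fun m => b m * n (x / lam ^ m)) := by
    intro m hm k _ hmk
    have h1 := h.pos (right_ne_zero_of_mul hm)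
    have hx : x ≠ 0 := by rintro rfl; simp at h1
    simp only at hmk
    have h2 : lam ^ m = lam ^ k := by
      have hm0 : lam ^ m ≠ 0 := by positivity
      have hk0 : lam ^ k ≠ 0 := by positivity
      field_simp at hmk
      exact hmk.symm
    exact pow_right_injective₀ hl0 hl.ne' h2
  refine Set.Finite.of_finite_image
    ((finite_le_of_summable h.summable h.nonpos x).subset ?_) hinj
  rintro _ ⟨m, hm, rfl⟩
  have h0 := right_ne_zero_of_mul (a := b m) hm
  have h1 := h.pos h0
  have hx : 0 < x := by
    rwa [div_pos_iff_of_pos_right (by positivity)] at h1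
  exact ⟨h0, div_le_self hx.le (one_le_pow₀ hl.le)⟩

theorem IsMult.dilate_of_nonpos {n : ℝ → ℕ} (h : IsMult n) {lam : ℝ} (hl : 1 < lam)
    (b : ℕ → ℕ) {x : ℝ} (hx : x ≤ 0) : dilate lam b n x = 0 := by
  rw [dilate]
  refine finsum_eq_zero_of_forall_eq_zero fun m => ?_
  rw [h.nonpos _ (div_nonpos_of_nonpos_of_nonneg hx (by positivity)), mul_zero]

theorem ofReal_pow_cpow {lam : ℝ} (hl : 0 ≤ lam) (m : ℕ) (s : ℂ) :
    ((lam ^ m : ℝ) : ℂ) ^ s = ((lam : ℂ) ^ s) ^ m := by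
  induction m with
  | zero => simp
  | succ m ih =>
    rw [pow_succ, Complex.ofReal_mul, Complex.mul_cpow_ofReal_nonneg (by positivity) hl, ih,
        pow_succ]

/-- An atom `a` moved to `lam ^ m a` contributes `(lam ^ (-s)) ^ m a ^ (-s)`, so the double series
over `m` and `a` is a product. Absolute convergence allows regrouping by the value of `lam ^ m a`.
-/
theorem IsMult.hasSum_dilate {n : ℝ → ℕ} (h : IsMult n) {lam : ℝ} (hl : 1 < lam)
    {b : ℕ → ℕ} {s : ℂ} (hn : Summable fun a : ℝ => (n a : ℝ) * a ^ (-s.re))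
    (hb : Summable fun m => (b m : ℝ) * (lam ^ (-s.re)) ^ m) :
    HasSum (fun x : ℝ => (dilate lam b n x : ℂ) * (x : ℂ) ^ (-s))
      ((∑' m, (b m : ℂ) * ((lam : ℂ) ^ (-s)) ^ m) * dirichlet n s) := by
  have hl0 : 0 < lam := by linarith
  have hlc : (lam : ℂ) ≠ 0 := by exact_mod_cast hl0.ne'
  set g : ℕ × ℝ → ℂ := fun q => (b q.1 : ℂ) * ((n (q.2 / lam ^ q.1) : ℂ) * (q.2 : ℂ) ^ (-s)) with hg
  have hscale : ∀ m : ℕ, ∀ a : ℝ, (n a : ℂ) * ((a * lam ^ m : ℝ) : ℂ) ^ (-s)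
      = ((lam : ℂ) ^ (-s)) ^ m * ((n a : ℂ) * (a : ℂ) ^ (-s)) := by
    intro m a
    by_cases ha : n a = 0
    · simp [ha]
    have ha0 := h.pos ha
    rw [Complex.ofReal_mul, Complex.mul_cpow_ofReal_nonneg ha0.le (by positivity),
      ofReal_pow_cpow hl0.le]
    ring
  have hinner : ∀ m : ℕ, HasSum (fun x : ℝ => (n (x / lam ^ m) : ℂ) * (x : ℂ) ^ (-s))
      (((lam : ℂ) ^ (-s)) ^ m * dirichlet n s) := by
    intro m
    have hm : lam ^ m ≠ 0 := by positivity
    rw [← (Equiv.mulRight₀ (lam ^ m) hm).hasSum_iff]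
    refine ((h.summable_cpow hn).hasSum.mul_left (((lam : ℂ) ^ (-s)) ^ m)).congr_fun ?_
    intro a
    simp only [Function.comp, Equiv.mulRight₀_apply, mul_div_cancel_right₀ _ hm]
    exact (hscale m a)
  have hnorm : ∀ m : ℕ, ∑' x, ‖g (m, x)‖ = (b m : ℝ) * (lam ^ (-s.re)) ^ m *
      ∑' a : ℝ, (n a : ℝ) * a ^ (-s.re) := by
    intro m
    have hm : lam ^ m ≠ 0 := by positivity
    rw [← (Equiv.mulRight₀ (lam ^ m) hm).tsum_eq, ← tsum_mul_left]
    refine tsum_congr fun a => ?_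
    simp only [hg, Equiv.mulRight₀_apply, mul_div_cancel_right₀ _ hm]
    rw [hscale, norm_mul, norm_mul, h.norm_term, norm_pow, Complex.norm_natCast,
      Complex.norm_cpow_eq_rpow_re_of_pos hl0, Complex.neg_re]
    ring
  have hgs : Summable g := by
    apply Summable.of_norm
    rw [summable_prod_of_nonneg fun _ => norm_nonneg _]
    refine ⟨fun m => by
      simp only [hg]
      exact ((hinner m).summable.mul_left (b m : ℂ)).norm, ?_⟩
    simp_rw [hnorm]
    exact hb.mul_right _
  have hT : HasSum g ((∑' m, (b m : ℂ) * ((lam : ℂ) ^ (-s)) ^ m) * dirichlet n s) := by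
    have h1 := hgs.hasSum
    have h2 : HasSum (fun m => (b m : ℂ) * (((lam : ℂ) ^ (-s)) ^ m * dirichlet n s)) (∑' q, g q) :=
      h1.prod_fiberwise fun m => by
        simp only [hg]
        exact (hinner m).mul_left (b m : ℂ)
    have h3 := h2.tsum_eq
    rw [← h3] at h1
    convert h1 using 1
    rw [← tsum_mul_right]
    exact tsum_congr fun m => by ring
  have hsw := (Equiv.prodComm ℝ ℕ).hasSum_iff.2 hT
  have h4 := hsw.prod_fiberwise fun x => (hsw.summable.prod_factor x).hasSum
  refine h4.congr_fun fun x => ?_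
  have hfin := h.finite_support_dilate hl b x
  simp only [Function.comp, Equiv.prodComm_apply, Prod.swap, hg]
  have e : ∀ m, (b m : ℂ) * ((n (x / lam ^ m) : ℂ) * (x : ℂ) ^ (-s))
      = ((b m * n (x / lam ^ m) : ℕ) : ℂ) * (x : ℂ) ^ (-s) := fun m => by push_cast; ring
  simp_rw [e]
  rw [tsum_mul_right, dilate]
  congr 1
  rw [tsum_eq_finsum (hfin.subset fun m hm => by
    simp only [Function.mem_support] at hm ⊢
    exact_mod_cast hm)]
  exact (Nat.castAddMonoidHom ℂ).map_finsum hfin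

/-! ### The zeta function: continuation, leading pole, lattices of poles -/

/-- `Y` is an entire function which continues `(lam ^ s - d) * ∑ n(a) a ^ (-s)`. -/
structure IsContinuation (n : ℝ → ℕ) (lam d κ : ℝ) (Y : ℂ → ℂ) : Prop where
  entire : Differentiable ℂ Y
  eq : ∀ s : ℂ, Real.logb lam d < s.re → Y s = ((lam : ℂ) ^ s - d) * dirichlet n s
  order : ∀ s : ℂ, κ = 0 ∨ s ≠ 0 → 0 ≤ meromorphicOrderAt (fun z => Y z * Complex.Gamma z) s
  growth : ∀ a b δ : ℝ, 0 < δ → ∃ C, ∀ s : ℂ, a ≤ s.re → s.re ≤ b →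
      ‖Y s‖ ≤ C * Real.exp (δ * |s.im|)

/-- The multiplicity function `mult` is obtained by spectral decimation from the scaling
multiplicity functions `n w`, `w ∈ A`, and the coefficients `β w` with rational generating
functions `num w / den w`. -/
structure IsDecimation (mult : ℝ → ℕ) (n : ℂ → ℝ → ℕ) (lam : ℝ) (d : ℕ) (A : Finset ℂ)
    (β : ℂ → ℕ → ℕ) (num den : ℂ → Polynomial ℂ) : Prop where
  nonempty : A.Nonempty
  scaling : ∀ w ∈ A, IsScaling (n w) lam d (if w = 0 then 1 else 0)
  rational : ∀ w ∈ A, IsRationalSeq (β w) (den w) (num w)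
  exists_ne : ∀ w ∈ A, ∃ m, β w m ≠ 0
  mult_eq : ∀ x ≠ 0, mult x = ∑ w ∈ A, dilate lam (β w) (n w) x

/-- The exponents `log_lam d` and the real parts of the poles of `R_w (lam ^ (-s))`. -/
def exponents (lam : ℝ) (d : ℕ) (A : Finset ℂ) (den : ℂ → Polynomial ℂ) : Set ℝ :=
  {Real.logb lam d} ∪ {σ : ℝ | ∃ w ∈ A, ∃ s : ℂ, (den w).eval ((lam : ℂ) ^ (-s)) = 0 ∧ σ = s.re}

/-- The continuation of the zeta function in terms of continuations `Y w`. -/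
noncomputable def zetaSum (lam : ℝ) (d : ℕ) (A : Finset ℂ) (num den : ℂ → Polynomial ℂ)
    (Y : ℂ → ℂ → ℂ) (s : ℂ) : ℂ :=
  ∑ w ∈ A, (num w).eval ((lam : ℂ) ^ (-s)) / (den w).eval ((lam : ℂ) ^ (-s)) *
    (Y w s / ((lam : ℂ) ^ s - d))

theorem exists_cpow_neg_eq {lam : ℝ} (hl : 1 < lam) {r : ℂ} (hr : r ≠ 0) :
    ∃ s : ℂ, (lam : ℂ) ^ (-s) = r := by
  have hl0 : 0 < lam := by linarith
  have hlc : (lam : ℂ) ≠ 0 := by exact_mod_cast hl0.ne'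
  have hlog : Complex.log lam ≠ 0 := by
    rw [← Complex.ofReal_log hl0.le]
    exact_mod_cast (Real.log_pos hl).ne'
  refine ⟨-(Complex.log r / Complex.log lam), ?_⟩
  rw [neg_neg, Complex.cpow_def_of_ne_zero hlc, mul_div_cancel₀ _ hlog, Complex.exp_log hr]

theorem norm_ofReal_cpow_neg {lam : ℝ} (hl : 1 < lam) (s : ℂ) :
    ‖(lam : ℂ) ^ (-s)‖ = lam ^ (-s.re) := by
  rw [Complex.norm_cpow_eq_rpow_re_of_pos (by linarith), Complex.neg_re]

theorem differentiable_ofReal_cpow {lam : ℝ} (hl : 1 < lam) :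
    Differentiable ℂ fun s : ℂ => (lam : ℂ) ^ s := by
  have hlc : (lam : ℂ) ≠ 0 := by exact_mod_cast (zero_lt_one.trans hl).ne'
  exact fun s => differentiableAt_id.const_cpow (Or.inl hlc)

theorem differentiable_ofReal_cpow_neg {lam : ℝ} (hl : 1 < lam) :
    Differentiable ℂ fun s : ℂ => (lam : ℂ) ^ (-s) :=
  (differentiable_ofReal_cpow hl).comp differentiable_neg

theorem differentiable_eval_cpow_neg {lam : ℝ} (hl : 1 < lam) (P : Polynomial ℂ) :
    Differentiable ℂ fun s : ℂ => P.eval ((lam : ℂ) ^ (-s)) :=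
  P.differentiable.comp (differentiable_ofReal_cpow_neg hl)

theorem meromorphicAt_Gamma (s : ℂ) : MeromorphicAt Complex.Gamma s := by
  have h : MeromorphicAt (fun z => (Complex.Gamma z)⁻¹) s :=
    (Complex.differentiable_one_div_Gamma.analyticAt s).meromorphicAt
  refine h.inv.congr (Eventually.of_forall fun z => ?_)
  simp

namespace IsDecimation

variable {mult : ℝ → ℕ} {n : ℂ → ℝ → ℕ} {lam : ℝ} {d : ℕ} {A : Finset ℂ}
  {β : ℂ → ℕ → ℕ} {num den : ℂ → Polynomial ℂ} {Y : ℂ → ℂ → ℂ} {σ₀ : ℝ}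

theorem one_lt_lam (h : IsDecimation mult n lam d A β num den) : 1 < lam := by
  obtain ⟨w, hw⟩ := h.nonempty
  exact (h.scaling w hw).one_lt_lam

theorem exists_isContinuation (h : IsDecimation mult n lam d A β num den) :
    ∃ Y : ℂ → ℂ → ℂ, ∀ w ∈ A, IsContinuation (n w) lam d (if w = 0 then 1 else 0) (Y w) := by
  have : ∀ w, ∃ Y, w ∈ A → IsContinuation (n w) lam d (if w = 0 then 1 else 0) Y := by
    intro w
    by_cases hw : w ∈ A
    · obtain ⟨Y, h1, h2, h3, h4⟩ := (h.scaling w hw).exists_continuation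
      exact ⟨Y, fun _ => ⟨h1, h2, h3, h4⟩⟩
    · exact ⟨0, fun h => absurd h hw⟩
  choose Y hY using this
  exact ⟨Y, hY⟩

theorem re_eq_of_root (h : IsDecimation mult n lam d A β num den) {s r : ℂ}
    (hs : (lam : ℂ) ^ (-s) = r) : s.re = -Real.logb lam ‖r‖ := by
  have hl := h.one_lt_lam
  rw [← hs, norm_ofReal_cpow_neg hl, Real.logb_rpow (by linarith) hl.ne', neg_neg]

/-- A solution of `lam ^ (-s) = r` has real part `-log_lam |r|`, so the infinitely many poles of the
`R_w` yield only finitely many exponents. -/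
theorem exists_isGreatest (h : IsDecimation mult n lam d A β num den) :
    ∃ σ₀, IsGreatest (exponents lam d A den) σ₀ := by
  have hfin : (exponents lam d A den).Finite := by
    refine (finite_singleton _).union ?_
    refine Set.Finite.subset (Finset.finite_toSet (A.biUnion fun w =>
      ((den w).roots.toFinset.image fun r => -Real.logb lam ‖r‖))) ?_
    rintro σ ⟨w, hw, s, hs, rfl⟩
    simp only [Finset.coe_biUnion, mem_iUnion, Finset.coe_image, Finset.mem_coe, mem_image,
      Multiset.mem_toFinset]
    exact ⟨w, hw, _, (Polynomial.mem_roots (h.rational w hw).ne_zero).2 hs,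
      (h.re_eq_of_root rfl).symm⟩
  obtain ⟨σ₀, h1, h2⟩ := Set.exists_max_image _ id hfin ⟨_, Or.inl rfl⟩
  exact ⟨σ₀, h1, fun σ hσ => h2 σ hσ⟩

theorem logb_le (hσ : IsGreatest (exponents lam d A den) σ₀) : Real.logb lam d ≤ σ₀ :=
  hσ.2 (Or.inl rfl)

theorem pos (h : IsDecimation mult n lam d A β num den)
    (hσ : IsGreatest (exponents lam d A den) σ₀) : 0 < σ₀ := by
  obtain ⟨w, hw⟩ := h.nonempty
  exact (h.scaling w hw).rho_pos.trans_le (logb_le hσ)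

theorem le_norm_root (h : IsDecimation mult n lam d A β num den)
    (hσ : IsGreatest (exponents lam d A den) σ₀) {w : ℂ} (hw : w ∈ A) {r : ℂ}
    (hr : (den w).eval r = 0) : lam ^ (-σ₀) ≤ ‖r‖ := by
  have hl := h.one_lt_lam
  have hr0 : r ≠ 0 := by rintro rfl; exact (h.rational w hw).eval_zero_ne hr
  obtain ⟨s, hs⟩ := exists_cpow_neg_eq hl hr0
  have h1 : s.re ≤ σ₀ := hσ.2 (Or.inr ⟨w, hw, s, by rw [hs]; exact hr, rfl⟩)
  rw [← hs, norm_ofReal_cpow_neg hl]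
  exact Real.rpow_le_rpow_of_exponent_le hl.le (by linarith)

theorem lt_norm_root (h : IsDecimation mult n lam d A β num den)
    (hσ : IsGreatest (exponents lam d A den) σ₀) {w : ℂ} (hw : w ∈ A) {r : ℂ}
    (hr : (den w).eval r = 0) {σ : ℝ} (hs : σ₀ < σ) : lam ^ (-σ) < ‖r‖ :=
  (Real.rpow_lt_rpow_of_exponent_lt h.one_lt_lam (by linarith)).trans_le (h.le_norm_root hσ hw hr)

theorem summable_beta (h : IsDecimation mult n lam d A β num den)
    (hσ : IsGreatest (exponents lam d A den) σ₀) {w : ℂ} (hw : w ∈ A) {σ : ℝ} (hs : σ₀ < σ) :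
    Summable fun m => (β w m : ℝ) * (lam ^ (-σ)) ^ m := by
  have hl := h.one_lt_lam
  exact (h.rational w hw).summable (by positivity) fun r hr => h.lt_norm_root hσ hw hr hs

theorem den_ne_zero (_h : IsDecimation mult n lam d A β num den)
    (hσ : IsGreatest (exponents lam d A den) σ₀) {w : ℂ} (hw : w ∈ A) {s : ℂ} (hs : σ₀ < s.re) :
    (den w).eval ((lam : ℂ) ^ (-s)) ≠ 0 := fun h0 => by
  have := hσ.2 (Or.inr ⟨w, hw, s, h0, rfl⟩)
  linarith

theorem cpow_ne (h : IsDecimation mult n lam d A β num den)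
    (hσ : IsGreatest (exponents lam d A den) σ₀) {s : ℂ} (hs : σ₀ < s.re) :
    (lam : ℂ) ^ s - d ≠ 0 := by
  obtain ⟨w, hw⟩ := h.nonempty
  have hl := h.one_lt_lam
  have hd := (h.scaling w hw).one_lt
  intro h0
  have h1 := congrArg norm (sub_eq_zero.1 h0)
  rw [Complex.norm_cpow_eq_rpow_re_of_pos (by linarith), Complex.norm_natCast] at h1
  have h2 := logb_le hσ
  rw [← h1, Real.logb_rpow (by linarith) hl.ne'] at h2
  linarith

theorem zetaSum_eq (h : IsDecimation mult n lam d A β num den)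
    (hσ : IsGreatest (exponents lam d A den) σ₀)
    (hY : ∀ w ∈ A, IsContinuation (n w) lam d (if w = 0 then 1 else 0) (Y w)) {s : ℂ}
    (hs : σ₀ < s.re) : zetaSum lam d A num den Y s
      = ∑ w ∈ A, (∑' m, (β w m : ℂ) * ((lam : ℂ) ^ (-s)) ^ m) * dirichlet (n w) s := by
  have hl := h.one_lt_lam
  refine Finset.sum_congr rfl fun w hw => ?_
  have h1 := h.den_ne_zero hσ hw hs
  have h2 := h.cpow_ne hσ hs
  have h3 := (h.rational w hw).eval_mul_tsum (z := (lam : ℂ) ^ (-s)) fun r hr => by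
    rw [norm_ofReal_cpow_neg hl]; exact h.lt_norm_root hσ hw hr hs
  rw [(hY w hw).eq s (by linarith [logb_le hσ]), ← h3, Complex.ofReal_natCast]
  field_simp

theorem hasSum (h : IsDecimation mult n lam d A β num den)
    (hσ : IsGreatest (exponents lam d A den) σ₀)
    (hY : ∀ w ∈ A, IsContinuation (n w) lam d (if w = 0 then 1 else 0) (Y w)) {s : ℂ}
    (hs : σ₀ < s.re) :
    HasSum (fun x : {x : ℝ // x ≠ 0} => (mult x : ℂ) * ((x : ℝ) : ℂ) ^ (-s))
      (zetaSum lam d A num den Y s) := by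
  rw [h.zetaSum_eq hσ hY hs]
  have h1 := hasSum_sum fun w hw => (h.scaling w hw).isMult.hasSum_dilate h.one_lt_lam
    ((h.scaling w hw).summable_rpow (by linarith [logb_le hσ])) (h.summable_beta hσ hw hs)
  have h2 := (hasSum_subtype_iff_of_support_subset (s := {x : ℝ | x ≠ 0}) (by
    intro x hx
    rintro rfl
    refine hx (Finset.sum_eq_zero fun w hw => ?_)
    rw [(h.scaling w hw).isMult.dilate_of_nonpos h.one_lt_lam _ le_rfl, Nat.cast_zero,
      zero_mul])).2 h1
  refine h2.congr_fun fun x => ?_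
  simp only [Function.comp, h.mult_eq x x.2]
  rw [← Finset.sum_mul]
  push_cast
  rfl

theorem meromorphic_zetaSum (h : IsDecimation mult n lam d A β num den)
    (hY : ∀ w ∈ A, IsContinuation (n w) lam d (if w = 0 then 1 else 0) (Y w)) :
    Meromorphic (zetaSum lam d A num den Y) := by
  have hl := h.one_lt_lam
  intro s
  refine MeromorphicAt.fun_sum fun w hw => ?_
  have h1 := fun P : Polynomial ℂ => ((differentiable_eval_cpow_neg hl P).analyticAt
      s).meromorphicAt
  have h2 := ((hY w hw).entire.analyticAt s).meromorphicAt
  have h3 := (((differentiable_ofReal_cpow hl).sub_const (d : ℂ)).analyticAt s).meromorphicAt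
  exact ((h1 _).div (h1 _)).mul (h2.div h3)

/-- Each summand is a quotient of functions of `lam ^ (-s)` times `Y w s Γ(s)`. The poles of `Γ` at
negative integers do not appear, because `Y w` vanishes there; at `0` this can fail for `w = 0`
only. -/
theorem pole_cases (h : IsDecimation mult n lam d A β num den)
    (hY : ∀ w ∈ A, IsContinuation (n w) lam d (if w = 0 then 1 else 0) (Y w)) {s : ℂ}
    (hs : IsPole (fun s => zetaSum lam d A num den Y s * Complex.Gamma s) s) :
    (∃ w ∈ A, (den w).eval ((lam : ℂ) ^ (-s)) = 0) ∨ (lam : ℂ) ^ s = d ∨ (s = 0 ∧ 0 ∈ A) := by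
  have hl := h.one_lt_lam
  by_contra! hcon
  obtain ⟨h1, h2, h3⟩ := hcon
  refine not_le.2 hs ?_
  have hm : MeromorphicAt (fun s => zetaSum lam d A num den Y s * Complex.Gamma s) s :=
    (h.meromorphic_zetaSum hY s).mul (meromorphicAt_Gamma s)
  rw [← tendsto_nhds_iff_meromorphicOrderAt_nonneg hm]
  have h4 : ∀ w ∈ A, ∃ c, Tendsto (fun z => Y w z * Complex.Gamma z) (𝓝[≠] s) (𝓝 c) := by
    intro w hw
    refine tendsto_nhds_of_meromorphicOrderAt_nonneg
      (((hY w hw).entire.analyticAt s).meromorphicAt.mul (meromorphicAt_Gamma s))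
      ((hY w hw).order s ?_)
    by_cases hw0 : w = 0
    · right
      intro hs0
      exact h3 hs0 (hw0 ▸ hw)
    · left; simp [hw0]
  have hP : ∀ P : Polynomial ℂ, Tendsto (fun z => P.eval ((lam : ℂ) ^ (-z))) (𝓝[≠] s)
      (𝓝 (P.eval ((lam : ℂ) ^ (-s)))) := fun P =>
    ((differentiable_eval_cpow_neg hl P).continuous.tendsto s).mono_left nhdsWithin_le_nhds
  have hD : Tendsto (fun z : ℂ => (lam : ℂ) ^ z - d) (𝓝[≠] s) (𝓝 ((lam : ℂ) ^ s - d)) :=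
    (((differentiable_ofReal_cpow hl).sub_const (d : ℂ)).continuous.tendsto s).mono_left
      nhdsWithin_le_nhds
  have h5 : ∀ w ∈ A, ∃ c, Tendsto (fun z => (num w).eval ((lam : ℂ) ^ (-z)) /
      (den w).eval ((lam : ℂ) ^ (-z)) * (Y w z / ((lam : ℂ) ^ z - d)) * Complex.Gamma z)
      (𝓝[≠] s) (𝓝 c) := by
    intro w hw
    obtain ⟨c, hc⟩ := h4 w hw
    refine ⟨_, ((((hP (num w)).div (hP (den w)) (h1 w hw)).mul
      (hc.div hD (sub_ne_zero.2 h2)))).congr fun z => ?_⟩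
    simp only [Pi.div_apply]
    ring
  choose! c hc using h5
  refine ⟨∑ w ∈ A, c w, (tendsto_finsetSum _ fun w hw => hc w hw).congr fun z => ?_⟩
  rw [zetaSum, Finset.sum_mul]

/-- On the real axis to the right of `σ₀` the zeta function is `∑ R_w D_w` with nonnegative `R_w`
(generating function) and `D_w` (Dirichlet series). At `σ₀` one of these factors is unbounded for
some `w`, the other is bounded below by one of its positive terms, and nothing can cancel. -/
theorem isPole (h : IsDecimation mult n lam d A β num den)
    (hσ : IsGreatest (exponents lam d A den) σ₀)
    (hY : ∀ w ∈ A, IsContinuation (n w) lam d (if w = 0 then 1 else 0) (Y w)) :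
    IsPole (zetaSum lam d A num den Y) (σ₀ : ℂ) := by
  have hl := h.one_lt_lam
  have hl0 : 0 < lam := by linarith
  by_contra hcon
  obtain ⟨c, hc⟩ := tendsto_nhds_of_meromorphicOrderAt_nonneg (h.meromorphic_zetaSum hY _)
    (not_lt.1 hcon)
  -- the restriction to the real axis
  have hre : Tendsto (fun σ : ℝ => (σ : ℂ)) (𝓝[>] σ₀) (𝓝[≠] (σ₀ : ℂ)) := by
    refine tendsto_nhdsWithin_of_tendsto_nhds_of_eventually_within _
      ((Complex.continuous_ofReal.tendsto σ₀).mono_left nhdsWithin_le_nhds) ?_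
    filter_upwards [self_mem_nhdsWithin] with σ hσ
    have : σ ≠ σ₀ := ne_of_gt hσ
    simpa using this
  have hb := ((hc.comp hre).norm.eventually (gt_mem_nhds (lt_add_one ‖c‖)))
  set R : ℂ → ℝ → ℝ := fun w σ => ∑' m, (β w m : ℝ) * (lam ^ (-σ)) ^ m with hR
  set D : ℂ → ℝ → ℝ := fun w σ => ∑' a : ℝ, (n w a : ℝ) * a ^ (-σ) with hD
  have hR0 : ∀ w σ, 0 ≤ R w σ := fun w σ => tsum_nonneg fun m => by positivity
  have hDt : ∀ w ∈ A, ∀ σ a : ℝ, 0 ≤ (n w a : ℝ) * a ^ (-σ) := fun w hw σ a => by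
    by_cases hn : n w a = 0
    · simp [hn]
    · have := (h.scaling w hw).isMult.pos hn
      positivity
  have hD0 : ∀ w ∈ A, ∀ σ, 0 ≤ D w σ := fun w hw σ => tsum_nonneg (hDt w hw σ)
  have hreal : ∀ σ : ℝ, σ₀ < σ → zetaSum lam d A num den Y (σ : ℂ)
      = ((∑ w ∈ A, R w σ * D w σ : ℝ) : ℂ) := by
    intro σ hs
    rw [h.zetaSum_eq hσ hY (by simpa using hs)]
    push_cast
    refine Finset.sum_congr rfl fun w hw => ?_
    have e1 : (lam : ℂ) ^ (-(σ : ℂ)) = ((lam ^ (-σ) : ℝ) : ℂ) := by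
      rw [Complex.ofReal_cpow hl0.le]; push_cast; rfl
    congr 1
    · rw [hR, Complex.ofReal_tsum]
      exact tsum_congr fun m => by rw [e1]; push_cast; rfl
    · rw [hD, dirichlet, Complex.ofReal_tsum]
      refine tsum_congr fun a => ?_
      by_cases hn : n w a = 0
      · simp [hn]
      · rw [Complex.ofReal_mul, Complex.ofReal_cpow ((h.scaling w hw).isMult.pos hn).le]
        push_cast
        rfl
  have hlow : ∀ w ∈ A, ∃ e : ℝ, 0 < e ∧ ∀ᶠ σ in 𝓝[>] σ₀, e ≤ R w σ ∧ e ≤ D w σ := by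
    intro w hw
    obtain ⟨m, hm⟩ := h.exists_ne w hw
    obtain ⟨a, ha⟩ := (h.scaling w hw).exists_ne
    have ha0 := (h.scaling w hw).isMult.pos ha
    set f1 : ℝ → ℝ := fun σ => (β w m : ℝ) * (lam ^ (-σ)) ^ m
    set f2 : ℝ → ℝ := fun σ => (n w a : ℝ) * a ^ (-σ)
    have hm1 : (0 : ℝ) < β w m := by exact_mod_cast Nat.pos_of_ne_zero hm
    have ha1 : (0 : ℝ) < n w a := by exact_mod_cast Nat.pos_of_ne_zero ha
    have c1 : ContinuousAt f1 σ₀ := (((Real.continuous_const_rpow hl0.ne').comp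
      continuous_neg).pow m).const_mul _ |>.continuousAt
    have c2 : ContinuousAt f2 σ₀ := ((Real.continuous_const_rpow ha0.ne').comp
      continuous_neg).const_mul _ |>.continuousAt
    have p1 : 0 < f1 σ₀ := by positivity
    have p2 : 0 < f2 σ₀ := by positivity
    refine ⟨min (f1 σ₀ / 2) (f2 σ₀ / 2), by positivity, ?_⟩
    filter_upwards [nhdsWithin_le_nhds (c1.eventually (lt_mem_nhds (half_lt_self p1))),
      nhdsWithin_le_nhds (c2.eventually (lt_mem_nhds (half_lt_self p2))), self_mem_nhdsWithin]
      with σ h1 h2 h3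
    have h3' : σ₀ < σ := h3
    refine ⟨(min_le_left _ _).trans (h1.le.trans ?_), (min_le_right _ _).trans (h2.le.trans ?_)⟩
    · exact (h.summable_beta hσ hw h3').le_tsum m fun _ _ => by positivity
    · exact ((h.scaling w hw).summable_rpow (by linarith [logb_le hσ])).le_tsum a
        fun b _ => hDt w hw σ b
  -- If `σ₀ = log_lam d`, the Dirichlet series diverges at `σ₀`; otherwise some `den w` has a root
  -- of modulus `lam ^ (-σ₀)`, which is then of least modulus, and Pringsheim's argument applies.
  have hbig : ∃ w ∈ A, ∀ K : ℝ, ∀ᶠ σ in 𝓝[>] σ₀, K ≤ R w σ * D w σ := by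
    rcases hσ.1 with h1 | ⟨w, hw, s, hs, hs2⟩
    · have h1' : σ₀ = Real.logb lam d := h1
      obtain ⟨w, hw⟩ := h.nonempty
      obtain ⟨e, he, hev⟩ := hlow w hw
      refine ⟨w, hw, fun K => ?_⟩
      have h2 := (h.scaling w hw).eventually_le_sum (|K| / e)
      rw [← h1'] at h2
      filter_upwards [hev, h2] with σ h3 h4
      calc K ≤ |K| := le_abs_self K
        _ = e * (|K| / e) := by field_simp
        _ ≤ R w σ * D w σ := by
          have : 0 ≤ |K| / e := by positivity
          exact mul_le_mul h3.1 h4 this (hR0 w σ)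
    · obtain ⟨e, he, hev⟩ := hlow w hw
      refine ⟨w, hw, fun K => ?_⟩
      have hn : ‖(lam : ℂ) ^ (-s)‖ = lam ^ (-σ₀) := by rw [norm_ofReal_cpow_neg hl, hs2]
      have h2 := (h.rational w hw).eventually_le_tsum hs (fun r hr => by
        rw [hn]; exact h.le_norm_root hσ hw hr) (|K| / e)
      rw [hn] at h2
      have ht : Tendsto (fun σ : ℝ => lam ^ (-σ)) (𝓝[>] σ₀) (𝓝[<] (lam ^ (-σ₀))) := by
        refine tendsto_nhdsWithin_of_tendsto_nhds_of_eventually_within _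
          ((((Real.continuous_const_rpow hl0.ne').comp continuous_neg).tendsto σ₀).mono_left
            nhdsWithin_le_nhds) ?_
        filter_upwards [self_mem_nhdsWithin] with σ hσ'
        have : σ₀ < σ := hσ'
        exact Real.rpow_lt_rpow_of_exponent_lt hl (by linarith)
      filter_upwards [hev, ht.eventually h2] with σ h3 h4
      calc K ≤ |K| := le_abs_self K
        _ = (|K| / e) * e := by field_simp
        _ ≤ R w σ * D w σ := mul_le_mul h4 h3.2 he.le (hR0 w σ)
  obtain ⟨w, hw, hK⟩ := hbig
  obtain ⟨σ, h1, h2, h3⟩ := (hb.and ((hK (‖c‖ + 1)).and self_mem_nhdsWithin)).exists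
  have h3' : σ₀ < σ := h3
  have h4 : R w σ * D w σ ≤ ∑ w ∈ A, R w σ * D w σ :=
    Finset.single_le_sum (f := fun w => R w σ * D w σ)
      (fun w hw => mul_nonneg (hR0 w σ) (hD0 w hw σ)) hw
  simp only [Function.comp] at h1
  rw [hreal σ h3', Complex.norm_real] at h1
  have h5 := le_abs_self (∑ w ∈ A, R w σ * D w σ)
  rw [Real.norm_eq_abs] at h1
  linarith

theorem exists_latticePt {lam : ℝ} (hl : 1 < lam) {s α : ℂ}
    (hs : (lam : ℂ) ^ s = (lam : ℂ) ^ α) : ∃ k : ℤ, s = latticePt lam α k := by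
  have hl0 : 0 < lam := by linarith
  have hlc : (lam : ℂ) ≠ 0 := by exact_mod_cast hl0.ne'
  have hlog : (Real.log lam : ℂ) ≠ 0 := by exact_mod_cast (Real.log_pos hl).ne'
  rw [Complex.cpow_def_of_ne_zero hlc, Complex.cpow_def_of_ne_zero hlc,
    Complex.exp_eq_exp_iff_exists_int] at hs
  obtain ⟨k, hk⟩ := hs
  refine ⟨k, ?_⟩
  rw [← Complex.ofReal_log hl0.le] at hk
  rw [latticePt]
  field_simp
  linear_combination hk

/-- Representatives of the lattices of poles. -/
theorem exists_representatives (h : IsDecimation mult n lam d A β num den)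
    (hσ : IsGreatest (exponents lam d A den) σ₀)
    (hY : ∀ w ∈ A, IsContinuation (n w) lam d (if w = 0 then 1 else 0) (Y w)) :
    ∃ J : Finset ℂ, (σ₀ : ℂ) ∉ J ∧
      Set.InjOn (fun α : ℂ => (lam : ℂ) ^ α) (insert (σ₀ : ℂ) (J : Set ℂ)) ∧
      (∀ α ∈ J, α.re ≤ σ₀ ∧
        IsPole (fun s => zetaSum lam d A num den Y s * Complex.Gamma s) α ∧
        ((∃ w ∈ A, (den w).eval ((lam : ℂ) ^ (-α)) = 0) ∨
          (lam : ℂ) ^ α = d ∨ (α = 0 ∧ 0 ∈ A))) ∧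
      (∀ s : ℂ, IsPole (fun s => zetaSum lam d A num den Y s * Complex.Gamma s) s →
        ∃ α ∈ insert (σ₀ : ℂ) (J : Set ℂ), ∃ k : ℤ, s = latticePt lam α k) := by
  classical
  have hl := h.one_lt_lam
  have hl0 : 0 < lam := by linarith
  set P : ℂ → Prop := IsPole (fun s => zetaSum lam d A num den Y s * Complex.Gamma s)
  -- All values that `lam ^ s` can take at a pole: inverses of roots of denominators, the degree
  -- `d`, and `1 = lam ^ 0`. A lattice is a fibre of `lam ^ s`, so one pole per attained value,
  -- other than the value at `σ₀`, represents all of them.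
  set V : Finset ℂ := (A.biUnion fun w => (den w).roots.toFinset.image fun r => r⁻¹) ∪ {(d : ℂ), 1}
    with hV
  have hPV : ∀ s, P s → (lam : ℂ) ^ s ∈ V := by
    intro s hs
    rcases h.pole_cases hY hs with ⟨w, hw, h1⟩ | h1 | h1
    · rw [hV, Finset.mem_union, Finset.mem_biUnion]
      left
      refine ⟨w, hw, Finset.mem_image.2 ⟨(lam : ℂ) ^ (-s), ?_, ?_⟩⟩
      · rw [Multiset.mem_toFinset]
        exact (Polynomial.mem_roots (h.rational w hw).ne_zero).2 h1
      · rw [Complex.cpow_neg, inv_inv]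
    · simp [hV, h1]
    · simp [hV, h1.1]
  have hPre : ∀ s, P s → s.re ≤ σ₀ := by
    intro s hs
    rcases h.pole_cases hY hs with ⟨w, hw, h1⟩ | h1 | h1
    · exact hσ.2 (Or.inr ⟨w, hw, s, h1, rfl⟩)
    · by_contra! hcon
      exact h.cpow_ne hσ hcon (sub_eq_zero.2 h1)
    · rw [h1.1, Complex.zero_re]
      exact (h.pos hσ).le
  have hch : ∀ v : ℂ, ∃ s, (∃ s, P s ∧ (lam : ℂ) ^ s = v) → P s ∧ (lam : ℂ) ^ s = v := by
    intro v
    by_cases hv : ∃ s, P s ∧ (lam : ℂ) ^ s = v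
    · obtain ⟨s, hs⟩ := hv
      exact ⟨s, fun _ => hs⟩
    · exact ⟨0, fun h => absurd h hv⟩
  choose f hf using hch
  set J := (V.filter fun v => v ≠ (lam : ℂ) ^ (σ₀ : ℂ) ∧ ∃ s, P s ∧ (lam : ℂ) ^ s = v).image f
    with hJ
  have hmem : ∀ α, α ∈ J → P α ∧ (lam : ℂ) ^ α ≠ (lam : ℂ) ^ (σ₀ : ℂ) ∧ α = f ((lam : ℂ) ^ α) := by
    intro α hα
    obtain ⟨v, hv, rfl⟩ := Finset.mem_image.1 hα
    obtain ⟨_, hv1, hv2⟩ := Finset.mem_filter.1 hv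
    obtain ⟨h1, h2⟩ := hf v hv2
    exact ⟨h1, by rwa [h2], by rw [h2]⟩
  refine ⟨J, fun hc => (hmem _ hc).2.1 rfl, ?_, fun α hα => ?_, fun s hs => ?_⟩
  · rintro α hα γ hγ hαγ
    simp only at hαγ
    rcases hα with rfl | hα <;> rcases hγ with rfl | hγ
    · rfl
    · exact absurd hαγ.symm (hmem γ hγ).2.1
    · exact absurd hαγ (hmem α hα).2.1
    · rw [(hmem α hα).2.2, (hmem γ hγ).2.2, hαγ]
  · obtain ⟨h1, _, _⟩ := hmem α hα
    exact ⟨hPre α h1, h1, h.pole_cases hY h1⟩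
  · by_cases hs0 : (lam : ℂ) ^ s = (lam : ℂ) ^ (σ₀ : ℂ)
    · exact ⟨_, Or.inl rfl, exists_latticePt hl hs0⟩
    · have hex : ∃ s', P s' ∧ (lam : ℂ) ^ s' = (lam : ℂ) ^ s := ⟨s, hs, rfl⟩
      refine ⟨f ((lam : ℂ) ^ s), Or.inr ?_, exists_latticePt hl (hf _ hex).2.symm⟩
      exact Finset.mem_image_of_mem f (Finset.mem_filter.2 ⟨hPV s hs, hs0, hex⟩)

end IsDecimation

/-! ### Exponential decay of `Γ` in vertical strips -/

theorem norm_cpow_mul_exp {s r : ℂ} {t : ℝ} (ht : 0 < t) :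
    ‖(t : ℂ) ^ (s - 1) * Complex.exp (-(r * t))‖ = t ^ (s.re - 1) * Real.exp (-(r.re * t)) := by
  rw [norm_mul, Complex.norm_exp, Complex.norm_cpow_eq_rpow_re_of_pos ht]
  simp

theorem integrableOn_rpow_mul_exp_neg {σ c : ℝ} (hσ : 0 < σ) (hc : 0 < c) :
    IntegrableOn (fun t : ℝ => t ^ (σ - 1) * Real.exp (-(c * t))) (Ioi 0) := by
  have h := (integrableOn_cpow_mul_exp_neg (s := (σ : ℂ)) (by simpa using hσ) hc).norm
  refine h.congr ?_
  filter_upwards [ae_restrict_mem measurableSet_Ioi] with t ht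
  rw [norm_cpow_mul_exp ht]
  simp

theorem measurable_cpow_mul_exp (s r : ℂ) :
    Measurable fun t : ℝ => (t : ℂ) ^ (s - 1) * Complex.exp (-(r * t)) := by
  fun_prop

theorem integrableOn_cpow_mul_exp_neg' {s r : ℂ} (hs : 0 < s.re) (hr : 0 < r.re) :
    IntegrableOn (fun t : ℝ => (t : ℂ) ^ (s - 1) * Complex.exp (-(r * t))) (Ioi 0) := by
  refine (integrableOn_rpow_mul_exp_neg hs hr).mono'
    (measurable_cpow_mul_exp s r).aestronglyMeasurable ?_
  filter_upwards [ae_restrict_mem measurableSet_Ioi] with t ht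
  rw [norm_cpow_mul_exp ht]

/-- The Gamma integral along a ray in the right half plane. -/
theorem integral_cpow_mul_exp_neg' {s r : ℂ} (hs : 0 < s.re) (hr : 0 < r.re) :
    ∫ t : ℝ in Ioi 0, (t : ℂ) ^ (s - 1) * Complex.exp (-(r * t)) = r ^ (-s) * Complex.Gamma s := by
  set U := {z : ℂ | 0 < z.re} with hU
  have hUo : IsOpen U := isOpen_lt continuous_const Complex.continuous_re
  have hUc : IsPreconnected U := (convex_halfSpace_re_gt 0).isPreconnected
  set f : ℂ → ℂ := fun r => ∫ t : ℝ in Ioi 0, (t : ℂ) ^ (s - 1) * Complex.exp (-(r * t)) with hf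
  have hfd : DifferentiableOn ℂ f U := by
    intro r₀ hr₀
    have hr₀' : 0 < r₀.re := hr₀
    have hball : ∀ r ∈ Metric.ball r₀ (r₀.re / 2), r₀.re / 2 ≤ r.re := by
      intro r hr
      rw [mem_ball_iff_norm] at hr
      have h1 := Complex.abs_re_le_norm (r - r₀)
      have h2 := neg_abs_le (r - r₀).re
      rw [Complex.sub_re] at h1 h2
      linarith
    have h := hasDerivAt_integral_of_dominated_loc_of_deriv_le
      (μ := (volume : Measure ℝ).restrict (Ioi 0))
      (F := fun r t => (t : ℂ) ^ (s - 1) * Complex.exp (-(r * t)))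
      (F' := fun r t => (t : ℂ) ^ (s - 1) * (Complex.exp (-(r * t)) * -(t : ℂ))) (x₀ := r₀)
      (s := Metric.ball r₀ (r₀.re / 2))
      (bound := fun t => t ^ ((s.re + 1) - 1) * Real.exp (-(r₀.re / 2 * t)))
      (Metric.ball_mem_nhds r₀ (by positivity))
      (Eventually.of_forall fun r => (measurable_cpow_mul_exp s r).aestronglyMeasurable)
      (integrableOn_cpow_mul_exp_neg' hs hr₀)
      (by
        apply Measurable.aestronglyMeasurable
        fun_prop)
      (by
        filter_upwards [ae_restrict_mem measurableSet_Ioi] with t ht r hr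
        have ht0 : 0 < t := ht
        rw [← mul_assoc, norm_mul, norm_cpow_mul_exp ht0, norm_neg, Complex.norm_real,
          Real.norm_of_nonneg ht0.le, show s.re + 1 - 1 = (s.re - 1) + 1 by ring,
          Real.rpow_add_one ht0.ne']
        have : Real.exp (-(r.re * t)) ≤ Real.exp (-(r₀.re / 2 * t)) := by
          refine Real.exp_le_exp.2 (neg_le_neg ?_)
          gcongr
          exact hball r hr
        calc _ = t ^ (s.re - 1) * t * Real.exp (-(r.re * t)) := by ring
          _ ≤ _ := by gcongr)
      (integrableOn_rpow_mul_exp_neg (by linarith) (by positivity))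
      (by
        refine Eventually.of_forall fun t r _ => ?_
        have h1 : HasDerivAt (fun r : ℂ => -(r * t)) (-(t : ℂ)) r := by
          have := ((hasDerivAt_id r).mul_const (t : ℂ)).neg
          rw [one_mul] at this
          exact this
        exact (h1.cexp).const_mul _)
    exact h.2.differentiableAt.differentiableWithinAt
  have hgd : DifferentiableOn ℂ (fun r : ℂ => r ^ (-s) * Complex.Gamma s) U := by
    intro r hr
    have : r ∈ Complex.slitPlane := Or.inl hr
    exact ((differentiableAt_id.cpow_const this).mul_const _).differentiableWithinAt
  -- Both sides are holomorphic in `r`; they agree at the real points `1 + 1 / (k + 1)`, which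
  -- accumulate at `1`.
  have h1 := (hfd.analyticOnNhd hUo).eqOn_of_preconnected_of_frequently_eq
    (hgd.analyticOnNhd hUo) hUc (z₀ := 1) (by simp [hU]) (by
      have hseq : Tendsto (fun k : ℕ => ((1 + 1 / ((k : ℝ) + 1) : ℝ) : ℂ)) atTop (𝓝[≠] 1) := by
        refine tendsto_nhdsWithin_of_tendsto_nhds_of_eventually_within _ ?_
          (Eventually.of_forall fun k => ?_)
        · have := (tendsto_const_nhds (x := (1 : ℝ))).add tendsto_one_div_add_atTop_nhds_zero_nat
          rw [add_zero] at this
          exact (Complex.continuous_ofReal.tendsto 1).comp this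
        · have : (0 : ℝ) < 1 / ((k : ℝ) + 1) := by positivity
          have h2 : (1 + 1 / ((k : ℝ) + 1) : ℝ) ≠ 1 := by linarith
          simpa only [mem_compl_iff, mem_singleton_iff, Complex.ofReal_eq_one] using h2
      refine hseq.frequently (Frequently.of_forall fun k => ?_)
      have hk : (0 : ℝ) < 1 + 1 / ((k : ℝ) + 1) := by positivity
      simp only [hf]
      rw [Complex.integral_cpow_mul_exp_neg_mul_Ioi hs hk, one_div, Complex.inv_cpow _ _ (by
        rw [Complex.arg_ofReal_of_nonneg hk.le]; exact Real.pi_pos.ne), Complex.cpow_neg])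
  exact h1 hr

theorem exp_mul_I_cpow {φ : ℝ} (h1 : -Real.pi < φ) (h2 : φ ≤ Real.pi) (s : ℂ) :
    Complex.exp (φ * Complex.I) ^ s = Complex.exp (φ * Complex.I * s) := by
  rw [Complex.cpow_def_of_ne_zero (Complex.exp_ne_zero _), Complex.log_exp (by simpa using h1)
    (by simpa using h2)]

/-- Rotate the ray of the Gamma integral by `±(π / 2 - δ)`. The integral stays bounded since the ray
remains in the right half plane, and the factor `r ^ (-s)` has modulus `exp (± (π / 2 - δ) Im s)`;
the sign is that of `Im s`. -/
theorem exists_norm_Gamma_le_of_pos {a b δ : ℝ} (ha : 0 < a) (hδ : 0 < δ) (hδ2 : δ < Real.pi / 2) :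
    ∃ C, ∀ s : ℂ, a ≤ s.re → s.re ≤ b →
      ‖Complex.Gamma s‖ ≤ C * Real.exp (-((Real.pi / 2 - δ) * |s.im|)) := by
  rcases lt_or_ge b a with hab | hab
  · exact ⟨0, fun s h1 h2 => by linarith⟩
  set θ := Real.pi / 2 - δ with hθ
  have hpi := Real.pi_pos
  have hcos : 0 < Real.cos θ := Real.cos_pos_of_mem_Ioo ⟨by linarith, by linarith⟩
  set I1 := ∫ t : ℝ in Ioi 0, (t ^ (a - 1) * Real.exp (-(Real.cos θ * t))
    + t ^ (b - 1) * Real.exp (-(Real.cos θ * t)))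
  refine ⟨I1, fun s h1 h2 => ?_⟩
  have hs : 0 < s.re := by linarith
  have key : ∀ φ : ℝ, |φ| = θ → ‖Complex.Gamma s‖ ≤ I1 * Real.exp (-(φ * s.im)) := by
    intro φ hφ
    set r := Complex.exp (φ * Complex.I) with hr
    have hrre : r.re = Real.cos θ := by
      rw [hr, Complex.exp_ofReal_mul_I_re, ← hφ, Real.cos_abs]
    have hφ1 := abs_le.1 hφ.le
    have e := integral_cpow_mul_exp_neg' hs (hrre ▸ hcos : 0 < r.re)
    have e1 : ‖r ^ (-s)‖ = Real.exp (φ * s.im) := by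
      rw [hr, exp_mul_I_cpow (by linarith) (by linarith), Complex.norm_exp]
      simp
    have e2 : ‖∫ t : ℝ in Ioi 0, (t : ℂ) ^ (s - 1) * Complex.exp (-(r * t))‖ ≤ I1 := by
      refine norm_integral_le_of_norm_le ((integrableOn_rpow_mul_exp_neg ha hcos).add
        (integrableOn_rpow_mul_exp_neg (ha.trans_le hab) hcos)) ?_
      filter_upwards [ae_restrict_mem measurableSet_Ioi] with t ht
      have ht0 : 0 < t := ht
      rw [norm_cpow_mul_exp ht0, hrre, ← add_mul]
      gcongr
      rcases le_total 1 t with h | h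
      · have := Real.rpow_le_rpow_of_exponent_le h (by linarith : s.re - 1 ≤ b - 1)
        have h0 : 0 ≤ t ^ (a - 1) := by positivity
        linarith
      · have := Real.rpow_le_rpow_of_exponent_ge ht0 h (by linarith : a - 1 ≤ s.re - 1)
        have h0 : 0 ≤ t ^ (b - 1) := by positivity
        linarith
    rw [e, norm_mul, e1] at e2
    rw [Real.exp_neg, ← div_eq_mul_inv, le_div_iff₀ (Real.exp_pos _)]
    linarith
  have hθ0 : 0 ≤ θ := by linarith
  rcases le_total 0 s.im with h | h
  · have := key θ (abs_of_nonneg hθ0)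
    rwa [abs_of_nonneg h]
  · have := key (-θ) (by rw [abs_neg, abs_of_nonneg hθ0])
    rw [abs_of_nonpos h]
    simpa using this

/-- Exponential decay of the Gamma function on vertical strips. -/
theorem exists_norm_Gamma_le (a b : ℝ) {δ : ℝ} (hδ : 0 < δ) (hδ2 : δ < Real.pi / 2) :
    ∃ C, ∀ s : ℂ, a ≤ s.re → s.re ≤ b → 1 ≤ |s.im| →
      ‖Complex.Gamma s‖ ≤ C * Real.exp (-((Real.pi / 2 - δ) * |s.im|)) := by
  obtain ⟨k, hk⟩ := exists_nat_gt (-a)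
  -- Negative real parts are reached by `Γ(s + 1) = s Γ(s)`; here `|Im s| ≥ 1` gives `|s| ≥ 1`, so
  -- nothing is lost.
  have main : ∀ k : ℕ, ∀ a b : ℝ, -a < k → ∃ C, ∀ s : ℂ, a ≤ s.re → s.re ≤ b → 1 ≤ |s.im| →
      ‖Complex.Gamma s‖ ≤ C * Real.exp (-((Real.pi / 2 - δ) * |s.im|)) := by
    intro k
    induction k with
    | zero =>
      intro a b ha
      obtain ⟨C, hC⟩ := exists_norm_Gamma_le_of_pos (a := a) (b := b) (by simpa using ha) hδ hδ2
      exact ⟨C, fun s h1 h2 _ => hC s h1 h2⟩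
    | succ k ih =>
      intro a b ha
      obtain ⟨C, hC⟩ := ih (a + 1) (b + 1) (by push_cast at ha; linarith)
      refine ⟨C, fun s h1 h2 h3 => ?_⟩
      have hs : s ≠ 0 := by rintro rfl; simp at h3; linarith
      have h4 := hC (s + 1) (by simpa using h1) (by simpa using h2) (by simpa using h3)
      rw [Complex.Gamma_add_one s hs, norm_mul] at h4
      have h5 : 1 ≤ ‖s‖ := h3.trans (Complex.abs_im_le_norm s)
      have h6 : ‖Complex.Gamma s‖ ≤ ‖s‖ * ‖Complex.Gamma s‖ :=
        le_mul_of_one_le_left (norm_nonneg _) h5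
      simpa using h6.trans h4
  exact main k a b hk

/-! ### Contour shifts, and functions with their Mellin transforms along rays -/

theorem integrable_exp_neg_mul_abs {c : ℝ} (hc : 0 < c) :
    Integrable fun y : ℝ => Real.exp (-(c * |y|)) := by
  have h1 : IntegrableOn (fun y : ℝ => Real.exp (-(c * |y|))) (Ioi 0) := by
    have := integrableOn_exp_mul_Ioi (a := -c) (by linarith) 0
    refine this.congr_fun (fun y (hy : 0 < y) => ?_) measurableSet_Ioi
    simp only [abs_of_pos hy, neg_mul]
  have h2 : IntegrableOn (fun y : ℝ => Real.exp (-(c * |y|))) (Iic 0) := by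
    have := integrableOn_exp_mul_Iic (a := c) hc 0
    refine this.congr_fun (fun y (hy : y ≤ 0) => ?_) measurableSet_Iic
    simp only [abs_of_nonpos hy, mul_neg, neg_neg]
  rw [← integrableOn_univ, ← Iic_union_Ioi (a := (0 : ℝ))]
  exact h2.union h1

theorem integrable_vertical {G : ℂ → ℂ} (hG : Continuous G) {a C c : ℝ} (hc : 0 < c)
    (hb : ∀ s : ℂ, s.re = a → ‖G s‖ ≤ C * Real.exp (-(c * |s.im|))) :
    Integrable fun y : ℝ => G (a + y * Complex.I) := by
  refine ((integrable_exp_neg_mul_abs hc).const_mul C).mono'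
    (Continuous.aestronglyMeasurable (by fun_prop)) (Eventually.of_forall fun y => ?_)
  have := hb (a + y * Complex.I) (by simp)
  simpa using this

/-- Shifting a vertical line of integration. -/
theorem integral_vertical_eq {G : ℂ → ℂ} (hG : Differentiable ℂ G) {a b C c : ℝ} (hab : a ≤ b)
    (hc : 0 < c) (hb : ∀ s : ℂ, a ≤ s.re → s.re ≤ b → ‖G s‖ ≤ C * Real.exp (-(c * |s.im|))) :
    ∫ y : ℝ, G (a + y * Complex.I) = ∫ y : ℝ, G (b + y * Complex.I) := by
  have hia := integrable_vertical hG.continuous hc (a := a) fun s hs => hb s hs.ge (by linarith)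
  have hib := integrable_vertical hG.continuous hc (a := b) fun s hs => hb s (by linarith) hs.le
  have ta := intervalIntegral_tendsto_integral hia tendsto_neg_atTop_atBot tendsto_id
  have tb := intervalIntegral_tendsto_integral hib tendsto_neg_atTop_atBot tendsto_id
  have hdec : Tendsto (fun T : ℝ => C * Real.exp (-(c * |T|)) * |b - a|) atTop (𝓝 0) := by
    have h1 : Tendsto (fun T : ℝ => -(c * |T|)) atTop atBot :=
      tendsto_neg_atTop_atBot.comp (tendsto_abs_atTop_atTop.const_mul_atTop hc)
    have := ((Real.tendsto_exp_atBot.comp h1).const_mul C).mul_const |b - a|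
    simpa using this
  have hhor : ∀ ε : ℝ, |ε| = 1 → Tendsto (fun T : ℝ => ∫ x : ℝ in a..b,
      G (x + (ε * T : ℝ) * Complex.I))
      atTop (𝓝 0) := by
    intro ε hε
    refine squeeze_zero_norm (fun T => ?_) hdec
    refine intervalIntegral.norm_integral_le_of_norm_le_const fun x hx => ?_
    rw [uIoc_of_le hab] at hx
    have := hb (x + (ε * T : ℝ) * Complex.I) (by simpa using hx.1.le) (by simpa using hx.2)
    have him : |((x : ℂ) + (ε * T : ℝ) * Complex.I).im| = |T| := by
      simp [abs_mul, hε]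
    rwa [him] at this
  have h0 := hhor (-1) (by simp)
  have h1 := hhor 1 (by simp)
  have hrect : ∀ T : ℝ, (∫ x : ℝ in a..b, G (x + ((-1) * T : ℝ) * Complex.I))
      - (∫ x : ℝ in a..b, G (x + (1 * T : ℝ) * Complex.I))
      + Complex.I * (∫ y : ℝ in (-T)..T, G (b + y * Complex.I))
      - Complex.I * (∫ y : ℝ in (-T)..T, G (a + y * Complex.I)) = 0 := by
    intro T
    have := Complex.integral_boundary_rect_eq_zero_of_differentiableOn G
      (⟨a, -T⟩ : ℂ) (⟨b, T⟩ : ℂ) hG.differentiableOn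
    simpa using this
  have hlim := ((h0.sub h1).add (tb.const_mul Complex.I)).sub (ta.const_mul Complex.I)
  have hlim2 : Tendsto (fun _ : ℝ => (0 : ℂ)) atTop (𝓝 (0 - 0 + Complex.I *
      (∫ y : ℝ, G (b + y * Complex.I)) - Complex.I * ∫ y : ℝ, G (a + y * Complex.I))) :=
    hlim.congr fun T => hrect T
  have h2 := tendsto_nhds_unique hlim2 tendsto_const_nhds
  rw [sub_zero, zero_add, ← mul_sub] at h2
  have h3 := (mul_eq_zero.1 h2).resolve_left Complex.I_ne_zero
  exact (sub_eq_zero.1 h3).symm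

/-- `f` is holomorphic in the right half plane, `O ((Re z) ^ (-σ))` for all `σ > σ₀`, and
`g` is its Mellin transform in `Re s > σ₀`, along all rays. -/
structure IsMellinPair (σ₀ : ℝ) (f g : ℂ → ℂ) : Prop where
  differentiableAt : ∀ z : ℂ, 0 < z.re → DifferentiableAt ℂ f z
  bound : ∀ σ, σ₀ < σ → ∃ C, ∀ z : ℂ, 0 < z.re → ‖f z‖ ≤ C * z.re ^ (-σ)
  mellin_eq : ∀ φ : ℝ, |φ| < Real.pi / 2 → ∀ s : ℂ, σ₀ < s.re →
    mellin (fun x : ℝ => f (x * Complex.exp (φ * Complex.I))) s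
      = Complex.exp (-(φ * Complex.I * s)) * g s

theorem re_mul_exp_mul_I (x φ : ℝ) :
    ((x : ℂ) * Complex.exp (φ * Complex.I)).re = x * Real.cos φ := by
  rw [Complex.re_ofReal_mul, Complex.exp_ofReal_mul_I_re]

theorem cos_pos_of_abs_lt {φ : ℝ} (h : |φ| < Real.pi / 2) : 0 < Real.cos φ := by
  obtain ⟨h1, h2⟩ := abs_lt.1 h
  exact Real.cos_pos_of_mem_Ioo ⟨h1, h2⟩

namespace IsMellinPair

variable {σ₀ : ℝ} {f f' g g' : ℂ → ℂ}

theorem continuousOn_ray (h : IsMellinPair σ₀ f g) {φ : ℝ} (hφ : |φ| < Real.pi / 2) :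
    ContinuousOn (fun x : ℝ => f (x * Complex.exp (φ * Complex.I))) (Ioi 0) := by
  intro x (hx : 0 < x)
  have h1 : ContinuousAt f (x * Complex.exp (φ * Complex.I)) :=
    (h.differentiableAt _ (by
      rw [re_mul_exp_mul_I]; exact mul_pos hx (cos_pos_of_abs_lt hφ))).continuousAt
  have h2 : ContinuousAt (fun x : ℝ => (x : ℂ) * Complex.exp (φ * Complex.I)) x := by fun_prop
  exact (ContinuousAt.comp (f := fun x : ℝ => (x : ℂ) * Complex.exp (φ * Complex.I)) h1
    h2).continuousWithinAt

theorem isBigO_ray (h : IsMellinPair σ₀ f g) {φ : ℝ} (hφ : |φ| < Real.pi / 2) {σ : ℝ}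
    (hσ : σ₀ < σ) {l : Filter ℝ} (hl : ∀ᶠ x in l, 0 < x) :
    (fun x : ℝ => f (x * Complex.exp (φ * Complex.I))) =O[l] fun x => x ^ (-σ) := by
  obtain ⟨C, hC⟩ := h.bound σ hσ
  have hc := cos_pos_of_abs_lt hφ
  refine IsBigO.of_bound (C * Real.cos φ ^ (-σ)) ?_
  filter_upwards [hl] with x hx
  have := hC (x * Complex.exp (φ * Complex.I)) (by rw [re_mul_exp_mul_I]; positivity)
  rw [re_mul_exp_mul_I, Real.mul_rpow hx.le hc.le] at this
  rw [Real.norm_of_nonneg (by positivity)]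
  linarith

theorem mellinConvergent (h : IsMellinPair σ₀ f g) {φ : ℝ} (hφ : |φ| < Real.pi / 2) {s : ℂ}
    (hs : σ₀ < s.re) :
    MellinConvergent (fun x : ℝ => f (x * Complex.exp (φ * Complex.I))) s := by
  obtain ⟨σ, h1, h2⟩ := exists_between hs
  refine mellinConvergent_of_isBigO_rpow (a := s.re + 1) (b := σ)
    ((h.continuousOn_ray hφ).locallyIntegrableOn measurableSet_Ioi)
    (h.isBigO_ray hφ (by linarith) (eventually_gt_atTop 0)) (by linarith)
    (h.isBigO_ray hφ h1 self_mem_nhdsWithin) h2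

theorem add (h : IsMellinPair σ₀ f g) (h' : IsMellinPair σ₀ f' g') :
    IsMellinPair σ₀ (f + f') (g + g') where
  differentiableAt z hz := (h.differentiableAt z hz).add (h'.differentiableAt z hz)
  bound σ hσ := by
    obtain ⟨C, hC⟩ := h.bound σ hσ
    obtain ⟨C', hC'⟩ := h'.bound σ hσ
    refine ⟨C + C', fun z hz => (norm_add_le _ _).trans ?_⟩
    linarith [hC z hz, hC' z hz]
  mellin_eq φ hφ s hs := by
    have := (hasMellin_add (h.mellinConvergent hφ hs) (h'.mellinConvergent hφ hs)).2
    rw [h.mellin_eq φ hφ s hs, h'.mellin_eq φ hφ s hs, ← mul_add] at this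
    exact this

theorem const_smul (h : IsMellinPair σ₀ f g) (c : ℂ) : IsMellinPair σ₀ (c • f) (c • g) where
  differentiableAt z hz := (h.differentiableAt z hz).const_smul c
  bound σ hσ := by
    obtain ⟨C, hC⟩ := h.bound σ hσ
    refine ⟨‖c‖ * C, fun z hz => ?_⟩
    rw [Pi.smul_apply, norm_smul, mul_assoc]
    gcongr
    exact hC z hz
  mellin_eq φ hφ s hs := by
    have := (hasMellin_const_smul (h.mellinConvergent hφ hs) c).2
    rw [h.mellin_eq φ hφ s hs] at this
    simp only [Pi.smul_apply, smul_eq_mul] at this ⊢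
    rw [this]
    ring

theorem dilation (h : IsMellinPair σ₀ f g) {lam : ℝ} (hl : 0 < lam) :
    IsMellinPair σ₀ (fun z => f (lam * z)) (fun s => (lam : ℂ) ^ (-s) * g s) where
  differentiableAt z hz := by
    have : 0 < (lam * z : ℂ).re := by rw [Complex.re_ofReal_mul]; positivity
    exact (h.differentiableAt _ this).comp z (by fun_prop)
  bound σ hσ := by
    obtain ⟨C, hC⟩ := h.bound σ hσ
    refine ⟨C * lam ^ (-σ), fun z hz => ?_⟩
    have := hC (lam * z) (by rw [Complex.re_ofReal_mul]; positivity)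
    rw [Complex.re_ofReal_mul, Real.mul_rpow hl.le hz.le] at this
    linarith
  mellin_eq φ hφ s hs := by
    have e : (fun x : ℝ => f (lam * (x * Complex.exp (φ * Complex.I))))
        = fun x : ℝ => (fun y : ℝ => f (y * Complex.exp (φ * Complex.I))) (lam * x) := by
      ext x
      push_cast
      ring_nf
    rw [e, mellin_comp_mul_left (fun y : ℝ => f (y * Complex.exp (φ * Complex.I))) s hl,
      h.mellin_eq φ hφ s hs, smul_eq_mul]
    ring

theorem congr (h : IsMellinPair σ₀ f g) (hg : ∀ s : ℂ, σ₀ < s.re → g s = g' s) :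
    IsMellinPair σ₀ f g' where
  differentiableAt := h.differentiableAt
  bound := h.bound
  mellin_eq φ hφ s hs := by rw [h.mellin_eq φ hφ s hs, hg s hs]

end IsMellinPair

/-- The operator `f ↦ f (lam ·)`. -/
def dilationOp (lam : ℝ) : (ℂ → ℂ) →ₗ[ℂ] (ℂ → ℂ) where
  toFun f z := f (lam * z)
  map_add' _ _ := rfl
  map_smul' _ _ := rfl

/-- Dilation by `lam` becomes multiplication by `lam ^ (-s)`, so a polynomial in the dilation
operator becomes the same polynomial in `lam ^ (-s)`. -/
theorem IsMellinPair.aeval {σ₀ : ℝ} {f g : ℂ → ℂ} (h : IsMellinPair σ₀ f g) {lam : ℝ}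
    (hl : 0 < lam) (P : Polynomial ℂ) :
    IsMellinPair σ₀ (Polynomial.aeval (dilationOp lam) P f)
      (fun s => P.eval ((lam : ℂ) ^ (-s)) * g s) := by
  induction P using Polynomial.induction_on with
  | C a =>
    rw [Polynomial.aeval_C]
    refine (h.const_smul a).congr fun s _ => ?_
    simp
  | add p q hp hq =>
    rw [map_add, LinearMap.add_apply]
    refine (hp.add hq).congr fun s _ => ?_
    simp [add_mul]
  | monomial k a ih =>
    have e : Polynomial.aeval (dilationOp lam) (Polynomial.C a * Polynomial.X ^ (k + 1)) f
        = fun z => (Polynomial.aeval (dilationOp lam) (Polynomial.C a * Polynomial.X ^ k) f)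
          (lam * z) := by
      rw [pow_succ', ← mul_assoc, mul_comm (Polynomial.C a), mul_assoc, map_mul, Polynomial.aeval_X,
        Module.End.mul_apply]
      rfl
    rw [e]
    refine (ih.dilation hl).congr fun s _ => ?_
    simp [pow_succ]
    ring

/-- The function `∑ m(x) e ^ (-x z)`. -/
noncomputable def expSum (m : ℝ → ℕ) (z : ℂ) : ℂ := ∑' x : ℝ, (m x : ℂ) * Complex.exp (-(x * z))

theorem exp_neg_le_rpow {σ y : ℝ} (hσ : 0 < σ) (hy : 0 < y) :
    Real.exp (-y) ≤ σ ^ σ * y ^ (-σ) := by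
  have h1 : y / σ ≤ Real.exp (y / σ) := by linarith [Real.add_one_le_exp (y / σ)]
  have h2 : (y / σ) ^ σ ≤ Real.exp y := by
    calc (y / σ) ^ σ ≤ (Real.exp (y / σ)) ^ σ := by gcongr
      _ = Real.exp y := by rw [← Real.exp_mul]; congr 1; field_simp
  rw [Real.div_rpow hy.le hσ.le, div_le_iff₀ (by positivity)] at h2
  rw [Real.exp_neg, Real.rpow_neg hy.le, ← div_eq_mul_inv, inv_le_comm₀ (Real.exp_pos _)
    (by positivity), inv_div, div_le_iff₀ (by positivity)]
  linarith

theorem norm_expSum_term {m : ℝ → ℕ} (x : ℝ) (z : ℂ) :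
    ‖(m x : ℂ) * Complex.exp (-(x * z))‖ = (m x : ℝ) * Real.exp (-(x * z.re)) := by
  rw [norm_mul, Complex.norm_natCast, Complex.norm_exp, Complex.neg_re, Complex.re_ofReal_mul]

theorem norm_expSum_term_le {m : ℝ → ℕ} (hm : ∀ x ≤ 0, m x = 0) {σ : ℝ} (hσ : 0 < σ) (x : ℝ)
    {z : ℂ} (hz : 0 < z.re) : ‖(m x : ℂ) * Complex.exp (-(x * z))‖
      ≤ (m x : ℝ) * x ^ (-σ) * (σ ^ σ * z.re ^ (-σ)) := by
  rw [norm_expSum_term]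
  by_cases hx : m x = 0
  · simp [hx]
  have hx0 : 0 < x := by by_contra h; exact hx (hm x (not_lt.1 h))
  have := exp_neg_le_rpow hσ (mul_pos hx0 hz)
  rw [Real.mul_rpow hx0.le hz.le] at this
  calc _ ≤ (m x : ℝ) * (σ ^ σ * (x ^ (-σ) * z.re ^ (-σ))) := by gcongr
    _ = _ := by ring

/-- Termwise Gamma integrals along a ray; the bound comes from `exp (-y) ≤ σ ^ σ y ^ (-σ)`, which
trades the exponential for the convergent series of `x ^ (-σ)`. -/
theorem isMellinPair_expSum {m : ℝ → ℕ} (hm : ∀ x ≤ 0, m x = 0) {σ₀ : ℝ} (hσ₀ : 0 < σ₀)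
    (hs : ∀ σ, σ₀ < σ → Summable fun x : ℝ => (m x : ℝ) * x ^ (-σ)) :
    IsMellinPair σ₀ (expSum m) (fun s => dirichlet m s * Complex.Gamma s) where
  differentiableAt z hz := by
    obtain ⟨ε, h1, h2⟩ := exists_between hz
    set U := {z : ℂ | ε < z.re}
    have hU : IsOpen U := isOpen_lt continuous_const Complex.continuous_re
    set σ := σ₀ + 1
    have hσ : 0 < σ := by positivity
    refine DifferentiableOn.differentiableAt (s := U) ?_ (hU.mem_nhds h2)
    refine Complex.differentiableOn_tsum_of_summable_norm
      (u := fun x => (m x : ℝ) * x ^ (-σ) * (σ ^ σ * ε ^ (-σ)))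
      ((hs σ (by simp [σ])).mul_right _) (fun x => by fun_prop) hU (fun x z hz' => ?_)
    have hz'' : ε < z.re := hz'
    refine (norm_expSum_term_le hm hσ x (h1.trans hz'')).trans ?_
    by_cases hx : m x = 0
    · simp [hx]
    have hx0 : 0 < x := by by_contra h; exact hx (hm x (not_lt.1 h))
    have : z.re ^ (-σ) ≤ ε ^ (-σ) := Real.rpow_le_rpow_of_nonpos h1 hz''.le (by linarith)
    gcongr
  bound σ hσ := by
    have hσ0 : 0 < σ := hσ₀.trans hσ
    refine ⟨(∑' x, (m x : ℝ) * x ^ (-σ)) * σ ^ σ, fun z hz => ?_⟩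
    have := tsum_of_norm_bounded ((hs σ hσ).hasSum.mul_right (σ ^ σ * z.re ^ (-σ)))
      fun x => norm_expSum_term_le hm hσ0 x hz
    rw [mul_assoc]
    exact this
  mellin_eq φ hφ s hsr := by
    set τ := Complex.exp (φ * Complex.I) with hτ
    have hc := cos_pos_of_abs_lt hφ
    have hτre : τ.re = Real.cos φ := Complex.exp_ofReal_mul_I_re φ
    have hs0 : 0 < s.re := hσ₀.trans hsr
    have hpi := Real.pi_pos
    obtain ⟨hφ1, hφ2⟩ := abs_lt.1 hφ
    set T := {x | m x ≠ 0}
    have hTpos : ∀ x : T, 0 < (x : ℝ) := fun x => by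
      by_contra h; exact x.2 (hm x (not_lt.1 h))
    have hTc : Countable T := ((hs s.re hsr).countable_support.mono fun x hx => by
      have hx0 := hTpos ⟨x, hx⟩
      have : (m x : ℝ) ≠ 0 := by exact_mod_cast hx
      have hx1 : 0 < x := hx0
      change (m x : ℝ) * x ^ (-s.re) ≠ 0
      positivity)
    have hsub : ∀ F : ℝ → ℂ, (Function.support fun x => (m x : ℂ) * F x) ⊆ T := fun F x hx h0 => by
      simp [h0] at hx
    set G : T → ℝ → ℂ := fun x t => (t : ℂ) ^ (s - 1) *
      ((m x : ℂ) * Complex.exp (-((x : ℝ) * (t * τ)))) with hG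
    have hG' : ∀ x : T, ∀ t : ℝ, G x t = (m x : ℂ) *
        ((t : ℂ) ^ (s - 1) * Complex.exp (-(((x : ℝ) * τ) * t))) := fun x t => by
      rw [hG]; ring_nf
    have hxre : ∀ x : T, 0 < ((x : ℝ) * τ).re := fun x => by
      rw [Complex.re_ofReal_mul, hτre]; exact mul_pos (hTpos x) hc
    have hint : ∀ x : T, Integrable (G x) ((volume : Measure ℝ).restrict (Ioi 0)) := fun x => by
      simp_rw [funext (hG' x)]
      exact (integrableOn_cpow_mul_exp_neg' hs0 (hxre x)).const_mul _
    have hnorm : ∀ x : T, ∫ t in Ioi (0 : ℝ), ‖G x t‖ =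
        ((m x : ℝ) * (x : ℝ) ^ (-s.re)) * (Real.cos φ ^ (-s.re) * Real.Gamma s.re) := by
      intro x
      have e1 : ∫ t in Ioi (0 : ℝ), ‖G x t‖ = ∫ t in Ioi (0 : ℝ), (m x : ℝ) *
          (t ^ (s.re - 1) * Real.exp (-((x * Real.cos φ) * t))) := by
        refine setIntegral_congr_fun measurableSet_Ioi fun t (ht : 0 < t) => ?_
        rw [hG', norm_mul, norm_cpow_mul_exp ht, Complex.norm_natCast, Complex.re_ofReal_mul, hτre]
      rw [e1, integral_const_mul, Real.integral_rpow_mul_exp_neg_mul_Ioi hs0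
        (mul_pos (hTpos x) hc), one_div, Real.inv_rpow (mul_pos (hTpos x) hc).le,
        ← Real.rpow_neg (mul_pos (hTpos x) hc).le, Real.mul_rpow (hTpos x).le hc.le]
      ring
    have hsum := hasSum_integral_of_summable_integral_norm (F := G)
      (μ := (volume : Measure ℝ).restrict (Ioi 0)) hint (by
        simp_rw [hnorm]
        exact ((hs s.re hsr).subtype T).mul_right _)
    have e2 : mellin (fun x : ℝ => expSum m (x * τ)) s = ∫ t in Ioi (0 : ℝ), ∑' x : T, G x t := by
      rw [mellin]
      refine setIntegral_congr_fun measurableSet_Ioi fun t (ht : 0 < t) => ?_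
      simp only [hG, smul_eq_mul]
      rw [tsum_mul_left, expSum, ← tsum_subtype_eq_of_support_subset (hsub _)]
    have hval : ∀ x : T, ∫ t in Ioi (0 : ℝ), G x t = (m x : ℂ) * ((x : ℝ) : ℂ) ^ (-s) *
        (Complex.exp (-(φ * Complex.I * s)) * Complex.Gamma s) := by
      intro x
      have e3 : ∫ t in Ioi (0 : ℝ), G x t = (m x : ℂ) *
          mellin (fun t : ℝ => (fun y : ℝ => Complex.exp (-(τ * y))) (x * t)) s := by
        rw [mellin, ← integral_const_mul]
        refine setIntegral_congr_fun measurableSet_Ioi fun t (ht : 0 < t) => ?_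
        simp only [hG', smul_eq_mul]
        push_cast
        ring_nf
      have e4 : mellin (fun y : ℝ => Complex.exp (-(τ * y))) s = τ ^ (-s) * Complex.Gamma s := by
        rw [mellin]
        simp only [smul_eq_mul]
        exact integral_cpow_mul_exp_neg' hs0 (hτre ▸ hc)
      rw [e3, mellin_comp_mul_left (fun y : ℝ => Complex.exp (-(τ * y))) s (hTpos x), e4, hτ,
        exp_mul_I_cpow (by linarith) (by linarith), smul_eq_mul, mul_neg]
      ring
    rw [e2, ← hsum.tsum_eq]
    simp_rw [hval]
    rw [tsum_mul_right, dirichlet, ← tsum_subtype_eq_of_support_subset (hsub _)]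
    ring

/-! ### Flat functions and their periodisation under dilation -/

/-- `h` is `O (‖z‖ ^ M)` for all `M` in every closed sector inside the right half plane. -/
def IsFlat (h : ℂ → ℂ) : Prop :=
  ∀ c : ℝ, 0 < c → ∀ M : ℝ, ∃ C, ∀ z : ℂ, z ≠ 0 → c * ‖z‖ ≤ z.re → ‖h z‖ ≤ C * ‖z‖ ^ M

/-- `F` decays like the Gamma function on vertical strips. -/
def HasGammaDecay (F : ℂ → ℂ) : Prop :=
  ∀ a b δ : ℝ, 0 < δ → δ < Real.pi / 2 → ∃ C, ∀ s : ℂ, a ≤ s.re → s.re ≤ b →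
    ‖F s‖ ≤ C * Real.exp (-((Real.pi / 2 - δ) * |s.im|))

/-- Mellin inversion on a line to the right of `σ₀`, shifted to `Re s = -M`, where `x ^ (-s)` has
modulus `x ^ M`. No residues arise as `F` is entire. -/
theorem IsMellinPair.exists_norm_ray_le {σ₀ : ℝ} {f F : ℂ → ℂ} (h : IsMellinPair σ₀ f F)
    (hF : Differentiable ℂ F) (hFd : HasGammaDecay F) {φ₀ : ℝ} (hφ₀ : φ₀ < Real.pi / 2)
    (hφ₀' : 0 ≤ φ₀) (M : ℝ) :
    ∃ C, ∀ φ : ℝ, |φ| ≤ φ₀ → ∀ x : ℝ, 0 < x →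
      ‖f (x * Complex.exp (φ * Complex.I))‖ ≤ C * x ^ M := by
  set σ := |σ₀| + 1 + |M| with hσ
  have hσ1 : σ₀ < σ := by rw [hσ]; linarith [le_abs_self σ₀, abs_nonneg M]
  have hσ2 : -M ≤ σ := by rw [hσ]; linarith [neg_le_abs M, abs_nonneg σ₀]
  -- Rotation by `φ` costs at most `exp (φ₀ |Im s|)`. Half of the gap between `φ₀` and `π / 2` is
  -- spent in the decay of `F`, and the other half leaves `exp (-δ |Im s|)`.
  set δ := (Real.pi / 2 - φ₀) / 2 with hδ
  have hδ0 : 0 < δ := by rw [hδ]; linarith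
  obtain ⟨C, hC⟩ := hFd (-M) σ δ hδ0 (by rw [hδ]; linarith [Real.pi_pos])
  have hC0 : 0 ≤ C := by
    have := (norm_nonneg _).trans (hC σ (by simpa using hσ2) (by simp))
    simpa using this
  set I1 := ∫ y : ℝ, Real.exp (-(δ * |y|))
  refine ⟨1 / (2 * Real.pi) * (C * I1), fun φ hφ x hx => ?_⟩
  have hφ2 : |φ| < Real.pi / 2 := hφ.trans_lt hφ₀
  have hxc : (x : ℂ) ≠ 0 := by exact_mod_cast hx.ne'
  set E : ℂ → ℂ := fun s => (x : ℂ) ^ (-s) * (Complex.exp (-(φ * Complex.I * s)) * F s) with hE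
  have hEd : Differentiable ℂ E := by
    have h1 : Differentiable ℂ fun s : ℂ => (x : ℂ) ^ (-s) := fun s =>
      (differentiableAt_id.neg).const_cpow (Or.inl hxc)
    exact h1.mul ((by fun_prop : Differentiable ℂ fun s : ℂ =>
      Complex.exp (-(φ * Complex.I * s))).mul hF)
  have hEn : ∀ s : ℂ, -M ≤ s.re → s.re ≤ σ →
      ‖E s‖ ≤ x ^ (-s.re) * (C * Real.exp (-(δ * |s.im|))) := by
    intro s h1 h2
    have e1 : ‖Complex.exp (-(φ * Complex.I * s))‖ ≤ Real.exp (φ₀ * |s.im|) := by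
      rw [Complex.norm_exp]
      refine Real.exp_le_exp.2 ?_
      have : (-(φ * Complex.I * s)).re = φ * s.im := by simp
      rw [this]
      calc φ * s.im ≤ |φ * s.im| := le_abs_self _
        _ = |φ| * |s.im| := abs_mul _ _
        _ ≤ φ₀ * |s.im| := by gcongr
    have e2 := hC s h1 h2
    have e3 : Real.exp (φ₀ * |s.im|) * Real.exp (-((Real.pi / 2 - δ) * |s.im|))
        = Real.exp (-(δ * |s.im|)) := by
      rw [← Real.exp_add]
      congr 1
      rw [hδ]; ring
    rw [hE]
    simp only [norm_mul, Complex.norm_cpow_eq_rpow_re_of_pos hx, Complex.neg_re]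
    rw [← e3]
    calc _ ≤ x ^ (-s.re) * (Real.exp (φ₀ * |s.im|) *
          (C * Real.exp (-((Real.pi / 2 - δ) * |s.im|)))) := by gcongr
      _ = _ := by ring
  have hshift := integral_vertical_eq hEd hσ2 hδ0 (C := (x ^ M + x ^ (-σ)) * C) (fun s h1 h2 => by
    refine (hEn s h1 h2).trans ?_
    rw [mul_assoc]
    gcongr
    rcases le_total 1 x with hx1 | hx1
    · have := Real.rpow_le_rpow_of_exponent_le hx1 (by linarith : -s.re ≤ M)
      have h0 : 0 ≤ x ^ (-σ) := by positivity
      linarith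
    · have := Real.rpow_le_rpow_of_exponent_ge hx hx1 (by linarith : -σ ≤ -s.re)
      have h0 : 0 ≤ x ^ M := by positivity
      linarith)
  set f1 : ℝ → ℂ := fun x => f (x * Complex.exp (φ * Complex.I)) with hf1
  have hline : ∀ y : ℝ, mellin f1 (σ + y * Complex.I)
      = Complex.exp (-(φ * Complex.I * (σ + y * Complex.I))) * F (σ + y * Complex.I) := fun y =>
    h.mellin_eq φ hφ2 _ (by simpa using hσ1)
  have hvi : Complex.VerticalIntegrable (mellin f1) σ := by
    rw [Complex.VerticalIntegrable]
    simp_rw [hline]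
    have hd : Continuous fun s : ℂ => Complex.exp (-(φ * Complex.I * s)) * F s :=
      (by fun_prop : Continuous fun s : ℂ => Complex.exp (-(φ * Complex.I * s))).mul hF.continuous
    refine integrable_vertical (G := fun s : ℂ => Complex.exp (-(φ * Complex.I * s)) * F s) hd hδ0
      (C := C) fun s hs => ?_
    have h1 := hEn s (by linarith) (by linarith)
    rw [hE] at h1
    simp only [norm_mul (_ ^ _), Complex.norm_cpow_eq_rpow_re_of_pos hx, Complex.neg_re] at h1
    exact le_of_mul_le_mul_left h1 (by positivity)
  have hinv := mellinInv_mellin_eq σ f1 hx (by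
      exact h.mellinConvergent hφ2 (by simpa using hσ1)) hvi
    ((h.continuousOn_ray hφ2).continuousAt (Ioi_mem_nhds hx))
  have e4 : f1 x = (1 / (2 * Real.pi) : ℝ) • ∫ y : ℝ, E ((-M : ℝ) + y * Complex.I) := by
    rw [← hinv, mellinInv, hshift]
    congr 1
    refine integral_congr_ae (Eventually.of_forall fun y => ?_)
    simp only [hline, hE, smul_eq_mul]
  change ‖f1 x‖ ≤ _
  have hpi := Real.pi_pos
  rw [e4, norm_smul, Real.norm_of_nonneg (by positivity), mul_assoc]
  gcongr
  have e5 : ‖∫ y : ℝ, E ((-M : ℝ) + y * Complex.I)‖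
      ≤ ∫ y : ℝ, x ^ M * (C * Real.exp (-(δ * |y|))) := by
    refine norm_integral_le_of_norm_le (((integrable_exp_neg_mul_abs hδ0).const_mul _).const_mul _)
      (Eventually.of_forall fun y => ?_)
    have := hEn ((-M : ℝ) + y * Complex.I) (by simp) (by simpa using hσ2)
    simpa using this
  refine e5.trans (le_of_eq ?_)
  rw [integral_const_mul, integral_const_mul]
  ring

/-- The sector `c ‖z‖ ≤ Re z` is `|arg z| ≤ arccos c`, an angle strictly below `π / 2`. -/
theorem IsMellinPair.isFlat {σ₀ : ℝ} {f F : ℂ → ℂ} (h : IsMellinPair σ₀ f F)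
    (hF : Differentiable ℂ F) (hFd : HasGammaDecay F) : IsFlat f := by
  intro c hc M
  rcases lt_or_ge 1 c with hc1 | hc1
  · refine ⟨0, fun z hz hcz => ?_⟩
    have h1 := Complex.re_le_norm z
    have h2 : 0 < ‖z‖ := norm_pos_iff.2 hz
    nlinarith
  obtain ⟨C, hC⟩ := h.exists_norm_ray_le hF hFd (φ₀ := Real.arccos c)
    (Real.arccos_lt_pi_div_two.2 hc) (Real.arccos_nonneg c) M
  refine ⟨C, fun z hz hcz => ?_⟩
  have hz0 : 0 < ‖z‖ := norm_pos_iff.2 hz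
  have h1 : c ≤ Real.cos |z.arg| := by
    rw [Real.cos_abs, Complex.cos_arg hz, le_div_iff₀ hz0]
    exact hcz
  have h2 : |z.arg| ≤ Real.arccos c := by
    rw [← Real.arccos_cos (abs_nonneg _) (Complex.abs_arg_le_pi z)]
    exact Real.antitone_arccos h1
  have h3 := hC z.arg h2 ‖z‖ hz0
  rwa [Complex.norm_mul_exp_arg_mul_I] at h3

theorem IsFlat.const_mul {h : ℂ → ℂ} (hh : IsFlat h) (a : ℂ) : IsFlat fun z => a * h z := by
  intro c hc M
  obtain ⟨C, hC⟩ := hh c hc M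
  refine ⟨‖a‖ * C, fun z hz hcz => ?_⟩
  rw [norm_mul, mul_assoc]
  gcongr
  exact hC z hz hcz

/-- The sum `∑ a ^ i h (lam ^ i z)` over all integers `i`. -/
noncomputable def periodize (lam : ℝ) (a : ℂ) (h : ℂ → ℂ) (z : ℂ) : ℂ :=
  ∑' i : ℤ, a ^ i * h ((lam ^ i : ℝ) * z)

theorem summable_half_pow_natAbs : Summable fun i : ℤ => (1 / 2 : ℝ) ^ i.natAbs := by
  refine Summable.of_nat_of_neg ?_ ?_ <;> simpa using summable_geometric_two

/-- Flatness offers every exponent, so one is chosen for each end of the sum: `|a| lam ^ M₁ = 1 / 2`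
for `i ≥ 0` and `|a| lam ^ M₂ = 2` for `i ≤ 0`. Both yield the ratio `1 / 2` in `|i|`, which makes
the two-sided sum converge for any `a ≠ 0`. -/
theorem IsFlat.exists_norm_term_le {h : ℂ → ℂ} (hh : IsFlat h) {lam : ℝ} (hl : 1 < lam) {a : ℂ}
    (ha : a ≠ 0) {c : ℝ} (hc : 0 < c) :
    ∃ C M₁ M₂ : ℝ, 0 ≤ C ∧ ∀ i : ℤ, ∀ z : ℂ, z ≠ 0 → c * ‖z‖ ≤ z.re →
      ‖a ^ i * h ((lam ^ i : ℝ) * z)‖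
        ≤ (1 / 2 : ℝ) ^ i.natAbs * (C * (‖z‖ ^ M₁ + ‖z‖ ^ M₂)) := by
  have hl0 : 0 < lam := by linarith
  have ha0 : 0 < ‖a‖ := norm_pos_iff.2 ha
  set M₁ := Real.logb lam (1 / (2 * ‖a‖)) with hM₁
  set M₂ := Real.logb lam (2 / ‖a‖) with hM₂
  have e1 : lam ^ M₁ = 1 / (2 * ‖a‖) := Real.rpow_logb hl0 hl.ne' (by positivity)
  have e2 : lam ^ M₂ = 2 / ‖a‖ := Real.rpow_logb hl0 hl.ne' (by positivity)
  obtain ⟨C₁, hC₁⟩ := hh c hc M₁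
  obtain ⟨C₂, hC₂⟩ := hh c hc M₂
  refine ⟨|C₁| + |C₂|, M₁, M₂, by positivity, fun i z hz hcz => ?_⟩
  have hz0 : 0 < ‖z‖ := norm_pos_iff.2 hz
  have hli : (0 : ℝ) < lam ^ i := by positivity
  have hn : ‖((lam ^ i : ℝ) : ℂ) * z‖ = lam ^ i * ‖z‖ := by
    rw [norm_mul, Complex.norm_real, Real.norm_of_nonneg hli.le]
  have hz1 : ((lam ^ i : ℝ) : ℂ) * z ≠ 0 := mul_ne_zero (by exact_mod_cast hli.ne') hz
  have hcz1 : c * ‖((lam ^ i : ℝ) : ℂ) * z‖ ≤ (((lam ^ i : ℝ) : ℂ) * z).re := by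
    rw [hn, Complex.re_ofReal_mul]
    calc c * (lam ^ i * ‖z‖) = lam ^ i * (c * ‖z‖) := by ring
      _ ≤ _ := by gcongr
  have hp1 : 0 < ‖z‖ ^ M₁ := by positivity
  have hp2 : 0 < ‖z‖ ^ M₂ := by positivity
  have hpow : ∀ M : ℝ, (lam ^ i * ‖z‖) ^ M = (lam ^ M) ^ i * ‖z‖ ^ M := fun M => by
    rw [Real.mul_rpow hli.le hz0.le, ← Real.rpow_intCast, ← Real.rpow_intCast,
      ← Real.rpow_mul hl0.le, ← Real.rpow_mul hl0.le, mul_comm (i : ℝ)]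
  rw [norm_mul, norm_zpow]
  rcases le_total 0 i with hi | hi
  · have h1 := hC₁ _ hz1 hcz1
    rw [hn, hpow, e1] at h1
    have h2 : ‖a‖ ^ i * (1 / (2 * ‖a‖)) ^ i = (1 / 2 : ℝ) ^ i.natAbs := by
      rw [← mul_zpow]
      have : ‖a‖ * (1 / (2 * ‖a‖)) = 1 / 2 := by field_simp
      rw [this, ← zpow_natCast, Int.natAbs_of_nonneg hi]
    calc ‖a‖ ^ i * ‖h (((lam ^ i : ℝ) : ℂ) * z)‖
        ≤ ‖a‖ ^ i * (C₁ * ((1 / (2 * ‖a‖)) ^ i * ‖z‖ ^ M₁)) := by gcongr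
      _ = (‖a‖ ^ i * (1 / (2 * ‖a‖)) ^ i) * (C₁ * ‖z‖ ^ M₁) := by ring
      _ ≤ _ := by
        rw [h2]
        gcongr
        · exact (le_abs_self C₁).trans (by linarith [abs_nonneg C₂])
        · linarith
  · have h1 := hC₂ _ hz1 hcz1
    rw [hn, hpow, e2] at h1
    have h2 : ‖a‖ ^ i * (2 / ‖a‖) ^ i = (1 / 2 : ℝ) ^ i.natAbs := by
      rw [← mul_zpow]
      have : ‖a‖ * (2 / ‖a‖) = 2 := by field_simp
      rw [this, ← zpow_natCast, Int.ofNat_natAbs_of_nonpos hi, one_div, inv_zpow', neg_neg]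
    calc ‖a‖ ^ i * ‖h (((lam ^ i : ℝ) : ℂ) * z)‖
        ≤ ‖a‖ ^ i * (C₂ * ((2 / ‖a‖) ^ i * ‖z‖ ^ M₂)) := by gcongr
      _ = (‖a‖ ^ i * (2 / ‖a‖) ^ i) * (C₂ * ‖z‖ ^ M₂) := by ring
      _ ≤ _ := by
        rw [h2]
        gcongr
        · exact (le_abs_self C₂).trans (by linarith [abs_nonneg C₁])
        · linarith

namespace IsFlat

variable {h : ℂ → ℂ} {lam : ℝ} {a : ℂ}

theorem summable_periodize (hh : IsFlat h) (hl : 1 < lam) (ha : a ≠ 0) {z : ℂ} (hz : 0 < z.re) :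
    Summable fun i : ℤ => a ^ i * h ((lam ^ i : ℝ) * z) := by
  have hz0 : z ≠ 0 := by rintro rfl; simp at hz
  have hzn : 0 < ‖z‖ := norm_pos_iff.2 hz0
  obtain ⟨C, M₁, M₂, _, hC⟩ := hh.exists_norm_term_le hl ha (c := z.re / ‖z‖) (by positivity)
  exact Summable.of_norm_bounded (summable_half_pow_natAbs.mul_right _) fun i =>
    hC i z hz0 (by rw [div_mul_cancel₀ _ hzn.ne'])

theorem differentiableAt_periodize (hh : IsFlat h) (hd : ∀ z : ℂ, 0 < z.re → DifferentiableAt ℂ h z)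
    (hl : 1 < lam) (ha : a ≠ 0) {z : ℂ} (hz : 0 < z.re) :
    DifferentiableAt ℂ (periodize lam a h) z := by
  have hl0 : 0 < lam := by linarith
  have hz0 : z ≠ 0 := by rintro rfl; simp at hz
  have hzn : 0 < ‖z‖ := norm_pos_iff.2 hz0
  set c := z.re / ‖z‖ / 2 with hc
  have hc0 : 0 < c := by positivity
  obtain ⟨C, M₁, M₂, hC0, hC⟩ := hh.exists_norm_term_le hl ha hc0
  set U := {y : ℂ | c * ‖y‖ < y.re} ∩ {y : ℂ | ‖z‖ / 2 < ‖y‖} ∩ {y : ℂ | ‖y‖ < 2 * ‖z‖} with hU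
  have hUo : IsOpen U := ((isOpen_lt (by fun_prop) Complex.continuous_re).inter
    (isOpen_lt (by fun_prop) (by fun_prop))).inter (isOpen_lt (by fun_prop) (by fun_prop))
  have hUre : ∀ y ∈ U, y ≠ 0 ∧ 0 < y.re := by
    rintro y ⟨⟨h1, h2⟩, _⟩
    have h2' : ‖z‖ / 2 < ‖y‖ := h2
    have h1' : c * ‖y‖ < y.re := h1
    have hy : 0 < ‖y‖ := by linarith
    exact ⟨norm_pos_iff.1 hy, lt_trans (by positivity) h1'⟩
  have hzU : z ∈ U := by
    refine ⟨⟨?_, ?_⟩, ?_⟩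
    · change c * ‖z‖ < z.re
      rw [hc]; field_simp; linarith
    · change ‖z‖ / 2 < ‖z‖; linarith
    · change ‖z‖ < 2 * ‖z‖; linarith
  have hpb : ∀ M : ℝ, ∀ y ∈ U, ‖y‖ ^ M ≤ (2 * ‖z‖) ^ M + (‖z‖ / 2) ^ M := by
    rintro M y ⟨⟨_, h2⟩, h3⟩
    have h2' : ‖z‖ / 2 < ‖y‖ := h2
    have h3' : ‖y‖ < 2 * ‖z‖ := h3
    have p1 : 0 ≤ (2 * ‖z‖) ^ M := by positivity
    have p2 : 0 ≤ (‖z‖ / 2) ^ M := by positivity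
    rcases le_total 0 M with hM | hM
    · have := Real.rpow_le_rpow (norm_nonneg y) h3'.le hM
      linarith
    · have := Real.rpow_le_rpow_of_nonpos (by positivity) h2'.le hM
      linarith
  refine DifferentiableOn.differentiableAt (s := U) ?_ (hUo.mem_nhds hzU)
  refine Complex.differentiableOn_tsum_of_summable_norm
    (u := fun i : ℤ => (1 / 2 : ℝ) ^ i.natAbs * (C * (((2 * ‖z‖) ^ M₁ + (‖z‖ / 2) ^ M₁) +
      ((2 * ‖z‖) ^ M₂ + (‖z‖ / 2) ^ M₂))))
    (summable_half_pow_natAbs.mul_right _) (fun i y hy => ?_) hUo (fun i y hy => ?_)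
  · refine DifferentiableAt.differentiableWithinAt (DifferentiableAt.const_mul ?_ _)
    have hli : (0 : ℝ) < lam ^ i := by positivity
    have h1 := hd ((lam ^ i : ℝ) * y) (by
      rw [Complex.re_ofReal_mul]; exact mul_pos hli (hUre y hy).2)
    exact h1.comp y (by fun_prop)
  · refine (hC i y (hUre y hy).1 (le_of_lt hy.1.1)).trans ?_
    gcongr
    · exact hpb M₁ y hy
    · exact hpb M₂ y hy

theorem periodize_mul (hl : 1 < lam) (ha : a ≠ 0) (z : ℂ) :
    a * periodize lam a h (lam * z) = periodize lam a h z := by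
  have hl0 : lam ≠ 0 := by linarith
  rw [periodize, periodize, ← tsum_mul_left, ← (Equiv.addRight (1 : ℤ)).tsum_eq
    (fun i : ℤ => a ^ i * h ((lam ^ i : ℝ) * z))]
  refine tsum_congr fun i => ?_
  simp only [Equiv.coe_addRight]
  rw [zpow_add_one₀ ha, zpow_add_one₀ hl0]
  push_cast
  ring_nf

end IsFlat

/-- If `f (z) - a f (lam z) = h (z)`, then `f` is the one-sided sum `∑ a ^ i h (lam ^ i z)`, and
its difference from the two-sided sum is flat at zero. -/
theorem periodize_sub_isBigO {f h : ℂ → ℂ} {lam σ₀ : ℝ} {a : ℂ} (hl : 1 < lam) (ha : a ≠ 0)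
    (hb : ∀ σ, σ₀ < σ → ∃ C, ∀ z : ℂ, 0 < z.re → ‖f z‖ ≤ C * z.re ^ (-σ))
    (hfh : ∀ z : ℂ, f z - a * f (lam * z) = h z) (hh : IsFlat h) (M : ℝ) :
    (fun t : ℝ => periodize lam a h t - f t) =O[𝓝[>] 0] fun t => t ^ M := by
  have hl0 : 0 < lam := by linarith
  have ha0 : 0 < ‖a‖ := norm_pos_iff.2 ha
  -- the one-sided sum
  have hone : ∀ t : ℝ, 0 < t → HasSum (fun i : ℕ => a ^ i * h ((lam ^ i : ℝ) * t)) (f t) := by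
    intro t ht
    have hs : Summable fun i : ℕ => a ^ i * h ((lam ^ i : ℝ) * t) := by
      have := (hh.summable_periodize hl ha (z := t) (by simpa using ht)).comp_injective
        Nat.cast_injective
      simpa [Function.comp_def] using this
    have hpart : ∀ N : ℕ, ∑ i ∈ Finset.range N, a ^ i * h ((lam ^ i : ℝ) * t)
        = f t - a ^ N * f ((lam ^ N : ℝ) * t) := by
      intro N
      induction N with
      | zero => simp
      | succ N ih =>
        rw [Finset.sum_range_succ, ih, ← hfh]
        have : (lam : ℂ) * ((lam ^ N : ℝ) * t) = (lam ^ (N + 1) : ℝ) * t := by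
          push_cast; ring
        rw [this]
        ring
    -- Such a `σ` gives `|a| lam ^ (-σ) < 1`, which sends the remainder `a ^ N f(lam ^ N t)` of the
    -- iteration to zero.
    set σ := max (σ₀ + 1) (Real.logb lam ‖a‖ + 1) with hσ
    obtain ⟨C, hC⟩ := hb σ (by linarith [le_max_left (σ₀ + 1) (Real.logb lam ‖a‖ + 1)])
    have hr : ‖a‖ * lam ^ (-σ) < 1 := by
      rw [Real.rpow_neg hl0.le, ← div_eq_mul_inv, div_lt_one (by positivity)]
      calc ‖a‖ = lam ^ (Real.logb lam ‖a‖) := (Real.rpow_logb hl0 hl.ne' ha0).symm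
        _ < lam ^ σ := Real.rpow_lt_rpow_of_exponent_lt hl (by
          linarith [le_max_right (σ₀ + 1) (Real.logb lam ‖a‖ + 1)])
    have ht0 : Tendsto (fun N : ℕ => a ^ N * f ((lam ^ N : ℝ) * t)) atTop (𝓝 0) := by
      have hg : Tendsto (fun N : ℕ => (‖a‖ * lam ^ (-σ)) ^ N * (C * t ^ (-σ))) atTop (𝓝 0) := by
        have := (tendsto_pow_atTop_nhds_zero_of_lt_one (by positivity) hr).mul_const (C * t ^ (-σ))
        rwa [zero_mul] at this
      refine squeeze_zero_norm (fun N => ?_) hg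
      have hlN : (0 : ℝ) < lam ^ N := by positivity
      have h1 := hC ((lam ^ N : ℝ) * t) (by
        rw [Complex.re_ofReal_mul, Complex.ofReal_re]; positivity)
      rw [Complex.re_ofReal_mul, Complex.ofReal_re, Real.mul_rpow hlN.le ht.le] at h1
      have h2 : (lam ^ N) ^ (-σ) = (lam ^ (-σ)) ^ N := by
        rw [← Real.rpow_natCast, ← Real.rpow_natCast, ← Real.rpow_mul hl0.le,
          ← Real.rpow_mul hl0.le, mul_comm]
      rw [h2] at h1
      rw [norm_mul, norm_pow, mul_pow]
      calc _ ≤ ‖a‖ ^ N * (C * ((lam ^ (-σ)) ^ N * t ^ (-σ))) := by gcongr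
        _ = _ := by ring
    have hlim : Tendsto (fun N : ℕ => ∑ i ∈ Finset.range N, a ^ i * h ((lam ^ i : ℝ) * t)) atTop
        (𝓝 (f t)) := by
      simp_rw [hpart]
      simpa using tendsto_const_nhds.sub ht0
    have := tendsto_nhds_unique hs.hasSum.tendsto_sum_nat hlim
    rw [← this]
    exact hs.hasSum
  -- Raising the exponent so that `|a| lam ^ M' ≥ 2` makes the sum over negative indices geometric
  -- with ratio `1 / 2`.
  set M' := max M (Real.logb lam (2 / ‖a‖)) with hM'
  have hlM : 2 / ‖a‖ ≤ lam ^ M' := by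
    calc 2 / ‖a‖ = lam ^ (Real.logb lam (2 / ‖a‖)) :=
          (Real.rpow_logb hl0 hl.ne' (by positivity)).symm
      _ ≤ _ := Real.rpow_le_rpow_of_exponent_le hl.le (le_max_right _ _)
  obtain ⟨C, hC⟩ := hh 1 one_pos M'
  refine IsBigO.of_bound (|C| * 2) ?_
  filter_upwards [Ioc_mem_nhdsGT zero_lt_one] with t ht
  have ht0 : 0 < t := ht.1
  have hsum := hh.summable_periodize hl ha (z := t) (by simpa using ht0)
  have hsplit : periodize lam a h t - f t
      = ∑' k : ℕ, a ^ (-((k : ℤ) + 1)) * h ((lam ^ (-((k : ℤ) + 1)) : ℝ) * t) := by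
    have hn : Summable fun k : ℕ => a ^ (-((k : ℤ) + 1)) * h ((lam ^ (-((k : ℤ) + 1)) : ℝ) * t) :=
      hsum.comp_injective (i := fun k : ℕ => -((k : ℤ) + 1)) (fun i j hij => by
        simp only at hij; omega)
    have := HasSum.of_nat_of_neg_add_one
      (f := fun i : ℤ => a ^ i * h ((lam ^ i : ℝ) * t)) (by simpa using hone t ht0) hn.hasSum
    rw [periodize, this.tsum_eq]
    ring
  rw [hsplit]
  have hterm : ∀ k : ℕ, ‖a ^ (-((k : ℤ) + 1)) * h ((lam ^ (-((k : ℤ) + 1)) : ℝ) * t)‖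
      ≤ (1 / 2) ^ k * (|C| * t ^ M') := by
    intro k
    have hlk : (0 : ℝ) < lam ^ (-((k : ℤ) + 1)) := by positivity
    have h0 : (((lam ^ (-((k : ℤ) + 1)) : ℝ) : ℂ) * t) ≠ 0 := by
      rw [← Complex.ofReal_mul]; exact_mod_cast (mul_pos hlk ht0).ne'
    have h1 := hC _ h0 (by
      rw [← Complex.ofReal_mul, Complex.norm_real, Complex.ofReal_re, one_mul,
        Real.norm_of_nonneg (mul_pos hlk ht0).le])
    rw [← Complex.ofReal_mul, Complex.norm_real, Real.norm_of_nonneg (mul_pos hlk ht0).le,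
      Real.mul_rpow hlk.le ht0.le] at h1
    have h2 : (lam ^ (-((k : ℤ) + 1))) ^ M' = ((lam ^ M') ^ (k + 1))⁻¹ := by
      rw [← Real.rpow_intCast, ← Real.rpow_mul hl0.le, ← Real.rpow_natCast, ← Real.rpow_mul hl0.le,
        ← Real.rpow_neg hl0.le]
      congr 1
      push_cast
      ring
    have h3 : ‖a‖ ^ (-((k : ℤ) + 1)) = (‖a‖ ^ (k + 1))⁻¹ := by
      rw [zpow_neg]; norm_cast
    have h4 : (‖a‖ ^ (k + 1))⁻¹ * ((lam ^ M') ^ (k + 1))⁻¹ ≤ (1 / 2) ^ k := by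
      rw [← mul_inv, ← mul_pow]
      have h5 : (2 : ℝ) ≤ ‖a‖ * lam ^ M' := by
        rw [div_le_iff₀ ha0] at hlM; linarith
      calc ((‖a‖ * lam ^ M') ^ (k + 1))⁻¹ ≤ ((2 : ℝ) ^ (k + 1))⁻¹ := by gcongr
        _ ≤ (2 ^ k)⁻¹ := by gcongr <;> norm_num
        _ = _ := by rw [one_div, inv_pow]
    rw [norm_mul, norm_zpow, h3, ← Complex.ofReal_mul]
    calc _ ≤ (‖a‖ ^ (k + 1))⁻¹ * (C * ((lam ^ (-((k : ℤ) + 1))) ^ M' * t ^ M')) := by gcongr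
      _ ≤ (‖a‖ ^ (k + 1))⁻¹ * (|C| * ((lam ^ (-((k : ℤ) + 1))) ^ M' * t ^ M')) := by
        gcongr; exact le_abs_self C
      _ = ((‖a‖ ^ (k + 1))⁻¹ * ((lam ^ M') ^ (k + 1))⁻¹) * (|C| * t ^ M') := by rw [h2]; ring
      _ ≤ _ := by gcongr
  have h5 := tsum_of_norm_bounded (hasSum_geometric_two.mul_right (|C| * t ^ M')) hterm
  rw [Real.norm_of_nonneg (by positivity)]
  have h6 : t ^ M' ≤ t ^ M := Real.rpow_le_rpow_of_exponent_ge ht0 ht.2 (le_max_left _ _)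
  calc _ ≤ 2 * (|C| * t ^ M') := h5
    _ ≤ _ := by nlinarith [abs_nonneg C]

theorem IsFlat.mellinConvergent {h : ℂ → ℂ} (hh : IsFlat h)
    (hd : ∀ z : ℂ, 0 < z.re → DifferentiableAt ℂ h z) (s : ℂ) :
    MellinConvergent (fun x : ℝ => h x) s ∧
      DifferentiableAt ℂ (mellin fun x : ℝ => h x) s := by
  have hb : ∀ M : ℝ, ∀ l : Filter ℝ, (∀ᶠ x in l, 0 < x) →
      (fun x : ℝ => h x) =O[l] fun x => x ^ (-M) := by
    intro M l hl
    obtain ⟨C, hC⟩ := hh 1 one_pos (-M)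
    refine IsBigO.of_bound C ?_
    filter_upwards [hl] with x hx
    have := hC x (by exact_mod_cast hx.ne') (by
      rw [Complex.norm_real, Real.norm_of_nonneg hx.le, Complex.ofReal_re, one_mul])
    rwa [Complex.norm_real, Real.norm_of_nonneg hx.le,
      ← Real.norm_of_nonneg (Real.rpow_nonneg hx.le _)] at this
  have hc : LocallyIntegrableOn (fun x : ℝ => h x) (Ioi 0) := by
    refine ContinuousOn.locallyIntegrableOn (fun x (hx : 0 < x) => ?_) measurableSet_Ioi
    exact (ContinuousAt.comp (f := fun x : ℝ => (x : ℂ)) (hd x (by simpa using hx)).continuousAt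
      Complex.continuous_ofReal.continuousAt).continuousWithinAt
  exact ⟨mellinConvergent_of_isBigO_rpow hc (hb (s.re + 1) _ (eventually_gt_atTop 0))
      (lt_add_one _) (hb (s.re - 1) _ self_mem_nhdsWithin) (sub_one_lt _),
    mellin_differentiableAt_of_isBigO_rpow hc (hb (s.re + 1) _ (eventually_gt_atTop 0))
      (lt_add_one _) (hb (s.re - 1) _ self_mem_nhdsWithin) (sub_one_lt _)⟩

/-- Flatness makes the Mellin integral entire, and it agrees with the entire `F` in a half plane. In
this way the values of `F` at the lattice points become integrals of `h`. -/
theorem IsMellinPair.mellin_eq_of_isFlat {σ₀ : ℝ} {h F : ℂ → ℂ} (hp : IsMellinPair σ₀ h F)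
    (hF : Differentiable ℂ F) (hh : IsFlat h) (s : ℂ) : mellin (fun x : ℝ => h x) s = F s := by
  have h1 : Differentiable ℂ (mellin fun x : ℝ => h x) := fun s =>
    (hh.mellinConvergent hp.differentiableAt s).2
  have h2 : mellin (fun x : ℝ => h x) =ᶠ[𝓝 ((σ₀ + 1 : ℝ) : ℂ)] F := by
    have hopen : IsOpen {s : ℂ | σ₀ < s.re} := isOpen_lt continuous_const Complex.continuous_re
    filter_upwards [hopen.mem_nhds (show σ₀ < ((σ₀ + 1 : ℝ) : ℂ).re by simp)] with z hz
    have := hp.mellin_eq 0 (by rw [abs_zero]; positivity) z hz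
    simpa using this
  exact congrFun (AnalyticOnNhd.eq_of_eventuallyEq
    (fun z _ => h1.analyticAt z) (fun z _ => hF.analyticAt z) h2) s

/-! ### The periodic functions and their Fourier coefficients -/

theorem range_exp_mul {c : ℝ} (hc : 0 < c) :
    (fun v : ℝ => Real.exp (c * v)) '' univ = Ioi 0 := by
  ext x
  simp only [image_univ, mem_range, mem_Ioi]
  refine ⟨?_, fun hx => ⟨Real.log x / c, ?_⟩⟩
  · rintro ⟨v, rfl⟩
    exact Real.exp_pos _
  · rw [mul_div_cancel₀ _ hc.ne', Real.exp_log hx]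

/-- The substitution `x = exp (c v)`; for `c = log lam` it turns dilation by `lam` into translation
by `1`. -/
theorem exp_mul_substitution {f : ℝ → ℂ} {c : ℝ} (hc : 0 < c) {s : ℂ} (hs : MellinConvergent f s) :
    Integrable (fun v : ℝ => Complex.exp (c * s * v) * f (Real.exp (c * v))) ∧
      ∫ v : ℝ, Complex.exp (c * s * v) * f (Real.exp (c * v)) = (c : ℂ)⁻¹ * mellin f s := by
  have hder : ∀ v ∈ (univ : Set ℝ), HasDerivWithinAt (fun v : ℝ => Real.exp (c * v))
      (Real.exp (c * v) * c) univ v := fun v _ => by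
    have := ((hasDerivAt_id v).const_mul c).exp
    simp only [id_eq, mul_one] at this
    exact this.hasDerivWithinAt
  have hinj : InjOn (fun v : ℝ => Real.exp (c * v)) univ := fun x _ y _ hxy =>
    mul_left_cancel₀ hc.ne' (Real.exp_injective hxy)
  have hcc : (c : ℂ) ≠ 0 := by exact_mod_cast hc.ne'
  have key : ∀ v : ℝ, |Real.exp (c * v) * c| • ((Real.exp (c * v) : ℂ) ^ (s - 1) •
      f (Real.exp (c * v))) = (c : ℂ) * (Complex.exp (c * s * v) * f (Real.exp (c * v))) := by
    intro v
    have hpos : (0 : ℝ) < Real.exp (c * v) := Real.exp_pos _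
    rw [abs_of_pos (by positivity), Complex.real_smul, smul_eq_mul,
      Complex.cpow_sub _ _ (by exact_mod_cast hpos.ne'), Complex.cpow_one,
      Complex.cpow_def_of_ne_zero (by exact_mod_cast hpos.ne'), ← Complex.ofReal_log hpos.le,
      Real.log_exp]
    have : (Real.exp (c * v) : ℂ) ≠ 0 := by exact_mod_cast hpos.ne'
    push_cast at this ⊢
    rw [show (c : ℂ) * v * s = c * s * v by ring]
    field_simp
  have hint := (integrableOn_image_iff_integrableOn_abs_deriv_smul MeasurableSet.univ hder hinj
    (fun x : ℝ => (x : ℂ) ^ (s - 1) • f x)).1 (by rw [range_exp_mul hc]; exact hs)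
  rw [integrableOn_univ] at hint
  simp_rw [key] at hint
  have hval := integral_image_eq_integral_abs_deriv_smul MeasurableSet.univ hder hinj
    (fun x : ℝ => (x : ℂ) ^ (s - 1) • f x)
  rw [range_exp_mul hc, setIntegral_univ] at hval
  simp_rw [key] at hval
  rw [integral_const_mul] at hval
  refine ⟨?_, ?_⟩
  · have := hint.const_mul (c : ℂ)⁻¹
    simpa only [inv_mul_cancel_left₀ hcc] using this
  · rw [mellin, hval, inv_mul_cancel_left₀ hcc]

theorem integral_tsum_comp_add_int {g : ℝ → ℂ} (hg : Integrable g) :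
    ∫ v in (0 : ℝ)..1, ∑' i : ℤ, g (v + i) = ∫ v, g v := by
  rw [← hg.hasSum_intervalIntegral_comp_add_int.tsum_eq,
    intervalIntegral.integral_of_le zero_le_one]
  simp_rw [intervalIntegral.integral_of_le (zero_le_one' ℝ)]
  refine (integral_tsum_of_summable_integral_norm (fun i => ?_) ?_).symm
  · exact (hg.comp_add_right _).integrableOn
  · have := hg.norm.hasSum_intervalIntegral_comp_add_int.summable
    simpa only [intervalIntegral.integral_of_le (zero_le_one' ℝ)] using this

/-- The `1`-periodic function `v ↦ lam ^ (α v) U (lam ^ v)` for a solution `U` of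
`lam ^ α U (lam z) = U (z)`. -/
noncomputable def periodicPart (lam : ℝ) (α : ℂ) (U : ℂ → ℂ) (v : ℝ) : ℂ :=
  Complex.exp (Real.log lam * α * v) * U (Real.exp (Real.log lam * v))

theorem ofReal_cpow_eq_exp {lam : ℝ} (hl : 1 < lam) (s : ℂ) :
    (lam : ℂ) ^ s = Complex.exp (Real.log lam * s) := by
  rw [Complex.cpow_def_of_ne_zero (by exact_mod_cast (by linarith : (0:ℝ) < lam).ne'),
    Complex.ofReal_log (by linarith)]

theorem cpow_latticePt {lam : ℝ} (hl : 1 < lam) (α : ℂ) (k : ℤ) :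
    (lam : ℂ) ^ latticePt lam α k = (lam : ℂ) ^ α := by
  have : (Real.log lam : ℂ) ≠ 0 := by exact_mod_cast (Real.log_pos hl).ne'
  rw [ofReal_cpow_eq_exp hl, ofReal_cpow_eq_exp hl, Complex.exp_eq_exp_iff_exists_int]
  refine ⟨k, ?_⟩
  rw [latticePt]
  field_simp

section periodicPart

variable {lam : ℝ} {α : ℂ} {h : ℂ → ℂ}

theorem cpow_neg_mul_periodicPart (hl : 1 < lam) (U : ℂ → ℂ) {t : ℝ} (ht : 0 < t) :
    (t : ℂ) ^ (-α) * periodicPart lam α U (Real.logb lam t) = U t := by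
  have h1 : Real.log lam * Real.logb lam t = Real.log t := by
    rw [Real.logb, mul_div_cancel₀ _ (Real.log_pos hl).ne']
  have h2 : (Real.log lam : ℂ) * Real.logb lam t = Real.log t := by exact_mod_cast h1
  rw [periodicPart, h1, Real.exp_log ht, mul_right_comm, h2,
    Complex.cpow_def_of_ne_zero (by exact_mod_cast ht.ne'), Complex.ofReal_log ht.le, ← mul_assoc,
    ← Complex.exp_add]
  simp

theorem periodicPart_periodic (hl : 1 < lam) :
    Function.Periodic (periodicPart lam α (periodize lam ((lam : ℂ) ^ α) h)) 1 := by
  intro v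
  have hl0 : 0 < lam := by linarith
  have e1 : Real.exp (Real.log lam * (v + 1)) = lam * Real.exp (Real.log lam * v) := by
    rw [mul_add, mul_one, Real.exp_add, Real.exp_log hl0, mul_comm]
  have ha : (lam : ℂ) ^ α ≠ 0 := by
    rw [ofReal_cpow_eq_exp hl]; exact Complex.exp_ne_zero _
  have e2 : Complex.exp (Real.log lam * α * ((v + 1 : ℝ) : ℂ))
      = Complex.exp (Real.log lam * α * v) * (lam : ℂ) ^ α := by
    rw [ofReal_cpow_eq_exp hl, ← Complex.exp_add]; push_cast; ring_nf
  rw [periodicPart, e1, e2, mul_assoc, Complex.ofReal_mul, IsFlat.periodize_mul hl ha, periodicPart]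

/-- The two-sided sum is holomorphic in the right half plane, and `exp (v log lam)` stays in it for
complex `v` near the real axis. -/
theorem periodicPart_analytic (hh : IsFlat h) (hd : ∀ z : ℂ, 0 < z.re → DifferentiableAt ℂ h z)
    (hl : 1 < lam) :
    AnalyticOnNhd ℝ (periodicPart lam α (periodize lam ((lam : ℂ) ^ α) h)) univ := by
  intro v _
  have ha : (lam : ℂ) ^ α ≠ 0 := by
    rw [ofReal_cpow_eq_exp hl]; exact Complex.exp_ne_zero _
  have h1 : AnalyticAt ℂ (fun z : ℂ => Complex.exp (Real.log lam * α * z) *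
      periodize lam ((lam : ℂ) ^ α) h (Complex.exp (Real.log lam * z))) v := by
    have hc : Continuous fun z : ℂ => (Complex.exp (Real.log lam * z)).re := by fun_prop
    have hU : {z : ℂ | 0 < (Complex.exp (Real.log lam * z)).re} ∈ 𝓝 (v : ℂ) := by
      refine (isOpen_lt continuous_const hc).mem_nhds ?_
      change 0 < (Complex.exp (Real.log lam * v)).re
      rw [← Complex.ofReal_mul, ← Complex.ofReal_exp, Complex.ofReal_re]
      exact Real.exp_pos _
    refine DifferentiableOn.analyticAt (s := {z : ℂ | 0 < (Complex.exp (Real.log lam * z)).re})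
      (fun z hz => ?_) hU
    refine DifferentiableAt.differentiableWithinAt ?_
    refine DifferentiableAt.mul (by fun_prop) ?_
    exact DifferentiableAt.comp (g := periodize lam ((lam : ℂ) ^ α) h)
      (f := fun z : ℂ => Complex.exp (Real.log lam * z)) z
      (IsFlat.differentiableAt_periodize hh hd hl ha hz) (by fun_prop)
  have h2 := AnalyticAt.fun_comp (f := fun v : ℝ => (v : ℂ)) (x := v) (h1.restrictScalars (𝕜 := ℝ))
    (Complex.ofRealCLM.analyticAt v)
  refine h2.congr (Eventually.of_forall fun y => ?_)
  simp only [periodicPart, Complex.ofReal_exp, Complex.ofReal_mul]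

/-- Unfolding: the two-sided sum integrated over a period is an integral over the whole line, that
is, a Mellin integral of `h` at the lattice point. -/
theorem integral_periodicPart (hh : IsFlat h) (hd : ∀ z : ℂ, 0 < z.re → DifferentiableAt ℂ h z)
    (hl : 1 < lam) (k : ℤ) :
    ∫ v in (0 : ℝ)..1, periodicPart lam α (periodize lam ((lam : ℂ) ^ α) h) v
        * Complex.exp (2 * k * Real.pi * Complex.I * v)
      = (Real.log lam : ℂ)⁻¹ * mellin (fun x : ℝ => h x) (latticePt lam α k) := by
  have hl0 : 0 < lam := by linarith
  have hlog : (Real.log lam : ℂ) ≠ 0 := by exact_mod_cast (Real.log_pos hl).ne'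
  obtain ⟨hg, hv⟩ := exp_mul_substitution (Real.log_pos hl)
    (hh.mellinConvergent hd (latticePt lam α k)).1
  rw [← hv, ← integral_tsum_comp_add_int hg]
  refine intervalIntegral.integral_congr fun v _ => ?_
  simp only [periodicPart, periodize]
  rw [mul_right_comm, ← tsum_mul_left]
  refine tsum_congr fun i => ?_
  have e1 : Real.exp (Real.log lam * (v + i)) = lam ^ i * Real.exp (Real.log lam * v) := by
    rw [mul_add, Real.exp_add, Real.exp_mul (Real.log lam) (i : ℝ), Real.rpow_intCast,
      Real.exp_log hl0, mul_comm]
  -- The shift by the integer `i` contributes `k i` full turns, which disappear; what remains of it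
  -- is the weight `(lam ^ α) ^ i`.
  have e2 : Complex.exp (Real.log lam * latticePt lam α k * ((v + i : ℝ) : ℂ))
      = Complex.exp (Real.log lam * α * v) * Complex.exp (2 * k * Real.pi * Complex.I * v) *
        ((lam : ℂ) ^ α) ^ i := by
    rw [ofReal_cpow_eq_exp hl, ← Complex.exp_int_mul, ← Complex.exp_add, ← Complex.exp_add,
      Complex.exp_eq_exp_iff_exists_int]
    refine ⟨k * i, ?_⟩
    rw [latticePt]
    push_cast
    field_simp
    ring
  rw [e1, e2]
  push_cast
  ring

end periodicPart

/-! ### Partial fractions and the expansion theorem -/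

/-- The polynomial `∏ (1 - a X)` over a finite set. -/
noncomputable def recipPoly (T : Finset ℂ) : Polynomial ℂ :=
  ∏ a ∈ T, (1 - Polynomial.C a * Polynomial.X)

theorem eval_recipPoly (T : Finset ℂ) (x : ℂ) : (recipPoly T).eval x = ∏ a ∈ T, (1 - a * x) := by
  simp [recipPoly, Polynomial.eval_prod]

theorem degree_recipPoly_le (T : Finset ℂ) : (recipPoly T).degree ≤ T.card := by
  refine (Polynomial.degree_prod_le _ _).trans ?_
  refine (Finset.sum_le_card_nsmul T _ 1 fun a _ => ?_).trans (by simp)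
  refine (Polynomial.degree_sub_le _ _).trans (max_le ?_ ?_)
  · exact Polynomial.degree_one_le.trans zero_le_one
  · exact Polynomial.degree_C_mul_X_le _

theorem eval_recipPoly_erase_ne_zero {T : Finset ℂ} {a : ℂ} (ha : a ≠ 0) :
    (recipPoly (T.erase a)).eval a⁻¹ ≠ 0 := by
  rw [eval_recipPoly, Finset.prod_ne_zero_iff]
  intro b hb h0
  have : b = a := by field_simp at h0; linear_combination -h0
  exact Finset.ne_of_mem_erase hb this

theorem recipPoly_eq_mul {T : Finset ℂ} {a : ℂ} (ha : a ∈ T) :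
    recipPoly T = (1 - Polynomial.C a * Polynomial.X) * recipPoly (T.erase a) :=
  (Finset.mul_prod_erase T _ ha).symm

/-- Partial fractions of `1 / ∏ (1 - a X)` with denominators cleared. Both sides have degree below
the number of elements of `T` and agree at the points `a⁻¹`. -/
theorem sum_recipPoly_erase {T : Finset ℂ} (hT : T.Nonempty) (h0 : ∀ a ∈ T, a ≠ 0) :
    ∑ a ∈ T, Polynomial.C ((recipPoly (T.erase a)).eval a⁻¹)⁻¹ * recipPoly (T.erase a) = 1 := by
  refine Polynomial.eq_of_degrees_lt_of_eval_index_eq T (v := fun a => a⁻¹)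
    (fun a _ b _ h => inv_injective h) ?_ ?_ fun a ha => ?_
  · rw [← Polynomial.mem_degreeLT]
    refine Submodule.sum_mem _ fun a ha => Polynomial.mem_degreeLT.2 ?_
    refine (Polynomial.degree_mul_le _ _).trans_lt ?_
    refine (add_le_add Polynomial.degree_C_le (degree_recipPoly_le _)).trans_lt ?_
    rw [zero_add, Finset.card_erase_of_mem ha]
    exact_mod_cast Nat.sub_lt hT.card_pos one_pos
  · rw [Polynomial.degree_one]
    exact_mod_cast hT.card_pos
  · rw [Polynomial.eval_finsetSum, Finset.sum_eq_single a]
    · rw [Polynomial.eval_mul, Polynomial.eval_C,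
        inv_mul_cancel₀ (eval_recipPoly_erase_ne_zero (h0 a ha)), Polynomial.eval_one]
    · intro b hb hba
      have : (recipPoly (T.erase b)).eval a⁻¹ = 0 := by
        rw [eval_recipPoly]
        exact Finset.prod_eq_zero (Finset.mem_erase.2 ⟨hba.symm, ha⟩)
          (by rw [mul_inv_cancel₀ (h0 a ha), sub_self])
      rw [Polynomial.eval_mul, this, mul_zero]
    · exact fun h => absurd ha h

theorem tendsto_div_one_sub {lam : ℝ} (hl : 1 < lam) (α : ℂ) (k : ℤ) :
    Tendsto (fun s => (s - latticePt lam α k) / (1 - (lam : ℂ) ^ α * (lam : ℂ) ^ (-s)))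
      (𝓝[≠] latticePt lam α k) (𝓝 (Real.log lam : ℂ)⁻¹) := by
  set s₀ := latticePt lam α k with hs₀
  have hlog : (Real.log lam : ℂ) ≠ 0 := by exact_mod_cast (Real.log_pos hl).ne'
  have e : ∀ s : ℂ, (lam : ℂ) ^ α * (lam : ℂ) ^ (-s) = Complex.exp (Real.log lam * (s₀ - s)) := by
    intro s
    rw [← cpow_latticePt hl α k, ofReal_cpow_eq_exp hl, ofReal_cpow_eq_exp hl, ← Complex.exp_add,
        ← hs₀]
    ring_nf
  simp_rw [e]
  have hd : HasDerivAt (fun s : ℂ => 1 - Complex.exp (Real.log lam * (s₀ - s)))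
      (-(Complex.exp (Real.log lam * (s₀ - s₀)) * (Real.log lam * (-1)))) s₀ :=
    ((((hasDerivAt_id s₀).const_sub s₀).const_mul (Real.log lam : ℂ)).cexp).const_sub 1
  have hval : -(Complex.exp (Real.log lam * (s₀ - s₀)) * ((Real.log lam : ℂ) * (-1)))
      = Real.log lam := by simp
  rw [hval] at hd
  have := (hasDerivAt_iff_tendsto_slope.1 hd).inv₀ hlog
  refine this.congr fun s => ?_
  rw [slope_def_field]
  simp

/-- The product of all `1 - λ^α D`, with `D` dilation by `lam`, maps `u` to a function `h` with
entire, decaying Mellin transform `F`, so `h` is flat. Partial fractions write `u` as a sum of `f`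
with `f(z) - λ^α f(λ z) = c h(z)`; each `f` is a one-sided sum, equal up to a flat error to the
two-sided one, which is `t^(-α)` times a periodic function. Its Fourier coefficients `c F(s_k) / log
lam` are the residues of `G`, because `1 / log lam` is the residue of `1 / (1 - λ^α λ^(-s))` and `c`
is the inverse of the remaining factors. -/
theorem IsMellinPair.exists_expansion {σ₀ lam : ℝ} (hl : 1 < lam) {u G F : ℂ → ℂ}
    (hu : IsMellinPair σ₀ u G) {W : Finset ℂ} (hW : W.Nonempty)
    (hinj : InjOn (fun α : ℂ => (lam : ℂ) ^ α) W) (hF : Differentiable ℂ F)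
    (hFd : HasGammaDecay F)
    (hFG : ∀ s : ℂ, σ₀ < s.re →
      F s = (recipPoly (W.image fun α => (lam : ℂ) ^ α)).eval ((lam : ℂ) ^ (-s)) * G s)
    (hFG' : ∀ s : ℂ, ∀ᶠ z in 𝓝[≠] s,
      F z = (recipPoly (W.image fun α => (lam : ℂ) ^ α)).eval ((lam : ℂ) ^ (-z)) * G z) :
    ∃ H : ℂ → ℝ → ℂ, (∀ α ∈ W, IsResidueFunction lam G α (H α)) ∧ ∀ M : ℝ,
      (fun t : ℝ => u t - ∑ α ∈ W, (t : ℂ) ^ (-α) * H α (Real.logb lam t))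
        =O[𝓝[>] 0] fun t => t ^ M := by
  classical
  have hl0 : 0 < lam := by linarith
  set T := W.image fun α => (lam : ℂ) ^ α with hT
  have hne : ∀ α : ℂ, (lam : ℂ) ^ α ≠ 0 := fun α => by
    rw [ofReal_cpow_eq_exp hl]; exact Complex.exp_ne_zero _
  have hT0 : ∀ a ∈ T, a ≠ 0 := fun a ha => by
    obtain ⟨α, -, rfl⟩ := Finset.mem_image.1 ha
    exact hne α
  have hmem : ∀ α ∈ W, (lam : ℂ) ^ α ∈ T := fun α hα => Finset.mem_image_of_mem _ hα
  set h := Polynomial.aeval (dilationOp lam) (recipPoly T) u with hh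
  have hpair : IsMellinPair σ₀ h F := (hu.aeval hl0 (recipPoly T)).congr fun s hs => (hFG s hs).symm
  have hflat : IsFlat h := hpair.isFlat hF hFd
  set c : ℂ → ℂ := fun a => ((recipPoly (T.erase a)).eval a⁻¹)⁻¹ with hc
  set f : ℂ → ℂ → ℂ := fun a =>
    Polynomial.aeval (dilationOp lam) (Polynomial.C (c a) * recipPoly (T.erase a)) u with hf
  have hfpair : ∀ a, IsMellinPair σ₀ (f a) _ := fun a => hu.aeval hl0 _
  have hrec : ∀ a ∈ T, ∀ z, f a z - a * f a (lam * z) = c a * h z := by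
    intro a ha z
    have e : (1 - Polynomial.C a * Polynomial.X) * (Polynomial.C (c a) * recipPoly (T.erase a))
        = Polynomial.C (c a) * recipPoly T := by
      rw [recipPoly_eq_mul ha]; ring
    have e2 := congrArg (fun P => Polynomial.aeval (dilationOp lam) P u z) e
    simp only [map_mul, map_sub, map_one, Polynomial.aeval_C, Polynomial.aeval_X,
      Module.End.mul_apply, LinearMap.sub_apply, Module.End.one_apply,
      Module.algebraMap_end_apply, Pi.sub_apply, Pi.smul_apply, smul_eq_mul] at e2
    rw [hh, ← e2, hf]
    simp only [map_mul, Polynomial.aeval_C, Module.End.mul_apply, Module.algebraMap_end_apply]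
    rfl
  have hsumf : ∀ z, u z = ∑ α ∈ W, f ((lam : ℂ) ^ α) z := by
    intro z
    have e := congrArg (fun P => Polynomial.aeval (dilationOp lam) P u z)
      (sum_recipPoly_erase (hW.image _) hT0)
    simp only [map_one, Module.End.one_apply, map_sum, LinearMap.sum_apply,
      Finset.sum_apply] at e
    rw [← e, Finset.sum_image hinj]
  have hcflat : ∀ a, IsFlat fun z => c a * h z := fun a => hflat.const_mul _
  have hcd : ∀ a, ∀ z : ℂ, 0 < z.re → DifferentiableAt ℂ (fun z => c a * h z) z := fun a z hz =>
    (hpair.differentiableAt z hz).const_mul _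
  refine ⟨fun α => periodicPart lam α (periodize lam ((lam : ℂ) ^ α)
    fun z => c ((lam : ℂ) ^ α) * h z), fun α hα => ⟨periodicPart_periodic hl,
      periodicPart_analytic (hcflat _) (hcd _) hl, fun k => ?_⟩, fun M => ?_⟩
  · rw [integral_periodicPart (hcflat _) (hcd _) hl]
    set a := (lam : ℂ) ^ α with ha
    have e1 : mellin (fun x : ℝ => c a * h x) (latticePt lam α k) = c a * F (latticePt lam α k) :=
        by
      rw [← hpair.mellin_eq_of_isFlat hF hflat]
      exact mellin_const_smul _ _ (c a)
    rw [e1]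
    have hq : Continuous fun s : ℂ => (recipPoly (T.erase a)).eval ((lam : ℂ) ^ (-s)) :=
      (differentiable_eval_cpow_neg hl _).continuous
    have hq0 : (recipPoly (T.erase a)).eval ((lam : ℂ) ^ (-latticePt lam α k)) = (c a)⁻¹ := by
      rw [Complex.cpow_neg, cpow_latticePt hl, hc, inv_inv]
    have hca : (c a)⁻¹ ≠ 0 := by
      rw [hc, inv_inv]; exact eval_recipPoly_erase_ne_zero (hne α)
    have h1 : Tendsto (fun s : ℂ => ((recipPoly (T.erase a)).eval ((lam : ℂ) ^ (-s)))⁻¹ * F s)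
        (𝓝[≠] latticePt lam α k) (𝓝 (c a * F (latticePt lam α k))) := by
      have := ((hq.tendsto (latticePt lam α k)).inv₀ (by rw [hq0]; exact hca)).mul
        (hF.continuous.tendsto _)
      rw [hq0, inv_inv] at this
      exact this.mono_left nhdsWithin_le_nhds
    refine ((tendsto_div_one_sub hl α k).mul h1).congr' ?_
    have hq1 : ∀ᶠ s in 𝓝[≠] latticePt lam α k,
        (recipPoly (T.erase a)).eval ((lam : ℂ) ^ (-s)) ≠ 0 :=
      (hq.continuousAt.eventually_ne (by rw [hq0]; exact hca)).filter_mono nhdsWithin_le_nhds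
    have hlim := tendsto_div_one_sub hl α k
    have hlog : (Real.log lam : ℂ)⁻¹ ≠ 0 :=
      inv_ne_zero (by exact_mod_cast (Real.log_pos hl).ne')
    filter_upwards [hFG' (latticePt lam α k), hq1, hlim.eventually_ne hlog] with s hs hs1 hs2
    have hs3 : 1 - (lam : ℂ) ^ α * (lam : ℂ) ^ (-s) ≠ 0 := fun h0 => hs2 (by rw [h0, div_zero])
    rw [hs, recipPoly_eq_mul (hmem α hα), Polynomial.eval_mul]
    simp only [Polynomial.eval_sub, Polynomial.eval_one, Polynomial.eval_mul, Polynomial.eval_C,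
      Polynomial.eval_X]
    rw [← ha] at hs3 ⊢
    field_simp
  · have hO : (fun t : ℝ => -∑ α ∈ W, (periodize lam ((lam : ℂ) ^ α)
        (fun z => c ((lam : ℂ) ^ α) * h z) t - f ((lam : ℂ) ^ α) t)) =O[𝓝[>] 0]
        fun t => t ^ M := by
      refine IsBigO.neg_left (IsBigO.fun_sum fun α hα => ?_)
      exact periodize_sub_isBigO hl (hne α) (hfpair _).bound (hrec _ (hmem α hα))
        (hcflat _) M
    refine hO.congr' ?_ EventuallyEq.rfl
    filter_upwards [self_mem_nhdsWithin] with t (ht : 0 < t)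
    rw [hsumf, Finset.sum_sub_distrib, neg_sub]
    congr 1
    exact Finset.sum_congr rfl fun α _ => (cpow_neg_mul_periodicPart hl _ ht).symm

/-! ### Gamma-type decay after removal of the poles -/

theorem ofReal_cpow_neg_eq_norm_mul {lam : ℝ} (hl : 1 < lam) (s : ℂ) :
    (lam : ℂ) ^ (-s) = ‖(lam : ℂ) ^ (-s)‖ * Complex.exp (-(s.im * Real.log lam * Complex.I)) := by
  have hl0 : 0 < lam := by linarith
  rw [norm_ofReal_cpow_neg hl, ofReal_cpow_eq_exp hl, Real.rpow_def_of_pos hl0, Complex.ofReal_exp,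
    ← Complex.exp_add]
  congr 1
  conv_lhs => rw [← Complex.re_add_im s]
  push_cast
  ring

/-- A grid of rectangles, invariant under the period of `lam ^ (-s)`, on whose boundaries
`P (lam ^ (-s))` is bounded away from zero. -/
theorem exists_rectangles {lam : ℝ} (hl : 1 < lam) {P : Polynomial ℂ} (hP : P ≠ 0) (a b : ℝ) :
    ∃ a' ≤ a, ∃ b' ≥ b, ∃ y₀ C : ℝ, ∀ s : ℂ, a' ≤ s.re → s.re ≤ b' →
      (s.re = a' ∨ s.re = b' ∨ ∃ n : ℤ, s.im = y₀ + n * (2 * Real.pi / Real.log lam)) →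
      P.eval ((lam : ℂ) ^ (-s)) ≠ 0 ∧ ‖(P.eval ((lam : ℂ) ^ (-s)))⁻¹‖ ≤ C := by
  have hl0 : 0 < lam := by linarith
  have hL := Real.log_pos hl
  have hfin : {x : ℂ | P.eval x = 0}.Finite := by
    refine (P.roots.toFinset.finite_toSet).subset fun x hx => ?_
    simpa [hP] using hx
  have hinj : Function.Injective fun y : ℝ => lam ^ (-y) := fun x y hxy => by
    have := (Real.rpow_right_inj hl0 hl.ne').1 hxy
    linarith
  have hnorm : ((fun y : ℝ => lam ^ (-y)) ⁻¹' (norm '' {x : ℂ | P.eval x = 0})).Finite :=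
    (hfin.image _).preimage hinj.injOn
  obtain ⟨a', ha', ha2⟩ := (Set.Iic_infinite a).exists_notMem_finite hnorm
  obtain ⟨b', hb', hb2⟩ := (Set.Ici_infinite b).exists_notMem_finite hnorm
  -- A height `y₀` is sought whose image under `lam ^ (-s)`, a ray from the origin, misses the roots
  -- of `P`. It suffices that the cosine of its angle differs from the finitely many `Re x / |x|`.
  have hinf : ((fun y : ℝ => Real.cos (y * Real.log lam))
      '' Ioo 0 (Real.pi / Real.log lam)).Infinite := by
    refine (Set.Ioo_infinite (by positivity)).image fun y hy y' hy' h => ?_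
    have := Real.injOn_cos ⟨(mul_pos hy.1 hL).le, ((lt_div_iff₀ hL).1 hy.2).le⟩
      ⟨(mul_pos hy'.1 hL).le, ((lt_div_iff₀ hL).1 hy'.2).le⟩ h
    exact mul_right_cancel₀ hL.ne' this
  obtain ⟨v, ⟨y₀, -, rfl⟩, hv⟩ := hinf.exists_notMem_finite
    (hfin.image fun x : ℂ => x.re / ‖x‖)
  set u : ℂ := Complex.exp (-(y₀ * Real.log lam * Complex.I)) with hu
  have hure : u.re = Real.cos (y₀ * Real.log lam) := by
    rw [hu, ← Complex.ofReal_mul, ← neg_mul, ← Complex.ofReal_neg, Complex.exp_ofReal_mul_I_re,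
      Real.cos_neg]
  have hunorm : ‖u‖ = 1 := by
    rw [hu, ← Complex.ofReal_mul, ← neg_mul, ← Complex.ofReal_neg, Complex.norm_exp_ofReal_mul_I]
  -- The images of all grid lines under the periodic map `lam ^ (-s)` lie in one compact set, two
  -- circles and a piece of a ray. This makes the bound uniform in the height.
  set K : Set ℂ := {x : ℂ | (lam ^ (-b') ≤ ‖x‖ ∧ ‖x‖ ≤ lam ^ (-a')) ∧
    (‖x‖ = lam ^ (-a') ∨ ‖x‖ = lam ^ (-b') ∨ x = ‖x‖ * u)} with hK
  have hKc : IsCompact K := by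
    refine (isCompact_closedBall (0 : ℂ) (lam ^ (-a'))).of_isClosed_subset ?_ fun x hx => ?_
    · refine (IsClosed.inter ?_ ?_).inter (IsClosed.union ?_ (IsClosed.union ?_ ?_))
      · exact isClosed_le continuous_const continuous_norm
      · exact isClosed_le continuous_norm continuous_const
      · exact isClosed_eq continuous_norm continuous_const
      · exact isClosed_eq continuous_norm continuous_const
      · exact isClosed_eq continuous_id (by fun_prop)
    · simpa using hx.1.2
  have hK0 : ∀ x ∈ K, P.eval x ≠ 0 := by
    rintro x ⟨⟨h1, -⟩, h | h | h⟩ h0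
    · exact ha2 ⟨x, h0, h⟩
    · exact hb2 ⟨x, h0, h⟩
    · refine hv ⟨x, h0, ?_⟩
      have hx : 0 < ‖x‖ := lt_of_lt_of_le (by positivity) h1
      have h2 := congrArg Complex.re h
      rw [Complex.re_ofReal_mul, hure] at h2
      simp only
      rw [h2, mul_div_cancel_left₀ _ hx.ne']
  obtain ⟨C, hC⟩ := hKc.exists_bound_of_continuousOn (f := fun x : ℂ => (P.eval x)⁻¹)
    (P.continuous.continuousOn.inv₀ hK0)
  refine ⟨a', ha', b', hb', y₀, C, fun s h1 h2 h3 => ?_⟩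
  have hmem : (lam : ℂ) ^ (-s) ∈ K := by
    have hn := norm_ofReal_cpow_neg hl s
    refine ⟨⟨?_, ?_⟩, ?_⟩
    · rw [hn]; exact Real.rpow_le_rpow_of_exponent_le hl.le (by linarith)
    · rw [hn]; exact Real.rpow_le_rpow_of_exponent_le hl.le (by linarith)
    · rcases h3 with h3 | h3 | ⟨n, h3⟩
      · exact Or.inl (by rw [hn, h3])
      · exact Or.inr (Or.inl (by rw [hn, h3]))
      · refine Or.inr (Or.inr ?_)
        have hLc : (Real.log lam : ℂ) ≠ 0 := by exact_mod_cast hL.ne'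
        have e : Complex.exp (-(s.im * Real.log lam * Complex.I)) = u := by
          rw [hu, Complex.exp_eq_exp_iff_exists_int]
          refine ⟨-n, ?_⟩
          rw [h3]
          push_cast
          field_simp
          ring
        rw [← e]
        exact ofReal_cpow_neg_eq_norm_mul hl s
  exact ⟨hK0 _ hmem, hC _ hmem⟩

theorem exists_norm_eval_cpow_le {lam : ℝ} (hl : 1 < lam) (P : Polynomial ℂ) (a b : ℝ) :
    ∃ C, ∀ s : ℂ, a ≤ s.re → s.re ≤ b → ‖P.eval ((lam : ℂ) ^ (-s))‖ ≤ C := by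
  obtain ⟨C, hC⟩ := (isCompact_closedBall (0 : ℂ) (lam ^ (-a))).exists_bound_of_continuousOn
    (f := fun x : ℂ => P.eval x) P.continuous.continuousOn
  refine ⟨C, fun s h1 _ => hC _ ?_⟩
  rw [mem_closedBall_zero_iff, norm_ofReal_cpow_neg hl]
  exact Real.rpow_le_rpow_of_exponent_le hl.le (by linarith)

theorem eq_of_frequently_eq {f g : ℂ → ℂ} {s : ℂ} (hf : ContinuousAt f s) (hg : ContinuousAt g s)
    (h : ∀ᶠ z in 𝓝[≠] s, f z = g z) : f s = g s :=
  tendsto_nhds_unique_of_eventuallyEq (hf.tendsto.mono_left nhdsWithin_le_nhds)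
    (hg.tendsto.mono_left nhdsWithin_le_nhds) h

/-- An entire function `F` with `P (lam ^ (-s)) F (s) = E (s) Γ (s)` off the real axis, `E` of
arbitrarily small exponential growth in strips, decays like the Gamma function. -/
theorem hasGammaDecay_of_mul_eq {lam : ℝ} (hl : 1 < lam) {P : Polynomial ℂ} (hP : P ≠ 0)
    {F E : ℂ → ℂ} (hF : Differentiable ℂ F)
    (hE : ∀ a b δ : ℝ, 0 < δ → ∃ C, ∀ s : ℂ, a ≤ s.re → s.re ≤ b →
      ‖E s‖ ≤ C * Real.exp (δ * |s.im|))
    (hFE : ∀ s : ℂ, s.im ≠ 0 → P.eval ((lam : ℂ) ^ (-s)) * F s = E s * Complex.Gamma s) :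
    HasGammaDecay F := by
  intro a b δ hδ hδ2
  have hL := Real.log_pos hl
  obtain ⟨a', ha', b', hb', y₀, C₁, hC₁⟩ := exists_rectangles hl hP a b
  obtain ⟨C₂, hC₂⟩ := hE a' b' (δ / 2) (by linarith)
  obtain ⟨C₃, hC₃⟩ := exists_norm_Gamma_le a' b' (δ := δ / 2) (by linarith) (by linarith)
  set τ := 2 * Real.pi / Real.log lam with hτ
  have hτ0 : 0 < τ := by positivity
  set c := Real.pi / 2 - δ with hc
  have hc0 : 0 < c := by rw [hc]; linarith
  have hbd : ∀ s : ℂ, a' ≤ s.re → s.re ≤ b' →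
      (s.re = a' ∨ s.re = b' ∨ ∃ n : ℤ, s.im = y₀ + n * τ) → 1 ≤ |s.im| →
      ‖F s‖ ≤ |C₁| * (|C₂| * |C₃|) * Real.exp (-(c * |s.im|)) := by
    intro s h1 h2 h3 h4
    obtain ⟨h5, h6⟩ := hC₁ s h1 h2 h3
    have h7 : F s = (P.eval ((lam : ℂ) ^ (-s)))⁻¹ * (E s * Complex.Gamma s) := by
      rw [← hFE s (fun h => by rw [h, abs_zero] at h4; linarith), inv_mul_cancel_left₀ h5]
    have e : Real.exp (-(c * |s.im|)) = Real.exp (δ / 2 * |s.im|) *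
        Real.exp (-((Real.pi / 2 - δ / 2) * |s.im|)) := by
      rw [← Real.exp_add, hc]; ring_nf
    have h8 : ‖E s‖ ≤ |C₂| * Real.exp (δ / 2 * |s.im|) := (hC₂ s h1 h2).trans (by
      gcongr; exact le_abs_self _)
    have h9 : ‖Complex.Gamma s‖ ≤ |C₃| * Real.exp (-((Real.pi / 2 - δ / 2) * |s.im|)) :=
      (hC₃ s h1 h2 h4).trans (by gcongr; exact le_abs_self _)
    rw [h7, norm_mul, norm_mul, e]
    calc _ ≤ |C₁| * ((|C₂| * Real.exp (δ / 2 * |s.im|)) *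
          (|C₃| * Real.exp (-((Real.pi / 2 - δ / 2) * |s.im|)))) := by
          gcongr
          exact h6.trans (le_abs_self _)
      _ = _ := by ring
  obtain ⟨C₄, hC₄⟩ := (IsCompact.reProdIm (isCompact_Icc (a := a) (b := b))
    (isCompact_Icc (a := -(τ + 1)) (b := τ + 1))).exists_bound_of_continuousOn
    (f := F) hF.continuous.continuousOn
  refine ⟨|C₁| * (|C₂| * |C₃|) * Real.exp (c * τ) + |C₄| * Real.exp (c * (τ + 1)),
    fun s h1 h2 => ?_⟩
  rw [add_mul]
  have hpos1 : 0 ≤ |C₁| * (|C₂| * |C₃|) * Real.exp (c * τ) * Real.exp (-(c * |s.im|)) := by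
    positivity
  have hpos2 : 0 ≤ |C₄| * Real.exp (c * (τ + 1)) * Real.exp (-(c * |s.im|)) := by positivity
  rcases le_total |s.im| (τ + 1) with h | h
  · have h5 : ‖F s‖ ≤ |C₄| := (hC₄ s ⟨⟨h1, h2⟩, abs_le.1 h⟩).trans (le_abs_self _)
    have h6 : 1 ≤ Real.exp (c * (τ + 1)) * Real.exp (-(c * |s.im|)) := by
      rw [← Real.exp_add]
      refine Real.one_le_exp ?_
      nlinarith
    have h7 := mul_le_mul_of_nonneg_left h6 (abs_nonneg C₄)
    linarith
  -- The rectangle of the grid around `s` has height `τ`, so passing from its boundary to `s` by the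
  -- maximum principle costs only the constant factor `exp (c τ)`.
  · set n : ℤ := ⌊(s.im - y₀) / τ⌋ with hn
    have hn1 : y₀ + n * τ ≤ s.im := by
      have := (le_div_iff₀ hτ0).1 (Int.floor_le ((s.im - y₀) / τ))
      linarith
    have hn2 : s.im ≤ y₀ + (n + 1) * τ := by
      have := ((div_lt_iff₀ hτ0).1 (Int.lt_floor_add_one ((s.im - y₀) / τ))).le
      linarith
    have hF1 : ‖F s‖ ≤ |C₁| * (|C₂| * |C₃|) * Real.exp (-(c * (|s.im| - τ))) := by
      refine norm_le_on_rectangle hF (a := a') (b := b') (c := y₀ + n * τ)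
        (e := y₀ + (n + 1) * τ) (fun z g1 g2 g3 g4 g5 => ?_) (by linarith) (by linarith) hn1 hn2
      have hz : |s.im| - τ ≤ |z.im| := by
        have : |s.im| - |z.im| ≤ |s.im - z.im| := abs_sub_abs_le_abs_sub _ _
        have : |s.im - z.im| ≤ τ := abs_le.2 ⟨by linarith, by linarith⟩
        linarith
      refine (hbd z g1 g2 ?_ (by linarith)).trans ?_
      · rcases g5 with g5 | g5 | g5 | g5
        · exact Or.inl g5
        · exact Or.inr (Or.inl g5)
        · exact Or.inr (Or.inr ⟨n, g5⟩)
        · exact Or.inr (Or.inr ⟨n + 1, by rw [g5]; push_cast; ring⟩)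
      · gcongr
    have e : Real.exp (-(c * (|s.im| - τ))) = Real.exp (c * τ) * Real.exp (-(c * |s.im|)) := by
      rw [← Real.exp_add]; ring_nf
    rw [e, ← mul_assoc] at hF1
    linarith

/-! ### The exponential sum of a decimated spectrum -/

/-- The restriction of a multiplicity function to nonzero points. -/
noncomputable def offZero (mult : ℝ → ℕ) (x : ℝ) : ℕ := if x = 0 then 0 else mult x

/-- The common denominator of the terms of `zetaSum`. -/
noncomputable def commonDen (d : ℕ) (A : Finset ℂ) (den : ℂ → Polynomial ℂ) : Polynomial ℂ :=
  (∏ w ∈ A, den w) * (1 - Polynomial.C (d : ℂ) * Polynomial.X)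

/-- The product of `zetaSum` with its common denominator. -/
noncomputable def zetaNum (lam : ℝ) (A : Finset ℂ) (num den : ℂ → Polynomial ℂ)
    (Y : ℂ → ℂ → ℂ) (s : ℂ) : ℂ :=
  ∑ w ∈ A, (Polynomial.X * num w * ∏ v ∈ A.erase w, den v).eval ((lam : ℂ) ^ (-s)) * Y w s

namespace IsDecimation

variable {mult : ℝ → ℕ} {n : ℂ → ℝ → ℕ} {lam : ℝ} {d : ℕ} {A : Finset ℂ} {β : ℂ → ℕ → ℕ}
  {num den : ℂ → Polynomial ℂ} {Y : ℂ → ℂ → ℂ} {σ₀ : ℝ}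

theorem commonDen_ne_zero (h : IsDecimation mult n lam d A β num den) :
    commonDen d A den ≠ 0 := by
  refine mul_ne_zero (Finset.prod_ne_zero_iff.2 fun w hw => (h.rational w hw).ne_zero) fun h0 => ?_
  have := congrArg (Polynomial.eval 0) h0
  simp at this

/-- With `x = lam ^ (-s)` one has `lam ^ s - d = (1 - d x) / x`; this is the origin of the factor
`X` in `zetaNum`. -/
theorem commonDen_mul_zetaSum (h : IsDecimation mult n lam d A β num den) {s : ℂ}
    (hs : (commonDen d A den).eval ((lam : ℂ) ^ (-s)) ≠ 0) :
    (commonDen d A den).eval ((lam : ℂ) ^ (-s)) * zetaSum lam d A num den Y s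
      = zetaNum lam A num den Y s := by
  have hl := h.one_lt_lam
  have hx : (lam : ℂ) ^ (-s) ≠ 0 := by rw [ofReal_cpow_eq_exp hl]; exact Complex.exp_ne_zero _
  have hinv : (lam : ℂ) ^ s = ((lam : ℂ) ^ (-s))⁻¹ := by rw [Complex.cpow_neg, inv_inv]
  rw [zetaSum, zetaNum, Finset.mul_sum]
  refine Finset.sum_congr rfl fun w hw => ?_
  rw [hinv]
  set x := (lam : ℂ) ^ (-s)
  rw [commonDen, ← Finset.mul_prod_erase A den hw] at hs ⊢
  simp only [Polynomial.eval_mul, Polynomial.eval_sub, Polynomial.eval_one, Polynomial.eval_C,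
    Polynomial.eval_X] at hs ⊢
  have h1 : (den w).eval x ≠ 0 := fun h0 => hs (by rw [h0]; ring)
  have h2 : 1 - (d : ℂ) * x ≠ 0 := fun h0 => hs (by rw [h0]; ring)
  have h3 : x⁻¹ - d = (1 - (d : ℂ) * x) / x := by field_simp
  rw [h3]
  field_simp

theorem zetaNum_growth (h : IsDecimation mult n lam d A β num den)
    (hY : ∀ w ∈ A, IsContinuation (n w) lam d (if w = 0 then 1 else 0) (Y w)) (a b δ : ℝ)
    (hδ : 0 < δ) : ∃ C, ∀ s : ℂ, a ≤ s.re → s.re ≤ b →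
      ‖zetaNum lam A num den Y s‖ ≤ C * Real.exp (δ * |s.im|) := by
  have hl := h.one_lt_lam
  have hw : ∀ w ∈ A, ∃ C, ∀ s : ℂ, a ≤ s.re → s.re ≤ b →
      ‖(Polynomial.X * num w * ∏ v ∈ A.erase w, den v).eval ((lam : ℂ) ^ (-s)) * Y w s‖
        ≤ C * Real.exp (δ * |s.im|) := by
    intro w hw
    obtain ⟨C₁, hC₁⟩ := exists_norm_eval_cpow_le hl
      (Polynomial.X * num w * ∏ v ∈ A.erase w, den v) a b
    obtain ⟨C₂, hC₂⟩ := (hY w hw).growth a b δ hδ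
    refine ⟨|C₁| * C₂, fun s h1 h2 => ?_⟩
    rw [norm_mul, mul_assoc |C₁|]
    exact mul_le_mul ((hC₁ s h1 h2).trans (le_abs_self _)) (hC₂ s h1 h2) (norm_nonneg _)
      (abs_nonneg _)
  choose! C hC using hw
  refine ⟨∑ w ∈ A, C w, fun s h1 h2 => ?_⟩
  rw [zetaNum, Finset.sum_mul]
  exact (norm_sum_le _ _).trans (Finset.sum_le_sum fun w hw => hC w hw s h1 h2)

theorem differentiable_zetaNum (h : IsDecimation mult n lam d A β num den)
    (hY : ∀ w ∈ A, IsContinuation (n w) lam d (if w = 0 then 1 else 0) (Y w)) :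
    Differentiable ℂ (zetaNum lam A num den Y) :=
  Differentiable.fun_sum fun w hw =>
    (differentiable_eval_cpow_neg h.one_lt_lam _).mul (hY w hw).entire

theorem eventually_eval_ne_zero {lam : ℝ} (hl : 1 < lam) {P : Polynomial ℂ} (hP : P ≠ 0) (s : ℂ) :
    ∀ᶠ z in 𝓝[≠] s, P.eval ((lam : ℂ) ^ (-z)) ≠ 0 := by
  have hd := differentiable_eval_cpow_neg hl P
  rcases (hd.analyticAt s).eventually_eq_zero_or_eventually_ne_zero with h0 | h0
  · exfalso
    have h1 : ∀ z : ℂ, P.eval ((lam : ℂ) ^ (-z)) = 0 := fun z =>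
      congrFun (AnalyticOnNhd.eq_of_eventuallyEq (fun z _ => hd.analyticAt z)
        (fun z _ => analyticAt_const (v := (0 : ℂ))) h0) z
    refine hP (Polynomial.eq_zero_of_infinite_isRoot P ?_)
    refine Set.Infinite.mono (s := {0}ᶜ) (fun r (hr :
        r ≠ 0) => ?_) (Set.finite_singleton _).infinite_compl
    obtain ⟨z, hz⟩ := exists_cpow_neg_eq hl hr
    have := h1 z
    rwa [hz] at this
  · exact h0

theorem zetaSum_eq_dirichlet (h : IsDecimation mult n lam d A β num den)
    (hσ : IsGreatest (exponents lam d A den) σ₀)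
    (hY : ∀ w ∈ A, IsContinuation (n w) lam d (if w = 0 then 1 else 0) (Y w)) {s : ℂ}
    (hs : σ₀ < s.re) :
    HasSum (fun x : ℝ => (offZero mult x : ℂ) * (x : ℂ) ^ (-s)) (zetaSum lam d A num den Y s) := by
  have h1 := h.hasSum hσ hY hs
  have h2 : (Function.support fun x : ℝ => (offZero mult x : ℂ) * (x : ℂ) ^ (-s)) ⊆ {x | x ≠ 0} :=
    fun x hx h0 => hx (by simp [offZero, show x = 0 from h0])
  rw [← hasSum_subtype_iff_of_support_subset h2]
  refine h1.congr_fun fun x => ?_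
  simp only [Function.comp, offZero, if_neg (show (x : ℝ) ≠ 0 from x.2)]

theorem mult_of_neg (h : IsDecimation mult n lam d A β num den) {x : ℝ} (hx : x < 0) :
    mult x = 0 := by
  rw [h.mult_eq x hx.ne]
  exact Finset.sum_eq_zero fun w hw =>
    (h.scaling w hw).isMult.dilate_of_nonpos h.one_lt_lam _ hx.le

theorem isMellinPair (h : IsDecimation mult n lam d A β num den)
    (hσ : IsGreatest (exponents lam d A den) σ₀)
    (hY : ∀ w ∈ A, IsContinuation (n w) lam d (if w = 0 then 1 else 0) (Y w)) :
    IsMellinPair σ₀ (expSum (offZero mult))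
      (fun s => zetaSum lam d A num den Y s * Complex.Gamma s) := by
  have h0 : ∀ x ≤ 0, offZero mult x = 0 := fun x hx => by
    rcases hx.lt_or_eq with hx | hx
    · rw [offZero, if_neg hx.ne, h.mult_of_neg hx]
    · rw [offZero, if_pos hx]
  refine (isMellinPair_expSum h0 (h.pos hσ) fun σ hs => ?_).congr fun s hs => ?_
  · have h1 := (h.zetaSum_eq_dirichlet hσ hY (s := (σ : ℂ)) (by simpa using hs)).summable.norm
    refine h1.congr fun x => ?_
    rcases le_or_gt x 0 with hx | hx
    · simp [h0 x hx]
    · rw [norm_mul, Complex.norm_natCast, Complex.norm_cpow_eq_rpow_re_of_pos hx]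
      simp
  · rw [dirichlet, (h.zetaSum_eq_dirichlet hσ hY hs).tsum_eq]

theorem eval_recipPoly_latticePt {lam : ℝ} (hl : 1 < lam) {W : Finset ℂ} {α : ℂ} (hα : α ∈ W)
    (k : ℤ) : (recipPoly (W.image fun α => (lam : ℂ) ^ α)).eval
      ((lam : ℂ) ^ (-latticePt lam α k)) = 0 := by
  rw [eval_recipPoly]
  refine Finset.prod_eq_zero (Finset.mem_image_of_mem _ hα) ?_
  have : (lam : ℂ) ^ α ≠ 0 := by rw [ofReal_cpow_eq_exp hl]; exact Complex.exp_ne_zero _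
  rw [Complex.cpow_neg, cpow_latticePt hl, mul_inv_cancel₀ this, sub_self]

theorem analyticAt_zetaSum_mul_Gamma (h : IsDecimation mult n lam d A β num den)
    (hσ : IsGreatest (exponents lam d A den) σ₀)
    (hY : ∀ w ∈ A, IsContinuation (n w) lam d (if w = 0 then 1 else 0) (Y w)) {s : ℂ}
    (hs : σ₀ < s.re) :
    ContinuousAt (fun s => zetaSum lam d A num den Y s * Complex.Gamma s) s := by
  have hl := h.one_lt_lam
  refine ContinuousAt.mul ?_ (analyticAt_Gamma ((h.pos hσ).trans hs)).continuousAt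
  unfold zetaSum
  refine tendsto_finsetSum _ fun w hw => ?_
  refine ContinuousAt.mul (ContinuousAt.div (differentiable_eval_cpow_neg hl
      _).continuous.continuousAt
    (differentiable_eval_cpow_neg hl _).continuous.continuousAt (h.den_ne_zero hσ hw hs))
    (ContinuousAt.div (hY w hw).entire.continuous.continuousAt
      ((differentiable_ofReal_cpow hl).continuous.sub continuous_const).continuousAt
      (h.cpow_ne hσ hs))

/-- The factor `q` vanishes on all lattices of poles, so it removes simple poles. Multiplied by the
common denominator, `q G` becomes `q zetaNum Γ`, a function of arbitrarily small exponential growth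
times `Γ`, which provides the decay required by the expansion theorem for Mellin pairs. -/
theorem exists_expansion (h : IsDecimation mult n lam d A β num den)
    (hσ : IsGreatest (exponents lam d A den) σ₀)
    (hY : ∀ w ∈ A, IsContinuation (n w) lam d (if w = 0 then 1 else 0) (Y w)) {W : Finset ℂ}
    (hne : W.Nonempty) (hinj : InjOn (fun α : ℂ => (lam : ℂ) ^ α) W)
    (hW : ∀ s : ℂ, IsPole (fun s => zetaSum lam d A num den Y s * Complex.Gamma s) s →
      ∃ α ∈ W, ∃ k : ℤ, s = latticePt lam α k)
    (hsimple : ∀ s : ℂ, -1 ≤ meromorphicOrderAt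
      (fun s => zetaSum lam d A num den Y s * Complex.Gamma s) s) :
    ∃ H : ℂ → ℝ → ℂ, (∀ α ∈ W, IsResidueFunction lam
        (fun s => zetaSum lam d A num den Y s * Complex.Gamma s) α (H α)) ∧
      ∀ M : ℝ, (fun t : ℝ => expSum (offZero mult) t -
        ∑ α ∈ W, (t : ℂ) ^ (-α) * H α (Real.logb lam t)) =O[𝓝[>] 0] fun t => t ^ M := by
  have hl := h.one_lt_lam
  set G : ℂ → ℂ := fun s => zetaSum lam d A num den Y s * Complex.Gamma s with hG
  set Q := recipPoly (W.image fun α => (lam : ℂ) ^ α) with hQ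
  set q : ℂ → ℂ := fun s => Q.eval ((lam : ℂ) ^ (-s)) with hq
  have hqd : Differentiable ℂ q := differentiable_eval_cpow_neg hl _
  have hGm : ∀ s, MeromorphicAt G s := fun s =>
    (h.meromorphic_zetaSum hY s).mul (meromorphicAt_Gamma s)
  have hgm : MeromorphicOn (q * G) univ := fun s _ => (hqd.analyticAt s).meromorphicAt.mul (hGm s)
  have hord : ∀ s, 0 ≤ meromorphicOrderAt (q * G) s := by
    intro s
    rw [meromorphicOrderAt_mul (hqd.analyticAt s).meromorphicAt (hGm s)]
    have h1 : 0 ≤ meromorphicOrderAt q s := (hqd.analyticAt s).meromorphicOrderAt_nonneg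
    by_cases hp : IsPole G s
    · obtain ⟨α, hα, k, rfl⟩ := hW s hp
      have h2 : meromorphicOrderAt q (latticePt lam α k) ≠ 0 := fun h0 =>
        ((hqd.analyticAt _).meromorphicNFAt.meromorphicOrderAt_eq_zero_iff.1 h0)
          (eval_recipPoly_latticePt hl hα k)
      have h3 : 1 ≤ meromorphicOrderAt q (latticePt lam α k) := by
        revert h1 h2
        cases meromorphicOrderAt q (latticePt lam α k) with
        | top => exact fun _ _ => le_top
        | coe m =>
          intro h1 h2
          have h1' : 0 ≤ m := by exact_mod_cast h1
          have h2' : m ≠ 0 := by exact_mod_cast h2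
          exact_mod_cast (by omega : 1 ≤ m)
      calc (0 : WithTop ℤ) = 1 + (-1) := by norm_cast
        _ ≤ _ := add_le_add h3 (hsimple _)
    · exact add_nonneg h1 (not_lt.1 hp)
  -- The normal form fills the removable singularities; `F` equals `q G` in punctured neighbourhoods
  -- only, so pointwise equalities are recovered by continuity.
  set F := toMeromorphicNFOn (q * G) univ with hF
  have hFnf := meromorphicNFOn_toMeromorphicNFOn (q * G) univ
  have hFd : Differentiable ℂ F := fun s => by
    refine AnalyticAt.differentiableAt ?_
    rw [← (hFnf (mem_univ s)).meromorphicOrderAt_nonneg_iff_analyticAt,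
      meromorphicOrderAt_toMeromorphicNFOn hgm (mem_univ s)]
    exact hord s
  have hFG' : ∀ s, ∀ᶠ z in 𝓝[≠] s, F z = q z * G z := fun s =>
    hgm.toMeromorphicNFOn_eq_self_on_nhdsNE (mem_univ s)
  have hdecay : HasGammaDecay F := by
    refine hasGammaDecay_of_mul_eq hl h.commonDen_ne_zero hFd
      (E := fun s => q s * zetaNum lam A num den Y s) (fun a b δ hδ => ?_) fun s hs => ?_
    · obtain ⟨C₁, hC₁⟩ := exists_norm_eval_cpow_le hl Q a b
      obtain ⟨C₂, hC₂⟩ := h.zetaNum_growth hY a b δ hδ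
      refine ⟨|C₁| * C₂, fun s h1 h2 => ?_⟩
      rw [norm_mul, mul_assoc]
      exact mul_le_mul ((hC₁ s h1 h2).trans (le_abs_self _)) (hC₂ s h1 h2) (norm_nonneg _)
        (abs_nonneg _)
    · have hΓ : ContinuousAt Complex.Gamma s := by
        refine (Complex.differentiableAt_Gamma s fun m hm => hs ?_).continuousAt
        rw [hm]; simp
      refine eq_of_frequently_eq
        (f := fun s => (commonDen d A den).eval ((lam : ℂ) ^ (-s)) * F s)
        (g := fun s => q s * zetaNum lam A num den Y s * Complex.Gamma s)
        ((differentiable_eval_cpow_neg hl _).continuous.continuousAt.mul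
          hFd.continuous.continuousAt)
        ((hqd.continuous.continuousAt.mul
          (h.differentiable_zetaNum hY).continuous.continuousAt).mul hΓ) ?_
      filter_upwards [hFG' s, eventually_eval_ne_zero hl h.commonDen_ne_zero s] with z h1 h2
      rw [h1, ← h.commonDen_mul_zetaSum h2, hG]
      ring
  exact (h.isMellinPair hσ hY).exists_expansion hl hne hinj hFd hdecay (fun s hs =>
    eq_of_frequently_eq (g := fun s => q s * G s) hFd.continuous.continuousAt
      (hqd.continuous.continuousAt.mul (h.analyticAt_zetaSum_mul_Gamma hσ hY hs)) (hFG' s)) hFG'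

end IsDecimation

/-! ### Addresses, cells and the boundary of the fractal -/

namespace Similitudes

variable {d m : ℕ} (F : Similitudes d m)

theorem dist_map (i : Fin m) (x y : Euc d) : dist (F.map i x) (F.map i y)
    = F.ratio i * dist x y := by
  rw [dist_eq_norm, dist_eq_norm, ← F.norm_lin, map, map, add_sub_add_left_eq_sub, ← map_sub]
  congr 2
  abel

theorem continuous_map (i : Fin m) : Continuous (F.map i) :=
  (LipschitzWith.of_dist_le_mul (K := (F.ratio i).toNNReal) fun x y => by
    rw [dist_map, Real.coe_toNNReal _ (F.ratio_pos i).le]).continuous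

theorem exists_ratio_le : ∃ ρ : ℝ, 0 ≤ ρ ∧ ρ < 1 ∧ ∀ i, F.ratio i ≤ ρ := by
  rcases isEmpty_or_nonempty (Fin m) with h | h
  · exact ⟨0, le_rfl, one_pos, fun i => h.elim i⟩
  · obtain ⟨i, hi⟩ := Finite.exists_max F.ratio
    exact ⟨F.ratio i, (F.ratio_pos i).le, F.ratio_lt_one i, hi⟩

theorem dist_wordMap_le {ρ : ℝ} (h0 : 0 ≤ ρ) (hρ : ∀ i, F.ratio i ≤ ρ) (ε : ℕ → Fin m) (n : ℕ)
    (x y : Euc d) : dist (F.wordMap ε n x) (F.wordMap ε n y) ≤ ρ ^ n * dist x y := by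
  induction n generalizing x y with
  | zero => simp [wordMap]
  | succ n ih =>
    refine (ih _ _).trans ?_
    rw [dist_map, pow_succ, mul_assoc]
    gcongr
    exact hρ _

theorem tendsto_wordMap_proj (ε : ℕ → Fin m) :
    Tendsto (fun n => F.wordMap ε n 0) atTop (𝓝 (F.proj ε)) := by
  obtain ⟨ρ, h0, h1, hρ⟩ := F.exists_ratio_le
  obtain ⟨C, hC⟩ := (Set.finite_range fun i => dist 0 (F.map i 0)).bddAbove
  refine (cauchySeq_of_le_geometric ρ C h1 fun n => ?_).tendsto_limUnder
  change dist (F.wordMap ε n 0) (F.wordMap ε n (F.map (ε n) 0)) ≤ _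
  refine (F.dist_wordMap_le h0 hρ ε n _ _).trans ?_
  rw [mul_comm]
  gcongr
  exact hC ⟨_, rfl⟩

theorem tendsto_wordMap (ε : ℕ → Fin m) {x : ℕ → Euc d} (hx : Bornology.IsBounded (range x)) :
    Tendsto (fun n => F.wordMap ε n (x n)) atTop (𝓝 (F.proj ε)) := by
  obtain ⟨ρ, h0, h1, hρ⟩ := F.exists_ratio_le
  obtain ⟨R, hR⟩ := hx.subset_closedBall 0
  refine (F.tendsto_wordMap_proj ε).congr_dist ?_
  refine squeeze_zero (fun _ => dist_nonneg) (fun n => (F.dist_wordMap_le h0 hρ ε n _ _).trans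
    (mul_le_mul_of_nonneg_left (b := dist 0 (x n)) (c := R) ?_ (pow_nonneg h0 n))) ?_
  · rw [dist_comm]; exact hR ⟨n, rfl⟩
  · simpa using (tendsto_pow_atTop_nhds_zero_of_lt_one h0 h1).mul_const R

/-- The sequence `i ε_0 ε_1 …`. -/
def cons (i : Fin m) (ε : ℕ → Fin m) : ℕ → Fin m
  | 0 => i
  | n + 1 => ε n

theorem wordMap_cons (i : Fin m) (ε : ℕ → Fin m) (n : ℕ) :
    F.wordMap (cons i ε) (n + 1) = F.map i ∘ F.wordMap ε n := by
  induction n with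
  | zero => rfl
  | succ n ih =>
    change F.wordMap (cons i ε) (n + 1) ∘ F.map (ε n) = _
    rw [ih]
    rfl

theorem map_proj (i : Fin m) (ε : ℕ → Fin m) : F.map i (F.proj ε) = F.proj (cons i ε) := by
  refine tendsto_nhds_unique (((F.continuous_map i).tendsto _).comp (F.tendsto_wordMap_proj ε)) ?_
  refine ((F.tendsto_wordMap_proj (cons i ε)).comp (tendsto_add_atTop_nat 1)).congr fun n => ?_
  simp only [Function.comp, wordMap_cons]

end Similitudes

namespace PCFFractal

variable {d m : ℕ} (X : PCFFractal d m)

theorem map_mem (i : Fin m) {x : Euc d} (hx : x ∈ X.carrier) : X.map i x ∈ X.carrier := by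
  rw [X.selfSimilar]
  exact mem_iUnion.2 ⟨i, x, hx, rfl⟩

theorem wordMap_mem (ε : ℕ → Fin m) (n : ℕ) {x : Euc d} (hx : x ∈ X.carrier) :
    X.wordMap ε n x ∈ X.carrier := by
  induction n generalizing x with
  | zero => exact hx
  | succ n ih => exact ih (X.map_mem _ hx)

theorem proj_mem (ε : ℕ → Fin m) : X.proj ε ∈ X.carrier := by
  obtain ⟨x, hx⟩ := X.nonempty
  refine X.isCompact.isClosed.mem_of_tendsto (X.tendsto_wordMap ε (x := fun _ => x) ?_)
    (Eventually.of_forall fun n => X.wordMap_mem ε n hx)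
  exact (Bornology.isBounded_singleton (x := x)).subset (range_subset_iff.2 fun _ => rfl)

theorem exists_proj_eq {x : Euc d} (hx : x ∈ X.carrier) : ∃ ε, X.proj ε = x := by
  have h : ∀ y : X.carrier, ∃ (i : Fin m) (z : X.carrier), X.map i z = y := by
    rintro ⟨y, hy⟩
    rw [X.selfSimilar] at hy
    obtain ⟨i, z, hz, rfl⟩ := mem_iUnion.1 hy
    exact ⟨i, ⟨z, hz⟩, rfl⟩
  choose I Z hIZ using h
  set y : ℕ → X.carrier := fun n => Z^[n] ⟨x, hx⟩ with hy
  set ε : ℕ → Fin m := fun n => I (y n) with hε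
  have hw : ∀ n, X.wordMap ε n (y n) = x := by
    intro n
    induction n with
    | zero => rfl
    | succ n ih =>
      change X.wordMap ε n (X.map (ε n) (y (n + 1))) = x
      have : y (n + 1) = Z (y n) := Function.iterate_succ_apply' _ _ _
      rw [this, hIZ, ih]
  refine ⟨ε, tendsto_nhds_unique (X.tendsto_wordMap ε (x := fun n => y n) ?_) ?_⟩
  · exact X.isCompact.isBounded.subset (by rintro _ ⟨n, rfl⟩; exact (y n).2)
  · simp only [hw]
    exact tendsto_const_nhds

/-- If `η` is an address of `y`, then `i η` is an address of a point in two different cells, hence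
critical, and its shift `η` is post-critical. -/
theorem mem_V0_of_map_mem {i j : Fin m} (hij : i ≠ j) {y : Euc d} (hy : y ∈ X.carrier)
    (hj : X.map i y ∈ X.map j '' X.carrier) : y ∈ X.V0 := by
  obtain ⟨η, rfl⟩ := X.exists_proj_eq hy
  refine ⟨η, ⟨Similitudes.cons i η, ⟨i, j, hij, ?_⟩, 1, le_rfl, rfl⟩, rfl⟩
  rw [← X.map_proj]
  exact ⟨⟨_, hy, rfl⟩, hj⟩

theorem V0_subset : X.V0 ⊆ X.carrier := by
  rintro _ ⟨η, -, rfl⟩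
  exact X.proj_mem η

theorem finite_V0 : X.V0.Finite := X.pcf.image _

/-- Shifting a post-critical address once more leaves it post-critical, so boundary points are
vertices of level one. -/
theorem exists_map_eq_of_mem_V0 {x : Euc d} (hx : x ∈ X.V0) : ∃ i, ∃ v ∈ X.V0, X.map i v = x := by
  obtain ⟨η, ⟨ε, hε, n, hn, rfl⟩, rfl⟩ := hx
  refine ⟨ε (0 + n), X.proj fun k => ε (k + (n + 1)), ⟨_, ⟨ε, hε, n + 1, by omega, rfl⟩, rfl⟩, ?_⟩
  rw [X.map_proj]
  congr 1
  funext k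
  cases k with
  | zero => rfl
  | succ k => simp only [Similitudes.cons]; congr 1; omega

theorem isClosed_cell (i : Fin m) : IsClosed (X.map i '' X.carrier) :=
  (X.isCompact.image (X.continuous_map i)).isClosed

/-- The cells of level one form a connected graph. -/
theorem reflTransGen_cells (i j : Fin m) : Relation.ReflTransGen
    (fun i j => i ≠ j ∧ (X.map i '' X.carrier ∩ X.map j '' X.carrier).Nonempty) i j := by
  set R : Fin m → Fin m → Prop :=
    fun i j => i ≠ j ∧ (X.map i '' X.carrier ∩ X.map j '' X.carrier).Nonempty
  by_contra hij
  -- The reachable and the unreachable cells would form two closed sets that cover the connected set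
  -- `K`; a common point links a reachable cell to an unreachable one.
  set U : Set (Euc d) := ⋃ k ∈ {k | Relation.ReflTransGen R i k}, X.map k '' X.carrier
  set V : Set (Euc d) := ⋃ k ∈ {k | ¬ Relation.ReflTransGen R i k}, X.map k '' X.carrier
  have hU : IsClosed U := (Set.toFinite _).isClosed_biUnion fun k _ => X.isClosed_cell k
  have hV : IsClosed V := (Set.toFinite _).isClosed_biUnion fun k _ => X.isClosed_cell k
  have hcov : X.carrier ⊆ U ∪ V := by
    intro x hx
    rw [X.selfSimilar] at hx
    obtain ⟨k, hk⟩ := mem_iUnion.1 hx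
    by_cases h : Relation.ReflTransGen R i k
    · exact Or.inl (mem_iUnion₂.2 ⟨k, h, hk⟩)
    · exact Or.inr (mem_iUnion₂.2 ⟨k, h, hk⟩)
  obtain ⟨x, hx⟩ := X.nonempty
  obtain ⟨y, -, hyU, hyV⟩ := isPreconnected_closed_iff.1 X.isConnected.isPreconnected U V hU hV
    hcov ⟨_, X.map_mem i hx, mem_iUnion₂.2 ⟨i, Relation.ReflTransGen.refl, x, hx, rfl⟩⟩
    ⟨_, X.map_mem j hx, mem_iUnion₂.2 ⟨j, hij, x, hx, rfl⟩⟩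
  obtain ⟨k, hk, hyk⟩ := mem_iUnion₂.1 hyU
  obtain ⟨l, hl, hyl⟩ := mem_iUnion₂.1 hyV
  exact hl (Relation.ReflTransGen.tail hk ⟨fun h => hl (h ▸ hk), y, hyk, hyl⟩)

theorem exists_common_point {i j : Fin m} (hij : i ≠ j)
    (h : (X.map i '' X.carrier ∩ X.map j '' X.carrier).Nonempty) :
    ∃ v ∈ X.V0, ∃ w ∈ X.V0, X.map i v = X.map j w := by
  obtain ⟨_, ⟨v, hv, rfl⟩, w, hw, hvw⟩ := h
  exact ⟨v, X.mem_V0_of_map_mem hij hv ⟨w, hw, hvw⟩, w,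
    X.mem_V0_of_map_mem hij.symm hw ⟨v, hv, hvw.symm⟩, hvw.symm⟩

theorem nonempty_V0 : X.V0.Nonempty := by
  have hm := X.two_le
  have h01 : (⟨0, by omega⟩ : Fin m) ≠ ⟨1, by omega⟩ := by simp
  have h := X.reflTransGen_cells ⟨0, by omega⟩ ⟨1, by omega⟩
  rcases h.cases_head with h | ⟨k, ⟨hk, hn⟩, -⟩
  · exact absurd h h01
  · obtain ⟨v, hv, -⟩ := X.exists_common_point hk hn
    exact ⟨v, hv⟩

end PCFFractal

/-! ### Energy bounds oscillation -/

/-- A linear functional that vanishes on the null space of a nonnegative symmetric bilinear form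
in finite dimension is bounded by the form. -/
theorem exists_sq_le_bilinForm {V : Type*} [AddCommGroup V] [Module ℝ V] [Module.Finite ℝ V]
    (e : LinearMap.BilinForm ℝ V) (hs : ∀ u v, e u v = e v u) (h0 : ∀ u, 0 ≤ e u u)
    (l : V →ₗ[ℝ] ℝ) (hl : ∀ u, e u u = 0 → l u = 0) :
    ∃ C, 0 ≤ C ∧ ∀ u, l u ^ 2 ≤ C * e u u := by
  -- In finite dimension this means `l = e(·, a)` for some `a`, and the claim is the Cauchy–Schwarz
  -- inequality.
  have h1 : l ∈ (LinearMap.ker e).dualAnnihilator := by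
    rw [Submodule.mem_dualAnnihilator]
    intro u hu
    refine hl u ?_
    rw [LinearMap.mem_ker.1 hu, LinearMap.zero_apply]
  rw [← LinearMap.range_dualMap_eq_dualAnnihilator_ker] at h1
  obtain ⟨ψ, hψ⟩ := h1
  obtain ⟨a, rfl⟩ := (Module.evalEquiv ℝ V).surjective ψ
  refine ⟨e a a, h0 a, fun u => ?_⟩
  have h2 : l u = e u a := by rw [← hψ]; rfl
  have h3 := LinearMap.BilinForm.apply_mul_apply_le_of_forall_zero_le e h0 u a
  rw [hs a u] at h3
  rw [h2, sq, mul_comm (e a a)]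
  exact h3

namespace PCFFractal.HarmonicStructure

variable {d m : ℕ} {X : PCFFractal d m} (S : X.HarmonicStructure)

/-- At level zero, compatibility says that `form` is the least level-one energy among all
extensions; higher levels are sums of this over cells. -/
theorem energy_le_succ (n : ℕ) (f : Euc d → ℝ) : S.energy n f f ≤ S.energy (n + 1) f f := by
  induction n generalizing f with
  | zero => exact (S.compatible (X.res f)).2 ⟨f, rfl, rfl⟩
  | succ n ih =>
    exact mul_le_mul_of_nonneg_left (Finset.sum_le_sum fun i _ =>
      mul_le_mul_of_nonneg_left (ih _) (inv_nonneg.2 (S.weight_pos i).le)) S.factor_pos.le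

theorem energy_mono (f : Euc d → ℝ) : Monotone fun n => S.energy n f f :=
  monotone_nat_of_le_succ fun n => S.energy_le_succ n f

theorem energy_comp_le (n : ℕ) (f : Euc d → ℝ) (i : Fin m) :
    S.energy n (f ∘ X.map i) (f ∘ X.map i) ≤ S.weight i / S.factor * S.energy (n + 1) f f := by
  have h := Finset.single_le_sum (f := fun i => (S.weight i)⁻¹ *
    S.energy n (f ∘ X.map i) (f ∘ X.map i)) (fun j _ =>
      mul_nonneg (inv_nonneg.2 (S.weight_pos j).le) (S.energy_nonneg n _)) (Finset.mem_univ i)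
  have hw := S.weight_pos i
  have hc := S.factor_pos
  change _ ≤ S.weight i / S.factor * (S.factor * _)
  rw [← mul_assoc, div_mul_cancel₀ _ hc.ne']
  have := mul_le_mul_of_nonneg_left h hw.le
  rwa [mul_inv_cancel_left₀ hw.ne'] at this

theorem exists_sub_sq_le_form : ∃ C, 0 ≤ C ∧ ∀ (u : X.V0 → ℝ) (x y : X.V0),
    (u x - u y) ^ 2 ≤ C * S.form u u := by
  have := X.finite_V0.to_subtype
  have := Fintype.ofFinite X.V0
  have h : ∀ q : X.V0 × X.V0, ∃ C, 0 ≤ C ∧ ∀ u : X.V0 → ℝ,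
      (u q.1 - u q.2) ^ 2 ≤ C * S.form u u := fun q =>
    exists_sq_le_bilinForm S.form S.isDirichlet.symm S.isDirichlet.nonneg
      ((LinearMap.proj q.1 : (X.V0 → ℝ) →ₗ[ℝ] ℝ) - LinearMap.proj q.2) fun u hu =>
        sub_eq_zero.2 (S.isDirichlet.const_of_zero u hu q.1 q.2)
  choose C hC0 hC using h
  refine ⟨∑ q, C q, Finset.sum_nonneg fun q _ => hC0 q, fun u x y => (hC (x, y) u).trans ?_⟩
  exact mul_le_mul_of_nonneg_right (Finset.single_le_sum (fun q _ => hC0 q)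
    (Finset.mem_univ (x, y))) (S.isDirichlet.nonneg u)

/-- Within a cell the level-one energy dominates a rescaled copy of `form`, which controls
differences on `V0`. Different cells are joined by a chain of intersecting ones, whose common points
are images of `V0`. -/
theorem exists_abs_sub_le_energy_one : ∃ D, 0 ≤ D ∧ ∀ (g : Euc d → ℝ) (i j : Fin m),
    ∀ v ∈ X.V0, ∀ w ∈ X.V0, |g (X.map i v) - g (X.map j w)| ≤ D * √(S.energy 1 g g) := by
  obtain ⟨C, hC0, hC⟩ := S.exists_sub_sq_le_form
  have hcell : ∀ (g : Euc d → ℝ) (i : Fin m), ∀ v ∈ X.V0, ∀ w ∈ X.V0,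
      |g (X.map i v) - g (X.map i w)| ≤ √C * √(S.energy 1 g g) := by
    intro g i v hv w hw
    rw [← Real.sqrt_mul hC0]
    refine Real.abs_le_sqrt ?_
    refine (hC (X.res (g ∘ X.map i)) ⟨v, hv⟩ ⟨w, hw⟩).trans (mul_le_mul_of_nonneg_left ?_ hC0)
    refine (S.energy_comp_le 0 g i).trans ?_
    exact mul_le_of_le_one_left (S.energy_nonneg 1 g)
      ((div_le_one S.factor_pos).2 (S.regular i).le)
  have h : ∀ q : Fin m × Fin m, ∃ D, 0 ≤ D ∧ ∀ g : Euc d → ℝ, ∀ v ∈ X.V0, ∀ w ∈ X.V0,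
      |g (X.map q.1 v) - g (X.map q.2 w)| ≤ D * √(S.energy 1 g g) := by
    rintro ⟨i, j⟩
    induction X.reflTransGen_cells i j with
    | refl => exact ⟨√C, Real.sqrt_nonneg _, fun g => hcell g i⟩
    | @tail j k _ hjk ih =>
      obtain ⟨D, hD0, hD⟩ := ih
      obtain ⟨a, ha, b, hb, hab⟩ := X.exists_common_point hjk.1 hjk.2
      refine ⟨D + √C, by positivity, fun g v hv w hw => ?_⟩
      have h1 := hD g v hv a ha
      have h2 := hcell g k b hb w hw
      simp only [hab] at h1
      have h3 := abs_sub_le (g (X.map i v)) (g (X.map k b)) (g (X.map k w))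
      simp only
      linarith
  choose D hD0 hD using h
  refine ⟨∑ q, D q, Finset.sum_nonneg fun q _ => hD0 q, fun g i j v hv w hw =>
    (hD (i, j) g v hv w hw).trans ?_⟩
  exact mul_le_mul_of_nonneg_right (Finset.single_le_sum (fun q _ => hD0 q)
    (Finset.mem_univ (i, j))) (Real.sqrt_nonneg _)

theorem exists_weight_le : ∃ θ : ℝ, 0 < θ ∧ θ < 1 ∧ ∀ i, S.weight i / S.factor ≤ θ := by
  have : Nonempty (Fin m) := ⟨⟨0, by have := X.two_le; omega⟩⟩
  obtain ⟨i, hi⟩ := Finite.exists_max fun i => S.weight i / S.factor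
  exact ⟨_, div_pos (S.weight_pos i) S.factor_pos, (div_lt_one S.factor_pos).2 (S.regular i), hi⟩

/-- Functions of finite energy have finite oscillation on `K`. -/
theorem exists_sub_sq_le : ∃ C, 0 ≤ C ∧ ∀ (f : Euc d → ℝ) (M : ℝ), ContinuousOn f X.carrier →
    (∀ n, S.energy n f f ≤ M) → ∀ x ∈ X.carrier, ∀ y ∈ X.carrier, (f x - f y) ^ 2 ≤ C * M := by
  obtain ⟨D, hD0, hD⟩ := S.exists_abs_sub_le_energy_one
  obtain ⟨θ, hθ0, hθ1, hθ⟩ := S.exists_weight_le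
  obtain ⟨v, hv⟩ := X.nonempty_V0
  obtain ⟨j, a, ha, hja⟩ := X.exists_map_eq_of_mem_V0 hv
  have hκ : √θ < 1 := by rw [Real.sqrt_lt' one_pos]; simpa using hθ1
  refine ⟨(2 * (D / (1 - √θ))) ^ 2, sq_nonneg _, fun f M hf hM => ?_⟩
  have hM0 : 0 ≤ M := (S.energy_nonneg 0 f).trans (hM 0)
  have key : ∀ x ∈ X.carrier, |f v - f x| ≤ D / (1 - √θ) * √M := by
    intro x hx
    obtain ⟨ε, rfl⟩ := X.exists_proj_eq hx
    -- Each further letter multiplies the energy by at most `r_i / c ≤ θ < 1`; this is where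
    -- regularity of the harmonic structure enters.
    have hE : ∀ n k, S.energy k (f ∘ X.wordMap ε n) (f ∘ X.wordMap ε n) ≤ θ ^ n * M := by
      intro n
      induction n with
      | zero => intro k; rw [pow_zero, one_mul]; exact hM k
      | succ n ih =>
        intro k
        refine (S.energy_comp_le k (f ∘ X.wordMap ε n) (ε n)).trans ?_
        rw [pow_succ', mul_assoc]
        exact mul_le_mul (hθ _) (ih _) (S.energy_nonneg _ _) hθ0.le
    -- As `v = F_j a` with `a` in `V0`, both points are level-one vertices of the cell of the first
    -- `n` letters, so their difference is controlled by its energy. The points converge to `x`, and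
    -- the differences sum geometrically.
    have hstep : ∀ n, dist (f (X.wordMap ε n v)) (f (X.wordMap ε (n + 1) v))
        ≤ D * √M * √θ ^ n := by
      intro n
      have h1 := hD (f ∘ X.wordMap ε n) j (ε n) a ha v hv
      rw [hja] at h1
      have h2 : √(S.energy 1 (f ∘ X.wordMap ε n) (f ∘ X.wordMap ε n)) ≤ √θ ^ n * √M := by
        refine (Real.sqrt_le_sqrt (hE n 1)).trans_eq ?_
        have h3 : √(θ ^ n) = √θ ^ n := by
          rw [← Real.sqrt_sq (pow_nonneg (Real.sqrt_nonneg θ) n), ← pow_mul, mul_comm, pow_mul,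
            Real.sq_sqrt hθ0.le]
        rw [Real.sqrt_mul (by positivity), h3]
      rw [Real.dist_eq]
      refine h1.trans ((mul_le_mul_of_nonneg_left h2 hD0).trans_eq (by ring))
    have hlim : Tendsto (fun n => f (X.wordMap ε n v)) atTop (𝓝 (f (X.proj ε))) := by
      have hvK := X.V0_subset hv
      have h1 := X.tendsto_wordMap ε (x := fun _ => v)
        ((Bornology.isBounded_singleton (x := v)).subset (range_subset_iff.2 fun _ => rfl))
      exact (hf _ (X.proj_mem ε)).tendsto.comp (tendsto_nhdsWithin_iff.2
        ⟨h1, Eventually.of_forall fun n => X.wordMap_mem ε n hvK⟩)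
    have := dist_le_of_le_geometric_of_tendsto₀ (√θ) (D * √M) hκ hstep hlim
    rw [Real.dist_eq] at this
    refine this.trans_eq ?_
    ring
  intro x hx y hy
  have h1 : |f x - f y| ≤ 2 * (D / (1 - √θ)) * √M := by
    have := abs_sub_le (f x) (f v) (f y)
    have h2 := key x hx
    rw [abs_sub_comm] at h2
    linarith [key y hy]
  calc (f x - f y) ^ 2 = |f x - f y| ^ 2 := (sq_abs _).symm
    _ ≤ (2 * (D / (1 - √θ)) * √M) ^ 2 := by gcongr
    _ = _ := by rw [mul_pow _ (√M), Real.sq_sqrt hM0]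

end PCFFractal.HarmonicStructure

/-! ### Integral operators with continuous kernel -/

section KernelOp

set_option linter.unusedSectionVars false

variable {E : Type*} [MetricSpace E] [MeasurableSpace E] [BorelSpace E]
  [SecondCountableTopology E] {μ : Measure E} [IsProbabilityMeasure μ] {K : Set E}

theorem memLp_of_continuousOn (hK : IsCompact K) (hμ : ∀ᵐ x ∂μ, x ∈ K) {g : E → ℝ}
    (hg : ContinuousOn g K) : MemLp g 2 μ := by
  obtain ⟨C, hC⟩ := hK.exists_bound_of_continuousOn hg
  refine MemLp.of_bound ?_ C (hμ.mono fun x hx => hC x hx)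
  rw [← Measure.restrict_eq_self_of_ae_mem hμ]
  exact hg.aestronglyMeasurable_of_isCompact hK hK.measurableSet

open Classical in
/-- The class of a square integrable function in `L²`, zero for other functions. -/
noncomputable def toL2 (μ : Measure E) (g : E → ℝ) : Lp ℝ 2 μ :=
  if h : MemLp g 2 μ then h.toLp g else 0

theorem coeFn_toL2 {g : E → ℝ} (hg : MemLp g 2 μ) : toL2 μ g =ᵐ[μ] g := by
  rw [toL2, dif_pos hg]
  exact hg.coeFn_toLp

theorem inner_toL2 {g : E → ℝ} (hg : MemLp g 2 μ) (u : Lp ℝ 2 μ) :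
    inner ℝ (toL2 μ g) u = ∫ y, g y * u y ∂μ := by
  rw [L2.inner_def]
  refine integral_congr_ae ?_
  filter_upwards [coeFn_toL2 hg] with y hy
  rw [hy]
  simp [mul_comm]

theorem norm_le_of_ae_le {u : Lp ℝ 2 μ} {C : ℝ} (hC : 0 ≤ C) (h : ∀ᵐ x ∂μ, |u x| ≤ C) :
    ‖u‖ ≤ C := by
  refine (Lp.norm_le_of_ae_bound hC h).trans_eq ?_
  simp [measureUnivNNReal]

theorem eq_zero_of_mem_support (hμ : ∀ᵐ x ∂μ, x ∈ K) {g : E → ℝ} (hg : ContinuousOn g K)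
    (h : g =ᵐ[μ] 0) {x : E} (hx : x ∈ K) (hxs : x ∈ μ.support) : g x = 0 := by
  by_contra h0
  have h1 : ∀ᶠ y in 𝓝 x, y ∈ K → g y ≠ 0 :=
    eventually_nhdsWithin_iff.1 ((hg x hx).eventually_ne h0)
  have h2 := (Measure.mem_support_iff_forall x).1 hxs _ h1
  refine h2.ne' (measure_mono_null (fun y hy => ?_) (hμ.and h))
  exact fun hy2 => hy hy2.1 hy2.2

/-- `T` is the integral operator on `L²` with the kernel `k`, continuous on `K × K`. -/
structure IsKernelOp (μ : Measure E) (K : Set E) (k : E → E → ℝ) (T : Lp ℝ 2 μ →L[ℝ] Lp ℝ 2 μ) :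
    Prop where
  cont : ContinuousOn (fun q : E × E => k q.1 q.2) (K ×ˢ K)
  ae_eq : ∀ u : Lp ℝ 2 μ, T u =ᵐ[μ] fun x => ∫ y, k x y * u y ∂μ

namespace IsKernelOp

variable {k k' : E → E → ℝ} {T T' : Lp ℝ 2 μ →L[ℝ] Lp ℝ 2 μ}

theorem cont_slice (h : IsKernelOp μ K k T) {x : E} (hx : x ∈ K) : ContinuousOn (k x) K :=
  h.cont.comp (f := fun y => (x, y)) (by fun_prop) fun _ hy => ⟨hx, hy⟩

theorem ae_inner (hK : IsCompact K) (hμ : ∀ᵐ x ∂μ, x ∈ K) (h : IsKernelOp μ K k T)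
    (u : Lp ℝ 2 μ) : ∀ᵐ x ∂μ, x ∈ K ∧ T u x = inner ℝ (toL2 μ (k x)) u := by
  filter_upwards [hμ, h.ae_eq u] with x hx h1
  rw [h1, inner_toL2 (memLp_of_continuousOn hK hμ (h.cont_slice hx))]
  exact ⟨hx, rfl⟩

theorem norm_sub_toL2_le (hK : IsCompact K) (hμ : ∀ᵐ x ∂μ, x ∈ K) {g g' : E → ℝ}
    (hg : ContinuousOn g K) (hg' : ContinuousOn g' K) {C : ℝ} (hC0 : 0 ≤ C)
    (hC : ∀ x ∈ K, |g x - g' x| ≤ C) : ‖toL2 μ g - toL2 μ g'‖ ≤ C := by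
  refine norm_le_of_ae_le hC0 ?_
  filter_upwards [coeFn_toL2 (memLp_of_continuousOn hK hμ hg),
    coeFn_toL2 (memLp_of_continuousOn hK hμ hg'), hμ,
    Lp.coeFn_sub (toL2 μ g) (toL2 μ g')] with x h1 h2 h3 h4
  rw [h4, Pi.sub_apply, h1, h2]
  exact hC x h3

theorem norm_sub_le (hK : IsCompact K) (hμ : ∀ᵐ x ∂μ, x ∈ K) (h : IsKernelOp μ K k T)
    (h' : IsKernelOp μ K k' T') {C : ℝ} (hC0 : 0 ≤ C)
    (hC : ∀ x ∈ K, ∀ y ∈ K, |k x y - k' x y| ≤ C) : ‖T - T'‖ ≤ C := by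
  refine ContinuousLinearMap.opNorm_le_bound _ hC0 fun u => ?_
  refine norm_le_of_ae_le (by positivity) ?_
  filter_upwards [h.ae_inner hK hμ u, h'.ae_inner hK hμ u, Lp.coeFn_sub (T u) (T' u)]
    with x h1 h2 h3
  rw [sub_apply, h3, Pi.sub_apply, h1.2, h2.2, ← inner_sub_left]
  exact (abs_real_inner_le_norm _ _).trans (mul_le_mul_of_nonneg_right (norm_sub_toL2_le hK hμ
    (h.cont_slice h1.1) (h'.cont_slice h1.1) hC0 (hC x h1.1)) (norm_nonneg _))

theorem continuousOn_inner (hK : IsCompact K) (hμ : ∀ᵐ x ∂μ, x ∈ K) (h : IsKernelOp μ K k T)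
    (u : Lp ℝ 2 μ) : ContinuousOn (fun x => inner ℝ (toL2 μ (k x)) u) K := by
  have hu := (hK.prod hK).uniformContinuousOn_of_continuous h.cont
  rw [Metric.uniformContinuousOn_iff_le] at hu
  refine ContinuousOn.inner (𝕜 := ℝ) ?_ continuousOn_const
  rw [Metric.continuousOn_iff]
  intro x hx ε hε
  obtain ⟨δ, hδ, H⟩ := hu (ε / 2) (half_pos hε)
  refine ⟨δ, hδ, fun y hy hxy => ?_⟩
  rw [dist_eq_norm]
  refine (norm_sub_toL2_le hK hμ (h.cont_slice hy) (h.cont_slice hx) (half_pos hε).le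
    fun z hz => ?_).trans_lt (half_lt_self hε)
  have := H (y, z) ⟨hy, hz⟩ (x, z) ⟨hx, hz⟩ (by simpa [Prod.dist_eq] using hxy.le)
  rwa [Real.dist_eq] at this

theorem exists_simpleFunc (hK : IsCompact K) (hKne : K.Nonempty) {δ : ℝ} (hδ : 0 < δ) :
    ∃ s : SimpleFunc E E, ∀ x ∈ K, s x ∈ K ∧ dist (s x) x < δ := by
  have : Nonempty K := hKne.to_subtype
  set e : ℕ → E := fun n => (TopologicalSpace.denseSeq K n : E)
  have hcov : K ⊆ ⋃ n, Metric.ball (e n) δ := fun x hx => by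
    obtain ⟨n, hn⟩ := (TopologicalSpace.denseRange_denseSeq K).exists_dist_lt (⟨x, hx⟩ : K) hδ
    exact mem_iUnion.2 ⟨n, hn⟩
  obtain ⟨I, hI⟩ := hK.elim_finite_subcover _ (fun n => Metric.isOpen_ball) hcov
  refine ⟨SimpleFunc.nearestPt e (I.sup id), fun x hx => ⟨?_, ?_⟩⟩
  · exact (TopologicalSpace.denseSeq K _).2
  · obtain ⟨n, hn, hxn⟩ := mem_iUnion₂.1 (hI hx)
    have h1 := SimpleFunc.edist_nearestPt_le e x (Finset.le_sup (f := id) hn)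
    rw [edist_dist, edist_dist, ENNReal.ofReal_le_ofReal_iff dist_nonneg] at h1
    refine h1.trans_lt ?_
    rw [dist_comm]
    exact hxn

/-- Replacing the first variable of the kernel by a nearby value of a simple function gives an
operator of finite rank. By uniform continuity of the kernel on `K × K` these approximate `T` in
norm. -/
theorem isCompactOperator (hK : IsCompact K) (hμ : ∀ᵐ x ∂μ, x ∈ K) (h : IsKernelOp μ K k T) :
    IsCompactOperator T := by
  have hKne : K.Nonempty := by
    obtain ⟨x, hx⟩ := hμ.exists
    exact ⟨x, hx⟩
  have hu := (hK.prod hK).uniformContinuousOn_of_continuous h.cont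
  rw [Metric.uniformContinuousOn_iff_le] at hu
  refine isClosed_setOfPred_isCompactOperator.closure_subset
    (Metric.mem_closure_iff.2 fun ε hε => ?_)
  obtain ⟨δ, hδ, H⟩ := hu (ε / 2) (half_pos hε)
  obtain ⟨s, hs⟩ := exists_simpleFunc hK hKne hδ
  set R : Lp ℝ 2 μ →L[ℝ] Lp ℝ 2 μ := ∑ v ∈ s.range, (innerSL ℝ (toL2 μ (k v))).smulRight
    (indicatorConstLp 2 (s.measurableSet_fiber v) (measure_ne_top μ _) (1 : ℝ)) with hR
  have hRc : IsCompactOperator R := by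
    rw [hR]
    refine Finset.sum_induction _ (fun R : Lp ℝ 2 μ →L[ℝ] Lp ℝ 2 μ => IsCompactOperator R)
      (fun _ _ h1 h2 => h1.add h2) isCompactOperator_zero fun v _ => ?_
    exact (isCompactOperator_of_locallyCompactSpace_dom (innerSL ℝ (toL2 μ (k v)))).clm_comp
      (ContinuousLinearMap.toSpanSingleton ℝ
        (indicatorConstLp 2 (s.measurableSet_fiber v) (measure_ne_top μ _) (1 : ℝ)))
  refine ⟨R, hRc, ?_⟩
  rw [dist_eq_norm]
  refine lt_of_le_of_lt (ContinuousLinearMap.opNorm_le_bound _ (half_pos hε).le fun u => ?_)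
    (half_lt_self hε)
  refine norm_le_of_ae_le (by positivity) ?_
  have hind : ∀ᵐ x ∂μ, ∀ v ∈ s.range, indicatorConstLp 2 (s.measurableSet_fiber v)
      (measure_ne_top μ _) (1 : ℝ) x = (s ⁻¹' {v}).indicator (fun _ => (1 : ℝ)) x :=
    (Finset.eventually_all s.range).2 fun v _ => indicatorConstLp_coeFn
  have hRu : R u =ᵐ[μ] fun x => inner ℝ (toL2 μ (k (s x))) u := by
    have e1 : R u = ∑ v ∈ s.range, (inner ℝ (toL2 μ (k v)) u : ℝ) • indicatorConstLp 2
        (s.measurableSet_fiber v) (measure_ne_top μ _) (1 : ℝ) := by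
      simp [hR]
    have hsm : ∀ᵐ x ∂μ, ∀ v ∈ s.range, ((inner ℝ (toL2 μ (k v)) u : ℝ) • indicatorConstLp 2
        (s.measurableSet_fiber v) (measure_ne_top μ _) (1 : ℝ)) x =
        inner ℝ (toL2 μ (k v)) u * indicatorConstLp 2
        (s.measurableSet_fiber v) (measure_ne_top μ _) (1 : ℝ) x :=
      (Finset.eventually_all s.range).2 fun v _ => Lp.coeFn_smul _ _
    rw [e1]
    filter_upwards [hind, hsm, Lp.coeFn_finsetSum s.range fun v =>
      (inner ℝ (toL2 μ (k v)) u : ℝ) • indicatorConstLp 2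
        (s.measurableSet_fiber v) (measure_ne_top μ _) (1 : ℝ)] with x h1 h2 h3
    rw [h3, Finset.sum_apply, Finset.sum_eq_single (s x)]
    · rw [h2 _ (s.mem_range_self x), h1 _ (s.mem_range_self x),
        indicator_of_mem (by simp), mul_one]
    · intro v hv hvx
      rw [h2 v hv, h1 v hv, indicator_of_notMem (by simpa using hvx.symm), mul_zero]
    · exact fun h0 => absurd (s.mem_range_self x) h0
  filter_upwards [h.ae_inner hK hμ u, hRu, Lp.coeFn_sub (T u) (R u)] with x h1 h2 h3
  rw [sub_apply, h3, Pi.sub_apply, h1.2, h2, ← inner_sub_left]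
  refine (abs_real_inner_le_norm _ _).trans (mul_le_mul_of_nonneg_right ?_ (norm_nonneg _))
  obtain ⟨hsK, hsd⟩ := hs x h1.1
  refine norm_sub_toL2_le hK hμ (h.cont_slice h1.1) (h.cont_slice hsK) (half_pos hε).le
    fun y hy => ?_
  have := H (x, y) ⟨h1.1, hy⟩ (s x, y) ⟨hsK, hy⟩ (by
    rw [Prod.dist_eq, dist_self, dist_comm]; exact max_le hsd.le hδ.le)
  rwa [Real.dist_eq] at this

end IsKernelOp

end KernelOp

/-! ### Symmetric semigroups, their generators and eigenvectors -/

/-- A strongly continuous semigroup on a Hilbert space, norm continuous for positive times, whose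
generator, given as the relation `D u g`, is symmetric. -/
structure IsSymmSemigroup {H : Type*} [NormedAddCommGroup H] [InnerProductSpace ℝ H]
    (T : ℝ → H →L[ℝ] H) (D : H → H → Prop) : Prop where
  add : ∀ s t, 0 < s → 0 < t → T (s + t) = (T s).comp (T t)
  tendsto : ∀ u, Tendsto (fun t => T t u) (𝓝[>] 0) (𝓝 u)
  generator : ∀ u g, D u g ↔ Tendsto (fun t : ℝ => t⁻¹ • (T t u - u)) (𝓝[>] 0) (𝓝 g)
  cont : ContinuousOn T (Ioi 0)
  symm : ∀ u g v h, D u g → D v h → inner ℝ g v = inner ℝ u h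

namespace IsSymmSemigroup

variable {H : Type*} [NormedAddCommGroup H] [InnerProductSpace ℝ H]
  {T : ℝ → H →L[ℝ] H} {D : H → H → Prop}

theorem add_apply (hT : IsSymmSemigroup T D) {s t : ℝ} (hs : 0 < s) (ht : 0 < t) (u : H) :
    T (s + t) u = T s (T t u) := by
  rw [hT.add s t hs ht]; rfl

theorem comm_apply (hT : IsSymmSemigroup T D) {s t : ℝ} (hs : 0 < s) (ht : 0 < t) (u : H) :
    T s (T t u) = T t (T s u) := by
  rw [← hT.add_apply hs ht, ← hT.add_apply ht hs, add_comm]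

theorem continuousAt (hT : IsSymmSemigroup T D) {t : ℝ} (ht : 0 < t) : ContinuousAt T t :=
  hT.cont.continuousAt (Ioi_mem_nhds ht)

theorem continuousAt_apply (hT : IsSymmSemigroup T D) {t : ℝ} (ht : 0 < t) (u : H) :
    ContinuousAt (fun s => T s u) t :=
  (hT.continuousAt ht).clm_apply continuousAt_const

theorem generator_apply (hT : IsSymmSemigroup T D) {u g : H} (h : D u g) {t : ℝ} (ht : 0 < t) :
    D (T t u) (T t g) := by
  rw [hT.generator] at h ⊢
  refine (((T t).continuous.tendsto g).comp h).congr' ?_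
  filter_upwards [self_mem_nhdsWithin] with s (hs : 0 < s)
  simp only [Function.comp, map_smul, map_sub, hT.comm_apply hs ht]

/-- The generator gives right difference quotients only. On the left the quotient at `s < t` is `T
s` applied to a quotient at time `t - s`, and norm continuity of `T` at `t` allows the passage to
the limit. -/
theorem hasDerivAt (hT : IsSymmSemigroup T D) {u g : H} (h : D u g) {t : ℝ} (ht : 0 < t) :
    HasDerivAt (fun s => T s u) (T t g) t := by
  have h0 := (hT.generator u g).1 h
  have hr : Tendsto (slope (fun s => T s u) t) (𝓝[>] t) (𝓝 (T t g)) := by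
    have h1 : Tendsto (fun s : ℝ => s - t) (𝓝[>] t) (𝓝[>] 0) := by
      refine tendsto_nhdsWithin_iff.2 ⟨?_, ?_⟩
      · have : Tendsto (fun s : ℝ => s - t) (𝓝 t) (𝓝 (t - t)) :=
          (continuous_id.sub continuous_const).tendsto t
        rw [sub_self] at this
        exact this.mono_left nhdsWithin_le_nhds
      · filter_upwards [self_mem_nhdsWithin] with s (hs : t < s) using sub_pos.2 hs
    refine (((T t).continuous.tendsto g).comp (h0.comp h1)).congr' ?_
    filter_upwards [self_mem_nhdsWithin] with s (hs : t < s)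
    simp only [Function.comp, map_smul, map_sub, slope_def_module]
    rw [← hT.add_apply ht (sub_pos.2 hs), add_sub_cancel]
  have hl : Tendsto (slope (fun s => T s u) t) (𝓝[<] t) (𝓝 (T t g)) := by
    have h1 : Tendsto (fun s : ℝ => t - s) (𝓝[<] t) (𝓝[>] 0) := by
      refine tendsto_nhdsWithin_iff.2 ⟨?_, ?_⟩
      · have : Tendsto (fun s : ℝ => t - s) (𝓝 t) (𝓝 (t - t)) :=
          (continuous_const.sub continuous_id).tendsto t
        rw [sub_self] at this
        exact this.mono_left nhdsWithin_le_nhds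
      · filter_upwards [self_mem_nhdsWithin] with s (hs : s < t) using sub_pos.2 hs
    have h2 : Tendsto T (𝓝[<] t) (𝓝 (T t)) := (hT.continuousAt ht).mono_left nhdsWithin_le_nhds
    refine (((isBoundedBilinearMap_apply (𝕜 := ℝ) (E := H) (F := H)).continuous.tendsto
      (T t, g)).comp (h2.prodMk_nhds (h0.comp h1))).congr' ?_
    filter_upwards [self_mem_nhdsWithin, mem_nhdsWithin_of_mem_nhds (Ioi_mem_nhds ht)]
      with s (hs : s < t) (hs0 : 0 < s)
    simp only [Function.comp, map_smul, map_sub, slope_def_module]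
    rw [← hT.add_apply hs0 (sub_pos.2 hs), add_sub_cancel, ← neg_sub t s, inv_neg, neg_smul,
      ← smul_neg, neg_sub]
  exact hasDerivAt_iff_tendsto_slope_left_right.2 ⟨hl, hr⟩

/-- The function `s ↦ ⟨T_s u, T_{t-s} v⟩` has derivative zero by symmetry of the generator; its
limits at the two ends are the two sides. -/
theorem inner_apply_of_generator (hT : IsSymmSemigroup T D) {u g v h : H} (hu : D u g)
    (hv : D v h) {t : ℝ} (ht : 0 < t) : inner ℝ (T t u) v = inner ℝ u (T t v) := by
  set f : ℝ → ℝ := fun s => inner ℝ (T s u) (T (t - s) v) with hf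
  have hd : ∀ s ∈ Ioo 0 t, HasDerivAt f 0 s := by
    intro s ⟨hs0, hst⟩
    have hts := sub_pos.2 hst
    have h1 := hT.hasDerivAt hu hs0
    have h2 : HasDerivAt (fun s => T (t - s) v) ((-1 : ℝ) • T (t - s) h) s :=
      HasDerivAt.scomp s (hT.hasDerivAt hv hts) ((hasDerivAt_id s).const_sub t)
    have h3 := h1.inner ℝ h2
    have e := hT.symm _ _ _ _ (hT.generator_apply hu hs0) (hT.generator_apply hv hts)
    rw [neg_one_smul, inner_neg_right, e, neg_add_cancel] at h3
    exact h3
  have hconst : ∀ s ∈ Ioo 0 t, f s = f (t / 2) := fun s hs =>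
    isOpen_Ioo.is_const_of_deriv_eq_zero isPreconnected_Ioo
      (fun s hs => (hd s hs).differentiableAt.differentiableWithinAt) (fun s hs => (hd s hs).deriv)
      hs ⟨half_pos ht, half_lt_self ht⟩
  have hto : Tendsto (fun s => t - s) (𝓝[>] 0) (𝓝 t) := by
    have : Tendsto (fun s : ℝ => t - s) (𝓝 0) (𝓝 (t - 0)) :=
      (continuous_const.sub continuous_id).tendsto 0
    rw [sub_zero] at this
    exact this.mono_left nhdsWithin_le_nhds
  have hIoo : Ioo 0 t ∈ 𝓝[>] (0 : ℝ) := Ioo_mem_nhdsGT ht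
  have h1 : Tendsto f (𝓝[>] 0) (𝓝 (inner ℝ u (T t v))) :=
    (hT.tendsto u).inner ((hT.continuousAt_apply ht v).tendsto.comp hto)
  have h2 : Tendsto (fun s => f (t - s)) (𝓝[>] 0) (𝓝 (inner ℝ (T t u) v)) := by
    refine (((hT.continuousAt_apply ht u).tendsto.comp hto).inner (hT.tendsto v)).congr fun s => ?_
    simp only [hf, Function.comp, sub_sub_cancel]
  have e1 : inner ℝ u (T t v) = f (t / 2) := tendsto_nhds_unique h1 (tendsto_const_nhds.congr' (by
    filter_upwards [hIoo] with s hs using (hconst s hs).symm))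
  have e2 : inner ℝ (T t u) v = f (t / 2) := tendsto_nhds_unique h2 (tendsto_const_nhds.congr' (by
    filter_upwards [hIoo] with s hs
    exact (hconst (t - s) ⟨by linarith [hs.2], by linarith [hs.1]⟩).symm))
  rw [e1, e2]

/-- The function `exp (-a s) T_s u` has derivative zero and limit `u` at `0`. -/
theorem apply_of_eigenvector (hT : IsSymmSemigroup T D) {u : H} {a : ℝ} (h : D u (a • u)) {t : ℝ}
    (ht : 0 < t) : T t u = Real.exp (a * t) • u := by
  set f : ℝ → H := fun s => Real.exp (-(a * s)) • T s u with hf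
  have hd : ∀ s ∈ Ioi (0 : ℝ), HasDerivAt f 0 s := by
    intro s (hs : 0 < s)
    have h1 : HasDerivAt (fun s : ℝ => Real.exp (-(a * s))) (Real.exp (-(a * s)) * (-(a * 1))) s :=
      (((hasDerivAt_id s).const_mul a).neg).exp
    have h2 := h1.smul (hT.hasDerivAt h hs)
    rw [map_smul, mul_one, smul_smul, ← add_smul, mul_neg, add_neg_cancel, zero_smul] at h2
    exact h2
  have hconst : ∀ s ∈ Ioi (0 : ℝ), f s = f t := fun s hs =>
    isOpen_Ioi.is_const_of_deriv_eq_zero isPreconnected_Ioi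
      (fun s hs => (hd s hs).differentiableAt.differentiableWithinAt) (fun s hs => (hd s hs).deriv)
      hs ht
  have h1 : Tendsto f (𝓝[>] 0) (𝓝 (Real.exp (-(a * 0)) • u)) := by
    refine Tendsto.smul ?_ (hT.tendsto u)
    have : Continuous fun s : ℝ => Real.exp (-(a * s)) := by fun_prop
    exact (this.tendsto 0).mono_left nhdsWithin_le_nhds
  have h2 : Tendsto f (𝓝[>] 0) (𝓝 (f t)) := tendsto_const_nhds.congr' (by
    filter_upwards [self_mem_nhdsWithin] with s hs using (hconst s hs).symm)
  have e := tendsto_nhds_unique h1 h2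
  rw [mul_zero, neg_zero, Real.exp_zero, one_smul] at e
  conv_rhs => rw [e, hf]
  rw [smul_smul, ← Real.exp_add, add_neg_cancel, Real.exp_zero, one_smul]

section Complete

variable [CompleteSpace H]

theorem generator_integral (hT : IsSymmSemigroup T D) (u : H) {a b : ℝ} (ha : 0 < a)
    (hab : a ≤ b) : D (∫ s in a..b, T s u) (T b u - T a u) := by
  have hb := ha.trans_le hab
  have hint : ∀ x y, 0 < x → 0 < y → IntervalIntegrable (fun s => T s u) volume x y :=
    fun x y hx hy => ContinuousOn.intervalIntegrable fun s hs =>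
      (hT.continuousAt_apply (lt_of_lt_of_le (lt_min hx hy) hs.1) u).continuousWithinAt
  rw [hT.generator]
  set G : ℝ → H := fun x => ∫ s in a..x, T s u with hG
  have hGd : ∀ x, 0 < x → HasDerivAt G (T x u) x := fun x hx =>
    intervalIntegral.integral_hasDerivAt_right (hint a x ha hx)
      ((hT.cont.clm_apply continuousOn_const).stronglyMeasurableAtFilter isOpen_Ioi x hx)
      (hT.continuousAt_apply hx u)
  have hd : HasDerivAt (fun h : ℝ => G (b + h) - G (a + h)) (T b u - T a u) 0 := by
    refine HasDerivAt.sub ?_ ?_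
    · exact HasDerivAt.comp_const_add b 0 (by rw [add_zero]; exact hGd b hb)
    · exact HasDerivAt.comp_const_add a 0 (by rw [add_zero]; exact hGd a ha)
  have := (hasDerivAt_iff_tendsto_slope.1 hd).mono_left
    (nhdsWithin_mono (0 : ℝ) (s := Ioi 0) fun x hx => ne_of_gt hx)
  refine this.congr' ?_
  filter_upwards [self_mem_nhdsWithin] with h (hh : 0 < h)
  have e1 : T h (∫ s in a..b, T s u) = G (b + h) - G (a + h) := by
    rw [hG, intervalIntegral.integral_interval_sub_left (hint _ _ ha (by linarith))
      (hint _ _ ha (by linarith)), ← ContinuousLinearMap.intervalIntegral_comp_comm _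
      (hint a b ha hb), ← intervalIntegral.integral_comp_add_right]
    refine intervalIntegral.integral_congr fun s hs => ?_
    rw [uIcc_of_le hab] at hs
    rw [add_comm, hT.add_apply hh (ha.trans_le hs.1)]
  rw [slope_def_module, e1, add_zero, add_zero, sub_zero]
  simp [hG]

/-- The averages of `T_s u` over `[a, 2 a]` lie in the domain and converge to `u`. The interval
avoids `0`, as `T` is controlled at positive times only. -/
theorem dense (hT : IsSymmSemigroup T D) : Dense {u : H | ∃ g, D u g} := by
  intro u
  have hlin : ∀ (c : ℝ) (v g : H), D v g → D (c • v) (c • g) := fun c v g h => by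
    rw [hT.generator] at h ⊢
    refine (h.const_smul c).congr fun t => ?_
    rw [map_smul, ← smul_sub, smul_comm]
  refine mem_closure_of_tendsto (f := fun a : ℝ => a⁻¹ • ∫ s in a..(2 * a), T s u)
    (b := 𝓝[>] 0) ?_ ?_
  · rw [Metric.tendsto_nhdsWithin_nhds]
    intro ε hε
    obtain ⟨δ, hδ, h⟩ := Metric.tendsto_nhdsWithin_nhds.1 (hT.tendsto u) (ε / 2) (half_pos hε)
    refine ⟨δ / 2, half_pos hδ, fun {a} (ha : 0 < a) had => ?_⟩
    rw [dist_zero_right, Real.norm_of_nonneg ha.le] at had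
    have hint : IntervalIntegrable (fun s => T s u) volume a (2 * a) :=
      ContinuousOn.intervalIntegrable fun s hs => (hT.continuousAt_apply
        (lt_of_lt_of_le (lt_min ha (by linarith)) hs.1) u).continuousWithinAt
    have e : a⁻¹ • (∫ s in a..(2 * a), T s u) - u = a⁻¹ • ∫ s in a..(2 * a), (T s u - u) := by
      rw [intervalIntegral.integral_sub hint intervalIntegrable_const,
        intervalIntegral.integral_const, smul_sub, smul_smul, show 2 * a - a = a by ring,
        inv_mul_cancel₀ ha.ne', one_smul]
    rw [dist_eq_norm, e, norm_smul, Real.norm_of_nonneg (inv_nonneg.2 ha.le)]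
    have hb : ‖∫ s in a..(2 * a), (T s u - u)‖ ≤ ε / 2 * |2 * a - a| := by
      refine intervalIntegral.norm_integral_le_of_norm_le_const fun s hs => ?_
      rw [uIoc_of_le (by linarith)] at hs
      have hs0 : 0 < s := ha.trans hs.1
      have := h hs0 (by
        rw [dist_zero_right, Real.norm_of_nonneg hs0.le]; linarith [hs.2])
      rw [dist_eq_norm] at this
      exact this.le
    rw [show 2 * a - a = a by ring, abs_of_pos ha] at hb
    calc _ ≤ a⁻¹ * (ε / 2 * a) := by gcongr
      _ = ε / 2 := by field_simp
      _ < ε := half_lt_self hε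
  · filter_upwards [self_mem_nhdsWithin] with a (ha : 0 < a)
    exact ⟨_, hlin a⁻¹ _ _ (hT.generator_integral u ha (by linarith))⟩

theorem inner_apply (hT : IsSymmSemigroup T D) {t : ℝ} (ht : 0 < t) (u v : H) :
    inner ℝ (T t u) v = inner ℝ u (T t v) := by
  have h1 : ∀ u ∈ {u : H | ∃ g, D u g}, ∀ v, inner ℝ (T t u) v = inner ℝ u (T t v) := by
    rintro u ⟨g, hu⟩ v
    have hc : IsClosed {v | inner ℝ (T t u) v = inner ℝ u (T t v)} :=
      isClosed_eq (by fun_prop) (by fun_prop)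
    exact hc.closure_subset_iff.2 (by
      rintro v ⟨h, hv⟩
      exact hT.inner_apply_of_generator hu hv ht) (hT.dense v)
  have hc : IsClosed {u | inner ℝ (T t u) v = inner ℝ u (T t v)} :=
    isClosed_eq (by fun_prop) (by fun_prop)
  exact hc.closure_subset_iff.2 (fun u hu => h1 u hu v) (hT.dense u)

theorem inner_self (hT : IsSymmSemigroup T D) {t : ℝ} (ht : 0 < t) (u : H) :
    inner ℝ (T (t + t) u) u = ‖T t u‖ ^ 2 := by
  rw [hT.add_apply ht ht, hT.inner_apply ht, real_inner_self_eq_norm_sq]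

/-- The vector `w = T_t v - κ v` satisfies `T_t w = -κ w`, whereas `T_t` is the square of the
symmetric `T_{t/2}` and hence nonnegative; so `w = 0`. -/
theorem apply_half (hT : IsSymmSemigroup T D) {v : H} {t κ : ℝ} (ht : 0 < t) (hκ : 0 < κ)
    (h : T (t + t) v = κ ^ 2 • v) : T t v = κ • v := by
  set w := T t v - κ • v with hw
  have h1 : T t w = -κ • w := by
    rw [hw, map_sub, map_smul, ← hT.add_apply ht ht, h, smul_sub, neg_smul, neg_smul, smul_smul, sq]
    abel
  have h2 := hT.inner_self (half_pos ht) w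
  rw [add_halves, h1, real_inner_smul_left, real_inner_self_eq_norm_sq] at h2
  have h3 : ‖w‖ = 0 := by
    by_contra h0
    have : 0 < ‖w‖ := lt_of_le_of_ne (norm_nonneg _) (Ne.symm h0)
    nlinarith [sq_nonneg ‖T (t / 2) w‖, mul_pos hκ (pow_pos this 2)]
  exact sub_eq_zero.1 (norm_eq_zero.1 h3)

/-- From `⟨T_{2t} v, v⟩ = ‖T_t v‖²` the vanishing descends to the times `2 ^ (-n)`, and `T_t v → v`
as `t → 0`. -/
theorem eq_zero_of_apply_eq_zero (hT : IsSymmSemigroup T D) {v : H} (h : T 1 v = 0) : v = 0 := by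
  have h1 : ∀ n : ℕ, T ((1 / 2) ^ n) v = 0 := by
    intro n
    induction n with
    | zero => simpa using h
    | succ n ih =>
      have h2 := hT.inner_self (t := (1 / 2) ^ (n + 1)) (by positivity) v
      rw [show ((1 / 2 : ℝ) ^ (n + 1) + (1 / 2) ^ (n + 1)) = (1 / 2) ^ n by ring, ih,
        inner_zero_left] at h2
      exact norm_eq_zero.1 (pow_eq_zero_iff two_ne_zero |>.1 h2.symm)
  have h2 : Tendsto (fun n : ℕ => (1 / 2 : ℝ) ^ n) atTop (𝓝[>] 0) :=
    tendsto_nhdsWithin_iff.2 ⟨tendsto_pow_atTop_nhds_zero_of_lt_one (by norm_num) (by norm_num),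
      Eventually.of_forall fun n => by simp only [mem_Ioi]; positivity⟩
  refine tendsto_nhds_unique ((hT.tendsto v).comp h2) ?_
  simp only [Function.comp_def, h1]
  exact tendsto_const_nhds

/-- Halving the time and taking positive square roots gives `T_t v = κ ^ t v` at the times `2 ^
(-n)`, then at their positive integer multiples, then for all `t > 0` by continuity; differentiate
at `0`. -/
theorem eigenvector_of_apply (hT : IsSymmSemigroup T D) {v : H} {κ : ℝ} (hκ : 0 < κ)
    (h : T 1 v = κ • v) : D v (Real.log κ • v) := by
  have h1 : ∀ n : ℕ, T ((1 / 2) ^ n) v = Real.exp (Real.log κ * (1 / 2) ^ n) • v := by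
    intro n
    induction n with
    | zero => simpa [Real.exp_log hκ] using h
    | succ n ih =>
      refine hT.apply_half (by positivity) (Real.exp_pos _) ?_
      rw [show ((1 / 2 : ℝ) ^ (n + 1) + (1 / 2) ^ (n + 1)) = (1 / 2) ^ n by ring, ih, sq,
        ← Real.exp_add]
      ring_nf
  have h2 : ∀ n k : ℕ, T ((k + 1) * (1 / 2) ^ n) v
      = Real.exp (Real.log κ * ((k + 1) * (1 / 2) ^ n)) • v := by
    intro n k
    induction k with
    | zero => simpa using h1 n
    | succ k ih =>
      push_cast
      rw [add_mul (k + 1 : ℝ) 1, one_mul, hT.add_apply (by positivity) (by positivity), h1,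
        map_smul, ih, smul_smul, ← Real.exp_add]
      ring_nf
  have h3 : ∀ t : ℝ, 0 < t → T t v = Real.exp (Real.log κ * t) • v := by
    intro t ht
    -- The floor is raised by one so that the dyadic approximations of `t` are positive times.
    have hlim : Tendsto (fun n : ℕ => ((⌊t * 2 ^ n⌋₊ : ℝ) + 1) * (1 / 2) ^ n) atTop (𝓝 t) := by
      have ha : Tendsto (fun n : ℕ => (2 : ℝ) ^ n) atTop atTop :=
        tendsto_pow_atTop_atTop_of_one_lt one_lt_two
      have hb := (tendsto_nat_floor_mul_div_atTop ht.le).comp ha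
      have hc := hb.add (tendsto_pow_atTop_nhds_zero_of_lt_one (r := (1 / 2 : ℝ)) (by norm_num)
        (by norm_num))
      rw [add_zero] at hc
      refine hc.congr fun n => ?_
      simp only [Function.comp, one_div, inv_pow]
      ring
    have hcont : Continuous fun s : ℝ => Real.exp (Real.log κ * s) • v := by fun_prop
    refine tendsto_nhds_unique ((hT.continuousAt_apply ht v).tendsto.comp hlim) ?_
    refine ((hcont.tendsto t).comp hlim).congr fun n => ?_
    exact (h2 n _).symm
  rw [hT.generator]
  have hd : HasDerivAt (fun t : ℝ => Real.exp (Real.log κ * t))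
      (Real.exp (Real.log κ * 0) * (Real.log κ * 1)) 0 :=
    ((hasDerivAt_id (0 : ℝ)).const_mul (Real.log κ)).exp
  rw [mul_zero, Real.exp_zero, one_mul, mul_one] at hd
  have := ((hasDerivAt_iff_tendsto_slope.1 hd).mono_left
    (nhdsWithin_mono (0 : ℝ) (s := Ioi 0) fun x hx => ne_of_gt hx)).smul_const v
  refine this.congr' ?_
  filter_upwards [self_mem_nhdsWithin] with t (ht : 0 < t)
  rw [h3 t ht, slope_def_module, mul_zero, Real.exp_zero, sub_zero, smul_assoc, sub_smul, one_smul]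

/-- The eigenvectors of the generator are total if the semigroup consists of compact operators. -/
theorem eq_zero_of_inner_eigenvector (hT : IsSymmSemigroup T D) (hc : IsCompactOperator (T 1))
    {w : H} (hw : ∀ (a : ℝ) (u : H), D u (a • u) → inner ℝ u w = 0) : w = 0 := by
  have hsymm : (T 1).IsSymmetric := fun u v => hT.inner_apply one_pos u v
  have h := ContinuousLinearMap.orthogonalComplement_iSup_eigenspaces_eq_bot hc hsymm
  rw [← Submodule.mem_bot ℝ, ← h, ← Submodule.iInf_orthogonal, Submodule.mem_iInf]
  intro κ
  rw [Submodule.mem_orthogonal]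
  intro u hu
  have hu1 : T 1 u = κ • u := Module.End.mem_eigenspace_iff.1 hu
  rcases eq_or_ne u 0 with rfl | hu0
  · exact inner_zero_left _
  -- `T 1` is the square of `T (1 / 2)`, so its eigenvalues are nonnegative; zero is excluded by
  -- injectivity, and a positive one belongs to an eigenvector of the generator.
  have h2 := hT.inner_self (t := 1 / 2) (by norm_num) u
  rw [add_halves, hu1, real_inner_smul_left, real_inner_self_eq_norm_sq] at h2
  have hn : 0 < ‖u‖ ^ 2 := by positivity
  have hκ0 : 0 ≤ κ := nonneg_of_mul_nonneg_left (h2 ▸ sq_nonneg _) hn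
  rcases hκ0.eq_or_lt with rfl | hκ
  · exact absurd (hT.eq_zero_of_apply_eq_zero (by rw [hu1, zero_smul])) hu0
  · exact hw _ _ (hT.eigenvector_of_apply hκ hu1)

end Complete

end IsSymmSemigroup

/-! ### The Laplace operator and its eigenfunctions -/

namespace PCFFractal

variable {d m : ℕ} (X : PCFFractal d m)

theorem ae_mem_carrier : ∀ᵐ x ∂X.measure, x ∈ X.carrier :=
  Measure.ae_smul_measure (ae_restrict_mem X.isCompact.isClosed.measurableSet) _

/-- If the Hausdorff measure of `K` is `0` or `∞`, the conventions for inverses in `ℝ≥0∞` make the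
normalised measure zero. Existence of an eigenvalue will exclude this case. -/
theorem measure_eq_zero_or_isProbabilityMeasure :
    X.measure = 0 ∨ IsProbabilityMeasure X.measure := by
  have h : X.measure univ = (μH[X.dim] X.carrier)⁻¹ * μH[X.dim] X.carrier := by
    simp [measure]
  by_cases h0 : μH[X.dim] X.carrier = 0
  · left; rw [← Measure.measure_univ_eq_zero, h, h0, mul_zero]
  by_cases h1 : μH[X.dim] X.carrier = ⊤
  · left; rw [← Measure.measure_univ_eq_zero, h, h1, ENNReal.inv_top, zero_mul]
  · right; exact ⟨by rw [h, ENNReal.inv_mul_cancel h0 h1]⟩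

end PCFFractal

namespace PCFFractal.HarmonicStructure

variable {d m : ℕ} {X : PCFFractal d m} (S : X.HarmonicStructure) {B : Set (Euc d)}

/-- `f` is a continuous representative that witnesses `Δ u = g`. -/
structure IsLaplacianRep (B : Set (Euc d)) (f : Euc d → ℝ) (u g : X.L2) : Prop where
  mem : f ∈ S.formDomain B
  ae_eq : u =ᵐ[X.measure] f
  tendsto : ∀ v ∈ S.formDomain B,
    Tendsto (fun n => S.energy n f v) atTop (𝓝 (-∫ x, g x * v x ∂X.measure))

theorem isLaplacian_iff {u g : X.L2} :
    S.IsLaplacian B u g ↔ ∃ f, S.IsLaplacianRep B f u g :=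
  ⟨fun ⟨f, h1, h2, h3⟩ => ⟨f, h1, h2, h3⟩, fun ⟨f, h⟩ => ⟨f, h.mem, h.ae_eq, h.tendsto⟩⟩

namespace IsLaplacianRep

variable {S} {f f' : Euc d → ℝ} {u g u' g' : X.L2}

theorem zero : S.IsLaplacianRep B (0 : Euc d → ℝ) 0 0 := by
  have he : ∀ n v, S.energy n 0 v = 0 := fun n v => by
    have h := S.energy_smul_left n 0 0 v
    simpa only [zero_smul, zero_mul] using h
  refine ⟨⟨continuousOn_const, ⟨0, ?_⟩, fun _ _ => rfl⟩, Lp.coeFn_zero _ _ _, fun v _ => ?_⟩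
  · rintro _ ⟨n, rfl⟩
    exact (he n 0).le
  · have h2 : ∫ y, (0 : X.L2) y * v y ∂X.measure = 0 := by
      refine integral_eq_zero_of_ae ?_
      filter_upwards [Lp.coeFn_zero ℝ 2 X.measure] with y hy
      rw [hy]
      simp
    simp only [h2, he, neg_zero]
    exact tendsto_const_nhds

theorem smul (h : S.IsLaplacianRep B f u g) (a : ℝ) :
    S.IsLaplacianRep B (a • f) (a • u) (a • g) := by
  refine ⟨S.formDomain_smul h.mem a, ?_, fun v hv => ?_⟩
  · filter_upwards [Lp.coeFn_smul a u, h.ae_eq] with y h1 h2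
    rw [h1, Pi.smul_apply, Pi.smul_apply, h2]
  · have h3 := (h.tendsto v hv).const_mul a
    simp only [energy_smul_left]
    convert h3 using 2
    rw [mul_neg, ← integral_const_mul]
    congr 1
    refine integral_congr_ae ?_
    filter_upwards [Lp.coeFn_smul a g] with y hy
    simp only [hy, Pi.smul_apply, smul_eq_mul, mul_assoc]

theorem add (h : S.IsLaplacianRep B f u g) (h' : S.IsLaplacianRep B f' u' g') :
    S.IsLaplacianRep B (f + f') (u + u') (g + g') := by
  refine ⟨S.formDomain_add h.mem h'.mem, ?_, fun v hv => ?_⟩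
  · filter_upwards [Lp.coeFn_add u u', h.ae_eq, h'.ae_eq] with y h1 h2 h3
    rw [h1, Pi.add_apply, Pi.add_apply, h2, h3]
  · have h3 := (h.tendsto v hv).add (h'.tendsto v hv)
    simp only [energy_add_left]
    convert h3 using 2
    rw [← neg_add, ← integral_add (X.integrable_mul _ hv.1) (X.integrable_mul _ hv.1)]
    congr 1
    refine integral_congr_ae ?_
    filter_upwards [Lp.coeFn_add g g'] with y hy
    rw [hy, Pi.add_apply, add_mul]

theorem sum {ι : Type*} {f : ι → Euc d → ℝ} {u g : ι → X.L2} (s : Finset ι)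
    (h : ∀ i ∈ s, S.IsLaplacianRep B (f i) (u i) (g i)) :
    S.IsLaplacianRep B (∑ i ∈ s, f i) (∑ i ∈ s, u i) (∑ i ∈ s, g i) := by
  classical
  induction s using Finset.induction_on with
  | empty => simpa using zero
  | insert i s hi ih =>
    rw [Finset.sum_insert hi, Finset.sum_insert hi, Finset.sum_insert hi]
    exact (h i (Finset.mem_insert_self i s)).add
      (ih fun j hj => h j (Finset.mem_insert_of_mem hj))

theorem integral_mul (h : S.IsLaplacianRep B f u g) (w : X.L2) :
    ∫ x, w x * f x ∂X.measure = inner ℝ w u := by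
  rw [L2.inner_def]
  refine integral_congr_ae ?_
  filter_upwards [h.ae_eq] with y hy
  rw [hy]
  simp [mul_comm]

theorem inner_eq (h : S.IsLaplacianRep B f u g) (h' : S.IsLaplacianRep B f' u' g') :
    inner ℝ g u' = inner ℝ u g' := by
  have h1 := h.tendsto f' h'.mem
  have h2 := h'.tendsto f h.mem
  rw [h'.integral_mul] at h1
  rw [h.integral_mul, real_inner_comm] at h2
  simp only [S.energy_symm _ f' f] at h2
  exact neg_injective (tendsto_nhds_unique h1 h2)

theorem energy_le (h : S.IsLaplacianRep B f u g) (n : ℕ) :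
    S.energy n f f ≤ -inner ℝ g u := by
  have h1 := h.tendsto f h.mem
  rw [h.integral_mul] at h1
  exact (S.energy_mono f).ge_of_tendsto h1 n

theorem inner_nonpos (h : S.IsLaplacianRep B f u g) : inner ℝ g u ≤ 0 := by
  linarith [h.energy_le 0, S.energy_nonneg 0 f]

end IsLaplacianRep

/-- Functions in the domain of `Δ` are bounded in terms of their energy and norm. -/
theorem exists_sq_le_of_isLaplacianRep [IsProbabilityMeasure X.measure] :
    ∃ C, 0 ≤ C ∧ ∀ (f : Euc d → ℝ) (u g : X.L2), S.IsLaplacianRep B f u g →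
      ∀ x ∈ X.carrier, f x ^ 2 ≤ C * (‖u‖ ^ 2 - inner ℝ g u) := by
  obtain ⟨C, hC0, hC⟩ := S.exists_sub_sq_le
  refine ⟨2 * C + 2, by positivity, fun f u g h x hx => ?_⟩
  have hf2 : Integrable (fun y => u y * f y) X.measure := X.integrable_mul u h.mem.1
  -- Integrating `f(x)² ≤ 2 (f(x) - f(y))² + 2 f(y)²` over `y`, with the first square bounded by the
  -- energy.
  have key : ∀ᵐ y ∂X.measure, f x ^ 2 ≤ 2 * (C * (-inner ℝ g u)) + 2 * (u y * f y) := by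
    filter_upwards [X.ae_mem_carrier, h.ae_eq] with y hy hu
    have := hC f _ h.mem.1 h.energy_le x hx y hy
    rw [hu]
    nlinarith [sq_nonneg (f x - 2 * f y)]
  have h1 := integral_mono_ae (integrable_const (f x ^ 2))
    ((integrable_const (2 * (C * (-inner ℝ g u)))).add (hf2.const_mul 2)) key
  simp only [Pi.add_apply] at h1
  rw [integral_add (integrable_const _) (hf2.const_mul 2), integral_const, integral_const,
    integral_const_mul, h.integral_mul, real_inner_self_eq_norm_sq] at h1
  simp only [probReal_univ, one_smul] at h1
  have h2 := h.inner_nonpos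
  nlinarith [sq_nonneg ‖u‖, mul_nonneg hC0 (sq_nonneg ‖u‖)]

theorem nonneg_of_eigenvector {u : X.L2} {x : ℝ} (hu : u ≠ 0)
    (h : S.IsLaplacian B u (-x • u)) : 0 ≤ x := by
  obtain ⟨f, hf⟩ := S.isLaplacian_iff.1 h
  have h1 := hf.inner_nonpos
  rw [real_inner_smul_left, real_inner_self_eq_norm_sq] at h1
  have h2 : 0 < ‖u‖ ^ 2 := by positivity
  nlinarith

/-- `∑ 1 / (1 + x)` is bounded over orthonormal systems of eigenfunctions. -/
theorem exists_sum_inv_le [IsProbabilityMeasure X.measure] :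
    ∃ C, ∀ (ι : Type) (v : ι → X.L2) (e : ι → ℝ), Orthonormal ℝ v →
      (∀ i, S.IsLaplacian B (v i) (-e i • v i)) → ∀ s : Finset ι, ∑ i ∈ s, (1 + e i)⁻¹ ≤ C := by
  obtain ⟨C, hC0, hC⟩ := S.exists_sq_le_of_isLaplacianRep (B := B)
  refine ⟨C, fun ι v e hv hD s => ?_⟩
  have he : ∀ i, 0 < 1 + e i := fun i => by
    have := S.nonneg_of_eigenvector (hv.ne_zero i) (hD i)
    linarith
  choose f hf using fun i => S.isLaplacian_iff.1 (hD i)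
  have hpt : ∀ x ∈ X.carrier, ∑ i ∈ s, (1 + e i)⁻¹ * f i x ^ 2 ≤ C := by
    intro x hx
    -- The Riesz representative of evaluation at `x`: for this combination the value at `x` and the
    -- quadratic form `‖u‖² - ⟨Δ u, u⟩` are the same number `A`, so the pointwise bound reads `A² ≤
    -- C A`. Integrating `A ≤ C` over `x` gives the claim.
    set a : ι → ℝ := fun i => (1 + e i)⁻¹ * f i x with ha
    have h1 := hC _ _ _ (IsLaplacianRep.sum s fun i _ => (hf i).smul (a i)) x hx
    have h2 : (∑ i ∈ s, a i • f i) x = ∑ i ∈ s, (1 + e i)⁻¹ * f i x ^ 2 := by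
      rw [Finset.sum_apply]
      refine Finset.sum_congr rfl fun i _ => ?_
      rw [Pi.smul_apply, smul_eq_mul, ha]
      ring
    have h3 : ‖∑ i ∈ s, a i • v i‖ ^ 2 = ∑ i ∈ s, a i * a i := by
      rw [← real_inner_self_eq_norm_sq, hv.inner_sum]
      simp
    have h4 : inner ℝ (∑ i ∈ s, a i • (-e i • v i)) (∑ i ∈ s, a i • v i)
        = ∑ i ∈ s, a i * (-e i) * a i := by
      simp_rw [smul_smul]
      rw [hv.inner_sum]
      simp
    rw [h2, h3, h4, ← Finset.sum_sub_distrib] at h1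
    have h5 : ∑ i ∈ s, (a i * a i - a i * -e i * a i) = ∑ i ∈ s, (1 + e i)⁻¹ * f i x ^ 2 := by
      refine Finset.sum_congr rfl fun i _ => ?_
      have := (he i).ne'
      rw [ha]
      field_simp
      ring
    rw [h5] at h1
    set A := ∑ i ∈ s, (1 + e i)⁻¹ * f i x ^ 2
    have hA : 0 ≤ A := Finset.sum_nonneg fun i _ =>
      mul_nonneg (inv_nonneg.2 (he i).le) (sq_nonneg _)
    rcases hA.eq_or_lt with hA | hA
    · rw [← hA]; exact hC0
    · rw [sq] at h1
      exact le_of_mul_le_mul_right h1 hA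
  have hint : ∀ i, Integrable (fun x => (1 + e i)⁻¹ * (v i x * f i x)) X.measure := fun i =>
    (X.integrable_mul (v i) (hf i).mem.1).const_mul _
  have h1 : ∫ x, ∑ i ∈ s, (1 + e i)⁻¹ * (v i x * f i x) ∂X.measure = ∑ i ∈ s, (1 + e i)⁻¹ := by
    rw [integral_finsetSum _ fun i _ => hint i]
    refine Finset.sum_congr rfl fun i _ => ?_
    rw [integral_const_mul, (hf i).integral_mul, real_inner_self_eq_norm_sq, hv.norm_eq_one]
    simp
  rw [← h1]
  have hall : ∀ᵐ x ∂X.measure, ∀ i ∈ s, v i x = f i x :=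
    (Finset.eventually_all s).2 fun i _ => (hf i).ae_eq
  have h2 := integral_mono_ae (integrable_finsetSum s fun i _ => hint i)
    (integrable_const (μ := X.measure) C) (by
      filter_upwards [hall, X.ae_mem_carrier] with x h3 h4
      refine le_of_eq_of_le (Finset.sum_congr rfl fun i hi => ?_) (hpt x h4)
      rw [h3 i hi, sq])
  simpa using h2

/-- Norm continuity at positive times follows from uniform continuity of the kernel on compact time
intervals; symmetry of the generator is that of the energy form. -/
theorem isSymmSemigroup [IsProbabilityMeasure X.measure] {p : ℝ → Euc d → Euc d → ℝ}
    (hp : S.IsHeatKernel B p) : ∃ T : ℝ → X.L2 →L[ℝ] X.L2,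
      IsSymmSemigroup T (S.IsLaplacian B) ∧
      ∀ t, 0 < t → IsKernelOp X.measure X.carrier (p t) (T t) := by
  obtain ⟨T, h1, h2, h3, h4⟩ := hp.semigroup
  have hker : ∀ t, 0 < t → IsKernelOp X.measure X.carrier (p t) (T t) := fun t ht =>
    ⟨hp.continuousOn.comp (f := fun q : Euc d × Euc d => (t, q.1, q.2)) (by fun_prop)
      fun q hq => ⟨ht, hq.1, hq.2⟩, h1 t ht⟩
  refine ⟨T, ⟨h2, h3, h4, ?_, ?_⟩, hker⟩
  · intro t (ht : 0 < t)
    refine ContinuousAt.continuousWithinAt ?_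
    have hsub : Icc (t / 2) (2 * t) ×ˢ X.carrier ×ˢ X.carrier ⊆
        Ioi 0 ×ˢ X.carrier ×ˢ X.carrier :=
      prod_mono (fun s hs => lt_of_lt_of_le (half_pos ht) hs.1) Subset.rfl
    have hu := (isCompact_Icc.prod (X.isCompact.prod X.isCompact)).uniformContinuousOn_of_continuous
      (hp.continuousOn.mono hsub)
    rw [Metric.uniformContinuousOn_iff_le] at hu
    rw [Metric.continuousAt_iff]
    intro ε hε
    obtain ⟨δ, hδ, H⟩ := hu (ε / 2) (half_pos hε)
    refine ⟨min δ (t / 2), lt_min hδ (half_pos ht), fun {s} hs => ?_⟩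
    have hsδ := hs.le.trans (min_le_left _ _)
    have hst := abs_le.1 (hs.le.trans (min_le_right _ _))
    have hs0 : 0 < s := by linarith [hst.1]
    rw [dist_eq_norm]
    refine (IsKernelOp.norm_sub_le X.isCompact X.ae_mem_carrier (hker s hs0) (hker t ht)
      (half_pos hε).le fun x hx y hy => ?_).trans_lt (half_lt_self hε)
    have := H (s, x, y) ⟨⟨by linarith [hst.1], by linarith [hst.2]⟩, hx, hy⟩ (t, x, y)
      ⟨⟨by linarith, by linarith⟩, hx, hy⟩ (by
        rw [Prod.dist_eq, dist_self]; exact max_le hsδ hδ.le)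
    rwa [Real.dist_eq] at this
  · intro u g v h hu hv
    obtain ⟨f, hf⟩ := S.isLaplacian_iff.1 hu
    obtain ⟨f', hf'⟩ := S.isLaplacian_iff.1 hv
    exact hf.inner_eq hf'

end PCFFractal.HarmonicStructure

/-! ### The trace formula -/

section

variable {E : Type*} [MetricSpace E] [MeasurableSpace E] [BorelSpace E]
  [SecondCountableTopology E] {μ : Measure E} [IsProbabilityMeasure μ] {K : Set E}

/-- The diagonal of the kernel of `T ∘ T` is the squared norm of the kernel of `T`. -/
theorem IsKernelOp.diagonal_eq (hK : IsCompact K) (hμ : ∀ᵐ x ∂μ, x ∈ K) {k k' : E → E → ℝ}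
    {T T' : Lp ℝ 2 μ →L[ℝ] Lp ℝ 2 μ} (h : IsKernelOp μ K k T) (h' : IsKernelOp μ K k' T')
    (hsymm : ∀ u v, inner ℝ (T u) v = inner ℝ u (T v)) (hTT : ∀ u, T' u = T (T u)) {x : E}
    (hx : x ∈ K) (hxs : x ∈ μ.support) : k' x x = ‖toL2 μ (k x)‖ ^ 2 := by
  -- The operator identity gives this for almost every point; both sides are continuous on `K`, so
  -- it holds at every point of the support.
  have h1 : ∀ u, inner ℝ (toL2 μ (k' x)) u = inner ℝ (toL2 μ (k x)) (T u) := by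
    intro u
    refine sub_eq_zero.1 (eq_zero_of_mem_support (K := K) hμ
      (g := fun x => inner ℝ (toL2 μ (k' x)) u - inner ℝ (toL2 μ (k x)) (T u))
      ((h'.continuousOn_inner hK hμ u).sub (h.continuousOn_inner hK hμ (T u))) ?_ hx hxs)
    filter_upwards [h'.ae_inner hK hμ u, h.ae_inner hK hμ (T u)] with y h1 h2
    rw [← h1.2, ← h2.2, hTT, sub_self, Pi.zero_apply]
  have h2 : toL2 μ (k' x) = T (toL2 μ (k x)) :=
    ext_inner_right ℝ fun u => by rw [h1, hsymm]
  have h3 : k' x x - inner ℝ (toL2 μ (k x)) (toL2 μ (k x)) = 0 := by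
    refine eq_zero_of_mem_support (K := K) hμ
      (g := fun y => k' x y - inner ℝ (toL2 μ (k y)) (toL2 μ (k x)))
      ((h'.cont_slice hx).sub (h.continuousOn_inner hK hμ _)) ?_ hx hxs
    filter_upwards [coeFn_toL2 (memLp_of_continuousOn hK hμ (h'.cont_slice hx)),
      h.ae_inner hK hμ (toL2 μ (k x))] with y h3 h4
    rw [← h3, ← h4.2, h2, sub_self, Pi.zero_apply]
  rw [sub_eq_zero.1 h3, real_inner_self_eq_norm_sq]

end

namespace PCFFractal.HarmonicStructure

variable {d m : ℕ} {X : PCFFractal d m} (S : X.HarmonicStructure) {B : Set (Euc d)}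

theorem orthogonalFamily_eigenspace :
    OrthogonalFamily ℝ (fun x : ℝ => S.eigenspace B (-x)) fun x =>
        (S.eigenspace B (-x)).subtypeₗᵢ := by
  rintro x y hxy ⟨u, hu⟩ ⟨v, hv⟩
  obtain ⟨f, hf⟩ := S.isLaplacian_iff.1 hu
  obtain ⟨f', hf'⟩ := S.isLaplacian_iff.1 hv
  have h := hf.inner_eq hf'
  rw [real_inner_smul_left, real_inner_smul_right] at h
  have h2 : (y - x) * inner ℝ u v = 0 := by linarith
  exact (mul_eq_zero.1 h2).resolve_left (sub_ne_zero.2 hxy.symm)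

theorem mult_of_neg {x : ℝ} (hx : x < 0) : S.mult B x = 0 := by
  have : S.eigenspace B (-x) = ⊥ := (Submodule.eq_bot_iff _).2 fun u hu => by
    by_contra h0
    linarith [S.nonneg_of_eigenvector h0 hu]
  rw [mult, this]
  exact finrank_bot ℝ _

variable [IsProbabilityMeasure X.measure] {p : ℝ → Euc d → Euc d → ℝ}

/-- The index type of the eigenvalues of `-Δ`, repeated according to multiplicity. -/
abbrev EigenIndex (B : Set (Euc d)) : Type := Σ x : ℝ, Fin (S.mult B x)

/-- Every eigenvector of `Δ` is one of the compact operator `T 1`, with a nonzero eigenvalue, so its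
eigenspaces are finite-dimensional and `mult` really counts. Different eigenspaces are orthogonal,
and together they are total by the spectral theorem for `T 1`. -/
theorem exists_eigenbasis (hp : S.IsHeatKernel B p) :
    ∃ b : HilbertBasis (S.EigenIndex B) ℝ X.L2, ∀ i, S.IsLaplacian B (b i) (-i.1 • b i) := by
  obtain ⟨T, hT, hker⟩ := S.isSymmSemigroup hp
  have hc := (hker 1 one_pos).isCompactOperator X.isCompact X.ae_mem_carrier
  have hfin : ∀ x : ℝ, FiniteDimensional ℝ (S.eigenspace B (-x)) := fun x => by
    have := ContinuousLinearMap.finite_dimensional_eigenspace hc (Real.exp (-x * 1))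
      (Real.exp_pos _).ne'
    exact Submodule.finiteDimensional_of_le
      (S₂ := Module.End.eigenspace (T 1).toLinearMap (Real.exp (-x * 1)))
      fun u hu => Module.End.mem_eigenspace_iff.2 (hT.apply_of_eigenvector hu one_pos)
  set v : S.EigenIndex B → X.L2 := fun i => (stdOrthonormalBasis ℝ (S.eigenspace B (-i.1)) i.2 :
      X.L2)
    with hv
  have hon : Orthonormal ℝ v :=
    (S.orthogonalFamily_eigenspace (B := B)).orthonormal_sigma_orthonormal
      (v_family := fun x => ⇑(stdOrthonormalBasis ℝ (S.eigenspace B (-x))))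
      fun x => (stdOrthonormalBasis ℝ (S.eigenspace B (-x))).orthonormal
  have hsp : (Submodule.span ℝ (range v))ᗮ = ⊥ := by
    refine (Submodule.eq_bot_iff _).2 fun w hw => ?_
    refine hT.eq_zero_of_inner_eigenvector hc fun a u hu => ?_
    have hu' : u ∈ S.eigenspace B (-(-a)) := by rw [neg_neg]; exact hu
    have h1 := congrArg (Subtype.val) ((stdOrthonormalBasis ℝ (S.eigenspace B (-(-a)))).sum_repr
      ⟨u, hu'⟩)
    rw [Submodule.coe_sum] at h1
    rw [show u = _ from h1.symm, sum_inner]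
    refine Finset.sum_eq_zero fun i _ => ?_
    rw [Submodule.coe_smul, real_inner_smul_left]
    have := (Submodule.mem_orthogonal _ _).1 hw (v ⟨-a, i⟩) (Submodule.subset_span ⟨_, rfl⟩)
    rw [show inner ℝ ((stdOrthonormalBasis ℝ (S.eigenspace B (-(-a)))) i : X.L2) w = 0 from this,
      mul_zero]
  refine ⟨HilbertBasis.mkOfOrthogonalEqBot hon hsp, fun i => ?_⟩
  rw [HilbertBasis.coe_mkOfOrthogonalEqBot]
  exact (stdOrthonormalBasis ℝ (S.eigenspace B (-i.1)) i.2).2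

theorem summable_inv (b : HilbertBasis (S.EigenIndex B) ℝ X.L2)
    (hb : ∀ i, S.IsLaplacian B (b i) (-i.1 • b i)) :
    (∀ i : S.EigenIndex B, 0 ≤ i.1) ∧ Summable fun i : S.EigenIndex B => (1 + i.1)⁻¹ := by
  have h0 : ∀ i : S.EigenIndex B, 0 ≤ i.1 := fun i =>
    S.nonneg_of_eigenvector (b.orthonormal.ne_zero i) (hb i)
  obtain ⟨C, hC⟩ := S.exists_sum_inv_le (B := B)
  refine ⟨h0, summable_of_sum_le (c := C) (fun i => ?_)
    (hC (S.EigenIndex B) b (fun i => i.1) b.orthonormal hb)⟩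
  have := h0 i
  positivity

/-- By the semigroup property `p_t(x, x)` is the squared norm of `p_{t/2}(x, ·)`, whose coefficients
in the eigenbasis are `exp (-e_i t / 2) b_i(x)`. Parseval and termwise integration give the trace.
-/
theorem hasSum_exp_eigenIndex (hp : S.IsHeatKernel B p) (b : HilbertBasis (S.EigenIndex B) ℝ X.L2)
    (hb : ∀ i, S.IsLaplacian B (b i) (-i.1 • b i)) {t : ℝ} (ht : 0 < t) :
    HasSum (fun i : S.EigenIndex B => Real.exp (-(t * i.1))) (∫ x, p t x x ∂X.measure) := by
  obtain ⟨T, hT, hker⟩ := S.isSymmSemigroup hp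
  obtain ⟨h0, hsum⟩ := S.summable_inv b hb
  have hs : 0 < t / 2 := half_pos ht
  -- Needed to collect the exceptional null sets of all eigenfunctions and to integrate termwise.
  have : Countable (S.EigenIndex B) := by
    have h := hsum.countable_support
    rw [Function.support_eq_univ fun i => inv_ne_zero (by have := h0 i; positivity)] at h
    exact countable_univ_iff.1 h
  have hTb : ∀ i, T (t / 2) (b i) = Real.exp (-i.1 * (t / 2)) • b i := fun i =>
    hT.apply_of_eigenvector (hb i) hs
  have hae : ∀ᵐ x ∂X.measure, HasSum
      (fun i : S.EigenIndex B => Real.exp (-(t * i.1)) * (b i x * b i x)) (p t x x) := by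
    have h1 : ∀ᵐ x ∂X.measure, ∀ i, inner ℝ (toL2 X.measure (p (t / 2) x)) (b i)
        = Real.exp (-i.1 * (t / 2)) * b i x := by
      refine ae_all_iff.2 fun i => ?_
      filter_upwards [(hker _ hs).ae_inner X.isCompact X.ae_mem_carrier (b i),
        Lp.coeFn_smul (Real.exp (-i.1 * (t / 2))) (b i)] with x h2 h3
      rw [← h2.2, hTb, h3, Pi.smul_apply, smul_eq_mul]
    filter_upwards [h1, X.ae_mem_carrier, Measure.support_mem_ae (μ := X.measure)] with x h2 h3 h4
    have h5 := (hker _ hs).diagonal_eq X.isCompact X.ae_mem_carrier (hker t ht)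
      (hT.inner_apply hs) (fun u => by rw [← hT.add_apply hs hs, add_halves]) h3 h4
    rw [h5, ← real_inner_self_eq_norm_sq]
    refine (b.hasSum_inner_mul_inner _ _).congr_fun fun i => ?_
    rw [real_inner_comm (toL2 X.measure (p (t / 2) x)) (b i), h2 i,
      show -(t * i.1) = -i.1 * (t / 2) + -i.1 * (t / 2) by ring, Real.exp_add]
    ring
  have hnorm : ∀ i, ∫ x, b i x * b i x ∂X.measure = 1 := fun i => by
    have := b.orthonormal.norm_eq_one i
    have h2 := real_inner_self_eq_norm_sq (b i)
    rw [L2.inner_def, this] at h2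
    simpa [sq] using h2
  have hbint : ∀ i, Integrable (fun x => b i x * b i x) X.measure := fun i =>
    (Lp.memLp (b i)).integrable_mul (Lp.memLp (b i))
  have hexp : Summable fun i : S.EigenIndex B => Real.exp (-(t * i.1)) := by
    refine Summable.of_nonneg_of_le (fun i => (Real.exp_pos _).le) (fun i => ?_)
      (hsum.mul_left (1 + t⁻¹))
    have hi := h0 i
    rw [Real.exp_neg, ← div_eq_mul_inv, inv_le_comm₀ (Real.exp_pos _) (by positivity), inv_div]
    refine le_trans ?_ (Real.add_one_le_exp _)
    rw [div_le_iff₀ (by positivity)]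
    have : (t * i.1 + 1) * (1 + t⁻¹) = 1 + i.1 + t * i.1 + t⁻¹ := by field_simp; ring
    rw [this]
    have := inv_pos.2 ht
    nlinarith [mul_nonneg ht.le hi]
  have hF := hasSum_integral_of_summable_integral_norm
    (F := fun (i : S.EigenIndex B) x => Real.exp (-(t * i.1)) * (b i x * b i x))
    (μ := X.measure) (fun i => (hbint i).const_mul _) (by
      refine hexp.congr fun i => ?_
      have e : ∀ x, ‖Real.exp (-(t * i.1)) * (b i x * b i x)‖
          = Real.exp (-(t * i.1)) * (b i x * b i x) := fun x =>
        Real.norm_of_nonneg (mul_nonneg (Real.exp_pos _).le (mul_self_nonneg _))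
      simp_rw [e]
      rw [integral_const_mul, hnorm, mul_one])
  rw [integral_congr_ae (hae.mono fun x hx => hx.tsum_eq)] at hF
  refine hF.congr_fun fun i => ?_
  rw [integral_const_mul, hnorm, mul_one]

theorem summable_mult (hp : S.IsHeatKernel B p) :
    Summable fun x : ℝ => (S.mult B x : ℝ) * (1 + x)⁻¹ := by
  obtain ⟨b, hb⟩ := S.exists_eigenbasis hp
  refine (S.summable_inv b hb).2.sigma.congr fun x => ?_
  simp

/-- The heat trace in terms of the eigenvalues. -/
theorem integral_heatKernel (hp : S.IsHeatKernel B p) {t : ℝ} (ht : 0 < t) :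
    ((∫ x, p t x x ∂X.measure : ℝ) : ℂ) = S.mult B 0 + expSum (offZero (S.mult B)) t := by
  obtain ⟨b, hb⟩ := S.exists_eigenbasis hp
  have h1 := (S.hasSum_exp_eigenIndex hp b hb ht).sigma (g := fun x : ℝ =>
    (S.mult B x : ℝ) * Real.exp (-(t * x))) fun x => by
      have := hasSum_fintype fun _ : Fin (S.mult B x) => Real.exp (-(t * x))
      simpa using this
  have h2 := (Complex.hasSum_ofReal.2 h1).sub
    (hasSum_ite_eq (0 : ℝ) (S.mult B 0 : ℂ))
  rw [expSum]
  have h3 : HasSum (fun x : ℝ => (offZero (S.mult B) x : ℂ) * Complex.exp (-(x * (t : ℂ))))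
      (((∫ x, p t x x ∂X.measure : ℝ) : ℂ) - S.mult B 0) := by
    refine h2.congr_fun fun x => ?_
    rw [offZero]
    split_ifs with hx
    · simp [hx]
    · push_cast
      rw [mul_comm (x : ℂ)]
      simp
  rw [h3.tsum_eq]
  ring

end PCFFractal.HarmonicStructure

/-! ### From spectral decimation to scaling multiplicities -/

namespace IsPoincare

variable {Φ : ℂ → ℂ} {p : Polynomial ℝ} {lam : ℝ}

/-- The points `-x / lam ^ m` tend to `0`, where solutions of `Φ = w` cannot accumulate. This is
available before any summability is known, and makes the `finsum` in the multiplicity formula a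
genuine sum. -/
theorem finite_support_mul_zeroMult (h : IsPoincare Φ p lam) (w : ℂ) (b : ℕ → ℕ) (x : ℝ) :
    (Function.support fun m => b m * zeroMult Φ w (x / lam ^ m)).Finite := by
  have hl := h.one_lt
  rcases le_or_gt x 0 with hx | hx
  · refine (Set.finite_empty).subset fun m hm => hm ?_
    simp only
    rw [zeroMult_of_nonpos (div_nonpos_of_nonpos_of_nonneg hx (by positivity)), mul_zero]
  have ha : AnalyticAt ℂ (fun z => Φ z - w) 0 := (h.entire.analyticAt 0).sub analyticAt_const
  have hne : ∀ᶠ z in 𝓝[≠] (0 : ℂ), Φ z - w ≠ 0 := by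
    rcases ha.eventually_eq_zero_or_eventually_ne_zero with h0 | h0
    · exact absurd (analyticOrderAt_eq_top.2 h0) (h.order_ne_top w 0)
    · exact h0
  have hlim : Tendsto (fun m : ℕ => -((x / lam ^ m : ℝ) : ℂ)) atTop (𝓝[≠] 0) := by
    refine tendsto_nhdsWithin_iff.2 ⟨?_, Eventually.of_forall fun m => ?_⟩
    · have h1 : Tendsto (fun m : ℕ => x / lam ^ m) atTop (𝓝 0) :=
        tendsto_const_nhds.div_atTop (tendsto_pow_atTop_atTop_of_one_lt hl)
      have h2 := ((Complex.continuous_ofReal.tendsto 0).comp h1).neg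
      simpa using h2
    · have : (x / lam ^ m : ℝ) ≠ 0 := by positivity
      exact neg_ne_zero.2 (by exact_mod_cast this)
  have hev := hlim.eventually hne
  rw [← Nat.cofinite_eq_atTop, eventually_cofinite] at hev
  refine hev.subset fun m hm h0 => h0 ?_
  rw [(h.apply_neg_eq (right_ne_zero_of_mul hm)).2, sub_self]

theorem zeroMult_ne_zero (h : IsPoincare Φ p lam) {w : ℂ} {x : ℝ} (hx : 0 < x)
    (hw : Φ (-(x : ℂ)) = w) : zeroMult Φ w x ≠ 0 := fun h0 => by
  have h1 := h.order_eq w hx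
  rw [h0, Nat.cast_zero] at h1
  have ha : AnalyticAt ℂ (fun z => Φ z - w) (-(x : ℂ)) :=
    (h.entire.analyticAt _).sub analyticAt_const
  exact (ha.analyticOrderAt_eq_zero.1 h1) (by rw [hw, sub_self])

/-- Summability of the multiplicities of zeros, by comparison with another spectrum. -/
theorem isMult_zeroMult_of_le (h : IsPoincare Φ p lam) {w : ℂ} {mult : ℝ → ℕ}
    (hs : Summable fun x : ℝ => (mult x : ℝ) * (1 + x)⁻¹)
    (hneg : ∀ x < 0, mult x = 0) {L : ℝ} (hL : 0 < L)
    (hle : ∀ x, 0 < x → zeroMult Φ w x ≤ mult (L * x)) : IsMult (zeroMult Φ w) := by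
  refine ⟨fun x hx => zeroMult_of_nonpos hx, ?_⟩
  have hg := hs.comp_injective (mul_right_injective₀ hL.ne' : Function.Injective fun x : ℝ => L * x)
  have hev := hg.tendsto_cofinite_zero.eventually (Iio_mem_nhds (show (0 : ℝ) < 1 / 2 by norm_num))
  refine Summable.of_norm_bounded_eventually (hg.mul_left (2 * L)) ?_
  -- With all but finitely many terms below `1 / 2`, an atom satisfies `L x > 1`, so `1 / x` is at
  -- most `2 L / (1 + L x)`.
  filter_upwards [hev] with x (hx : (mult (L * x) : ℝ) * (1 + L * x)⁻¹ < 1 / 2)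
  simp only [Function.comp]
  rcases eq_or_ne (zeroMult Φ w x) 0 with h0 | h0
  · rw [h0, Nat.cast_zero, zero_div, norm_zero]
    rcases lt_or_ge x 0 with hx0 | hx0
    · rw [hneg _ (mul_neg_of_pos_of_neg hL hx0)]
      simp
    · positivity
  · have hx0 := (h.apply_neg_eq h0).1
    have h1 : (1 : ℝ) ≤ mult (L * x) := by
      exact_mod_cast (Nat.one_le_iff_ne_zero.2 h0).trans (hle x hx0)
    have h2 : (zeroMult Φ w x : ℝ) ≤ mult (L * x) := by exact_mod_cast hle x hx0
    have hLx : 0 < L * x := by positivity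
    have h3 : 1 < L * x := by
      by_contra h4
      rw [not_lt] at h4
      have : (1 / 2 : ℝ) ≤ (1 + L * x)⁻¹ := by
        rw [le_inv_comm₀ (by norm_num) (by positivity)]
        norm_num
        linarith
      nlinarith [inv_pos.2 (show 0 < 1 + L * x by positivity)]
    rw [Real.norm_of_nonneg (by positivity), div_le_iff₀ hx0]
    have h5 : 1 ≤ 2 * L * (1 + L * x)⁻¹ * x := by
      rw [show 2 * L * (1 + L * x)⁻¹ * x = (2 * (L * x)) / (1 + L * x) by field_simp,
        le_div_iff₀ (by positivity)]
      linarith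
    calc (zeroMult Φ w x : ℝ) ≤ mult (L * x) * 1 := by rw [mul_one]; exact h2
      _ ≤ mult (L * x) * (2 * L * (1 + L * x)⁻¹ * x) := by gcongr
      _ = _ := by ring

end IsPoincare

namespace PCFFractal.HarmonicStructure.SpectralDecimation

variable {d m : ℕ} {X : PCFFractal d m} {S : X.HarmonicStructure} {B : Set (Euc d)}

theorem isPoincare (D : S.SpectralDecimation B) : IsPoincare D.poincare D.poly D.lam where
  one_lt := D.one_lt_lam
  two_le := D.two_le_degree
  coeff_zero := D.coeff_zero
  coeff_one := D.coeff_one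
  entire := D.poincare_entire
  map_zero := D.poincare_zero
  deriv_zero := D.deriv_poincare_zero
  eq z := by rw [D.poincare_eq, Polynomial.eval_map_algebraMap]

/-- For the zero measure `L²` would be trivial and have no eigenvector, whereas decimation provides
an eigenvalue. -/
theorem isProbabilityMeasure (D : S.SpectralDecimation B) : IsProbabilityMeasure X.measure := by
  refine X.measure_eq_zero_or_isProbabilityMeasure.resolve_left fun h0 => ?_
  obtain ⟨w, hw⟩ := D.A_nonempty
  obtain ⟨⟨m, hm⟩, z, hz, hzw⟩ := D.occurs w hw
  obtain ⟨x, -, hx⟩ := D.isEigenvalue w hw m hm z hz hzw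
  refine hx ((Submodule.eq_bot_iff _).2 fun u _ => Lp.ext ?_)
  have hae : ae X.measure = ⊥ := by rw [h0, ae_zero]
  rw [EventuallyEq, hae]
  trivial

/-- Some `lam ^ m z` is a nonzero eigenvalue of `Δ`, hence real and negative. -/
theorem exists_neg (D : S.SpectralDecimation B) {w : ℂ} (hw : w ∈ D.A) {z : ℂ} (hz : z ≠ 0)
    (hzw : D.poincare z = w) : ∃ x : ℝ, 0 < x ∧ z = -x := by
  have hl := D.one_lt_lam
  obtain ⟨⟨m, hm⟩, -⟩ := D.occurs w hw
  obtain ⟨x, hx, hne⟩ := D.isEigenvalue w hw m hm z hz hzw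
  obtain ⟨u, hu, hu0⟩ := (Submodule.ne_bot_iff _).1 hne
  have hlm : (D.lam : ℂ) ^ m ≠ 0 := pow_ne_zero _ (by exact_mod_cast (by linarith : D.lam ≠ 0))
  have h1 : 0 ≤ -x := S.nonneg_of_eigenvector hu0 (by rw [neg_neg]; exact hu)
  have h2 : x ≠ 0 := fun h0 => by
    rw [h0, Complex.ofReal_zero] at hx
    exact mul_ne_zero hlm hz hx.symm
  have h3 : 0 < -x := lt_of_le_of_ne h1 (neg_ne_zero.2 h2).symm
  refine ⟨-x / D.lam ^ m, by positivity, ?_⟩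
  push_cast
  rw [hx]
  field_simp

theorem mult_eq (D : S.SpectralDecimation B) {x : ℝ} (hx : 0 < x) :
    S.mult B x = ∑ w ∈ D.A, dilate D.lam (D.β w) (zeroMult D.poincare w) x := by
  have hl := D.one_lt_lam
  rw [mult, Module.finrank_eq_of_rank_eq (D.rank_eigenspace (-x) (neg_ne_zero.2 hx.ne'))]
  refine Finset.sum_congr rfl fun w _ => finsum_congr fun m => ?_
  rw [zeroMult, if_pos (by positivity)]
  push_cast
  rw [neg_div]

theorem isSpectralValue (D : S.SpectralDecimation B)
    (hs : Summable fun x : ℝ => (S.mult B x : ℝ) * (1 + x)⁻¹) {w : ℂ} (hw : w ∈ D.A) :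
    IsPoincare.IsSpectralValue D.poincare w where
  neg _ hz hzw := D.exists_neg hw hz hzw
  -- For an `m` with `β w m ≠ 0` every solution at `-x` adds its order to the multiplicity of `lam ^
  -- m x`, so the bound on the eigenvalues passes to the solutions.
  isMult := by
    have hl := D.one_lt_lam
    obtain ⟨⟨m, hm⟩, -⟩ := D.occurs w hw
    refine D.isPoincare.isMult_zeroMult_of_le hs (fun _ hx => S.mult_of_neg hx)
      (L := D.lam ^ m) (by positivity) fun x hx => ?_
    rw [D.mult_eq (by positivity)]
    refine le_trans ?_ (Finset.single_le_sum (fun _ _ => Nat.zero_le _) hw)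
    have h1 := single_le_finsum m
      (D.isPoincare.finite_support_mul_zeroMult w (D.β w) (D.lam ^ m * x)) fun _ => Nat.zero_le _
    refine le_trans ?_ h1
    rw [mul_div_cancel_left₀ _ (by positivity)]
    exact Nat.le_mul_of_pos_left _ (Nat.pos_of_ne_zero hm)
  exists_ne := by
    obtain ⟨-, z, hz, hzw⟩ := D.occurs w hw
    obtain ⟨x, hx, rfl⟩ := D.exists_neg hw hz hzw
    exact ⟨x, D.isPoincare.zeroMult_ne_zero hx hzw⟩

theorem isDecimation (D : S.SpectralDecimation B)
    (hs : Summable fun x : ℝ => (S.mult B x : ℝ) * (1 + x)⁻¹) :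
    IsDecimation (S.mult B) (zeroMult D.poincare) D.lam D.poly.natDegree D.A D.β D.num D.den where
  nonempty := D.A_nonempty
  scaling _ hw := D.isPoincare.isScaling (D.isSpectralValue hs hw)
  rational w hw := ⟨D.coprime w hw, D.generating w hw⟩
  exists_ne w hw := (D.occurs w hw).1
  mult_eq x hx := by
    rcases hx.lt_or_gt with hx | hx
    · rw [S.mult_of_neg hx]
      exact (Finset.sum_eq_zero fun w hw =>
        (D.isSpectralValue hs hw).isMult.dilate_of_nonpos D.one_lt_lam _ hx.le).symm
    · exact D.mult_eq hx

end PCFFractal.HarmonicStructure.SpectralDecimation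

end FractalHeat

theorem mainTheorem3 {d m : ℕ} (X : FractalHeat.PCFFractal d m) (S : X.HarmonicStructure)
    (B : Set (FractalHeat.Euc d)) (hB : B ⊆ X.V0) (D : S.SpectralDecimation B)
    (p : ℝ → FractalHeat.Euc d → FractalHeat.Euc d → ℝ) (hp : S.IsHeatKernel B p) :
    ∃ (dS : ℝ) (Z : ℂ → ℂ) (J : Finset ℂ),
      0 < dS ∧
      -- `Z` is the meromorphic continuation of the spectral zeta function
      Meromorphic Z ∧
      (∀ s : ℂ, dS / 2 < s.re →
        HasSum (fun x : {x : ℝ // x ≠ 0} => (S.mult B x : ℂ) * ((x : ℝ) : ℂ) ^ (-s)) (Z s)) ∧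
      -- the number `dS / 2`
      IsGreatest ({Real.logb D.lam D.poly.natDegree} ∪
        {σ : ℝ | ∃ w ∈ D.A, ∃ s : ℂ, (D.den w).eval ((D.lam : ℂ) ^ (-s)) = 0 ∧ σ = s.re})
        (dS / 2) ∧
      FractalHeat.IsPole Z ((dS / 2 : ℝ) : ℂ) ∧
      -- the finitely many exponents
      ((dS / 2 : ℝ) : ℂ) ∉ J ∧
      Set.InjOn (fun α : ℂ => (D.lam : ℂ) ^ α) (insert ((dS / 2 : ℝ) : ℂ) (J : Set ℂ)) ∧
      (∀ α ∈ J, α.re ≤ dS / 2 ∧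
        FractalHeat.IsPole (fun s => Z s * Complex.Gamma s) α ∧
        ((∃ w ∈ D.A, (D.den w).eval ((D.lam : ℂ) ^ (-α)) = 0) ∨
          (D.lam : ℂ) ^ α = D.poly.natDegree ∨ (α = 0 ∧ 0 ∈ D.A))) ∧
      (∀ s : ℂ, FractalHeat.IsPole (fun s => Z s * Complex.Gamma s) s →
        ∃ α ∈ insert ((dS / 2 : ℝ) : ℂ) (J : Set ℂ), ∃ k : ℤ,
          s = FractalHeat.latticePt D.lam α k) ∧
      -- the expansion of the heat trace
      ((∀ s : ℂ, -1 ≤ meromorphicOrderAt (fun s => Z s * Complex.Gamma s) s) →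
        ∃ (H : ℝ → ℂ) (Hj : ℂ → ℝ → ℂ),
          FractalHeat.IsResidueFunction D.lam (fun s => Z s * Complex.Gamma s)
            ((dS / 2 : ℝ) : ℂ) H ∧
          (∀ α ∈ J, FractalHeat.IsResidueFunction D.lam (fun s => Z s * Complex.Gamma s)
            α (Hj α)) ∧
          ∀ M : ℕ,
            (fun t : ℝ => ((∫ x, p t x x ∂X.measure : ℝ) : ℂ) - (S.mult B 0 : ℂ)
              - ((t : ℂ) ^ (-((dS / 2 : ℝ) : ℂ)) * H (Real.logb D.lam t)
                + ∑ α ∈ J, (t : ℂ) ^ (-α) * Hj α (Real.logb D.lam t)))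
              =O[𝓝[>] 0] fun t : ℝ => t ^ ((M : ℝ) + 1 / 2)) := by
  classical
  have := D.isProbabilityMeasure
  have hD := D.isDecimation (S.summable_mult hp)
  obtain ⟨Y, hY⟩ := hD.exists_isContinuation
  obtain ⟨σ₀, hσ⟩ := hD.exists_isGreatest
  obtain ⟨J, hJ1, hJ2, hJ3, hJ4⟩ := hD.exists_representatives hσ hY
  obtain ⟨dS, rfl⟩ : ∃ dS, σ₀ = dS / 2 := ⟨2 * σ₀, by ring⟩
  refine ⟨dS, _, J, by linarith [hD.pos hσ], hD.meromorphic_zetaSum hY,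
    fun s hs => hD.hasSum hσ hY hs, hσ, hD.isPole hσ hY, hJ1, hJ2, hJ3, hJ4, fun hsimple => ?_⟩
  obtain ⟨H, hH, hexp⟩ := hD.exists_expansion hσ hY (W := insert ((dS / 2 : ℝ) : ℂ) J)
    (Finset.insert_nonempty _ _) (by rw [Finset.coe_insert]; exact hJ2)
    (fun s hs => by
      obtain ⟨α, hα, k, hk⟩ := hJ4 s hs
      exact ⟨α, by rw [← Finset.mem_coe, Finset.coe_insert]; exact hα, k, hk⟩) hsimple
  refine ⟨H _, H, hH _ (Finset.mem_insert_self _ _),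
    fun α hα => hH α (Finset.mem_insert_of_mem hα), fun M => ?_⟩
  refine (hexp ((M : ℝ) + 1 / 2)).congr' ?_ EventuallyEq.rfl
  filter_upwards [self_mem_nhdsWithin] with t (ht : 0 < t)
  rw [Finset.sum_insert hJ1, S.integral_heatKernel hp ht]
  ring
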